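/- **Setting.** Let $n\ge 1$ be an integer and $N=2n$, let $\Omega_{nuc}\subset\mathbb R^3$ be a nonempty compact set, and let $Z>0$. Let $$\mathcal A_{nuc}=\{\mu \text{ a nonnegative Radon measure on } \Omega_{nuc}:\ \mu(\Omega_{nuc})=Z\}.$$ Let $e_{xc}:[0,\infty)\to\mathbb R$ be continuously differentiable with derivative $v_{xc}=e_{xc}'$ (one-sided at $0$), such that $e_{xc}(0)=0=v_{xc}(0)$, $v_{xc}\le 0$, $|v_{xc}(\rho)|\le c_{xc}(1+\rho^{p-1})$ for all $\rho\ge 0$ with some $p\in[1,\tfrac53)$ and $c_{xc}>0$, and $\limsup_{\rho\to0+}e_{xc}(\rho)/\rho^{q}<0$ (the value $-\infty$ being allowed) for some $q\in[1,\tfrac32)$. Functions on $\mathbb R^3$ are complex valued, $\langle\cdot,\cdot\rangle$ is the inner product of $L^2(\mathbb R^3;\mathbb C)$, and $H^1(\mathbb R^3)$ is the space of functions in $L^2(\mathbb R^3;\mathbb C)$ with weak first derivatives in $L^2$. Let $$\mathcal A=\{\Phi=(\varphi_1,\dots,\varphi_n)\in H^1(\mathbb R^3)^n:\ \langle\varphi_i,\varphi_j\rangle=\delta_{ij}\}.$$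 For $\mu\in\mathcal A_{nuc}$ and $\Phi\in\mathcal A$ put $\rho=2\sum_{k=1}^n|\varphi_k|^2$, $v_{ext}(x)=-\int\frac{d\mu(y)}{|x-y|}$, $v_H(x)=\int_{\mathbb R^3}\frac{\rho(y)}{|x-y|}\,dy$, and $$\mathcal E_\mu[\Phi]=\sum_{k=1}^n 2\int_{\mathbb R^3}\tfrac12|\nabla\varphi_k|^2+\int_{\mathbb R^3} v_{ext}\,\rho+\tfrac12\iint\frac{\rho(x)\rho(y)}{|x-y|}\,dx\,dy+\int_{\mathbb R^3} e_{xc}(\rho),$$ $$\mathcal E_{\mu,\rho}[\chi]=\tfrac12\int_{\mathbb R^3}|\nabla\chi|^2+\int_{\mathbb R^3}\big(v_{ext}+v_H+v_{xc}(\rho)\big)|\chi|^2\qquad(\chi\in H^1(\mathbb R^3)).$$ Let $\mathcal A^H_\Phi=\{\chi\in\mathrm{Span}\{\varphi_1,\dots,\varphi_n\}:\|\chi\|_2=1\}$ and $\mathcal A^L_\Phi=\{\chi\in H^1(\mathbb R^3):\langle\varphi_k,\chi\rangle=0 \text{ for } k=1,\dots,n,\ \|\chi\|_2=1\}$. We say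 that $\Phi,\varphi_H,\varphi_L$ are a Kohn-Sham ground state, a HOMO and a LUMO for $\mu$ if $$\Phi\in\operatorname*{argmin}_{\mathcal A}\mathcal E_\mu,\qquad \varphi_H\in\operatorname*{argmax}_{\mathcal A^H_\Phi}\mathcal E_{\mu,\rho},\qquad \varphi_L\in\operatorname*{argmin}_{\mathcal A^L_\Phi}\mathcal E_{\mu,\rho}.\tag{$*$}$$ For $\varepsilon_*\in\mathbb R$ the bandgap tuning functional is $$J[\Phi,\varphi_H,\varphi_L,\mu]=\big|\mathcal E_{\mu,\rho}[\varphi_L]-\mathcal E_{\mu,\rho}[\varphi_H]-\varepsilon_*\big|^2 .$$ **Theorem.** Let $\varepsilon_*>0$ and $Z>N$. Then there exists a nuclear charge distribution $\mu\in\mathcal A_{nuc}$ that minimizes the bandgap tuning functional over $\mathcal A_{nuc}$ subject to the constraints $(*)$. That is, there are $\mu\in\mathcal A_{nuc}$ and $\Phi,\varphi_H,\varphi_L$ satisfying $(*)$ for $\mu$ such that $$J[\Phi,\varphi_H,\varphi_L,\mu]\le J[\Phi',\varphi_H',\varphi_L',\mu']$$ for all $\mu'\in\mathcal A_{nuc}$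 and all $\Phi',\varphi_H',\varphi_L'$ satisfying $(*)$ for $\mu'$. -/

import Mathlib

namespace KohnSham

open MeasureTheory Set Filter Topology
open scoped LineDeriv

noncomputable section

/-- Physical space `ℝ³` with the Euclidean norm. -/
abbrev Space : Type := EuclideanSpace ℝ (Fin 3)

/-- The complex Hilbert space `L²(ℝ³; ℂ)`. -/
abbrev L2 : Type := Lp ℂ 2 (volume : Measure Space)

/-! ### The Sobolev space `H¹(ℝ³)` -/

/-- `g ∈ L²` is the weak (distributional) partial derivative of `u ∈ L²` in the `i`-th coordinate
direction. -/
def IsWeakPartial (i : Fin 3) (u g : L2) : Prop :=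
  ∂_{(EuclideanSpace.single i (1 : ℝ) : Space)} (Lp.toTemperedDistribution u) =
    Lp.toTemperedDistribution g

/-- `H¹(ℝ³)`: the functions in `L²` all of whose weak partial derivatives are in `L²`. -/
def H1 : Set L2 := {u | ∀ i, ∃ g, IsWeakPartial i u g}

open Classical in
/-- The weak partial derivative of `u` in the `i`-th coordinate direction (and `0` if it is not in
`L²`). -/
def weakPartial (i : Fin 3) (u : L2) : L2 :=
  if h : ∃ g, IsWeakPartial i u g then h.choose else 0

theorem IsWeakPartial.unique {i : Fin 3} {u g g' : L2} (h : IsWeakPartial i u g)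
    (h' : IsWeakPartial i u g') : g = g' := by
  have hinj : Function.Injective
      (Lp.toTemperedDistributionCLM ℂ (volume : Measure Space) 2) :=
    LinearMap.ker_eq_bot.mp (Lp.ker_toTemperedDistributionCLM_eq_bot (p := 2))
  exact hinj (h.symm.trans h')

theorem IsWeakPartial.weakPartial_eq {i : Fin 3} {u g : L2} (h : IsWeakPartial i u g) :
    weakPartial i u = g := by
  have hex : ∃ g, IsWeakPartial i u g := ⟨g, h⟩
  rw [weakPartial, dif_pos hex]
  exact hex.choose_spec.unique h

/-- `∫ |∇u|²`, for `u ∈ H¹(ℝ³)`. -/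
def gradNormSq (u : L2) : ℝ := ∑ i, ‖weakPartial i u‖ ^ 2

/-! ### Nuclear charge distributions and the exchange-correlation energy -/

/-- The admissible nuclear charge distributions: nonnegative Borel measures (automatically Radon)
concentrated on `Ω` with total mass `Z`. -/
def nuclearCharges (Ω : Set Space) (Z : ℝ) : Set (Measure Space) :=
  {μ | μ Ωᶜ = 0 ∧ μ univ = ENNReal.ofReal Z}

/-- The exchange-correlation potential `v_xc = d e_xc / dρ` on `[0, ∞)` (one-sided at `0`). -/
def vXC (e : ℝ → ℝ) (r : ℝ) : ℝ := derivWithin e (Ici 0) r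

/-- The standing assumptions on the exchange-correlation energy density `e_xc : [0, ∞) → ℝ`
(a function on `ℝ` of which only the values on `[0, ∞)` matter). The upper limit is taken in the
extended reals, so that the value `-∞` is allowed. -/
structure IsExchangeCorrelation (e : ℝ → ℝ) : Prop where
  contDiffOn : ContDiffOn ℝ 1 e (Ici 0)
  zero : e 0 = 0
  deriv_zero : vXC e 0 = 0
  deriv_nonpos : ∀ r, 0 ≤ r → vXC e r ≤ 0
  growth : ∃ p : ℝ, 1 ≤ p ∧ p < 5 / 3 ∧ ∃ c : ℝ, 0 < c ∧
    ∀ r, 0 ≤ r → |vXC e r| ≤ c * (1 + r ^ (p - 1))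
  near_zero : ∃ q : ℝ, 1 ≤ q ∧ q < 3 / 2 ∧
    limsup (fun r : ℝ => ((e r / r ^ q : ℝ) : EReal)) (𝓝[>] 0) < 0

/-! ### Densities, potentials and energies -/

/-- The total electron density `ρ = 2 ∑ₖ |φₖ|²`. -/
def density {n : ℕ} (Φ : Fin n → L2) (x : Space) : ℝ := 2 * ∑ k, ‖Φ k x‖ ^ 2

/-- The electrostatic potential of the nuclei, `v_ext(x) = -∫ 1/|x-y| dμ(y)`. -/
def vExt (μ : Measure Space) (x : Space) : ℝ := -∫ y, 1 / ‖x - y‖ ∂μ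

/-- The Hartree potential of a density, `v_H(x) = ∫ ρ(y)/|x-y| dy`. -/
def vHartree (ρ : Space → ℝ) (x : Space) : ℝ := ∫ y, ρ y / ‖x - y‖

/-- The Kohn-Sham energy functional
`∑ₖ 2 ∫ ½|∇φₖ|² + ∫ v_ext ρ + ½ ∬ ρ(x)ρ(y)/|x-y| dx dy + ∫ e_xc(ρ)`. -/
def ksEnergy (e : ℝ → ℝ) (μ : Measure Space) {n : ℕ} (Φ : Fin n → L2) : ℝ :=
  (∑ k, 2 * (1 / 2 * gradNormSq (Φ k)))
    + (∫ x, vExt μ x * density Φ x)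
    + 1 / 2 * (∫ x, ∫ y, density Φ x * density Φ y / ‖x - y‖)
    + ∫ x, e (density Φ x)

/-- The excitation energy functional, i.e. the quadratic form
`½ ∫ |∇χ|² + ∫ (v_ext + v_H + v_xc(ρ)) |χ|²` of the Kohn-Sham Hamiltonian with density `ρ`. -/
def excitationEnergy (e : ℝ → ℝ) (μ : Measure Space) (ρ : Space → ℝ) (χ : L2) : ℝ :=
  1 / 2 * gradNormSq χ + ∫ x, (vExt μ x + vHartree ρ x + vXC e (ρ x)) * ‖χ x‖ ^ 2

/-! ### Admissible sets and the governing variational principles -/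

/-- Admissible orbitals: `L²`-orthonormal `n`-tuples in `H¹(ℝ³)`. -/
def ksAdmissible (n : ℕ) : Set (Fin n → L2) :=
  {Φ | (∀ k, Φ k ∈ H1) ∧ Orthonormal ℂ Φ}

/-- HOMO-admissible functions: normalized elements of the span of the orbitals. -/
def homoAdmissible {n : ℕ} (Φ : Fin n → L2) : Set L2 :=
  {φ | φ ∈ Submodule.span ℂ (range Φ) ∧ ‖φ‖ = 1}

/-- LUMO-admissible functions: normalized `H¹`-functions orthogonal to the orbitals. -/
def lumoAdmissible {n : ℕ} (Φ : Fin n → L2) : Set L2 :=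
  {φ | φ ∈ H1 ∧ (∀ k, inner ℂ (Φ k) φ = 0) ∧ ‖φ‖ = 1}

/-- `Φ` is a Kohn-Sham ground state for `μ`. -/
def IsGroundState (e : ℝ → ℝ) (μ : Measure Space) {n : ℕ} (Φ : Fin n → L2) : Prop :=
  Φ ∈ ksAdmissible n ∧ IsMinOn (fun Ψ : Fin n → L2 => ksEnergy e μ Ψ) (ksAdmissible n) Φ

/-- `φ` is a HOMO for the orbitals `Φ` and the nuclear charge distribution `μ`. -/
def IsHOMO (e : ℝ → ℝ) (μ : Measure Space) {n : ℕ} (Φ : Fin n → L2) (φ : L2) : Prop :=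
  φ ∈ homoAdmissible Φ ∧ IsMaxOn (excitationEnergy e μ (density Φ)) (homoAdmissible Φ) φ

/-- `φ` is a LUMO for the orbitals `Φ` and the nuclear charge distribution `μ`. -/
def IsLUMO (e : ℝ → ℝ) (μ : Measure Space) {n : ℕ} (Φ : Fin n → L2) (φ : L2) : Prop :=
  φ ∈ lumoAdmissible Φ ∧ IsMinOn (excitationEnergy e μ (density Φ)) (lumoAdmissible Φ) φ

/-- `Φ`, `φH`, `φL` are a Kohn-Sham ground state, a HOMO and a LUMO for `μ`. -/
structure SolvesKS (e : ℝ → ℝ) (μ : Measure Space) {n : ℕ} (Φ : Fin n → L2) (φH φL : L2) :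
    Prop where
  groundState : IsGroundState e μ Φ
  homo : IsHOMO e μ Φ φH
  lumo : IsLUMO e μ Φ φL

/-- The bandgap tuning functional `|ε_L - ε_H - ε_*|²`, where `ε_L` and `ε_H` are the values of the
excitation energy functional at `φL` and `φH`. -/
def bandgapFunctional (e : ℝ → ℝ) (εstar : ℝ) {n : ℕ} (Φ : Fin n → L2) (φH φL : L2)
    (μ : Measure Space) : ℝ :=
  |excitationEnergy e μ (density Φ) φL - excitationEnergy e μ (density Φ) φH - εstar| ^ 2

end

end KohnSham

namespace KohnSham

open MeasureTheory Set Filter Topology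
open scoped LineDeriv SchwartzMap ContDiff ENNReal NNReal FourierTransform ComplexConjugate

noncomputable section

/-! ### Weak derivatives, translations and multipliers -/

/-! The proof is the direct method. The nuclear charges on a compact set form a weakly sequentially
compact family (`exists_nucTendsto_subseq`), so everything rests on stability: along a weakly
convergent sequence of charges, solutions of the system have a subsequence converging to a solution
for the limit charge, with convergence of the HOMO and LUMO energies (`exists_solvesKS_limit`). The
limit of a minimizing sequence for the bandgap functional then attains the infimum. Fubini turns the
nuclear attraction into the integral against `μ` of the Coulomb potential of `ρ`. That potential is
bounded and continuous for `ρ` in L¹ ∩ L², so weak convergence of the charges is exactly what is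
needed.

Ground states require a concentration-compactness argument. Subcritical growth of the
exchange-correlation energy bounds the kinetic energy (`exists_kin_le`). Orthonormality is relaxed
to the Gram inequality `‖comb A c‖ ^ 2 ≤ csq c`, which survives weak limits and localization. The
infimum does not change: the defect of the Gram matrix is a sum of rank-one forms, which widely
spread lumps placed far away realize at arbitrarily small cost, because the exchange-correlation
energy is nonpositive (`IsLowerBound.le_of_relaxed`).

The condition `Z > 2n` gives strictness. A charge placed at a distance comparable to a large radius
R sees a net attractive charge and gains energy of order 1/R. Cutting the remaining orbitals at R
costs only o(1/R) for suitable R, since the shells are disjoint and a summable sequence cannot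
dominate the harmonic series (`exists_shellInt_le`). Hence orbitals with a Gram defect lie strictly
above the infimum (`IsLowerBound.lt_of_relaxed`), and a free cluster at infinity is bound with
strict gain (`exists_binding`). If a minimizing sequence lost mass, the escaping part would either
vanish, and then carry asymptotically nonnegative energy, or contain a cluster that could be bound.
Both contradict minimality (`IsLowerBound.norm_comb_sq_eq`). So the weak limit is orthonormal, and
norm convergence upgrades weak to strong H¹ convergence (`IsLowerBound.exists_H1Tendsto`,
`exists_isGroundState`).

For the LUMO, the same comparison of attraction and repulsion gives a state of negative energy
orthogonal to the orbitals (`exists_lumoAdmissible_neg`). The potential part of the excitation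
energy is continuous under bounded weak H¹ convergence, so a weak limit of almost minimizers has
energy at most the negative limit value. It is therefore nonzero, and normalizing it only lowers the
energy (`KSLimit.exists_lumoAdmissible_le`). The HOMO is a maximum over a finite-dimensional sphere
and passes to the limit through its coefficients (`KSLimit.exists_isHOMO`). -/

/-- The standard basis vectors of physical space. -/
abbrev basisVec (i : Fin 3) : Space := EuclideanSpace.single i (1 : ℝ)

/-- A Schwartz function as an element of `L²`. -/
abbrev ofSchwartz (ψ : 𝓢(Space, ℂ)) : L2 := ψ.toLp 2 volume

lemma ofSchwartz_ae (ψ : 𝓢(Space, ℂ)) : ofSchwartz ψ =ᵐ[volume] ψ := ψ.coeFn_toLp 2 volume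

/-- Complex conjugation on Schwartz functions. -/
def conjSchwartz (ψ : 𝓢(Space, ℂ)) : 𝓢(Space, ℂ) :=
  SchwartzMap.postcompCLM (Complex.conjCLE : ℂ →L[ℝ] ℂ) ψ

lemma conjSchwartz_apply (ψ : 𝓢(Space, ℂ)) (x : Space) : conjSchwartz ψ x = conj (ψ x) := rfl

lemma conjSchwartz_conj (ψ : 𝓢(Space, ℂ)) : conjSchwartz (conjSchwartz ψ) = ψ := by
  ext x; simp [conjSchwartz_apply]

lemma lineDeriv_conjSchwartz (m : Space) (ψ : 𝓢(Space, ℂ)) :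
    ∂_{m} (conjSchwartz ψ) = conjSchwartz (∂_{m} ψ) := by
  ext x
  rw [SchwartzMap.lineDerivOp_apply_eq_fderiv, conjSchwartz_apply,
    SchwartzMap.lineDerivOp_apply_eq_fderiv]
  have h : HasFDerivAt (conjSchwartz ψ)
      ((Complex.conjCLE : ℂ →L[ℝ] ℂ).comp (fderiv ℝ ψ x)) x :=
    (Complex.conjCLE : ℂ →L[ℝ] ℂ).hasFDerivAt.comp x (ψ.hasFDerivAt x)
  rw [h.fderiv]; rfl

lemma inner_ofSchwartz (ψ : 𝓢(Space, ℂ)) (u : L2) :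
    inner ℂ (ofSchwartz ψ) u = ∫ x, conj (ψ x) * u x := by
  rw [L2.inner_def]
  apply integral_congr_ae
  filter_upwards [ofSchwartz_ae ψ] with x hx
  rw [hx, RCLike.inner_apply, mul_comm]

lemma toTemperedDistribution_eq_inner (u : L2) (ψ : 𝓢(Space, ℂ)) :
    Lp.toTemperedDistribution u ψ = inner ℂ (ofSchwartz (conjSchwartz ψ)) u := by
  rw [Lp.toTemperedDistribution_apply, inner_ofSchwartz]
  simp [conjSchwartz_apply]

/-- Testing with L² inner products lets weak limits, translations and multiplications be moved onto
the Schwartz function. The pairing of distributions is bilinear while the inner product is conjugate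
linear on the left, hence the passage through `conjSchwartz`. -/
lemma isWeakPartial_iff {i : Fin 3} {u g : L2} :
    IsWeakPartial i u g ↔ ∀ ψ : 𝓢(Space, ℂ),
      inner ℂ (ofSchwartz ψ) g = - inner ℂ (ofSchwartz (∂_{basisVec i} ψ)) u := by
  have key : IsWeakPartial i u g ↔ ∀ ψ : 𝓢(Space, ℂ),
      Lp.toTemperedDistribution u (- ∂_{basisVec i} ψ) = Lp.toTemperedDistribution g ψ := by
    unfold IsWeakPartial
    constructor
    · intro h ψ
      rw [← h]; rfl
    · intro h
      ext ψ
      exact h ψ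
  rw [key]
  constructor
  · intro h ψ
    have := h (conjSchwartz ψ)
    rw [map_neg, toTemperedDistribution_eq_inner, toTemperedDistribution_eq_inner,
      lineDeriv_conjSchwartz, conjSchwartz_conj, conjSchwartz_conj] at this
    exact this.symm
  · intro h ψ
    rw [map_neg, toTemperedDistribution_eq_inner, toTemperedDistribution_eq_inner, h,
      lineDeriv_conjSchwartz]

lemma isWeakPartial_weakPartial {u : L2} (hu : u ∈ H1) (i : Fin 3) :
    IsWeakPartial i u (weakPartial i u) := by
  obtain ⟨g, hg⟩ := hu i
  rwa [hg.weakPartial_eq]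

lemma IsWeakPartial.add {i : Fin 3} {u g v h : L2} (hu : IsWeakPartial i u g)
    (hv : IsWeakPartial i v h) : IsWeakPartial i (u + v) (g + h) := by
  rw [isWeakPartial_iff] at *
  intro ψ
  rw [inner_add_right, inner_add_right, hu, hv, neg_add]

lemma IsWeakPartial.smul {i : Fin 3} {u g : L2} (c : ℂ) (hu : IsWeakPartial i u g) :
    IsWeakPartial i (c • u) (c • g) := by
  rw [isWeakPartial_iff] at *
  intro ψ
  rw [inner_smul_right, inner_smul_right, hu, mul_neg]

lemma isWeakPartial_zero (i : Fin 3) : IsWeakPartial i 0 0 := by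
  rw [isWeakPartial_iff]; simp

/-- `H¹` as a submodule of `L²`. -/
def H1Sub : Submodule ℂ L2 where
  carrier := H1
  add_mem' := fun hu hv i =>
    ⟨_, (isWeakPartial_weakPartial hu i).add (isWeakPartial_weakPartial hv i)⟩
  zero_mem' := fun i => ⟨0, isWeakPartial_zero i⟩
  smul_mem' := fun c _ hu i => ⟨_, (isWeakPartial_weakPartial hu i).smul c⟩

lemma H1_add {u v : L2} (hu : u ∈ H1) (hv : v ∈ H1) : u + v ∈ H1 := H1Sub.add_mem hu hv
lemma H1_sub {u v : L2} (hu : u ∈ H1) (hv : v ∈ H1) : u - v ∈ H1 := H1Sub.sub_mem hu hv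
lemma H1_smul (c : ℂ) {u : L2} (hu : u ∈ H1) : c • u ∈ H1 := H1Sub.smul_mem c hu
lemma H1_zero : (0 : L2) ∈ H1 := H1Sub.zero_mem

/-- The weak partial derivative as a linear map on `H¹`. -/
def weakPartialLin (i : Fin 3) : H1Sub →ₗ[ℂ] L2 where
  toFun u := weakPartial i u
  map_add' u v :=
    ((isWeakPartial_weakPartial u.2 i).add (isWeakPartial_weakPartial v.2 i)).weakPartial_eq
  map_smul' c u := ((isWeakPartial_weakPartial u.2 i).smul c).weakPartial_eq

lemma weakPartial_add (i : Fin 3) {u v : L2} (hu : u ∈ H1) (hv : v ∈ H1) :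
    weakPartial i (u + v) = weakPartial i u + weakPartial i v :=
  (weakPartialLin i).map_add ⟨u, hu⟩ ⟨v, hv⟩

lemma weakPartial_sub (i : Fin 3) {u v : L2} (hu : u ∈ H1) (hv : v ∈ H1) :
    weakPartial i (u - v) = weakPartial i u - weakPartial i v :=
  (weakPartialLin i).map_sub ⟨u, hu⟩ ⟨v, hv⟩

lemma weakPartial_smul (i : Fin 3) (c : ℂ) {u : L2} (hu : u ∈ H1) :
    weakPartial i (c • u) = c • weakPartial i u :=
  (weakPartialLin i).map_smul c ⟨u, hu⟩

lemma weakPartial_zero (i : Fin 3) : weakPartial i 0 = 0 := (isWeakPartial_zero i).weakPartial_eq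

lemma weakPartial_sum {ι : Type*} (i : Fin 3) (s : Finset ι) {u : ι → L2} (hu : ∀ k, u k ∈ H1) :
    weakPartial i (∑ k ∈ s, u k) = ∑ k ∈ s, weakPartial i (u k) := by
  have := map_sum (weakPartialLin i) (fun k => (⟨u k, hu k⟩ : H1Sub)) s
  have e : ((∑ k ∈ s, (⟨u k, hu k⟩ : H1Sub) : H1Sub) : L2) = ∑ k ∈ s, u k :=
    Submodule.coe_sum _ _ _
  rw [← e]
  exact this

lemma H1_sum {ι : Type*} (s : Finset ι) {u : ι → L2} (hu : ∀ k, u k ∈ H1) :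
    ∑ k ∈ s, u k ∈ H1 := H1Sub.sum_mem fun k _ => hu k

lemma gradNormSq_nonneg (u : L2) : 0 ≤ gradNormSq u :=
  Finset.sum_nonneg fun _ _ => sq_nonneg _

lemma gradNormSq_smul (c : ℂ) {u : L2} (hu : u ∈ H1) :
    gradNormSq (c • u) = ‖c‖ ^ 2 * gradNormSq u := by
  simp only [gradNormSq, weakPartial_smul _ c hu, norm_smul, mul_pow, Finset.mul_sum]

lemma gradNormSq_zero : gradNormSq 0 = 0 := by simp [gradNormSq, weakPartial_zero]

/-- Weak convergence of a sequence in `L²`. -/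
def WeakTendsto (u : ℕ → L2) (v : L2) : Prop :=
  ∀ w : L2, Tendsto (fun j => inner ℂ w (u j)) atTop (𝓝 (inner ℂ w v))

lemma WeakTendsto.isWeakPartial {i : Fin 3} {u g : ℕ → L2} {v h : L2} (hu : WeakTendsto u v)
    (hg : WeakTendsto g h) (H : ∀ j, IsWeakPartial i (u j) (g j)) : IsWeakPartial i v h := by
  simp only [isWeakPartial_iff] at *
  intro ψ
  refine tendsto_nhds_unique (hg (ofSchwartz ψ)) ?_
  simp only [fun j => H j ψ]
  exact (hu _).neg

lemma WeakTendsto.of_tendsto {u : ℕ → L2} {v : L2} (h : Tendsto u atTop (𝓝 v)) :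
    WeakTendsto u v := fun _ => tendsto_const_nhds.inner h

/-! ### Translations on L² and H¹. -/

lemma measurePreserving_sub (z : Space) :
    MeasurePreserving (fun x : Space => x - z) volume volume :=
  measurePreserving_sub_right volume z

/-- Translation by `z` on `L²`. -/
def tr (z : Space) : L2 →ₗᵢ[ℂ] L2 :=
  Lp.compMeasurePreservingₗᵢ ℂ (fun x : Space => x - z) (measurePreserving_sub z)

lemma tr_ae (z : Space) (u : L2) : tr z u =ᵐ[volume] fun x => u (x - z) :=
  Lp.coeFn_compMeasurePreserving u (measurePreserving_sub z)

lemma tr_tr (z w : Space) (u : L2) : tr z (tr w u) = tr (z + w) u := by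
  apply Lp.ext
  filter_upwards [tr_ae z (tr w u), tr_ae (z + w) u,
    (measurePreserving_sub z).quasiMeasurePreserving.ae (tr_ae w u)] with x h1 h2 h3
  rw [h1, h2, h3, sub_sub]

lemma tr_zero (u : L2) : tr 0 u = u := by
  apply Lp.ext
  filter_upwards [tr_ae 0 u] with x h1
  rw [h1, sub_zero]

lemma tr_tr_neg (z : Space) (u : L2) : tr z (tr (-z) u) = u := by
  rw [tr_tr, add_neg_cancel, tr_zero]

lemma inner_tr (z : Space) (u v : L2) : inner ℂ u (tr z v) = inner ℂ (tr (-z) u) v := by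
  conv_lhs => rw [← tr_tr_neg z u]
  exact (tr z).inner_map_map _ _

lemma tr_ofSchwartz (z : Space) (ψ : 𝓢(Space, ℂ)) :
    tr z (ofSchwartz ψ) = ofSchwartz (SchwartzMap.compSubConstCLM ℂ z ψ) := by
  apply Lp.ext
  filter_upwards [tr_ae z (ofSchwartz ψ), ofSchwartz_ae (SchwartzMap.compSubConstCLM ℂ z ψ),
    (measurePreserving_sub z).quasiMeasurePreserving.ae (ofSchwartz_ae ψ)] with x h1 h2 h3
  rw [h1, h2, h3]; rfl

lemma lineDeriv_compSubConst (m z : Space) (ψ : 𝓢(Space, ℂ)) :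
    ∂_{m} (SchwartzMap.compSubConstCLM ℂ z ψ) = SchwartzMap.compSubConstCLM ℂ z (∂_{m} ψ) := by
  ext x
  simp only [SchwartzMap.lineDerivOp_apply_eq_fderiv, SchwartzMap.compSubConstCLM_apply]
  have : (SchwartzMap.compSubConstCLM ℂ z ψ : Space → ℂ) = fun y => ψ (y - z) := by
    ext y; simp
  rw [this, fderiv_comp_sub]

lemma IsWeakPartial.tr {i : Fin 3} {u g : L2} (h : IsWeakPartial i u g) (z : Space) :
    IsWeakPartial i (tr z u) (KohnSham.tr z g) := by
  rw [isWeakPartial_iff] at *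
  intro ψ
  rw [inner_tr, inner_tr, tr_ofSchwartz, tr_ofSchwartz, h, lineDeriv_compSubConst]

lemma H1_tr {u : L2} (hu : u ∈ H1) (z : Space) : tr z u ∈ H1 :=
  fun i => ⟨_, (isWeakPartial_weakPartial hu i).tr z⟩

lemma weakPartial_tr {u : L2} (hu : u ∈ H1) (z : Space) (i : Fin 3) :
    weakPartial i (tr z u) = tr z (weakPartial i u) :=
  ((isWeakPartial_weakPartial hu i).tr z).weakPartial_eq

lemma gradNormSq_tr {u : L2} (hu : u ∈ H1) (z : Space) : gradNormSq (tr z u) = gradNormSq u := by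
  simp [gradNormSq, weakPartial_tr hu]

/-! ### Multiplication operators and the product rule. -/

open Classical in
/-- Multiplication of an `L²` function by a bounded real function. -/
def mulL2 (m : Space → ℝ) (u : L2) : L2 :=
  if h : MemLp (fun x => (m x : ℂ) * u x) 2 volume then h.toLp else 0

/-- Bounded measurable functions. -/
structure IsBddMeas (m : Space → ℝ) : Prop where
  meas : Measurable m
  bdd : ∃ C, ∀ x, |m x| ≤ C

lemma IsBddMeas.memLp {m : Space → ℝ} (hm : IsBddMeas m) (u : L2) :
    MemLp (fun x => (m x : ℂ) * u x) 2 volume := by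
  obtain ⟨C, hC⟩ := hm.bdd
  refine (Lp.memLp u).of_le_mul (c := C) ?_ (Eventually.of_forall fun x => ?_)
  · exact (Complex.measurable_ofReal.comp hm.meas).aestronglyMeasurable.mul
      (Lp.aestronglyMeasurable u)
  · rw [norm_mul, Complex.norm_real, Real.norm_eq_abs]
    gcongr
    exact hC x

lemma mulL2_ae {m : Space → ℝ} (hm : IsBddMeas m) (u : L2) :
    mulL2 m u =ᵐ[volume] fun x => (m x : ℂ) * u x := by
  rw [mulL2, dif_pos (hm.memLp u)]
  exact MemLp.coeFn_toLp _

lemma inner_mulL2 {m : Space → ℝ} (hm : IsBddMeas m) (u v : L2) :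
    inner ℂ u (mulL2 m v) = inner ℂ (mulL2 m u) v := by
  rw [L2.inner_def, L2.inner_def]
  apply integral_congr_ae
  filter_upwards [mulL2_ae hm u, mulL2_ae hm v] with x h1 h2
  rw [h1, h2, RCLike.inner_apply, RCLike.inner_apply, map_mul, Complex.conj_ofReal]
  ring

lemma mulL2_add {m : Space → ℝ} (hm : IsBddMeas m) (u v : L2) :
    mulL2 m (u + v) = mulL2 m u + mulL2 m v := by
  apply Lp.ext
  filter_upwards [mulL2_ae hm u, mulL2_ae hm v, mulL2_ae hm (u + v), Lp.coeFn_add u v,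
    Lp.coeFn_add (mulL2 m u) (mulL2 m v)] with x h1 h2 h3 h4 h5
  rw [h3, h5, h4, Pi.add_apply, Pi.add_apply, h1, h2, mul_add]

lemma mulL2_smul {m : Space → ℝ} (hm : IsBddMeas m) (c : ℂ) (u : L2) :
    mulL2 m (c • u) = c • mulL2 m u := by
  apply Lp.ext
  filter_upwards [mulL2_ae hm u, mulL2_ae hm (c • u), Lp.coeFn_smul c u,
    Lp.coeFn_smul c (mulL2 m u)] with x h1 h2 h3 h4
  rw [h2, h4, h3, Pi.smul_apply, Pi.smul_apply, h1, smul_eq_mul, smul_eq_mul]; ring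

/-- Multiplication by a bounded measurable function as a linear map. -/
def mulL2Lin {m : Space → ℝ} (hm : IsBddMeas m) : L2 →ₗ[ℂ] L2 where
  toFun := mulL2 m
  map_add' := mulL2_add hm
  map_smul' := mulL2_smul hm

lemma mulL2_sub {m : Space → ℝ} (hm : IsBddMeas m) (u v : L2) :
    mulL2 m (u - v) = mulL2 m u - mulL2 m v := (mulL2Lin hm).map_sub u v

lemma mulL2_sum {ι : Type*} {m : Space → ℝ} (hm : IsBddMeas m) (s : Finset ι) (u : ι → L2) :
    mulL2 m (∑ k ∈ s, u k) = ∑ k ∈ s, mulL2 m (u k) := map_sum (mulL2Lin hm) u s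

lemma norm_mulL2_le {m : Space → ℝ} (hm : IsBddMeas m) {C : ℝ} (hC : ∀ x, |m x| ≤ C) (u : L2) :
    ‖mulL2 m u‖ ≤ C * ‖u‖ := by
  apply Lp.norm_le_mul_norm_of_ae_le_mul
  filter_upwards [mulL2_ae hm u] with x hx
  rw [hx, norm_mul, Complex.norm_real, Real.norm_eq_abs]
  gcongr
  exact hC x

/-- Smooth multipliers on `H¹`. -/
structure IsMultiplier (m : Space → ℝ) : Prop where
  temperate : m.HasTemperateGrowth
  bdd : ∃ C, ∀ x, |m x| ≤ C
  bdd_fderiv : ∃ C, ∀ x, ‖fderiv ℝ m x‖ ≤ C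

lemma IsMultiplier.isBddMeas {m : Space → ℝ} (hm : IsMultiplier m) : IsBddMeas m :=
  ⟨hm.temperate.1.continuous.measurable, hm.bdd⟩

/-- The classical partial derivative of a multiplier. -/
def partialD (m : Space → ℝ) (i : Fin 3) (x : Space) : ℝ := fderiv ℝ m x (basisVec i)

lemma abs_partialD_le (m : Space → ℝ) (i : Fin 3) (x : Space) :
    |partialD m i x| ≤ ‖fderiv ℝ m x‖ := by
  have := (fderiv ℝ m x).le_opNorm (basisVec i)
  simpa [partialD] using this

lemma IsMultiplier.isBddMeas_partialD {m : Space → ℝ} (hm : IsMultiplier m) (i : Fin 3) :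
    IsBddMeas (partialD m i) := by
  refine ⟨?_, ?_⟩
  · exact ((hm.temperate.1.continuous_fderiv (by simp)).clm_apply continuous_const).measurable
  · obtain ⟨C, hC⟩ := hm.bdd_fderiv
    exact ⟨C, fun x => (abs_partialD_le m i x).trans (hC x)⟩

lemma mulL2_ofSchwartz {m : Space → ℝ} (hm : IsMultiplier m) (ψ : 𝓢(Space, ℂ)) :
    mulL2 m (ofSchwartz ψ) = ofSchwartz (SchwartzMap.smulLeftCLM ℂ m ψ) := by
  apply Lp.ext
  filter_upwards [mulL2_ae hm.isBddMeas (ofSchwartz ψ), ofSchwartz_ae ψ,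
    ofSchwartz_ae (SchwartzMap.smulLeftCLM ℂ m ψ)] with x h1 h2 h3
  rw [h1, h2, h3, SchwartzMap.smulLeftCLM_apply_apply hm.temperate, Complex.real_smul]

lemma ofSchwartz_lineDeriv_smulLeft {m : Space → ℝ} (hm : IsMultiplier m) (ψ : 𝓢(Space, ℂ))
    (i : Fin 3) : ofSchwartz (∂_{basisVec i} (SchwartzMap.smulLeftCLM ℂ m ψ)) =
      mulL2 m (ofSchwartz (∂_{basisVec i} ψ)) + mulL2 (partialD m i) (ofSchwartz ψ) := by
  apply Lp.ext
  filter_upwards [mulL2_ae hm.isBddMeas (ofSchwartz (∂_{basisVec i} ψ)), ofSchwartz_ae ψ,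
    ofSchwartz_ae (∂_{basisVec i} (SchwartzMap.smulLeftCLM ℂ m ψ)),
    ofSchwartz_ae (∂_{basisVec i} ψ),
    mulL2_ae (hm.isBddMeas_partialD i) (ofSchwartz ψ),
    Lp.coeFn_add (mulL2 m (ofSchwartz (∂_{basisVec i} ψ)))
      (mulL2 (partialD m i) (ofSchwartz ψ))] with x h1 h2 h3 h4 h5 h6
  rw [h3, h6, Pi.add_apply, h1, h5, h2, h4, SchwartzMap.lineDerivOp_apply_eq_fderiv,
    SchwartzMap.lineDerivOp_apply_eq_fderiv, SchwartzMap.smulLeftCLM_apply hm.temperate,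
    fderiv_fun_smul ((hm.temperate.1.differentiable (by simp)) x) ψ.differentiableAt]
  simp [partialD]

/-- By duality: the real multiplier is moved onto the test function, where the classical product
rule holds. -/
lemma IsWeakPartial.mul {i : Fin 3} {u g : L2} (h : IsWeakPartial i u g) {m : Space → ℝ}
    (hm : IsMultiplier m) :
    IsWeakPartial i (mulL2 m u) (mulL2 m g + mulL2 (partialD m i) u) := by
  rw [isWeakPartial_iff] at *
  intro ψ
  rw [inner_add_right, inner_mulL2 hm.isBddMeas, inner_mulL2 hm.isBddMeas,
    inner_mulL2 (hm.isBddMeas_partialD i), mulL2_ofSchwartz hm, h,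
    ofSchwartz_lineDeriv_smulLeft hm, inner_add_left]
  ring

lemma H1_mul {u : L2} (hu : u ∈ H1) {m : Space → ℝ} (hm : IsMultiplier m) : mulL2 m u ∈ H1 :=
  fun i => ⟨_, (isWeakPartial_weakPartial hu i).mul hm⟩

lemma weakPartial_mul {u : L2} (hu : u ∈ H1) {m : Space → ℝ} (hm : IsMultiplier m) (i : Fin 3) :
    weakPartial i (mulL2 m u) = mulL2 m (weakPartial i u) + mulL2 (partialD m i) u :=
  ((isWeakPartial_weakPartial hu i).mul hm).weakPartial_eq

lemma isWeakPartial_ofSchwartz (ψ : 𝓢(Space, ℂ)) (i : Fin 3) :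
    IsWeakPartial i (ofSchwartz ψ) (ofSchwartz (∂_{basisVec i} ψ)) := by
  rw [isWeakPartial_iff]
  intro η
  rw [inner_ofSchwartz, inner_ofSchwartz]
  have h := SchwartzMap.integral_mul_lineDerivOp_right_eq_neg_left (μ := volume) (conjSchwartz η)
    ψ (basisVec i)
  rw [lineDeriv_conjSchwartz] at h
  simp only [conjSchwartz_apply] at h
  calc _ = ∫ x, conj (η x) * (∂_{basisVec i} ψ) x := by
        apply integral_congr_ae
        filter_upwards [ofSchwartz_ae (∂_{basisVec i} ψ)] with x hx
        rw [hx]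
    _ = _ := h
    _ = _ := by
        congr 1
        apply integral_congr_ae
        filter_upwards [ofSchwartz_ae ψ] with x hx
        rw [hx]

lemma H1_ofSchwartz (ψ : 𝓢(Space, ℂ)) : ofSchwartz ψ ∈ H1 :=
  fun i => ⟨_, isWeakPartial_ofSchwartz ψ i⟩

lemma weakPartial_ofSchwartz (ψ : 𝓢(Space, ℂ)) (i : Fin 3) :
    weakPartial i (ofSchwartz ψ) = ofSchwartz (∂_{basisVec i} ψ) :=
  (isWeakPartial_ofSchwartz ψ i).weakPartial_eq

/-! ### Radial cutoffs -/

/-- The smooth radial variable `√(1 + |x|²)`. -/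
def jb (x : Space) : ℝ := (1 + ‖x‖ ^ 2) ^ (1 / 2 : ℝ)

lemma jb_eq (x : Space) : jb x = √(1 + ‖x‖ ^ 2) := by rw [jb, Real.sqrt_eq_rpow]

lemma norm_le_jb (x : Space) : ‖x‖ ≤ jb x := by
  rw [jb_eq]; exact Real.le_sqrt_of_sq_le (by linarith)

lemma jb_le (x : Space) : jb x ≤ 1 + ‖x‖ := by
  rw [jb_eq]; exact Real.sqrt_le_iff.2 ⟨by positivity, by nlinarith [norm_nonneg x]⟩

lemma jb_temperate : jb.HasTemperateGrowth :=
  Function.hasTemperateGrowth_one_add_norm_sq_rpow Space (1 / 2)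

/-- Because the smooth radial variable is 1-Lipschitz, the gradients of all radial cutoffs are
bounded independently of the radius. -/
lemma jb_lipschitz : LipschitzWith 1 jb := by
  apply LipschitzWith.of_le_add
  intro x y
  rw [jb_eq, jb_eq, dist_eq_norm]
  apply Real.sqrt_le_iff.2 ⟨by positivity, ?_⟩
  have h1 : ‖x‖ ≤ ‖y‖ + ‖x - y‖ := by
    calc ‖x‖ = ‖y + (x - y)‖ := by congr 1; abel
      _ ≤ _ := norm_add_le _ _
  have h2 : ‖y‖ ≤ √(1 + ‖y‖ ^ 2) := Real.le_sqrt_of_sq_le (by linarith)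
  have h3 := Real.sq_sqrt (show (0 : ℝ) ≤ 1 + ‖y‖ ^ 2 by positivity)
  nlinarith [norm_nonneg x, norm_nonneg y, norm_nonneg (x - y),
    mul_nonneg (norm_nonneg (x - y)) (sub_nonneg.2 h2)]

lemma continuous_jb : Continuous jb := jb_lipschitz.continuous

/-- A smooth function on the line which is locally constant off `[0, 1]`. -/
structure IsProfile (p : ℝ → ℝ) : Prop where
  smooth : ContDiff ℝ ∞ p
  left : ∀ t ≤ 0, p t = p 0
  right : ∀ t, 1 ≤ t → p t = p 1
  bdd : ∀ t, |p t| ≤ 1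

lemma IsProfile.fderiv_eq_zero {p : ℝ → ℝ} (hp : IsProfile p) {t : ℝ} (ht : t ∉ Icc (0 : ℝ) 1) :
    fderiv ℝ p t = 0 := by
  by_cases h : t < 0
  · have : p =ᶠ[𝓝 t] fun _ => p 0 := by
      filter_upwards [Iio_mem_nhds h] with s hs using hp.left s (le_of_lt hs)
    rw [this.fderiv_eq, fderiv_const_apply]
  · have h1 : 1 < t := by
      by_contra h1; exact ht ⟨not_lt.1 h, not_lt.1 h1⟩
    have : p =ᶠ[𝓝 t] fun _ => p 1 := by
      filter_upwards [Ioi_mem_nhds h1] with s hs using hp.right s (le_of_lt hs)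
    rw [this.fderiv_eq, fderiv_const_apply]

lemma IsProfile.hasCompactSupport {p : ℝ → ℝ} (hp : IsProfile p) :
    HasCompactSupport (fderiv ℝ p) :=
  HasCompactSupport.intro isCompact_Icc fun _ ht => hp.fderiv_eq_zero ht

lemma IsProfile.temperate {p : ℝ → ℝ} (hp : IsProfile p) : p.HasTemperateGrowth :=
  .of_fderiv (hp.hasCompactSupport.hasTemperateGrowth (hp.smooth.fderiv_right (by simp)))
    (hp.smooth.differentiable (by simp)) (k := 0) (C := 1) fun x => by simpa using hp.bdd x

lemma IsProfile.exists_bound {p : ℝ → ℝ} (hp : IsProfile p) :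
    ∃ C, ∀ t, ‖fderiv ℝ p t‖ ≤ C :=
  hp.hasCompactSupport.exists_bound_of_continuous (hp.smooth.continuous_fderiv (by simp))

/-- The radial function with profile `p` and shell starting at `R`. -/
def radial (p : ℝ → ℝ) (R : ℝ) (x : Space) : ℝ := p (jb x - R)

lemma radial_hasFDerivAt {p : ℝ → ℝ} (hp : IsProfile p) (R : ℝ) (x : Space) :
    HasFDerivAt (radial p R) ((fderiv ℝ p (jb x - R)).comp (fderiv ℝ jb x)) x := by
  have h1 : HasFDerivAt (fun x => jb x - R) (fderiv ℝ jb x) x :=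
    ((jb_temperate.1.differentiable (by simp)) x).hasFDerivAt.sub_const R
  exact ((hp.smooth.differentiable (by simp)) _).hasFDerivAt.comp x h1

lemma norm_fderiv_radial_le {p : ℝ → ℝ} (hp : IsProfile p) (R : ℝ) (x : Space) :
    ‖fderiv ℝ (radial p R) x‖ ≤ ‖fderiv ℝ p (jb x - R)‖ := by
  rw [(radial_hasFDerivAt hp R x).fderiv]
  refine (ContinuousLinearMap.opNorm_comp_le _ _).trans ?_
  have : ‖fderiv ℝ jb x‖ ≤ 1 := by simpa using norm_fderiv_le_of_lipschitz ℝ jb_lipschitz (x₀ := x)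
  exact mul_le_of_le_one_right (norm_nonneg _) this

lemma isMultiplier_radial {p : ℝ → ℝ} (hp : IsProfile p) (R : ℝ) : IsMultiplier (radial p R) := by
  refine ⟨?_, ⟨1, fun x => hp.bdd _⟩, ?_⟩
  · exact hp.temperate.comp (jb_temperate.sub (Function.HasTemperateGrowth.const R))
  · obtain ⟨C, hC⟩ := hp.exists_bound
    exact ⟨C, fun x => (norm_fderiv_radial_le hp R x).trans (hC _)⟩

/-- The angle profile. -/
def angle (t : ℝ) : ℝ := Real.pi / 2 * Real.smoothTransition t

lemma angle_contDiff : ContDiff ℝ ∞ angle := contDiff_const.mul Real.smoothTransition.contDiff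

lemma angle_zero {t : ℝ} (h : t ≤ 0) : angle t = 0 := by
  simp [angle, Real.smoothTransition.zero_of_nonpos h]

lemma angle_one {t : ℝ} (h : 1 ≤ t) : angle t = Real.pi / 2 := by
  simp [angle, Real.smoothTransition.one_of_one_le h]

lemma isProfile_cos : IsProfile fun t => Real.cos (angle t) where
  smooth := Real.contDiff_cos.comp angle_contDiff
  left t ht := by simp [angle_zero ht, angle_zero le_rfl]
  right t ht := by simp [angle_one ht, angle_one le_rfl]
  bdd t := Real.abs_cos_le_one _

lemma isProfile_sin : IsProfile fun t => Real.sin (angle t) where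
  smooth := Real.contDiff_sin.comp angle_contDiff
  left t ht := by simp [angle_zero ht, angle_zero le_rfl]
  right t ht := by simp [angle_one ht, angle_one le_rfl]
  bdd t := Real.abs_sin_le_one _

/-- The inner cutoff at radius `R`. -/
def cosCut (R : ℝ) : Space → ℝ := radial (fun t => Real.cos (angle t)) R

/-- The outer cutoff at radius `R`. -/
def sinCut (R : ℝ) : Space → ℝ := radial (fun t => Real.sin (angle t)) R

lemma isMultiplier_cosCut (R : ℝ) : IsMultiplier (cosCut R) := isMultiplier_radial isProfile_cos R
lemma isMultiplier_sinCut (R : ℝ) : IsMultiplier (sinCut R) := isMultiplier_radial isProfile_sin R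

/-- The cutoffs are cosine and sine of one angle. This gives a quadratic partition of unity, the
form needed to split L² norms, densities and Gram forms exactly. -/
lemma sq_cosCut_add (R : ℝ) (x : Space) : cosCut R x ^ 2 + sinCut R x ^ 2 = 1 :=
  Real.cos_sq_add_sin_sq _

lemma cosCut_eq_one {R : ℝ} {x : Space} (h : jb x ≤ R) : cosCut R x = 1 := by
  simp [cosCut, radial, angle_zero (sub_nonpos.2 h)]

lemma sinCut_eq_zero {R : ℝ} {x : Space} (h : jb x ≤ R) : sinCut R x = 0 := by
  simp [sinCut, radial, angle_zero (sub_nonpos.2 h)]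

lemma cosCut_eq_zero {R : ℝ} {x : Space} (h : R + 1 ≤ jb x) : cosCut R x = 0 := by
  simp [cosCut, radial, angle_one (show 1 ≤ jb x - R by linarith)]

lemma sinCut_eq_one {R : ℝ} {x : Space} (h : R + 1 ≤ jb x) : sinCut R x = 1 := by
  simp [sinCut, radial, angle_one (show 1 ≤ jb x - R by linarith)]

lemma abs_cosCut_le (R : ℝ) (x : Space) : |cosCut R x| ≤ 1 := Real.abs_cos_le_one _
lemma abs_sinCut_le (R : ℝ) (x : Space) : |sinCut R x| ≤ 1 := Real.abs_sin_le_one _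

/-- The shell on which the cutoffs at radius `R` vary. -/
def shell (R : ℝ) : Set Space := {x | jb x - R ∈ Icc (0 : ℝ) 1}

lemma measurableSet_shell (R : ℝ) : MeasurableSet (shell R) :=
  (continuous_jb.sub continuous_const).measurable measurableSet_Icc

lemma exists_partialD_radial_bound {p : ℝ → ℝ} (hp : IsProfile p) :
    ∃ C, 0 ≤ C ∧ ∀ R i x, |partialD (radial p R) i x| ≤ (shell R).indicator (fun _ => C) x := by
  obtain ⟨C, hC⟩ := hp.exists_bound
  have hC0 : 0 ≤ C := (norm_nonneg _).trans (hC 0)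
  refine ⟨C, hC0, fun R i x => ?_⟩
  refine ((abs_partialD_le _ i x).trans (norm_fderiv_radial_le hp R x)).trans ?_
  by_cases h : x ∈ shell R
  · rw [indicator_of_mem h]; exact hC _
  · rw [indicator_of_notMem h, hp.fderiv_eq_zero h, norm_zero]

/-- Differentiating the quadratic partition of unity. This identity cancels the cross terms in the
localization of the kinetic energy. -/
lemma cosCut_mul_partialD (R : ℝ) (i : Fin 3) (x : Space) :
    cosCut R x * partialD (cosCut R) i x + sinCut R x * partialD (sinCut R) i x = 0 := by
  have h1 := (radial_hasFDerivAt isProfile_cos R x).pow 2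
  have h2 := (radial_hasFDerivAt isProfile_sin R x).pow 2
  have h3 := h1.add h2
  have h4 : ((fun y => radial (fun t => Real.cos (angle t)) R y ^ 2) +
      fun y => radial (fun t => Real.sin (angle t)) R y ^ 2) = fun _ => (1 : ℝ) := by
    ext y; exact sq_cosCut_add R y
  have h5 := h3.unique (by rw [h4]; exact hasFDerivAt_const 1 x)
  have h6 := congrArg (fun L : Space →L[ℝ] ℝ => L (basisVec i)) h5
  simp only [partialD, cosCut, sinCut, (radial_hasFDerivAt isProfile_cos R x).fderiv,
    (radial_hasFDerivAt isProfile_sin R x).fderiv]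
  simp at h6
  simp
  linarith

/-! ### Strong convergence of multipliers -/

lemma norm_sq_eq_integral (u : L2) : ‖u‖ ^ 2 = ∫ x, ‖u x‖ ^ 2 := by
  rw [← inner_self_eq_norm_sq (𝕜 := ℂ), L2.inner_def, ← integral_re (L2.integrable_inner u u)]
  refine integral_congr_ae (Eventually.of_forall fun x => ?_)
  exact inner_self_eq_norm_sq (𝕜 := ℂ) (u x)

lemma integrable_norm_sq (u : L2) : Integrable fun x => ‖u x‖ ^ 2 :=
  (Lp.memLp u).integrable_norm_pow (by simp)

lemma norm_mulL2_sq {m : Space → ℝ} (hm : IsBddMeas m) (u : L2) :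
    ‖mulL2 m u‖ ^ 2 = ∫ x, m x ^ 2 * ‖u x‖ ^ 2 := by
  rw [norm_sq_eq_integral]
  apply integral_congr_ae
  filter_upwards [mulL2_ae hm u] with x hx
  rw [hx, norm_mul, mul_pow, Complex.norm_real, Real.norm_eq_abs, sq_abs]

lemma tendsto_mulL2_zero {m : ℕ → Space → ℝ} (hm : ∀ j, IsBddMeas (m j)) {C : ℝ}
    (hC : ∀ j x, |m j x| ≤ C) (h0 : ∀ x, Tendsto (fun j => m j x) atTop (𝓝 0)) (u : L2) :
    Tendsto (fun j => mulL2 (m j) u) atTop (𝓝 0) := by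
  rw [tendsto_zero_iff_norm_tendsto_zero]
  have h : Tendsto (fun j => ‖mulL2 (m j) u‖ ^ 2) atTop (𝓝 0) := by
    simp only [norm_mulL2_sq (hm _)]
    rw [show (0 : ℝ) = ∫ x : Space, (0 : ℝ) by simp]
    apply tendsto_integral_of_dominated_convergence (fun x => C ^ 2 * ‖u x‖ ^ 2)
    · intro j
      exact (((hm j).meas.pow_const 2).aestronglyMeasurable).mul
        ((Lp.aestronglyMeasurable u).norm.pow 2)
    · exact (integrable_norm_sq u).const_mul _
    · intro j
      refine Eventually.of_forall fun x => ?_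
      rw [norm_mul, Real.norm_eq_abs, Real.norm_eq_abs, abs_pow, abs_pow, abs_norm]
      gcongr
      exact hC j x
    · refine Eventually.of_forall fun x => ?_
      simpa using ((h0 x).pow 2).mul_const (‖u x‖ ^ 2)
  have := h.sqrt
  simpa [Real.sqrt_sq (norm_nonneg _)] using this

lemma eventually_jb_le (x : Space) : ∀ᶠ j : ℕ in atTop, jb x ≤ j :=
  tendsto_natCast_atTop_atTop.eventually_ge_atTop _

lemma mulL2_one_sub {m : Space → ℝ} (hm : IsBddMeas m) (u : L2) :
    mulL2 (fun x => m x - 1) u = mulL2 m u - u := by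
  have h1 : IsBddMeas fun x => m x - 1 := by
    refine ⟨hm.meas.sub_const 1, ?_⟩
    obtain ⟨C, hC⟩ := hm.bdd
    exact ⟨C + 1, fun x => (abs_sub _ _).trans (by simpa using hC x)⟩
  apply Lp.ext
  filter_upwards [mulL2_ae h1 u, mulL2_ae hm u, Lp.coeFn_sub (mulL2 m u) u] with x h1 h2 h3
  rw [h1, h3, Pi.sub_apply, h2]; push_cast; ring

lemma tendsto_cosCut (u : L2) : Tendsto (fun j : ℕ => mulL2 (cosCut j) u) atTop (𝓝 u) := by
  rw [← tendsto_sub_nhds_zero_iff]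
  simp only [← mulL2_one_sub (isMultiplier_cosCut _).isBddMeas]
  apply tendsto_mulL2_zero (C := 2)
  · intro j
    exact ⟨(isMultiplier_cosCut _).isBddMeas.meas.sub_const 1,
      2, fun x => (abs_sub _ _).trans (by have := abs_cosCut_le j x; norm_num; linarith)⟩
  · intro j x
    exact (abs_sub _ _).trans (by have := abs_cosCut_le j x; norm_num; linarith)
  · intro x
    apply tendsto_const_nhds.congr'
    filter_upwards [eventually_jb_le x] with j hj
    rw [cosCut_eq_one hj, sub_self]

lemma tendsto_partialD_radial {p : ℝ → ℝ} (hp : IsProfile p) (u : L2) (i : Fin 3) :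
    Tendsto (fun j : ℕ => mulL2 (partialD (radial p j) i) u) atTop (𝓝 0) := by
  obtain ⟨C, hC0, hC⟩ := exists_partialD_radial_bound hp
  apply tendsto_mulL2_zero (C := C) (fun j => (isMultiplier_radial hp _).isBddMeas_partialD i)
  · intro j x
    exact (hC j i x).trans (indicator_le_self' (fun _ _ => hC0) x)
  · intro x
    apply tendsto_const_nhds.congr'
    filter_upwards [(tendsto_natCast_atTop_atTop (R := ℝ)).eventually_gt_atTop (jb x)] with j hj
    have := hC j i x
    rw [indicator_of_notMem (by simp only [shell, mem_ofPred_eq, mem_Icc, not_and]; intro h; linarith)]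
      at this
    exact (abs_nonpos_iff.1 this).symm

lemma tendsto_weakPartial_cosCut {u : L2} (hu : u ∈ H1) (i : Fin 3) :
    Tendsto (fun j : ℕ => weakPartial i (mulL2 (cosCut j) u)) atTop (𝓝 (weakPartial i u)) := by
  simp only [weakPartial_mul hu (isMultiplier_cosCut _)]
  simpa [cosCut] using (tendsto_cosCut (weakPartial i u)).add (tendsto_partialD_radial isProfile_cos u i)

/-! ### Density of test functions in `H¹` -/

/-- The operator 1 - Δ is inverted on Schwartz functions by the Fourier multiplier 1 / (1 + |2πξ|²).
Surjectivity is what makes Schwartz functions dense in H¹ below. -/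
lemma exists_helmholtz (η : 𝓢(Space, ℂ)) : ∃ ψ : 𝓢(Space, ℂ),
    ψ - ∑ i, ∂_{basisVec i} (∂_{basisVec i} ψ) = η := by
  let g : Space → ℝ := fun x => (1 + ‖(2 * Real.pi) • x‖ ^ 2) ^ (-1 : ℝ)
  have hg : g.HasTemperateGrowth :=
    (Function.hasTemperateGrowth_one_add_norm_sq_rpow Space (-1)).comp
      (((2 * Real.pi) • ContinuousLinearMap.id ℝ Space).hasTemperateGrowth)
  let ψ := SchwartzMap.fourierMultiplierCLM (𝕜 := ℝ) ℂ g η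
  refine ⟨ψ, ?_⟩
  have h1 := SchwartzMap.laplacian_eq_sum (EuclideanSpace.basisFun (Fin 3) ℝ) ψ
  simp only [EuclideanSpace.basisFun_apply] at h1
  rw [← h1, SchwartzMap.laplacian_eq_fourierMultiplierCLM]
  have h2 : (fun x : Space => ‖x‖ ^ 2).HasTemperateGrowth := Function.hasTemperateGrowth_norm_sq Space
  have h3 : SchwartzMap.fourierMultiplierCLM (𝕜 := ℝ) ℂ ((fun x : Space => ‖x‖ ^ 2)) ψ =
      SchwartzMap.fourierMultiplierCLM (𝕜 := ℝ) ℂ ((fun x : Space => ‖x‖ ^ 2) * g) η :=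
    SchwartzMap.fourierMultiplierCLM_fourierMultiplierCLM_apply h2 hg η
  have h4 : (fun x : Space => ‖x‖ ^ 2) * g = ((2 * Real.pi) ^ 2)⁻¹ • ((fun _ => (1 : ℝ)) - g) := by
    ext x
    simp only [g, Pi.mul_apply, Pi.smul_apply, Pi.sub_apply, smul_eq_mul, norm_smul, mul_pow,
      Real.rpow_neg_one, Real.norm_eq_abs, sq_abs]
    have : 0 < 1 + (2 * Real.pi) ^ 2 * ‖x‖ ^ 2 := by positivity
    have hpi : Real.pi ≠ 0 := Real.pi_ne_zero
    field_simp
    ring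
  have hc : (fun _ : Space => (1 : ℝ)).HasTemperateGrowth := .const 1
  have h5 : SchwartzMap.fourierMultiplierCLM (𝕜 := ℝ) ℂ ((fun _ => (1 : ℝ)) - g) η = η - ψ := by
    have hs : (fun _ : Space => (1 : ℝ)) - g = fun x => ∑ b : Bool, (cond b (fun _ => 1) (-g)) x := by
      ext x; simp [sub_eq_add_neg]
    have hng : (-g) = (-1 : ℝ) • g := by ext x; simp
    rw [hs, SchwartzMap.fourierMultiplierCLM_sum]
    · simp only [Fintype.sum_bool, cond_true, cond_false]
      rw [hng, SchwartzMap.fourierMultiplierCLM_smul hg, SchwartzMap.fourierMultiplierCLM_const]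
      simp [ψ, sub_eq_add_neg]
    · intro b _
      cases b
      · exact hg.neg
      · exact hc
  have h6 : SchwartzMap.fourierMultiplierCLM (𝕜 := ℝ) ℂ ((fun x : Space => ‖x‖ ^ 2)) ψ =
      ((2 * Real.pi) ^ 2)⁻¹ • (η - ψ) := by
    rw [h3, h4, SchwartzMap.fourierMultiplierCLM_smul, ← h5]
    · rfl
    · exact hc.sub hg
  have h7 : (fun x : Space => ‖x‖ ^ 2) = (‖·‖ ^ 2) := rfl
  rw [h7] at h6
  rw [h6, neg_smul, smul_smul, mul_inv_cancel₀ (by have := Real.pi_pos; positivity), one_smul]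
  abel

/-- The Hilbert space containing the graphs of the weak gradient. -/
abbrev GraphSpace : Type := PiLp 2 fun _ : Option (Fin 3) => L2

/-- The graph of the weak gradient at `u`. -/
def graphPt (u : L2) : GraphSpace :=
  WithLp.toLp 2 fun o => o.elim u fun i => weakPartial i u

/-- The graph map of the gradient on Schwartz functions. -/
def schwartzGraph : 𝓢(Space, ℂ) →ₗ[ℂ] GraphSpace where
  toFun ψ := graphPt (ofSchwartz ψ)
  map_add' φ ψ := by
    have h : ofSchwartz (φ + ψ) = ofSchwartz φ + ofSchwartz ψ :=
      (SchwartzMap.toLpCLM ℂ ℂ 2 volume).map_add φ ψ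
    ext1 o
    cases o with
    | none => exact h
    | some i =>
      change weakPartial i _ = weakPartial i _ + weakPartial i _
      rw [h, weakPartial_add i (H1_ofSchwartz φ) (H1_ofSchwartz ψ)]
  map_smul' c ψ := by
    have h : ofSchwartz (c • ψ) = c • ofSchwartz ψ :=
      (SchwartzMap.toLpCLM ℂ ℂ 2 volume).map_smul c ψ
    ext1 o
    cases o with
    | none => exact h
    | some i =>
      change weakPartial i _ = c • weakPartial i _
      rw [h, weakPartial_smul i c (H1_ofSchwartz ψ)]

lemma IsWeakPartial.of_mem_closure {q : GraphSpace}
    (hq : q ∈ (LinearMap.range schwartzGraph).topologicalClosure) (i : Fin 3) :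
    IsWeakPartial i (q none) (q (some i)) := by
  obtain ⟨s, hs, hlim⟩ := mem_closure_iff_seq_limit.1 hq
  choose ψ hψ using hs
  have h : ∀ o, Tendsto (fun j => s j o) atTop (𝓝 (q o)) := fun o =>
    ((PiLp.continuous_apply 2 (fun _ : Option (Fin 3) => L2) o).tendsto q).comp hlim
  refine (WeakTendsto.of_tendsto (h none)).isWeakPartial (.of_tendsto (h (some i))) fun j => ?_
  rw [← hψ j]
  exact isWeakPartial_weakPartial (H1_ofSchwartz (ψ j)) i

/-- Density of Schwartz functions by orthogonal projection. The remainder after projecting onto the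
closure is again the graph of a weak gradient. Orthogonality to the graph of ψ says that its
function component is orthogonal to (1 - Δ)ψ, and these exhaust the Schwartz functions. -/
lemma graphPt_mem_closure {u : L2} (hu : u ∈ H1) :
    graphPt u ∈ (LinearMap.range schwartzGraph).topologicalClosure := by
  set K := (LinearMap.range schwartzGraph).topologicalClosure with hK
  have : CompleteSpace K := (Submodule.isClosed_topologicalClosure _).completeSpace_coe
  set P : GraphSpace := (K.starProjection (graphPt u)) with hP
  have hPK : P ∈ K := Submodule.starProjection_apply_mem _ _
  set q := graphPt u - P with hq
  have hqK : q ∈ Kᗮ := Submodule.sub_starProjection_mem_orthogonal _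
  have hw : ∀ i, IsWeakPartial i (q none) (q (some i)) := by
    intro i
    have h1 := (IsWeakPartial.of_mem_closure hPK i).smul (-1)
    have h2 := (isWeakPartial_weakPartial hu i).add h1
    have e1 : q none = u + (-1 : ℂ) • P none := by
      simp [hq, graphPt, sub_eq_add_neg]
    have e2 : q (some i) = weakPartial i u + (-1 : ℂ) • P (some i) := by
      simp [hq, graphPt, sub_eq_add_neg]
    rw [e1, e2]; exact h2
  have hz : ∀ η : 𝓢(Space, ℂ), inner ℂ (ofSchwartz η) (q none) = 0 := by
    intro η
    obtain ⟨ψ, hψ⟩ := exists_helmholtz η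
    have h1 : inner ℂ (schwartzGraph ψ) q = 0 :=
      (Submodule.mem_orthogonal _ _).1 hqK _
        (Submodule.le_topologicalClosure _ (LinearMap.mem_range_self _ ψ))
    rw [PiLp.inner_apply, Fintype.sum_option] at h1
    have h2 : ∀ i, inner ℂ (schwartzGraph ψ (some i)) (q (some i)) =
        - inner ℂ (ofSchwartz (∂_{basisVec i} (∂_{basisVec i} ψ))) (q none) := by
      intro i
      have : schwartzGraph ψ (some i) = ofSchwartz (∂_{basisVec i} ψ) :=
        weakPartial_ofSchwartz ψ i
      rw [this, isWeakPartial_iff.1 (hw i)]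
    simp only [h2] at h1
    have h3 : ofSchwartz η = ofSchwartz ψ -
        ∑ i, ofSchwartz (∂_{basisVec i} (∂_{basisVec i} ψ)) := by
      rw [← hψ]
      change SchwartzMap.toLpCLM ℂ ℂ 2 volume _ = _
      rw [map_sub, map_sum]; rfl
    rw [h3, inner_sub_left, sum_inner]
    rw [Finset.sum_neg_distrib, ← sub_eq_add_neg] at h1
    exact h1
  have hq0 : q none = 0 := by
    have hd := SchwartzMap.denseRange_toLpCLM (E := Space) (F := ℂ) (p := 2) (μ := volume)
      (by simp)
    apply hd.eq_zero_of_inner_right (𝕜 := ℂ)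
    exact hz
  have hq1 : ∀ i, q (some i) = 0 := fun i =>
    (hw i).unique (by rw [hq0]; exact isWeakPartial_zero i)
  have : q = 0 := by
    ext1 o
    cases o with
    | none => exact hq0
    | some i => exact hq1 i
  rw [sub_eq_zero.1 this]
  exact hPK

/-- Convergence in `H¹`. -/
def H1Tendsto (u : ℕ → L2) (v : L2) : Prop :=
  Tendsto u atTop (𝓝 v) ∧
    ∀ i, Tendsto (fun j => weakPartial i (u j)) atTop (𝓝 (weakPartial i v))

lemma exists_schwartz_tendsto {u : L2} (hu : u ∈ H1) :
    ∃ ψ : ℕ → 𝓢(Space, ℂ), H1Tendsto (fun j => ofSchwartz (ψ j)) u := by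
  obtain ⟨s, hs, hlim⟩ := mem_closure_iff_seq_limit.1 (graphPt_mem_closure hu)
  choose ψ hψ using hs
  have h : ∀ o, Tendsto (fun j => s j o) atTop (𝓝 (graphPt u o)) := fun o =>
    ((PiLp.continuous_apply 2 (fun _ : Option (Fin 3) => L2) o).tendsto _).comp hlim
  refine ⟨ψ, ?_, fun i => ?_⟩
  · have := h none
    simp only [← hψ] at this
    exact this
  · have := h (some i)
    simp only [← hψ] at this
    exact this

/-! ### The Gagliardo-Nirenberg inequality -/

/-- The norm of the weak gradient. -/
def gr (u : L2) : ℝ := √(gradNormSq u)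

lemma gr_nonneg (u : L2) : 0 ≤ gr u := Real.sqrt_nonneg _

lemma gr_sq (u : L2) : gr u ^ 2 = gradNormSq u := Real.sq_sqrt (gradNormSq_nonneg u)

lemma norm_weakPartial_le (u : L2) (i : Fin 3) : ‖weakPartial i u‖ ≤ gr u :=
  Real.le_sqrt_of_sq_le
    (Finset.single_le_sum (f := fun i => ‖weakPartial i u‖ ^ 2) (fun _ _ => sq_nonneg _)
      (Finset.mem_univ i))

lemma H1Tendsto.gradNormSq {u : ℕ → L2} {v : L2} (h : H1Tendsto u v) :
    Tendsto (fun j => gradNormSq (u j)) atTop (𝓝 (gradNormSq v)) :=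
  tendsto_finsetSum _ fun i _ => (h.2 i).norm.pow 2

lemma H1Tendsto.gr {u : ℕ → L2} {v : L2} (h : H1Tendsto u v) :
    Tendsto (fun j => gr (u j)) atTop (𝓝 (gr v)) := h.gradNormSq.sqrt

lemma exists_subseq_ae {u : ℕ → L2} {v : L2} (h : Tendsto u atTop (𝓝 v)) :
    ∃ ns : ℕ → ℕ, StrictMono ns ∧
      ∀ᵐ x ∂(volume : Measure Space), Tendsto (fun j => u (ns j) x) atTop (𝓝 (v x)) :=
  (tendstoInMeasure_of_tendsto_Lp h).exists_seq_tendsto_ae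

/-- The Gagliardo-Nirenberg bound for the quartic integral, with constant `C`. -/
def QuarticBound (C : ℝ) (u : L2) : Prop :=
  ∫⁻ x, ‖u x‖ₑ ^ 4 ≤ ENNReal.ofReal (C * (‖u‖ * gr u ^ 3))

/-- Fatou's lemma along an almost everywhere convergent subsequence. -/
lemma QuarticBound.of_tendsto {C : ℝ} {u : ℕ → L2} {v : L2} (h : H1Tendsto u v)
    (hu : ∀ j, QuarticBound C (u j)) : QuarticBound C v := by
  obtain ⟨ns, hns, hae⟩ := exists_subseq_ae h.1
  have h1 : Tendsto (fun j => ENNReal.ofReal (C * (‖u (ns j)‖ * gr (u (ns j)) ^ 3))) atTop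
      (𝓝 (ENNReal.ofReal (C * (‖v‖ * gr v ^ 3)))) :=
    ENNReal.tendsto_ofReal
      (((h.1.norm.mul (h.gr.pow 3)).const_mul C).comp hns.tendsto_atTop)
  calc ∫⁻ x, ‖v x‖ₑ ^ 4 = ∫⁻ x, liminf (fun j => ‖u (ns j) x‖ₑ ^ 4) atTop := by
        apply lintegral_congr_ae
        filter_upwards [hae] with x hx
        exact ((ENNReal.continuous_pow 4).tendsto _ |>.comp hx.enorm).liminf_eq.symm
    _ ≤ liminf (fun j => ∫⁻ x, ‖u (ns j) x‖ₑ ^ 4) atTop :=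
        lintegral_liminf_le' fun j => ((Lp.aestronglyMeasurable _).enorm.pow_const 4)
    _ ≤ liminf (fun j => ENNReal.ofReal (C * (‖u (ns j)‖ * gr (u (ns j)) ^ 3))) atTop :=
        liminf_le_liminf (Eventually.of_forall fun j => hu (ns j))
    _ = _ := h1.liminf_eq

/-- The factor 3 arises from bounding the operator norm of the derivative by the sum of three
partial derivatives, each with L² norm at most `gr`. -/
lemma fderiv_eLpNorm_le (ψ : 𝓢(Space, ℂ)) :
    eLpNorm (fderiv ℝ ψ) 2 volume ≤ ENNReal.ofReal (3 * gr (ofSchwartz ψ)) := by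
  have h1 : ∀ x, ‖fderiv ℝ ψ x‖ ≤ ∑ i, ‖(∂_{basisVec i} ψ) x‖ := by
    intro x
    apply ContinuousLinearMap.opNorm_le_bound _ (Finset.sum_nonneg fun _ _ => norm_nonneg _)
    intro v
    have hv : v = ∑ i, v i • basisVec i := by
      have := (EuclideanSpace.basisFun (Fin 3) ℝ).sum_repr v
      simpa using this.symm
    have e1 : fderiv ℝ ψ x v = ∑ i, v i • fderiv ℝ ψ x (basisVec i) := by
      conv_lhs => rw [hv, map_sum]
      simp
    rw [e1, Finset.sum_mul]
    refine (norm_sum_le _ _).trans (Finset.sum_le_sum fun i _ => ?_)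
    rw [norm_smul, mul_comm]
    exact mul_le_mul_of_nonneg_left (PiLp.norm_apply_le v i) (norm_nonneg _)
  have hcont : ∀ i, Continuous fun x => ‖(∂_{basisVec i} ψ : 𝓢(Space, ℂ)) x‖ := fun i =>
    (∂_{basisVec i} ψ : 𝓢(Space, ℂ)).continuous.norm
  have hsum : eLpNorm (∑ i, fun x => ‖(∂_{basisVec i} ψ : 𝓢(Space, ℂ)) x‖) 2 volume ≤
      ∑ i, eLpNorm (fun x => ‖(∂_{basisVec i} ψ : 𝓢(Space, ℂ)) x‖) 2 volume :=
    eLpNorm_sum_le (fun i _ => (hcont i).aestronglyMeasurable) (by norm_num)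
  calc eLpNorm (fderiv ℝ ψ) 2 volume
      ≤ eLpNorm (∑ i, fun x => ‖(∂_{basisVec i} ψ : 𝓢(Space, ℂ)) x‖) 2 volume := by
        apply eLpNorm_mono_real
        intro x
        rw [Finset.sum_apply]
        exact h1 x
    _ ≤ ∑ i, eLpNorm (fun x => ‖(∂_{basisVec i} ψ : 𝓢(Space, ℂ)) x‖) 2 volume := hsum
    _ = ∑ i, ENNReal.ofReal ‖weakPartial i (ofSchwartz ψ)‖ := by
        refine Finset.sum_congr rfl fun i _ => ?_
        rw [eLpNorm_norm, weakPartial_ofSchwartz, SchwartzMap.norm_toLp, ENNReal.ofReal_toReal]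
        exact (SchwartzMap.eLpNorm_lt_top _ 2 volume).ne
    _ ≤ ∑ i : Fin 3, ENNReal.ofReal (gr (ofSchwartz ψ)) :=
        Finset.sum_le_sum fun i _ => ENNReal.ofReal_le_ofReal (norm_weakPartial_le _ i)
    _ = _ := by
        rw [Finset.sum_const, Finset.card_univ, Fintype.card_fin, nsmul_eq_mul,
          ENNReal.ofReal_mul (by norm_num)]
        simp

/-- Cauchy-Schwarz for |ψ| · |ψ|³ bounds the quartic integral by ‖ψ‖₂ ‖ψ‖₆³, and the Sobolev
inequality bounds the L⁶ norm by the gradient. -/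
lemma exists_quarticBound_of_hasCompactSupport : ∃ C : ℝ, 0 ≤ C ∧ ∀ ψ : 𝓢(Space, ℂ),
    HasCompactSupport ψ → QuarticBound C (ofSchwartz ψ) := by
  let C₀ : ℝ≥0 := SNormLESNormFDerivOfEqConst ℂ (volume : Measure Space) 2
  refine ⟨(C₀ * 3) ^ 3, by positivity, fun ψ hψ => ?_⟩
  have hS : eLpNorm ψ 6 volume ≤ C₀ * eLpNorm (fderiv ℝ ψ) 2 volume := by
    have := eLpNorm_le_eLpNorm_fderiv_of_eq (volume : Measure Space) (u := ψ) (ψ.smooth 1) hψ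
      (p := 2) (p' := 6) (by norm_num) (by simp) (by simp; norm_num)
    simpa using this
  have hS' : eLpNorm ψ 6 volume ≤ ENNReal.ofReal (C₀ * 3 * gr (ofSchwartz ψ)) := by
    refine hS.trans ?_
    rw [mul_assoc, ENNReal.ofReal_mul (by positivity), ENNReal.ofReal_coe_nnreal]
    gcongr
    exact fderiv_eLpNorm_le ψ
  have e6 : (∫⁻ x, (‖ψ x‖ₑ ^ 3) ^ (2 : ℝ)) ^ (1 / 2 : ℝ) = eLpNorm ψ 6 volume ^ 3 := by
    rw [eLpNorm_eq_lintegral_rpow_enorm_toReal (by norm_num) (by norm_num), ← ENNReal.rpow_natCast,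
      ← ENNReal.rpow_mul]
    norm_num
    congr 2
    ext x
    rw [← pow_mul]
  have e2 : (∫⁻ x, (‖ψ x‖ₑ) ^ (2 : ℝ)) ^ (1 / 2 : ℝ) = ENNReal.ofReal ‖ofSchwartz ψ‖ := by
    rw [SchwartzMap.norm_toLp, ENNReal.ofReal_toReal (ψ.eLpNorm_lt_top 2 volume).ne,
      eLpNorm_eq_lintegral_rpow_enorm_toReal (by norm_num) (by norm_num)]
    norm_num
  have hH := ENNReal.lintegral_mul_le_Lp_mul_Lq (volume : Measure Space)
    (Real.HolderConjugate.two_two) (f := fun x => ‖ψ x‖ₑ) (g := fun x => ‖ψ x‖ₑ ^ 3)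
    ψ.continuous.enorm.aemeasurable (ψ.continuous.enorm.aemeasurable.pow_const 3)
  rw [e6, e2] at hH
  unfold QuarticBound
  calc ∫⁻ x, ‖ofSchwartz ψ x‖ₑ ^ 4 = ∫⁻ x, ((fun x => ‖ψ x‖ₑ) * fun x => ‖ψ x‖ₑ ^ 3) x := by
        apply lintegral_congr_ae
        filter_upwards [ofSchwartz_ae ψ] with x hx
        rw [hx, Pi.mul_apply]; ring
    _ ≤ _ := hH
    _ ≤ ENNReal.ofReal ‖ofSchwartz ψ‖ * ENNReal.ofReal (C₀ * 3 * gr (ofSchwartz ψ)) ^ 3 := by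
        gcongr
    _ = _ := by
        rw [← ENNReal.ofReal_pow (by have := gr_nonneg (ofSchwartz ψ); positivity),
          ← ENNReal.ofReal_mul (norm_nonneg _)]
        congr 1; ring

lemma H1Tendsto_cosCut {u : L2} (hu : u ∈ H1) : H1Tendsto (fun j : ℕ => mulL2 (cosCut j) u) u :=
  ⟨tendsto_cosCut u, tendsto_weakPartial_cosCut hu⟩

lemma hasCompactSupport_cosCut_smul (R : ℝ) (ψ : 𝓢(Space, ℂ)) :
    HasCompactSupport (SchwartzMap.smulLeftCLM ℂ (cosCut R) ψ) := by
  apply HasCompactSupport.intro (isCompact_closedBall (0 : Space) (R + 1))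
  intro x hx
  rw [SchwartzMap.smulLeftCLM_apply_apply (isMultiplier_cosCut R).temperate, cosCut_eq_zero,
    zero_smul]
  rw [mem_closedBall_zero_iff, not_le] at hx
  linarith [norm_le_jb x]

/-- Two approximations: Schwartz functions are dense in H¹, and cutting them off gives compact
support. The constant is preserved by both. -/
theorem exists_quarticBound : ∃ C : ℝ, 0 ≤ C ∧ ∀ u ∈ H1, QuarticBound C u := by
  obtain ⟨C, hC, h⟩ := exists_quarticBound_of_hasCompactSupport
  refine ⟨C, hC, fun u hu => ?_⟩
  obtain ⟨ψ, hψ⟩ := exists_schwartz_tendsto hu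
  refine QuarticBound.of_tendsto hψ fun j => ?_
  refine QuarticBound.of_tendsto (H1Tendsto_cosCut (H1_ofSchwartz (ψ j))) fun k => ?_
  rw [mulL2_ofSchwartz (isMultiplier_cosCut _)]
  exact h _ (hasCompactSupport_cosCut_smul _ _)

/-- The Gagliardo-Nirenberg constant. -/
def gnConst : ℝ := exists_quarticBound.choose

lemma gnConst_nonneg : 0 ≤ gnConst := exists_quarticBound.choose_spec.1

lemma lintegral_quartic_le {u : L2} (hu : u ∈ H1) :
    ∫⁻ x, ‖u x‖ₑ ^ 4 ≤ ENNReal.ofReal (gnConst * (‖u‖ * gr u ^ 3)) :=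
  exists_quarticBound.choose_spec.2 u hu

lemma integrable_quartic {u : L2} (hu : u ∈ H1) : Integrable fun x => ‖u x‖ ^ 4 := by
  refine ⟨(Lp.aestronglyMeasurable u).norm.pow 4, ?_⟩
  rw [hasFiniteIntegral_iff_enorm]
  refine lt_of_le_of_lt ?_ ((lintegral_quartic_le hu).trans_lt ENNReal.ofReal_lt_top)
  simp

lemma integral_quartic_le {u : L2} (hu : u ∈ H1) :
    ∫ x, ‖u x‖ ^ 4 ≤ gnConst * (‖u‖ * gr u ^ 3) := by
  have h0 : 0 ≤ gnConst * (‖u‖ * gr u ^ 3) :=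
    mul_nonneg gnConst_nonneg (mul_nonneg (norm_nonneg _) (pow_nonneg (gr_nonneg u) 3))
  rw [integral_eq_lintegral_of_nonneg_ae (Eventually.of_forall fun x => by positivity)
    (integrable_quartic hu).1]
  apply ENNReal.toReal_le_of_le_ofReal h0
  refine le_trans (le_of_eq ?_) (lintegral_quartic_le hu)
  congr 1; ext x
  rw [← ofReal_norm, ENNReal.ofReal_pow (norm_nonneg _)]

/-! ### The gradient seminorm -/

lemma gr_eq_norm (u : L2) :
    gr u = ‖(WithLp.toLp 2 fun i => weakPartial i u : PiLp 2 fun _ : Fin 3 => L2)‖ := by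
  rw [PiLp.norm_eq_of_L2]; rfl

lemma gr_add_le {u v : L2} (hu : u ∈ H1) (hv : v ∈ H1) : gr (u + v) ≤ gr u + gr v := by
  simp only [gr_eq_norm, weakPartial_add _ hu hv]
  exact norm_add_le (WithLp.toLp 2 fun i => weakPartial i u : PiLp 2 fun _ : Fin 3 => L2)
    (WithLp.toLp 2 fun i => weakPartial i v)

lemma gr_smul (c : ℂ) {u : L2} (hu : u ∈ H1) : gr (c • u) = ‖c‖ * gr u := by
  rw [gr, gradNormSq_smul c hu, Real.sqrt_mul (sq_nonneg _), Real.sqrt_sq (norm_nonneg _)]; rfl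

lemma gr_sub_le {u v : L2} (hu : u ∈ H1) (hv : v ∈ H1) : gr (u - v) ≤ gr u + gr v := by
  have h1 : gr ((-1 : ℂ) • v) = gr v := by rw [gr_smul _ hv]; simp
  calc gr (u - v) = gr (u + (-1 : ℂ) • v) := by congr 1; simp [sub_eq_add_neg]
    _ ≤ gr u + gr ((-1 : ℂ) • v) := gr_add_le hu (H1_smul _ hv)
    _ = _ := by rw [h1]

lemma gr_tr {u : L2} (hu : u ∈ H1) (z : Space) : gr (tr z u) = gr u := by
  rw [gr, gradNormSq_tr hu, gr]

/-! ### Weak compactness -/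

/-- Sequential Banach-Alaoglu in the dual of the separable space L², transported by the
conjugate-linear Riesz map. -/
lemma exists_weakTendsto_subseq {u : ℕ → L2} {M : ℝ} (hu : ∀ j, ‖u j‖ ≤ M) :
    ∃ v, ∃ ns : ℕ → ℕ, StrictMono ns ∧ WeakTendsto (fun j => u (ns j)) v := by
  have : Fact ((2 : ℝ≥0∞) ≠ ⊤) := ⟨by simp⟩
  have : TopologicalSpace.SeparableSpace L2 := inferInstance
  have hc := WeakDual.isSeqCompact_closedBall ℂ L2 0 M
  obtain ⟨f, -, ns, hns, hlim⟩ := hc (x := fun j =>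
    StrongDual.toWeakDual (InnerProductSpace.toDual ℂ L2 (u j))) (fun j => by
      rw [mem_preimage, mem_closedBall_zero_iff]
      exact ((InnerProductSpace.toDual ℂ L2).norm_map (u j)).le.trans (hu j))
  refine ⟨(InnerProductSpace.toDual ℂ L2).symm (WeakDual.toStrongDual f), ns, hns, fun w => ?_⟩
  have h1 := (WeakDual.eval_continuous (𝕜 := ℂ) w).tendsto f |>.comp hlim
  have h2 : Tendsto (fun j => inner ℂ (u (ns j)) w) atTop
      (𝓝 (inner ℂ ((InnerProductSpace.toDual ℂ L2).symm (WeakDual.toStrongDual f)) w)) := by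
    rw [InnerProductSpace.toDual_symm_apply]
    exact h1
  have h3 := (Complex.continuous_conj.tendsto _).comp h2
  simp only [Function.comp_def, inner_conj_symm] at h3
  exact h3

lemma WeakTendsto.comp {u : ℕ → L2} {v : L2} (h : WeakTendsto u v) {ns : ℕ → ℕ}
    (hns : Tendsto ns atTop atTop) : WeakTendsto (fun j => u (ns j)) v := fun w => (h w).comp hns

lemma WeakTendsto.add {u u' : ℕ → L2} {v v' : L2} (h : WeakTendsto u v) (h' : WeakTendsto u' v') :
    WeakTendsto (fun j => u j + u' j) (v + v') := fun w => by
  simpa only [inner_add_right] using (h w).add (h' w)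

lemma WeakTendsto.sub {u u' : ℕ → L2} {v v' : L2} (h : WeakTendsto u v) (h' : WeakTendsto u' v') :
    WeakTendsto (fun j => u j - u' j) (v - v') := fun w => by
  simpa only [inner_sub_right] using (h w).sub (h' w)

lemma WeakTendsto.mulL2 {u : ℕ → L2} {v : L2} (h : WeakTendsto u v) {m : Space → ℝ}
    (hm : IsBddMeas m) : WeakTendsto (fun j => mulL2 m (u j)) (mulL2 m v) := fun w => by
  simpa only [inner_mulL2 hm] using h (KohnSham.mulL2 m w)

lemma WeakTendsto.of_dense {u : ℕ → L2} {v : L2} {M : ℝ} (hu : ∀ j, ‖u j‖ ≤ M) {S : Set L2}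
    (hS : Dense S)
    (h : ∀ w ∈ S, Tendsto (fun j => inner ℂ w (u j)) atTop (𝓝 (inner ℂ w v))) :
    WeakTendsto u v := by
  intro w
  have hM : 0 ≤ M := (norm_nonneg _).trans (hu 0)
  rw [Metric.tendsto_atTop]
  intro ε hε
  obtain ⟨s, hs, hd⟩ := Metric.mem_closure_iff.1 (hS w) (ε / (2 * (M + ‖v‖ + 1)))
    (by positivity)
  obtain ⟨N, hN⟩ := Metric.tendsto_atTop.1 (h s hs) (ε / 2) (by positivity)
  refine ⟨N, fun j hj => ?_⟩
  have h1 := hN j hj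
  rw [dist_eq_norm] at *
  have e : inner ℂ w (u j) - inner ℂ w v = (inner ℂ s (u j) - inner ℂ s v) +
      inner ℂ (w - s) (u j - v) := by
    simp only [inner_sub_left, inner_sub_right]; ring
  rw [e]
  have h2 : ‖inner ℂ (w - s) (u j - v)‖ ≤ ‖w - s‖ * (M + ‖v‖) :=
    (norm_inner_le_norm _ _).trans (by
      gcongr; exact (norm_sub_le _ _).trans (by gcongr; exact hu j))
  have h3 : ‖w - s‖ * (M + ‖v‖) ≤ ε / 2 := by
    have hp : 0 < M + ‖v‖ + 1 := by positivity
    calc ‖w - s‖ * (M + ‖v‖) ≤ ε / (2 * (M + ‖v‖ + 1)) * (M + ‖v‖ + 1) := by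
          exact mul_le_mul hd.le (by linarith) (by positivity) (by positivity)
      _ = ε / 2 := by field_simp
  calc _ ≤ _ := norm_add_le _ _
    _ < ε / 2 + ε / 2 := by linarith
    _ = ε := by ring

lemma dense_range_ofSchwartz : Dense (range ofSchwartz) :=
  SchwartzMap.denseRange_toLpCLM (E := Space) (F := ℂ) (p := 2) (μ := volume) (by simp)

/-- Bounded weakly convergent sequences in `H¹`. -/
structure WeakH1 (u : ℕ → L2) (v : L2) (M : ℝ) : Prop where
  mem : ∀ j, u j ∈ H1
  norm_le : ∀ j, ‖u j‖ ≤ M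
  gr_le : ∀ j, gr (u j) ≤ M
  weak : WeakTendsto u v

lemma exists_weakH1_subseq {u : ℕ → L2} {M : ℝ} (hmem : ∀ j, u j ∈ H1) (hu : ∀ j, ‖u j‖ ≤ M)
    (hgr : ∀ j, gr (u j) ≤ M) :
    ∃ v, ∃ ns : ℕ → ℕ, StrictMono ns ∧ WeakH1 (fun j => u (ns j)) v M := by
  obtain ⟨v, ns, hns, h⟩ := exists_weakTendsto_subseq hu
  exact ⟨v, ns, hns, fun j => hmem _, fun j => hu _, fun j => hgr _, h⟩

lemma exists_weakH1_subseq_pi {n : ℕ} {u : Fin n → ℕ → L2} {M : ℝ} (hmem : ∀ k j, u k j ∈ H1)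
    (hu : ∀ k j, ‖u k j‖ ≤ M) (hgr : ∀ k j, gr (u k j) ≤ M) :
    ∃ v : Fin n → L2, ∃ ns : ℕ → ℕ, StrictMono ns ∧
      ∀ k, WeakH1 (fun j => u k (ns j)) (v k) M := by
  induction n with
  | zero => exact ⟨fun k => k.elim0, id, strictMono_id, fun k => k.elim0⟩
  | succ n ih =>
    obtain ⟨v, ns, hns, h⟩ := ih (u := fun k => u k.succ) (fun k => hmem _) (fun k => hu _)
      (fun k => hgr _)
    obtain ⟨w, ms, hms, hw⟩ := exists_weakH1_subseq (u := fun j => u 0 (ns j))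
      (fun j => hmem _ _) (fun j => hu _ _) (fun j => hgr _ _)
    refine ⟨Fin.cons w v, ns ∘ ms, hns.comp hms, fun k => ?_⟩
    refine Fin.cases ?_ (fun k => ?_) k
    · exact hw
    · exact ⟨fun j => hmem _ _, fun j => hu _ _, fun j => hgr _ _,
        (h k).weak.comp hms.tendsto_atTop⟩

lemma WeakH1.comp {u : ℕ → L2} {v : L2} {M : ℝ} (h : WeakH1 u v M) {ns : ℕ → ℕ}
    (hns : Tendsto ns atTop atTop) : WeakH1 (fun j => u (ns j)) v M :=
  ⟨fun _ => h.mem _, fun _ => h.norm_le _, fun _ => h.gr_le _, h.weak.comp hns⟩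

lemma WeakH1.limit_mem {u : ℕ → L2} {v : L2} {M : ℝ} (h : WeakH1 u v M) : v ∈ H1 := by
  intro i
  obtain ⟨g, ns, hns, hg⟩ := exists_weakTendsto_subseq (u := fun j => weakPartial i (u j))
    (fun j => (norm_weakPartial_le _ _).trans (h.gr_le j))
  exact ⟨g, (h.weak.comp hns.tendsto_atTop).isWeakPartial hg
    fun j => isWeakPartial_weakPartial (h.mem _) i⟩

/-- The gradients are bounded, so it suffices to test them on the dense Schwartz functions, where
the derivative moves to the test function. No further subsequence is needed. -/
lemma WeakH1.weakPartial {u : ℕ → L2} {v : L2} {M : ℝ} (h : WeakH1 u v M) (i : Fin 3) :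
    WeakTendsto (fun j => weakPartial i (u j)) (weakPartial i v) := by
  refine WeakTendsto.of_dense (fun j => (norm_weakPartial_le _ _).trans (h.gr_le j))
    dense_range_ofSchwartz ?_
  rintro _ ⟨ψ, rfl⟩
  simp only [fun j => isWeakPartial_iff.1 (isWeakPartial_weakPartial (h.mem j) i),
    isWeakPartial_iff.1 (isWeakPartial_weakPartial h.limit_mem i)]
  exact (h.weak _).neg

lemma WeakTendsto.re_inner_self {u : ℕ → L2} {v : L2} (h : WeakTendsto u v) :
    Tendsto (fun j => (inner ℂ v (u j)).re) atTop (𝓝 (‖v‖ ^ 2)) := by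
  have := (Complex.continuous_re.tendsto _).comp (h v)
  rwa [show (inner ℂ v v : ℂ).re = ‖v‖ ^ 2 from inner_self_eq_norm_sq (𝕜 := ℂ) v] at this

lemma WeakTendsto.norm_sq_lsc {u : ℕ → L2} {v : L2} (h : WeakTendsto u v) {ε : ℝ} (hε : 0 < ε) :
    ∀ᶠ j in atTop, ‖v‖ ^ 2 ≤ ‖u j‖ ^ 2 + ε := by
  have h1 := h.re_inner_self
  filter_upwards [h1.eventually_const_lt (show ‖v‖ ^ 2 - ε / 2 < ‖v‖ ^ 2 by linarith)] with j hj
  have h2 : (inner ℂ v (u j)).re ≤ ‖v‖ * ‖u j‖ :=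
    (Complex.re_le_norm _).trans (norm_inner_le_norm _ _)
  nlinarith [sq_nonneg (‖v‖ - ‖u j‖)]

lemma WeakH1.gradNormSq_lsc {u : ℕ → L2} {v : L2} {M : ℝ} (h : WeakH1 u v M) {ε : ℝ}
    (hε : 0 < ε) : ∀ᶠ j in atTop, gradNormSq v ≤ gradNormSq (u j) + ε := by
  have h1 : ∀ i, ∀ᶠ j in atTop, ‖KohnSham.weakPartial i v‖ ^ 2 ≤
      ‖KohnSham.weakPartial i (u j)‖ ^ 2 + ε / 3 :=
    fun i => (h.weakPartial i).norm_sq_lsc (by positivity)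
  filter_upwards [eventually_all.2 h1] with j hj
  calc gradNormSq v ≤ ∑ i, (‖KohnSham.weakPartial i (u j)‖ ^ 2 + ε / 3) :=
        Finset.sum_le_sum fun i _ => hj i
    _ = _ := by rw [Finset.sum_add_distrib]; simp [gradNormSq]; ring

/-- The Radon-Riesz property, by expanding the square of the distance. -/
lemma WeakTendsto.tendsto_of_norm {u : ℕ → L2} {v : L2} (h : WeakTendsto u v)
    (hn : Tendsto (fun j => ‖u j‖ ^ 2) atTop (𝓝 (‖v‖ ^ 2))) : Tendsto u atTop (𝓝 v) := by
  rw [tendsto_iff_norm_sub_tendsto_zero]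
  have h1 := h.re_inner_self
  have h2 : Tendsto (fun j => ‖u j - v‖ ^ 2) atTop (𝓝 0) := by
    have h3 := (hn.sub (h1.const_mul 2)).add_const (‖v‖ ^ 2)
    rw [show ‖v‖ ^ 2 - 2 * ‖v‖ ^ 2 + ‖v‖ ^ 2 = 0 by ring] at h3
    refine h3.congr fun j => ?_
    rw [@norm_sub_sq ℂ, ← inner_conj_symm (u j) v, RCLike.conj_re]
    rfl
  have := h2.sqrt
  simpa [Real.sqrt_sq (norm_nonneg _)] using this

/-! ### Local compactness -/

/-- By Plancherel, translation multiplies the Fourier transform by a phase, and |exp(iθ) - 1| ≤ |θ|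
compares it with the symbol of the directional derivative. -/
lemma norm_tr_sub_schwartz_le (ψ : 𝓢(Space, ℂ)) (z : Space) :
    ‖tr z (ofSchwartz ψ) - ofSchwartz ψ‖ ≤ ‖ofSchwartz (∂_{z} ψ)‖ := by
  rw [tr_ofSchwartz]
  have e : ofSchwartz (SchwartzMap.compSubConstCLM ℂ z ψ) - ofSchwartz ψ =
      ofSchwartz (SchwartzMap.compSubConstCLM ℂ z ψ - ψ) :=
    ((SchwartzMap.toLpCLM ℂ ℂ 2 volume).map_sub _ _).symm
  rw [e, ← SchwartzMap.norm_fourier_toL2_eq, ← SchwartzMap.norm_fourier_toL2_eq (∂_{z} ψ)]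
  apply Lp.norm_le_norm_of_ae_le
  filter_upwards [(𝓕 (SchwartzMap.compSubConstCLM ℂ z ψ - ψ)).coeFn_toLp 2 volume,
    (𝓕 (∂_{z} ψ)).coeFn_toLp 2 volume] with ξ h1 h2
  rw [h1, h2, SchwartzMap.fourier_lineDerivOp_eq]
  have h3 : (𝓕 (SchwartzMap.compSubConstCLM ℂ z ψ)) ξ =
      Complex.exp (↑(-2 * Real.pi * inner ℝ z ξ) * Complex.I) * (𝓕 ψ) ξ := by
    rw [SchwartzMap.fourier_coe, SchwartzMap.fourier_coe, Real.fourier_eq', Real.fourier_eq',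
      ← integral_const_mul, ← integral_add_right_eq_self _ z]
    refine integral_congr_ae (Eventually.of_forall fun x => ?_)
    simp only [SchwartzMap.compSubConstCLM_apply, add_sub_cancel_right, inner_add_left,
      smul_eq_mul]
    rw [← mul_assoc, ← Complex.exp_add]
    congr 2
    push_cast; ring
  have h4 : (𝓕 (SchwartzMap.compSubConstCLM ℂ z ψ - ψ)) ξ =
      (Complex.exp (Complex.I * ↑(-2 * Real.pi * inner ℝ z ξ)) - 1) * (𝓕 ψ) ξ := by
    have : 𝓕 (SchwartzMap.compSubConstCLM ℂ z ψ - ψ) =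
        𝓕 (SchwartzMap.compSubConstCLM ℂ z ψ) - 𝓕 ψ :=
      (FourierTransform.fourierCLM ℂ 𝓢(Space, ℂ)).map_sub _ _
    rw [this, sub_apply, h3, mul_comm Complex.I]; ring
  rw [h4, norm_mul, smul_apply, norm_smul,
    SchwartzMap.smulLeftCLM_apply_apply (by fun_prop), norm_smul]
  rw [← mul_assoc]
  gcongr
  refine Real.norm_exp_I_mul_ofReal_sub_one_le.trans (le_of_eq ?_)
  simp [real_inner_comm, abs_of_pos Real.pi_pos]

lemma norm_ofSchwartz_lineDeriv_le (ψ : 𝓢(Space, ℂ)) (z : Space) :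
    ‖ofSchwartz (∂_{z} ψ)‖ ≤ 3 * ‖z‖ * gr (ofSchwartz ψ) := by
  have hz : z = ∑ i, z i • basisVec i := by
    have := (EuclideanSpace.basisFun (Fin 3) ℝ).sum_repr z
    simpa using this.symm
  have h1 : ofSchwartz (∂_{z} ψ) = ∑ i, (z i : ℂ) • ofSchwartz (∂_{basisVec i} ψ) := by
    have : ∂_{z} ψ = ∑ i, (z i : ℂ) • ∂_{basisVec i} ψ := by
      ext x
      rw [SchwartzMap.lineDerivOp_apply_eq_fderiv]
      conv_lhs => rw [hz, map_sum]
      simp [SchwartzMap.lineDerivOp_apply_eq_fderiv, Fin.sum_univ_three]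
    rw [this]
    change SchwartzMap.toLpCLM ℂ ℂ 2 volume _ = _
    rw [map_sum]
    simp only [map_smul]; rfl
  rw [h1]
  calc _ ≤ ∑ i, ‖(z i : ℂ) • ofSchwartz (∂_{basisVec i} ψ)‖ := norm_sum_le _ _
    _ ≤ ∑ i : Fin 3, ‖z‖ * gr (ofSchwartz ψ) := by
        refine Finset.sum_le_sum fun i _ => ?_
        rw [norm_smul, Complex.norm_real, ← weakPartial_ofSchwartz]
        gcongr
        · exact PiLp.norm_apply_le z i
        · exact norm_weakPartial_le _ i
    _ = _ := by simp; ring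

lemma norm_tr_sub_le {u : L2} (hu : u ∈ H1) (z : Space) :
    ‖tr z u - u‖ ≤ 3 * ‖z‖ * gr u := by
  obtain ⟨ψ, hψ⟩ := exists_schwartz_tendsto hu
  refine le_of_tendsto_of_tendsto ?_ (hψ.gr.const_mul (3 * ‖z‖)) (Eventually.of_forall fun j =>
    (norm_tr_sub_schwartz_le (ψ j) z).trans (norm_ofSchwartz_lineDeriv_le (ψ j) z))
  exact ((((tr z).continuous.tendsto u).comp hψ.1).sub hψ.1).norm

/-- The average of `u` over the ball of radius `ε` around a point. -/
def ballAverage (ε : ℝ) (u : L2) (x : Space) : ℂ :=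
  ⨍ h in Metric.ball (0 : Space) ε, u (x - h)

lemma measurable_L2 (u : L2) : Measurable u := (Lp.stronglyMeasurable u).measurable

/-- The error of averaging is a mean of translation differences. The L¹ norm is at most the L² norm
for the normalized measure `κ` on the ball, Tonelli exchanges the integrals, and each translation by
|h| < ε costs at most 3 ε `gr u`. -/
lemma lintegral_sub_ballAverage_le {u : L2} (hu : u ∈ H1) {ε : ℝ} (hε : 0 < ε) :
    ∫⁻ x, ‖u x - ballAverage ε u x‖ₑ ^ 2 ≤ ENNReal.ofReal (3 * ε * gr u) ^ 2 := by
  have hB0 : volume (Metric.ball (0 : Space) ε) ≠ 0 := (Metric.measure_ball_pos _ _ hε).ne'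
  have hBt : volume (Metric.ball (0 : Space) ε) ≠ ⊤ := measure_ball_lt_top.ne
  set κ : Measure Space := (volume (Metric.ball (0 : Space) ε))⁻¹ •
    volume.restrict (Metric.ball (0 : Space) ε) with hκ
  have hκp : IsProbabilityMeasure κ := ⟨by
    rw [hκ, Measure.smul_apply, Measure.restrict_apply_univ, smul_eq_mul,
      ENNReal.inv_mul_cancel hB0 hBt]⟩
  have hmeas : Measurable fun p : Space × Space => u (p.1 - p.2) :=
    (measurable_L2 u).comp (measurable_fst.sub measurable_snd)
  have hmx : ∀ x, Measurable fun h => u (x - h) := fun x =>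
    (measurable_L2 u).comp (measurable_const.sub measurable_id)
  have hint : ∀ x, Integrable (fun h => u (x - h)) κ := by
    intro x
    have h1 : MemLp (fun h => u (x - h)) 2 volume :=
      (Lp.memLp u).comp_measurePreserving (Measure.measurePreserving_sub_left volume x)
    have h2 : IntegrableOn (fun h => u (x - h)) (Metric.ball (0 : Space) ε) := by
      have : IsFiniteMeasure (volume.restrict (Metric.ball (0 : Space) ε)) :=
        ⟨by rw [Measure.restrict_apply_univ]; exact hBt.lt_top⟩
      exact (h1.restrict _).integrable (by norm_num)
    exact Integrable.smul_measure h2 (by simpa using hB0)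
  have hpt : ∀ x, ‖u x - ballAverage ε u x‖ₑ ^ 2 ≤ ∫⁻ h, ‖u x - u (x - h)‖ₑ ^ 2 ∂κ := by
    intro x
    have e1 : u x - ballAverage ε u x = ∫ h, (u x - u (x - h)) ∂κ := by
      rw [integral_sub (integrable_const _) (hint x), integral_const, ballAverage, average,
        Measure.restrict_apply_univ, probReal_univ, one_smul]
    rw [e1]
    have h1 : ‖∫ h, (u x - u (x - h)) ∂κ‖ₑ ≤ eLpNorm (fun h => u x - u (x - h)) 1 κ := by
      rw [eLpNorm_one_eq_lintegral_enorm]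
      exact enorm_integral_le_lintegral_enorm _
    have h2 := h1.trans (eLpNorm_le_eLpNorm_of_exponent_le (q := 2) (by norm_num)
      (measurable_const.sub (hmx x)).aestronglyMeasurable)
    calc _ ≤ (eLpNorm (fun h => u x - u (x - h)) 2 κ) ^ 2 := by gcongr
      _ = _ := by
        rw [eLpNorm_eq_lintegral_rpow_enorm_toReal (by norm_num) (by norm_num),
          ← ENNReal.rpow_natCast, ← ENNReal.rpow_mul]
        norm_num
  calc ∫⁻ x, ‖u x - ballAverage ε u x‖ₑ ^ 2
      ≤ ∫⁻ x, (∫⁻ h, ‖u x - u (x - h)‖ₑ ^ 2 ∂κ) := lintegral_mono hpt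
    _ = ∫⁻ h, (∫⁻ x, ‖u x - u (x - h)‖ₑ ^ 2) ∂κ := by
        apply lintegral_lintegral_swap
        exact ((((measurable_L2 u).comp measurable_fst).sub hmeas).enorm.pow_const 2).aemeasurable
    _ ≤ ∫⁻ h, ENNReal.ofReal (3 * ε * gr u) ^ 2 ∂κ := by
        apply lintegral_mono_ae
        have hb : ∀ᵐ h ∂κ, h ∈ Metric.ball (0 : Space) ε :=
          Measure.ae_smul_measure (ae_restrict_mem measurableSet_ball) _
        filter_upwards [hb] with h hh
        have e : ∫⁻ x, ‖u x - u (x - h)‖ₑ ^ 2 = ENNReal.ofReal (‖tr h u - u‖ ^ 2) := by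
          rw [norm_sq_eq_integral, ofReal_integral_eq_lintegral_ofReal (integrable_norm_sq _)
            (Eventually.of_forall fun x => sq_nonneg _)]
          apply lintegral_congr_ae
          filter_upwards [Lp.coeFn_sub (tr h u) u, tr_ae h u] with x h1 h2
          rw [h1, Pi.sub_apply, h2, ENNReal.ofReal_pow (norm_nonneg _), ofReal_norm, enorm_sub_rev]
        rw [e, ENNReal.ofReal_pow (norm_nonneg _)]
        gcongr
        refine (norm_tr_sub_le hu h).trans ?_
        have := gr_nonneg u
        have hh' := (mem_ball_zero_iff.1 hh).le
        gcongr
    _ = _ := by simp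

/-- As an inner product with an indicator, the average is weakly continuous and bounded by the L²
norm uniformly in the centre. -/
lemma ballAverage_eq_inner (ε : ℝ) (v : L2) (x : Space) :
    ballAverage ε v x = (volume.real (Metric.ball (0 : Space) ε))⁻¹ • inner ℂ
      (indicatorConstLp 2 (measurableSet_ball (x := x) (ε := ε)) measure_ball_lt_top.ne (1 : ℂ))
      v := by
  rw [L2.inner_indicatorConstLp_one, ballAverage, setAverage_eq]
  congr 1
  rw [← integral_indicator measurableSet_ball, ← integral_indicator measurableSet_ball,
    ← integral_sub_left_eq_self _ volume x]
  congr 1; ext y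
  simp only [indicator, Metric.mem_ball, sub_sub_cancel, dist_eq_norm, norm_sub_rev, sub_zero]

lemma WeakTendsto.ballAverage {u : ℕ → L2} (h : WeakTendsto u 0) {ε : ℝ} (x : Space) :
    Tendsto (fun j => ballAverage ε (u j) x) atTop (𝓝 0) := by
  simp only [ballAverage_eq_inner]
  simpa using (h (indicatorConstLp 2 measurableSet_ball measure_ball_lt_top.ne (1 : ℂ))).const_smul
    ((volume.real (Metric.ball (0 : Space) ε))⁻¹)

lemma norm_ballAverage_le (ε : ℝ) : ∃ C : ℝ, ∀ x, ∀ u : L2,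
    ‖ballAverage ε u x‖ ≤ C * ‖u‖ := by
  refine ⟨(volume.real (Metric.ball (0 : Space) ε))⁻¹ *
    (volume.real (Metric.ball (0 : Space) ε)) ^ (1 / (2 : ℝ)), fun x v => ?_⟩
  rw [ballAverage_eq_inner, norm_smul, mul_assoc, Real.norm_of_nonneg (by positivity)]
  gcongr
  refine (norm_inner_le_norm _ _).trans ?_
  gcongr
  rw [norm_indicatorConstLp (by norm_num) (by norm_num)]
  have : volume.real (Metric.ball x ε) = volume.real (Metric.ball (0 : Space) ε) := by
    simp only [Measure.real, Measure.addHaar_ball_center]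
  rw [this]; simp

lemma measurable_ballAverage (ε : ℝ) (u : L2) : StronglyMeasurable (ballAverage ε u) := by
  have hmeas : StronglyMeasurable fun p : Space × Space => u (p.1 - p.2) :=
    (Lp.stronglyMeasurable u).comp_measurable (measurable_fst.sub measurable_snd)
  exact hmeas.integral_prod_right'

/-- Local compactness of the embedding of `H¹` into `L²` for null sequences. -/
lemma WeakH1.tendsto_lintegral_ball {u : ℕ → L2} {M : ℝ} (h : WeakH1 u 0 M) (R : ℝ) :
    Tendsto (fun j => ∫⁻ x in Metric.closedBall (0 : Space) R, ‖u j x‖ₑ ^ 2) atTop (𝓝 0) := by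
  rw [ENNReal.tendsto_nhds_zero]
  intro δ hδ
  have hM : 0 ≤ M := (norm_nonneg _).trans (h.norm_le 0)
  -- The scale ε is fixed first, so that replacing every term of the sequence by its ball averages
  -- costs at most δ/2 in the squared L² norm. The factor 2 comes from (a + b)² ≤ 2a² + 2b².
  obtain ⟨ε, hε, hεδ⟩ : ∃ ε : ℝ, 0 < ε ∧ 2 * ENNReal.ofReal (3 * ε * M) ^ 2 ≤ δ / 2 := by
    have hc : Tendsto (fun ε : ℝ => 2 * ENNReal.ofReal (3 * ε * M) ^ 2) (𝓝[>] 0) (𝓝 0) := by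
      have h1 : Tendsto (fun ε : ℝ => ENNReal.ofReal (3 * ε * M)) (𝓝[>] 0) (𝓝 0) := by
        have : Tendsto (fun ε : ℝ => 3 * ε * M) (𝓝 0) (𝓝 (3 * 0 * M)) :=
          (tendsto_id.const_mul 3).mul_const M
        simpa using ENNReal.tendsto_ofReal (this.mono_left nhdsWithin_le_nhds)
      have h2 := ENNReal.Tendsto.const_mul (a := 2) (ENNReal.Tendsto.pow (n := 2) h1) (Or.inr (by simp))
      simpa using h2
    have h3 := (ENNReal.tendsto_nhds_zero.1 hc (δ / 2) (ENNReal.half_pos hδ.ne')).and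
      self_mem_nhdsWithin
    obtain ⟨ε, h4, h5⟩ := h3.exists
    exact ⟨ε, h5, h4⟩
  obtain ⟨C, hC⟩ := norm_ballAverage_le ε
  -- At this fixed scale the averages tend to zero pointwise by weak convergence and are uniformly
  -- bounded, so dominated convergence applies on the ball.
  have hav : Tendsto (fun j => 2 * ∫⁻ x in Metric.closedBall (0 : Space) R,
      ‖ballAverage ε (u j) x‖ₑ ^ 2) atTop (𝓝 0) := by
    have h1 : Tendsto (fun j => ∫⁻ x in Metric.closedBall (0 : Space) R,
        ‖ballAverage ε (u j) x‖ₑ ^ 2) atTop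
        (𝓝 (∫⁻ x in Metric.closedBall (0 : Space) R, 0)) := by
      apply tendsto_lintegral_of_dominated_convergence (fun _ => ENNReal.ofReal (|C| * M) ^ 2)
      · exact fun j => (measurable_ballAverage ε (u j)).measurable.enorm.pow_const 2
      · refine fun j => Eventually.of_forall fun x => ?_
        change ‖ballAverage ε (u j) x‖ₑ ^ 2 ≤ ENNReal.ofReal (|C| * M) ^ 2
        gcongr
        rw [← ofReal_norm]
        apply ENNReal.ofReal_le_ofReal
        refine (hC x (u j)).trans ?_
        exact mul_le_mul (le_abs_self C) (h.norm_le j) (norm_nonneg _) (abs_nonneg _)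
      · rw [setLIntegral_const]
        exact ENNReal.mul_ne_top (by finiteness) measure_closedBall_lt_top.ne
      · refine Eventually.of_forall fun x => ?_
        have := (h.weak.ballAverage (ε := ε) x).enorm
        simpa using ENNReal.Tendsto.pow (n := 2) this
    have h2 := ENNReal.Tendsto.const_mul (a := 2) h1 (Or.inr (by simp))
    simpa using h2
  filter_upwards [ENNReal.tendsto_nhds_zero.1 hav (δ / 2) (ENNReal.half_pos hδ.ne')] with j hj
  have hpt : ∀ x, ‖u j x‖ₑ ^ 2 ≤ 2 * ‖u j x - ballAverage ε (u j) x‖ₑ ^ 2 +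
      2 * ‖ballAverage ε (u j) x‖ₑ ^ 2 := by
    intro x
    have h1 : ‖u j x‖ₑ ≤ ‖u j x - ballAverage ε (u j) x‖ₑ + ‖ballAverage ε (u j) x‖ₑ := by
      simpa using enorm_add_le (u j x - ballAverage ε (u j) x) (ballAverage ε (u j) x)
    calc _ ≤ (‖u j x - ballAverage ε (u j) x‖ₑ + ‖ballAverage ε (u j) x‖ₑ) ^ 2 := by gcongr
      _ ≤ 2 * (‖u j x - ballAverage ε (u j) x‖ₑ ^ 2 + ‖ballAverage ε (u j) x‖ₑ ^ 2) := by
          have := ENNReal.rpow_add_le_mul_rpow_add_rpow ‖u j x - ballAverage ε (u j) x‖ₑ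
            ‖ballAverage ε (u j) x‖ₑ (p := 2) (by norm_num)
          norm_num at this
          exact_mod_cast this
      _ = _ := by rw [mul_add]
  calc ∫⁻ x in Metric.closedBall (0 : Space) R, ‖u j x‖ₑ ^ 2
      ≤ ∫⁻ x in Metric.closedBall (0 : Space) R, (2 * ‖u j x - ballAverage ε (u j) x‖ₑ ^ 2 +
          2 * ‖ballAverage ε (u j) x‖ₑ ^ 2) := lintegral_mono hpt
    _ = (∫⁻ x in Metric.closedBall (0 : Space) R, 2 * ‖u j x - ballAverage ε (u j) x‖ₑ ^ 2) +
        ∫⁻ x in Metric.closedBall (0 : Space) R, 2 * ‖ballAverage ε (u j) x‖ₑ ^ 2 :=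
        lintegral_add_right _
          ((measurable_ballAverage ε (u j)).measurable.enorm.pow_const 2 |>.const_mul 2)
    _ ≤ δ / 2 + δ / 2 := by
        gcongr
        · refine (setLIntegral_le_lintegral _ _).trans ?_
          rw [lintegral_const_mul' _ _ (by simp)]
          refine le_trans ?_ hεδ
          gcongr
          refine (lintegral_sub_ballAverage_le (h.mem j) hε).trans ?_
          gcongr
          exact h.gr_le j
        · rwa [lintegral_const_mul' _ _ (by simp)]
    _ = δ := ENNReal.add_halves δ

/-- Functions vanishing outside a ball. -/
def VanishesOff (R : ℝ) (m : Space → ℝ) : Prop := ∀ x, R < ‖x‖ → m x = 0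

/-- Rellich's theorem in the form used below: a multiplier of bounded support turns weak H¹
convergence into strong L² convergence. -/
theorem WeakH1.tendsto_mulL2 {u : ℕ → L2} {v : L2} {M : ℝ} (h : WeakH1 u v M) {m : Space → ℝ}
    (hm : IsBddMeas m) {R : ℝ} (hR : VanishesOff R m) :
    Tendsto (fun j => mulL2 m (u j)) atTop (𝓝 (mulL2 m v)) := by
  rw [← tendsto_sub_nhds_zero_iff]
  simp only [← mulL2_sub hm]
  have hz : WeakH1 (fun j => u j - v) 0 (M + ‖v‖ + gr v) := by
    have hM : 0 ≤ M := (norm_nonneg _).trans (h.norm_le 0)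
    refine ⟨fun j => H1_sub (h.mem j) h.limit_mem, fun j => ?_, fun j => ?_, ?_⟩
    · refine (norm_sub_le _ _).trans ?_
      linarith [h.norm_le j, gr_nonneg v]
    · refine (gr_sub_le (h.mem j) h.limit_mem).trans ?_
      linarith [h.gr_le j, norm_nonneg v]
    · have := h.weak.sub (WeakTendsto.of_tendsto (tendsto_const_nhds (x := v)))
      rwa [sub_self] at this
  obtain ⟨C, hC⟩ := hm.bdd
  have hC0 : 0 ≤ C := (abs_nonneg _).trans (hC 0)
  have h1 := hz.tendsto_lintegral_ball R
  have h2 := ENNReal.Tendsto.const_mul (a := ENNReal.ofReal C ^ 2) h1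
    (Or.inr (by finiteness))
  rw [mul_zero] at h2
  have h3 : Tendsto (fun j => ENNReal.ofReal (‖mulL2 m (u j - v)‖ ^ 2)) atTop (𝓝 0) := by
    refine tendsto_of_tendsto_of_tendsto_of_le_of_le tendsto_const_nhds h2 (fun _ => zero_le)
      fun j => ?_
    change ENNReal.ofReal (‖mulL2 m (u j - v)‖ ^ 2) ≤ _
    rw [norm_sq_eq_integral, ofReal_integral_eq_lintegral_ofReal (integrable_norm_sq _)
      (Eventually.of_forall fun x => sq_nonneg _), ← lintegral_const_mul' _ _ (by finiteness),
      ← lintegral_indicator measurableSet_closedBall]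
    apply lintegral_mono_ae
    filter_upwards [mulL2_ae hm (u j - v)] with x hx
    rw [hx, norm_mul, Complex.norm_real]
    by_cases hxR : x ∈ Metric.closedBall (0 : Space) R
    · rw [indicator_of_mem hxR, ← ofReal_norm, ← ENNReal.ofReal_pow (norm_nonneg _),
        ← ENNReal.ofReal_pow hC0, ← ENNReal.ofReal_mul (by positivity), ← mul_pow]
      apply ENNReal.ofReal_le_ofReal
      gcongr
      exact hC x
    · rw [hR x (by simpa using hxR)]; simp
  have h4 : Tendsto (fun j => ‖mulL2 m (u j - v)‖ ^ 2) atTop (𝓝 0) := by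
    have := (ENNReal.tendsto_toReal (by simp)).comp h3
    simpa [Function.comp_def, ENNReal.toReal_ofReal (sq_nonneg _)] using this
  rw [tendsto_zero_iff_norm_tendsto_zero]
  simpa [Real.sqrt_sq (norm_nonneg _)] using h4.sqrt

/-! ### Bounds on the exchange-correlation energy density -/

namespace IsExchangeCorrelation

variable {e : ℝ → ℝ}

lemma hasDerivWithinAt (he : IsExchangeCorrelation e) {r : ℝ} (hr : 0 ≤ r) :
    HasDerivWithinAt e (vXC e r) (Ici 0) r :=
  ((he.contDiffOn.differentiableOn (by simp)) r hr).hasDerivWithinAt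

lemma continuousOn_vXC (he : IsExchangeCorrelation e) : ContinuousOn (vXC e) (Ici 0) :=
  he.contDiffOn.continuousOn_derivWithin (uniqueDiffOn_Ici 0) le_rfl

lemma antitoneOn (he : IsExchangeCorrelation e) : AntitoneOn e (Ici 0) := by
  apply antitoneOn_of_deriv_nonpos (convex_Ici 0) he.contDiffOn.continuousOn
  · exact (he.contDiffOn.differentiableOn (by simp)).mono interior_subset
  · intro x hx
    rw [interior_Ici] at hx
    have h := (he.hasDerivWithinAt (le_of_lt hx)).hasDerivAt (Ici_mem_nhds hx)
    rw [h.deriv]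
    exact he.deriv_nonpos x (le_of_lt hx)

lemma nonpos (he : IsExchangeCorrelation e) {r : ℝ} (hr : 0 ≤ r) : e r ≤ 0 := by
  rw [← he.zero]; exact he.antitoneOn (mem_Ici.2 le_rfl) hr hr

lemma abs_sub_le_of_bound (he : IsExchangeCorrelation e) {M C s t : ℝ}
    (hC : ∀ r, 0 ≤ r → r ≤ M → |vXC e r| ≤ C) (hs : 0 ≤ s) (hsM : s ≤ M) (ht : 0 ≤ t)
    (htM : t ≤ M) : |e s - e t| ≤ C * |s - t| := by
  have := (convex_Icc (0 : ℝ) M).norm_image_sub_le_of_norm_hasDerivWithin_le (f := e)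
    (f' := vXC e) (C := C) (fun x hx => (he.hasDerivWithinAt hx.1).mono Icc_subset_Ici_self)
    (fun x hx => hC x hx.1 hx.2) ⟨ht, htM⟩ ⟨hs, hsM⟩
  exact this

lemma abs_le_of_bound (he : IsExchangeCorrelation e) {C r : ℝ}
    (hC : ∀ s, 0 ≤ s → s ≤ r → |vXC e s| ≤ C) (hr : 0 ≤ r) : |e r| ≤ C * r := by
  have := he.abs_sub_le_of_bound hC hr le_rfl le_rfl hr
  rwa [he.zero, sub_zero, sub_zero, abs_of_nonneg hr] at this

lemma rpow_le {a b δ : ℝ} (hab : a < b) (ha : 0 ≤ a) (hδ : 0 < δ) :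
    ∃ C, 0 ≤ C ∧ ∀ r : ℝ, 0 ≤ r → r ^ a ≤ C + δ * r ^ b := by
  have h := tendsto_rpow_neg_atTop (sub_pos.2 hab)
  obtain ⟨r₀, h1, h0⟩ := ((h.eventually_le_const hδ).and (eventually_gt_atTop (0 : ℝ))).exists
  refine ⟨r₀ ^ a, by positivity, fun r hr => ?_⟩
  rcases le_or_gt r r₀ with h2 | h2
  · have : r ^ a ≤ r₀ ^ a := Real.rpow_le_rpow hr h2 ha
    have : 0 ≤ δ * r ^ b := by positivity
    linarith
  · have hr' : 0 < r := h0.trans h2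
    have h3 : r ^ a = r ^ (-(b - a)) * r ^ b := by
      rw [← Real.rpow_add hr']; congr 1; ring
    have h4 : r ^ (-(b - a)) ≤ δ :=
      (Real.rpow_le_rpow_of_nonpos h0 h2.le (by linarith)).trans h1
    rw [h3]
    have h5 : 0 ≤ r₀ ^ a := by positivity
    have h6 : r ^ (-(b - a)) * r ^ b ≤ δ * r ^ b := by gcongr
    linarith

/-- Strict subcriticality p - 1 < 2/3 makes the coefficient of the critical power arbitrarily small;
this is what lets the kinetic energy dominate. -/
lemma abs_vXC_le_rpow (he : IsExchangeCorrelation e) {δ : ℝ} (hδ : 0 < δ) :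
    ∃ C, 0 ≤ C ∧ ∀ r, 0 ≤ r → |vXC e r| ≤ C + δ * r ^ (2 / 3 : ℝ) := by
  obtain ⟨p, hp1, hp2, c, hc, h⟩ := he.growth
  obtain ⟨C, hC0, hC⟩ := rpow_le (a := p - 1) (b := 2 / 3) (δ := δ / c) (by linarith)
    (by linarith) (by positivity)
  refine ⟨c * (1 + C), by positivity, fun r hr => (h r hr).trans ?_⟩
  calc c * (1 + r ^ (p - 1)) ≤ c * (1 + (C + δ / c * r ^ (2 / 3 : ℝ))) := by
        gcongr; exact hC r hr
    _ = _ := by field_simp; ring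

lemma abs_vXC_le_linear (he : IsExchangeCorrelation e) {δ : ℝ} (hδ : 0 < δ) :
    ∃ C, 0 ≤ C ∧ ∀ r, 0 ≤ r → |vXC e r| ≤ C + δ * r := by
  obtain ⟨C, hC0, hC⟩ := he.abs_vXC_le_rpow (show (0 : ℝ) < 1 by norm_num)
  obtain ⟨C', hC0', hC'⟩ := rpow_le (a := 2 / 3) (b := 1) (δ := δ) (by norm_num) (by norm_num) hδ
  refine ⟨C + C', by positivity, fun r hr => (hC r hr).trans ?_⟩
  have := hC' r hr
  rw [Real.rpow_one] at this
  linarith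

/-- Near zero the bound δ comes from continuity and `deriv_zero`; away from zero the constant of the
linear growth bound is absorbed into the linear term. -/
lemma abs_vXC_le_small (he : IsExchangeCorrelation e) {δ : ℝ} (hδ : 0 < δ) :
    ∃ C, 0 ≤ C ∧ ∀ r, 0 ≤ r → |vXC e r| ≤ δ + C * r := by
  obtain ⟨C, hC0, hC⟩ := he.abs_vXC_le_linear (show (0 : ℝ) < 1 by norm_num)
  have h0 : ∀ᶠ r in 𝓝[Ici 0] (0 : ℝ), |vXC e r| < δ := by
    have := (he.continuousOn_vXC 0 (mem_Ici.2 le_rfl)).abs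
    rw [ContinuousWithinAt, he.deriv_zero, abs_zero] at this
    exact this.eventually_lt_const hδ
  obtain ⟨η, hη, hη'⟩ := Metric.mem_nhdsWithin_iff.1 h0
  refine ⟨C / η + 1, by positivity, fun r hr => ?_⟩
  rcases lt_or_ge r η with h1 | h1
  · have h2 : |vXC e r| < δ := hη' ⟨by
      rw [Metric.mem_ball, dist_zero_right, Real.norm_eq_abs, abs_of_nonneg hr]
      exact h1, hr⟩
    have h3 : 0 ≤ (C / η + 1) * r := by positivity
    linarith
  · have h2 : C ≤ C / η * r := by
      rw [div_mul_eq_mul_div, le_div_iff₀ hη]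
      gcongr
    linarith [hC r hr]

lemma abs_le_small (he : IsExchangeCorrelation e) {δ : ℝ} (hδ : 0 < δ) :
    ∃ C, 0 ≤ C ∧ ∀ r, 0 ≤ r → |e r| ≤ δ * r + C * r ^ 2 := by
  obtain ⟨C, hC0, hC⟩ := he.abs_vXC_le_small hδ
  refine ⟨C, hC0, fun r hr => ?_⟩
  have := he.abs_le_of_bound (C := δ + C * r) (r := r)
    (fun s hs hsr => (hC s hs).trans (by gcongr)) hr
  linarith

lemma abs_le_rpow (he : IsExchangeCorrelation e) {δ : ℝ} (hδ : 0 < δ) :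
    ∃ C, 0 ≤ C ∧ ∀ r, 0 ≤ r → |e r| ≤ C * r + δ * r ^ (5 / 3 : ℝ) := by
  obtain ⟨C, hC0, hC⟩ := he.abs_vXC_le_rpow hδ
  refine ⟨C, hC0, fun r hr => ?_⟩
  have := he.abs_le_of_bound (C := C + δ * r ^ (2 / 3 : ℝ)) (r := r)
    (fun s hs hsr => (hC s hs).trans (by gcongr)) hr
  refine this.trans (le_of_eq ?_)
  rcases hr.eq_or_lt with rfl | hr'
  · simp
  · rw [show (5 / 3 : ℝ) = 2 / 3 + 1 by norm_num, Real.rpow_add hr', Real.rpow_one]; ring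

lemma exists_abs_le (he : IsExchangeCorrelation e) :
    ∃ C, 0 ≤ C ∧ ∀ r, 0 ≤ r → |e r| ≤ C * (r + r ^ 2) := by
  obtain ⟨C, hC0, hC⟩ := he.abs_le_small (show (0 : ℝ) < 1 by norm_num)
  refine ⟨C + 1, by positivity, fun r hr => (hC r hr).trans ?_⟩
  nlinarith [sq_nonneg r]

lemma exists_abs_sub_le (he : IsExchangeCorrelation e) :
    ∃ C, 0 ≤ C ∧ ∀ s t, 0 ≤ s → 0 ≤ t → |e s - e t| ≤ C * (1 + s + t) * |s - t| := by
  obtain ⟨C, hC0, hC⟩ := he.abs_vXC_le_linear (show (0 : ℝ) < 1 by norm_num)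
  refine ⟨C + 1, by positivity, fun s t hs ht => ?_⟩
  refine he.abs_sub_le_of_bound (M := s + t) (fun r hr hrM => (hC r hr).trans ?_) hs
    (by linarith) ht (by linarith)
  nlinarith

/-- The potential is merely continuous, so no Lipschitz bound is available. Uniform continuity on a
bounded interval and slow growth outside replace it. -/
lemma exists_vXC_sub_le (he : IsExchangeCorrelation e) {ε : ℝ} (hε : 0 < ε) :
    ∃ C, 0 ≤ C ∧ ∀ s t, 0 ≤ s → 0 ≤ t →
      |vXC e s - vXC e t| ≤ ε * (1 + s + t) + C * |s - t| := by
  obtain ⟨C, hC0, hC⟩ := he.abs_vXC_le_linear (half_pos hε)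
  -- Chosen so that 2C = (ε/2) M: once s + t exceeds M, the growth bounds alone give the claim.
  set M : ℝ := 4 * C / ε with hM
  have hM0 : 0 ≤ M := by positivity
  have huc : UniformContinuousOn (vXC e) (Icc 0 M) :=
    isCompact_Icc.uniformContinuousOn_of_continuous
      (he.continuousOn_vXC.mono Icc_subset_Ici_self)
  obtain ⟨η, hη, hη'⟩ := Metric.uniformContinuousOn_iff.1 huc ε hε
  refine ⟨(2 * C + ε * M) / η, by positivity, fun s t hs ht => ?_⟩
  have h1 : |vXC e s - vXC e t| ≤ 2 * C + ε / 2 * (s + t) := by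
    have := abs_sub (vXC e s) (vXC e t)
    linarith [hC s hs, hC t ht]
  have hK : 0 ≤ (2 * C + ε * M) / η * |s - t| := by positivity
  by_cases hbig : M < s + t
  · have h2 : 2 * C ≤ ε / 2 * (s + t) := by
      have : 2 * C = ε / 2 * M := by rw [hM]; field_simp; ring
      rw [this]; gcongr
    linarith
  · rw [not_lt] at hbig
    by_cases hd : |s - t| < η
    · have := hη' s ⟨hs, by linarith⟩ t ⟨ht, by linarith⟩ hd
      rw [Real.dist_eq] at this
      nlinarith
    · rw [not_lt] at hd
      have h2 : 2 * C + ε * M ≤ (2 * C + ε * M) / η * |s - t| := by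
        rw [div_mul_eq_mul_div, le_div_iff₀ hη]
        gcongr
      nlinarith

/-- Nothing is assumed about negative arguments; truncating at zero gives a globally continuous
function, from which measurability of compositions follows. -/
lemma continuous_comp_max (he : IsExchangeCorrelation e) : Continuous fun r => e (max r 0) :=
  he.contDiffOn.continuousOn.comp_continuous (continuous_id.max continuous_const)
    fun _ => mem_Ici.2 (le_max_right _ _)

lemma continuous_vXC_comp_max (he : IsExchangeCorrelation e) :
    Continuous fun r => vXC e (max r 0) :=
  he.continuousOn_vXC.comp_continuous (continuous_id.max continuous_const)
    fun _ => mem_Ici.2 (le_max_right _ _)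

lemma measurable_comp (he : IsExchangeCorrelation e) {ρ : Space → ℝ} (hρ : Measurable ρ)
    (h0 : ∀ x, 0 ≤ ρ x) : Measurable fun x => e (ρ x) := by
  have := he.continuous_comp_max.measurable.comp hρ
  simpa [Function.comp_def, max_eq_left (h0 _)] using this

lemma measurable_vXC_comp (he : IsExchangeCorrelation e) {ρ : Space → ℝ} (hρ : Measurable ρ)
    (h0 : ∀ x, 0 ≤ ρ x) : Measurable fun x => vXC e (ρ x) := by
  have := he.continuous_vXC_comp_max.measurable.comp hρ
  simpa [Function.comp_def, max_eq_left (h0 _)] using this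

end IsExchangeCorrelation

/-! ### Coulomb potentials of functions in `L¹ ∩ L²` -/

/-- Real functions in `L¹ ∩ L²`. -/
structure IsL12 (f : Space → ℝ) : Prop where
  int : Integrable f
  sq : Integrable fun x => f x ^ 2

/-- The `L¹` norm. -/
def nrm1 (f : Space → ℝ) : ℝ := ∫ x, |f x|

/-- The `L²` norm. -/
def nrm2 (f : Space → ℝ) : ℝ := √(∫ x, f x ^ 2)

lemma nrm1_nonneg (f : Space → ℝ) : 0 ≤ nrm1 f := integral_nonneg fun _ => abs_nonneg _
lemma nrm2_nonneg (f : Space → ℝ) : 0 ≤ nrm2 f := Real.sqrt_nonneg _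
lemma nrm2_sq (f : Space → ℝ) : nrm2 f ^ 2 = ∫ x, f x ^ 2 :=
  Real.sq_sqrt (integral_nonneg fun _ => sq_nonneg _)

lemma nrm1_of_nonneg {f : Space → ℝ} (h : ∀ x, 0 ≤ f x) : nrm1 f = ∫ x, f x := by
  simp only [nrm1, abs_of_nonneg (h _)]

namespace IsL12

variable {f g : Space → ℝ}

lemma memLp (hf : IsL12 f) : MemLp f 2 volume := (memLp_two_iff_integrable_sq hf.int.1).2 hf.sq

lemma of_memLp (h : Integrable f) (h2 : MemLp f 2 volume) : IsL12 f :=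
  ⟨h, (memLp_two_iff_integrable_sq h.1).1 h2⟩

lemma add (hf : IsL12 f) (hg : IsL12 g) : IsL12 fun x => f x + g x :=
  of_memLp (hf.int.add hg.int) (hf.memLp.add hg.memLp)

lemma sub (hf : IsL12 f) (hg : IsL12 g) : IsL12 fun x => f x - g x :=
  of_memLp (hf.int.sub hg.int) (hf.memLp.sub hg.memLp)

lemma const_mul (hf : IsL12 f) (c : ℝ) : IsL12 fun x => c * f x :=
  of_memLp (hf.int.const_mul c) (hf.memLp.const_mul c)

lemma abs (hf : IsL12 f) : IsL12 fun x => |f x| := of_memLp hf.int.abs hf.memLp.abs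

lemma mono (hf : IsL12 f) (hg : AEStronglyMeasurable g volume) (h : ∀ᵐ x, |g x| ≤ |f x|) :
    IsL12 g := of_memLp (hf.int.mono hg h) (hf.memLp.mono hg h)

lemma mul_bdd (hf : IsL12 f) {m : Space → ℝ} (hm : IsBddMeas m) : IsL12 fun x => m x * f x := by
  obtain ⟨C, hC⟩ := hm.bdd
  refine (hf.const_mul C).mono (hm.meas.aestronglyMeasurable.mul hf.int.1)
    (Eventually.of_forall fun x => ?_)
  rw [abs_mul, abs_mul]
  exact mul_le_mul_of_nonneg_right ((hC x).trans (le_abs_self C)) (abs_nonneg _)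

lemma sum {ι : Type*} (s : Finset ι) {F : ι → Space → ℝ} (h : ∀ i, IsL12 (F i)) :
    IsL12 fun x => ∑ i ∈ s, F i x := by
  classical
  induction s using Finset.induction_on with
  | empty => exact ⟨by simp, by simp⟩
  | insert a s ha ih => simpa [Finset.sum_insert ha] using (h a).add ih

end IsL12

lemma integrable_mul_of_sq {f g : Space → ℝ} (hf : MemLp f 2 volume) (hg : MemLp g 2 volume) :
    Integrable fun x => f x * g x := hf.integrable_mul hg

/-- The Cauchy-Schwarz inequality. -/
lemma integral_abs_mul_le {f g : Space → ℝ} (hf : MemLp f 2 volume) (hg : MemLp g 2 volume) :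
    ∫ x, |f x * g x| ≤ nrm2 f * nrm2 g := by
  have h := integral_mul_le_Lp_mul_Lq_of_nonneg (μ := (volume : Measure Space))
    Real.HolderConjugate.two_two (f := fun x => |f x|) (g := fun x => |g x|)
    (Eventually.of_forall fun x => abs_nonneg _) (Eventually.of_forall fun x => abs_nonneg _)
    (by rw [show ENNReal.ofReal 2 = 2 by simp]; exact hf.abs)
    (by rw [show ENNReal.ofReal 2 = 2 by simp]; exact hg.abs)
  simp only [abs_mul]
  refine h.trans (le_of_eq ?_)
  simp [nrm2, Real.sqrt_eq_rpow]

lemma abs_integral_mul_le {f g : Space → ℝ} (hf : MemLp f 2 volume) (hg : MemLp g 2 volume) :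
    |∫ x, f x * g x| ≤ nrm2 f * nrm2 g :=
  (abs_integral_le_integral_abs).trans (integral_abs_mul_le hf hg)

/-- The singular part of the Coulomb kernel at scale `r`. -/
def singKernel (r : ℝ) (x : Space) : ℝ := (Iio r).indicator (fun t => 1 / t) ‖x‖

lemma measurable_singKernel (r : ℝ) : Measurable (singKernel r) :=
  ((measurable_const.div measurable_id).indicator measurableSet_Iio).comp measurable_norm

lemma singKernel_sq (r : ℝ) : (fun x => singKernel r x ^ 2) =
    fun x : Space => (Iio r).indicator (fun t => 1 / t ^ 2) ‖x‖ := by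
  ext x
  by_cases h : ‖x‖ ∈ Iio r
  · simp [singKernel, indicator_of_mem h]
  · simp [singKernel, indicator_of_notMem h]

lemma radial_weight (r : ℝ) : ∀ y ∈ Ioi (0 : ℝ), y ^ (Module.finrank ℝ Space - 1) •
    (Iio r).indicator (fun t : ℝ => 1 / t ^ 2) y = (Iio r).indicator (fun _ => (1 : ℝ)) y := by
  intro y hy
  have hy' : y ≠ 0 := (ne_of_gt hy)
  by_cases h : y ∈ Iio r
  · rw [indicator_of_mem h, indicator_of_mem h]; simp [hy']
  · rw [indicator_of_notMem h, indicator_of_notMem h]; simp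

lemma memLp_singKernel (r : ℝ) : MemLp (singKernel r) 2 volume := by
  rw [memLp_two_iff_integrable_sq (measurable_singKernel r).aestronglyMeasurable, singKernel_sq,
    integrable_fun_norm_addHaar, integrableOn_congr_fun (radial_weight r) measurableSet_Ioi,
    integrableOn_indicator_iff measurableSet_Iio]
  rw [integrableOn_const_iff]
  right
  have : Iio r ∩ Ioi 0 ⊆ Icc 0 r := fun x hx => ⟨le_of_lt hx.2, le_of_lt hx.1⟩
  exact (measure_mono this).trans_lt measure_Icc_lt_top

/-- The constant in the Coulomb bound. -/
def coulConst : ℝ := √(3 * volume.real (Metric.ball (0 : Space) 1))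

lemma coulConst_nonneg : 0 ≤ coulConst := Real.sqrt_nonneg _

lemma nrm2_singKernel {r : ℝ} (hr : 0 ≤ r) : nrm2 (singKernel r) = coulConst * √r := by
  have h : ∫ x, singKernel r x ^ 2 = 3 * volume.real (Metric.ball (0 : Space) 1) * r := by
    rw [singKernel_sq, integral_fun_norm_addHaar,
      setIntegral_congr_fun measurableSet_Ioi (radial_weight r),
      setIntegral_indicator measurableSet_Iio, Ioi_inter_Iio]
    simp [hr, mul_assoc]
  rw [nrm2, h, Real.sqrt_mul (by positivity)]; rfl

/-- The Coulomb kernel splits into a part bounded by 1/r, paired with the L¹ norm, and a singular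
part with L² norm of order √r, paired with the L² norm. The scale r remains free and is adapted to
each use. -/
lemma inv_norm_le {r : ℝ} (hr : 0 < r) (w : Space) : 1 / ‖w‖ ≤ 1 / r + singKernel r w := by
  by_cases h : ‖w‖ < r
  · rw [singKernel, indicator_of_mem (show ‖w‖ ∈ Iio r from h)]
    have : 0 < 1 / r := by positivity
    linarith
  · rw [singKernel, indicator_of_notMem (show ‖w‖ ∉ Iio r from h), add_zero]
    exact one_div_le_one_div_of_le hr (not_lt.1 h)

lemma memLp_singKernel_sub (r : ℝ) (x : Space) : MemLp (fun y => singKernel r (x - y)) 2 volume :=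
  (memLp_singKernel r).comp_measurePreserving (Measure.measurePreserving_sub_left volume x)

lemma nrm2_singKernel_sub (r : ℝ) (x : Space) :
    nrm2 (fun y => singKernel r (x - y)) = nrm2 (singKernel r) := by
  rw [nrm2, nrm2, integral_sub_left_eq_self (fun y => singKernel r y ^ 2) volume x]

lemma singKernel_nonneg (r : ℝ) (x : Space) : 0 ≤ singKernel r x := by
  rw [singKernel]
  exact indicator_nonneg (s := Iio r) (f := fun t => 1 / t) (a := ‖x‖) |> fun h => by
    by_cases h : ‖x‖ ∈ Iio r
    · rw [indicator_of_mem h]; positivity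
    · rw [indicator_of_notMem h]

lemma integrable_mul_singKernel {f : Space → ℝ} (hf : IsL12 f) (r : ℝ) (x : Space) :
    Integrable fun y => |f y| * singKernel r (x - y) :=
  integrable_mul_of_sq hf.abs.memLp (memLp_singKernel_sub r x)

lemma integral_mul_singKernel_le {f : Space → ℝ} (hf : IsL12 f) {r : ℝ} (hr : 0 ≤ r) (x : Space) :
    ∫ y, |f y| * singKernel r (x - y) ≤ coulConst * √r * nrm2 f := by
  have h := abs_integral_mul_le hf.abs.memLp (memLp_singKernel_sub r x)
  rw [nrm2_singKernel_sub, nrm2_singKernel hr] at h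
  refine (le_abs_self _).trans (h.trans (le_of_eq ?_))
  simp only [nrm2, sq_abs]; ring

lemma integrable_coulomb {f : Space → ℝ} (hf : IsL12 f) (x : Space) :
    Integrable fun y => f y / ‖x - y‖ := by
  have h : Integrable fun y => |f y| * (1 / 1) + |f y| * singKernel 1 (x - y) :=
    (hf.int.abs.mul_const _).add (integrable_mul_singKernel hf 1 x)
  refine h.mono' ?_ (Eventually.of_forall fun y => ?_)
  · exact hf.int.1.div₀ (measurable_const.sub measurable_id).norm.aestronglyMeasurable
  · change ‖f y / ‖x - y‖‖ ≤ |f y| * (1 / 1) + |f y| * singKernel 1 (x - y)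
    rw [norm_div, norm_norm, div_eq_mul_one_div, ← mul_add]
    exact mul_le_mul_of_nonneg_left (inv_norm_le one_pos _) (norm_nonneg _)

lemma vHartree_abs_le {f : Space → ℝ} (hf : IsL12 f) {r : ℝ} (hr : 0 < r) (x : Space) :
    vHartree (fun y => |f y|) x ≤ 1 / r * nrm1 f + coulConst * √r * nrm2 f := by
  have h1 : vHartree (fun y => |f y|) x ≤
      ∫ y, (|f y| * (1 / r) + |f y| * singKernel r (x - y)) := by
    apply integral_mono (integrable_coulomb hf.abs x)
      ((hf.int.abs.mul_const _).add (integrable_mul_singKernel hf r x))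
    intro y
    change |f y| / ‖x - y‖ ≤ |f y| * (1 / r) + |f y| * singKernel r (x - y)
    rw [div_eq_mul_one_div, ← mul_add]
    exact mul_le_mul_of_nonneg_left (inv_norm_le hr _) (abs_nonneg _)
  rw [integral_add (hf.int.abs.mul_const _) (integrable_mul_singKernel hf r x),
    integral_mul_const] at h1
  have := integral_mul_singKernel_le hf hr.le x
  rw [nrm1]
  linarith

lemma abs_vHartree_le_vHartree_abs (f : Space → ℝ) (x : Space) :
    |vHartree f x| ≤ vHartree (fun y => |f y|) x := by
  refine abs_integral_le_integral_abs.trans (le_of_eq ?_)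
  simp only [vHartree, abs_div, abs_norm]

lemma abs_vHartree_le {f : Space → ℝ} (hf : IsL12 f) {r : ℝ} (hr : 0 < r) (x : Space) :
    |vHartree f x| ≤ 1 / r * nrm1 f + coulConst * √r * nrm2 f :=
  (abs_vHartree_le_vHartree_abs f x).trans (vHartree_abs_le hf hr x)

lemma abs_vHartree_le_one {f : Space → ℝ} (hf : IsL12 f) (x : Space) :
    |vHartree f x| ≤ nrm1 f + coulConst * nrm2 f := by
  simpa using abs_vHartree_le hf one_pos x

lemma vHartree_nonneg {f : Space → ℝ} (hf : ∀ x, 0 ≤ f x) (x : Space) : 0 ≤ vHartree f x :=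
  integral_nonneg fun y => div_nonneg (hf y) (norm_nonneg _)

lemma vHartree_congr {f g : Space → ℝ} (h : f =ᵐ[volume] g) : vHartree f = vHartree g := by
  ext x
  apply integral_congr_ae
  filter_upwards [h] with y hy
  rw [hy]

lemma vHartree_add {f g : Space → ℝ} (hf : IsL12 f) (hg : IsL12 g) (x : Space) :
    vHartree (fun y => f y + g y) x = vHartree f x + vHartree g x := by
  simp only [vHartree, add_div]
  exact integral_add (integrable_coulomb hf x) (integrable_coulomb hg x)

lemma vHartree_sub {f g : Space → ℝ} (hf : IsL12 f) (hg : IsL12 g) (x : Space) :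
    vHartree (fun y => f y - g y) x = vHartree f x - vHartree g x := by
  simp only [vHartree, sub_div]
  exact integral_sub (integrable_coulomb hf x) (integrable_coulomb hg x)

lemma vHartree_const_mul (c : ℝ) (f : Space → ℝ) (x : Space) :
    vHartree (fun y => c * f y) x = c * vHartree f x := by
  simp only [vHartree, mul_div_assoc]
  exact integral_const_mul _ _

lemma vHartree_comp_sub (f : Space → ℝ) (z x : Space) :
    vHartree (fun y => f (y - z)) x = vHartree f (x - z) := by
  simp only [vHartree]
  rw [← integral_add_right_eq_self _ z]
  congr 1; ext y
  rw [add_sub_cancel_right]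
  congr 2; abel

/-- The potential is a uniform limit, as r → 0, of potentials with the truncated kernel 1 / max(|x -
y|, r), which are continuous by dominated convergence. -/
lemma continuous_vHartree {f : Space → ℝ} (hf : IsL12 f) : Continuous (vHartree f) := by
  have key : ∀ r : ℝ, 0 < r → Continuous fun x => ∫ y, f y / max ‖x - y‖ r := by
    intro r hr
    apply continuous_of_dominated (bound := fun y => |f y| / r)
    · intro x
      exact hf.int.1.div₀ ((measurable_const.sub measurable_id).norm.max
        measurable_const).aestronglyMeasurable
    · intro x
      refine Eventually.of_forall fun y => ?_
      rw [norm_div, Real.norm_eq_abs, Real.norm_eq_abs,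
        abs_of_pos (lt_of_lt_of_le hr (le_max_right _ _))]
      gcongr
      exact le_max_right _ _
    · exact hf.int.abs.div_const r
    · refine Eventually.of_forall fun y => ?_
      refine continuous_const.div ((continuous_id.sub continuous_const).norm.max continuous_const)
        fun x => (lt_of_lt_of_le hr (le_max_right _ _)).ne'
  apply continuous_of_uniform_approx_of_continuous
  intro u hu
  obtain ⟨ε, hε, hεu⟩ := Metric.mem_uniformity_dist.1 hu
  obtain ⟨r, hr, hrε⟩ : ∃ r : ℝ, 0 < r ∧ coulConst * √r * nrm2 f < ε := by
    have h1 : Tendsto (fun r : ℝ => coulConst * √r * nrm2 f) (𝓝[>] 0) (𝓝 0) := by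
      have h2 : Continuous fun r : ℝ => coulConst * √r * nrm2 f := by fun_prop
      have := h2.tendsto 0
      simp only [Real.sqrt_zero, mul_zero, zero_mul] at this
      exact this.mono_left nhdsWithin_le_nhds
    obtain ⟨r, h3, h4⟩ := ((h1.eventually_lt_const hε).and self_mem_nhdsWithin).exists
    exact ⟨r, h4, h3⟩
  refine ⟨_, key r hr, fun x => hεu ?_⟩
  rw [Real.dist_eq]
  have hi : Integrable fun y => f y / max ‖x - y‖ r := by
    refine (hf.int.abs.div_const r).mono' (hf.int.1.div₀ ((measurable_const.sub measurable_id).norm.max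
        measurable_const).aestronglyMeasurable) (Eventually.of_forall fun y => ?_)
    rw [norm_div, Real.norm_eq_abs, Real.norm_eq_abs,
      abs_of_pos (lt_of_lt_of_le hr (le_max_right _ _))]
    gcongr
    exact le_max_right _ _
  rw [vHartree, ← integral_sub (integrable_coulomb hf x) hi]
  refine lt_of_le_of_lt (abs_integral_le_integral_abs.trans ?_)
    (lt_of_le_of_lt (integral_mul_singKernel_le hf hr.le x) hrε)
  apply integral_mono_ae ((integrable_coulomb hf x).sub hi).abs (integrable_mul_singKernel hf r x)
  filter_upwards [compl_mem_ae_iff.2 (measure_singleton x)] with y hy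
  change |f y / ‖x - y‖ - f y / max ‖x - y‖ r| ≤ |f y| * singKernel r (x - y)
  rw [div_eq_mul_one_div, div_eq_mul_one_div (f y) (max _ _), ← mul_sub, abs_mul]
  gcongr
  by_cases h : ‖x - y‖ < r
  · rw [singKernel, indicator_of_mem (show ‖x - y‖ ∈ Iio r from h), max_eq_right h.le]
    have h0 : 0 < ‖x - y‖ := norm_pos_iff.2 (sub_ne_zero.2 fun hxy => hy hxy.symm)
    have h1 : 1 / r ≤ 1 / ‖x - y‖ := one_div_le_one_div_of_le h0 h.le
    have h2 : 0 < 1 / r := by positivity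
    rw [abs_of_nonneg (by linarith)]
    linarith
  · rw [max_eq_left (not_lt.1 h), sub_self, abs_zero]
    exact singKernel_nonneg _ _

/-! ### The Coulomb energy -/

/-- The combined `L¹` and `L²` norm. -/
def nrm (f : Space → ℝ) : ℝ := nrm1 f + nrm2 f

lemma nrm_nonneg (f : Space → ℝ) : 0 ≤ nrm f := add_nonneg (nrm1_nonneg f) (nrm2_nonneg f)
lemma nrm1_le_nrm (f : Space → ℝ) : nrm1 f ≤ nrm f := le_add_of_nonneg_right (nrm2_nonneg f)
lemma nrm2_le_nrm (f : Space → ℝ) : nrm2 f ≤ nrm f := le_add_of_nonneg_left (nrm1_nonneg f)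

lemma nrm1_congr {f g : Space → ℝ} (h : f =ᵐ[volume] g) : nrm1 f = nrm1 g :=
  integral_congr_ae (h.mono fun x hx => by simp only [hx])

lemma nrm2_congr {f g : Space → ℝ} (h : f =ᵐ[volume] g) : nrm2 f = nrm2 g := by
  rw [nrm2, nrm2, integral_congr_ae (g := fun x => g x ^ 2) (h.mono fun x hx => by simp only [hx])]

lemma nrm1_add_le {f g : Space → ℝ} (hf : IsL12 f) (hg : IsL12 g) :
    nrm1 (fun x => f x + g x) ≤ nrm1 f + nrm1 g := by
  rw [nrm1, nrm1, nrm1, ← integral_add hf.int.abs hg.int.abs]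
  exact integral_mono (hf.add hg).int.abs (hf.int.abs.add hg.int.abs) fun x => abs_add_le _ _

lemma nrm2_add_le {f g : Space → ℝ} (hf : IsL12 f) (hg : IsL12 g) :
    nrm2 (fun x => f x + g x) ≤ nrm2 f + nrm2 g := by
  apply Real.sqrt_le_iff.2 ⟨add_nonneg (nrm2_nonneg f) (nrm2_nonneg g), ?_⟩
  have h1 := integrable_mul_of_sq hf.memLp hg.memLp
  have h2 : ∫ x, (f x + g x) ^ 2 = (∫ x, f x ^ 2) + 2 * (∫ x, f x * g x) + ∫ x, g x ^ 2 := by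
    rw [← integral_const_mul, ← integral_add hf.sq (h1.const_mul 2),
      ← integral_add (f := fun x => f x ^ 2 + 2 * (f x * g x))
        (hf.sq.add (h1.const_mul 2)) hg.sq]
    congr 1; ext x; ring
  have h3 := (le_abs_self _).trans (abs_integral_mul_le hf.memLp hg.memLp)
  rw [h2, ← nrm2_sq, ← nrm2_sq]
  nlinarith

lemma nrm_add_le {f g : Space → ℝ} (hf : IsL12 f) (hg : IsL12 g) :
    nrm (fun x => f x + g x) ≤ nrm f + nrm g := by
  have := nrm1_add_le hf hg
  have := nrm2_add_le hf hg
  simp only [nrm]; linarith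

lemma nrm1_mono {f g : Space → ℝ} (hf : IsL12 f) (hg : IsL12 g) (h : ∀ x, |f x| ≤ |g x|) :
    nrm1 f ≤ nrm1 g := integral_mono hf.int.abs hg.int.abs h

lemma nrm2_mono {f g : Space → ℝ} (hf : IsL12 f) (hg : IsL12 g) (h : ∀ x, |f x| ≤ |g x|) :
    nrm2 f ≤ nrm2 g :=
  Real.sqrt_le_sqrt (integral_mono hf.sq hg.sq fun x => sq_le_sq.2 (h x))

lemma nrm_mono {f g : Space → ℝ} (hf : IsL12 f) (hg : IsL12 g) (h : ∀ x, |f x| ≤ |g x|) :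
    nrm f ≤ nrm g := add_le_add (nrm1_mono hf hg h) (nrm2_mono hf hg h)

lemma nrm1_const_mul (c : ℝ) (f : Space → ℝ) : nrm1 (fun x => c * f x) = |c| * nrm1 f := by
  simp only [nrm1, abs_mul]; exact integral_const_mul _ _

lemma nrm2_const_mul (c : ℝ) (f : Space → ℝ) : nrm2 (fun x => c * f x) = |c| * nrm2 f := by
  simp only [nrm2, mul_pow, integral_const_mul]
  rw [Real.sqrt_mul (sq_nonneg c), Real.sqrt_sq_eq_abs]

lemma nrm_const_mul (c : ℝ) (f : Space → ℝ) : nrm (fun x => c * f x) = |c| * nrm f := by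
  rw [nrm, nrm1_const_mul, nrm2_const_mul, nrm]; ring

/-- The constant in the uniform bound for Coulomb potentials. -/
def potConst : ℝ := 1 + coulConst

lemma potConst_pos : 0 < potConst := by have := coulConst_nonneg; unfold potConst; linarith

lemma abs_vHartree_le_nrm {f : Space → ℝ} (hf : IsL12 f) (x : Space) :
    |vHartree f x| ≤ potConst * nrm f := by
  refine (abs_vHartree_le_one hf x).trans ?_
  have := nrm1_nonneg f
  have := nrm2_nonneg f
  have := coulConst_nonneg
  unfold potConst nrm
  nlinarith [mul_nonneg coulConst_nonneg (nrm1_nonneg f)]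

/-- The mutual Coulomb energy `∬ f(x) g(y) / |x - y|`. -/
def coul (f g : Space → ℝ) : ℝ := ∫ x, f x * vHartree g x

lemma integrable_mul_vHartree {ν : Measure Space} {f g : Space → ℝ} (hf : Integrable f ν)
    (hg : IsL12 g) : Integrable (fun x => f x * vHartree g x) ν :=
  hf.mul_bdd (c := potConst * nrm g) (continuous_vHartree hg).measurable.aestronglyMeasurable
    (Eventually.of_forall fun x => abs_vHartree_le_nrm hg x)

lemma integrable_vHartree (ν : Measure Space) [IsFiniteMeasure ν] {g : Space → ℝ}
    (hg : IsL12 g) : Integrable (vHartree g) ν := by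
  simpa using integrable_mul_vHartree (ν := ν) (integrable_const (1 : ℝ)) hg

lemma integrable_prod_coulomb {ν : Measure Space} [SFinite ν] {f g : Space → ℝ}
    (hf : Integrable f ν) (hg : IsL12 g) :
    Integrable (fun p : Space × Space => f p.1 * (g p.2 / ‖p.1 - p.2‖)) (ν.prod volume) := by
  have hm : AEStronglyMeasurable (fun p : Space × Space => f p.1 * (g p.2 / ‖p.1 - p.2‖))
      (ν.prod volume) :=
    hf.1.comp_fst.mul (hg.int.1.comp_snd.div₀
      (measurable_fst.sub measurable_snd).norm.aestronglyMeasurable)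
  rw [integrable_prod_iff hm]
  refine ⟨Eventually.of_forall fun x => (integrable_coulomb hg x).const_mul (f x), ?_⟩
  refine (integrable_mul_vHartree hf.abs hg.abs).congr (Eventually.of_forall fun x => ?_)
  simp only [norm_mul, norm_div, Real.norm_eq_abs, vHartree, abs_norm]
  exact (integral_const_mul (|f x|) (fun y => |g y| / ‖x - y‖)).symm

/-- Fubini with a general measure ν serves two purposes: Lebesgue measure gives the symmetry of the
Coulomb energy, and a nuclear charge with f = 1 gives the attraction term. -/
lemma integral_mul_vHartree {ν : Measure Space} [SFinite ν] {f g : Space → ℝ}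
    (hf : Integrable f ν) (hg : IsL12 g) :
    ∫ x, f x * vHartree g x ∂ν = ∫ y, g y * ∫ x, f x / ‖y - x‖ ∂ν := by
  have h := integral_integral_swap (f := fun x y => f x * (g y / ‖x - y‖))
    (integrable_prod_coulomb hf hg)
  simp only [integral_const_mul] at h
  refine h.trans (integral_congr_ae (Eventually.of_forall fun y => ?_))
  simp only [← integral_const_mul]
  congr 1; ext x
  rw [norm_sub_rev]; ring

lemma coul_comm {f g : Space → ℝ} (hf : IsL12 f) (hg : IsL12 g) : coul f g = coul g f :=
  integral_mul_vHartree hf.int hg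

/-- The singular potential of a measure is traded for the bounded continuous potential of `g`, which
can be tested against weakly convergent measures. -/
lemma vExt_mul (μ : Measure Space) [IsFiniteMeasure μ] {g : Space → ℝ} (hg : IsL12 g) :
    ∫ x, vExt μ x * g x = - ∫ x, vHartree g x ∂μ := by
  have h := integral_mul_vHartree (ν := μ) (integrable_const (1 : ℝ)) hg
  simp only [one_mul] at h
  rw [h, ← integral_neg]
  congr 1; ext y
  rw [vExt]; ring

lemma integrable_vExt_mul (μ : Measure Space) [IsFiniteMeasure μ] {g : Space → ℝ} (hg : IsL12 g) :
    Integrable fun x => vExt μ x * g x := by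
  have h := (integrable_prod_coulomb (ν := μ) (integrable_const (1 : ℝ)) hg).integral_prod_right
  refine h.neg.congr (Eventually.of_forall fun y => ?_)
  simp only [Pi.neg_apply, vExt, neg_mul, ← integral_mul_const]
  congr 1
  refine integral_congr_ae (Eventually.of_forall fun x => ?_)
  simp only [norm_sub_rev x y]; ring

lemma coul_congr {f f' g g' : Space → ℝ} (hf : f =ᵐ[volume] f') (hg : g =ᵐ[volume] g') :
    coul f g = coul f' g' := by
  rw [coul, coul, vHartree_congr hg]
  exact integral_congr_ae (hf.mono fun x hx => by simp only [hx])

lemma coul_add_left {f f' g : Space → ℝ} (hf : IsL12 f) (hf' : IsL12 f') (hg : IsL12 g) :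
    coul (fun x => f x + f' x) g = coul f g + coul f' g := by
  simp only [coul, add_mul]
  exact integral_add (integrable_mul_vHartree hf.int hg) (integrable_mul_vHartree hf'.int hg)

lemma coul_add_self {f g : Space → ℝ} (hf : IsL12 f) (hg : IsL12 g) :
    coul (fun x => f x + g x) (fun x => f x + g x) = coul f f + coul g g + 2 * coul f g := by
  rw [coul_add_left hf hg (hf.add hg), coul_comm hf (hf.add hg), coul_comm hg (hf.add hg),
    coul_add_left hf hg hf, coul_add_left hf hg hg, coul_comm hg hf]
  ring

lemma coul_nonneg {f g : Space → ℝ} (hf : ∀ x, 0 ≤ f x) (hg : ∀ x, 0 ≤ g x) : 0 ≤ coul f g :=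
  integral_nonneg fun x => mul_nonneg (hf x) (vHartree_nonneg hg x)

lemma abs_coul_le {f g : Space → ℝ} (hf : IsL12 f) (hg : IsL12 g) :
    |coul f g| ≤ nrm1 f * (potConst * nrm g) := by
  rw [nrm1, ← integral_mul_const]
  refine abs_integral_le_integral_abs.trans (integral_mono
    (integrable_mul_vHartree hf.int hg).abs (hf.int.abs.mul_const _) fun x => ?_)
  simp only [abs_mul]
  exact mul_le_mul_of_nonneg_left (abs_vHartree_le_nrm hg x) (abs_nonneg _)

lemma abs_coul_sub_le {f g : Space → ℝ} (hf : IsL12 f) (hg : IsL12 g) :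
    |coul f f - coul g g| ≤ potConst * (nrm f + nrm g) * nrm (fun x => f x - g x) := by
  have hd := hf.sub hg
  have h : coul f f - coul g g = coul (fun x => f x - g x) (fun x => f x + g x) := by
    have h1 : coul f (fun x => f x + g x) = coul f f + coul f g := by
      rw [coul_comm hf (hf.add hg), coul_add_left hf hg hf, coul_comm hg hf]
    have h2 : coul g (fun x => f x + g x) = coul f g + coul g g := by
      rw [coul_comm hg (hf.add hg), coul_add_left hf hg hg]
    have h3 := coul_add_left hd hg (hf.add hg)
    simp only [sub_add_cancel] at h3
    have h4 : coul (fun x => f x) (fun x => f x + g x) = coul f (fun x => f x + g x) := rfl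
    linarith
  rw [h]
  refine (abs_coul_le hd (hf.add hg)).trans ?_
  have h1 := nrm_add_le hf hg
  have h2 := nrm1_le_nrm (fun x => f x - g x)
  have h3 := nrm1_nonneg (fun x => f x - g x)
  have h4 := potConst_pos
  have h5 := nrm_nonneg f
  have h6 := nrm_nonneg g
  calc _ ≤ nrm (fun x => f x - g x) * (potConst * (nrm f + nrm g)) :=
        mul_le_mul h2 (mul_le_mul_of_nonneg_left h1 h4.le)
          (mul_nonneg h4.le (nrm_nonneg _)) (nrm_nonneg _)
    _ = _ := by ring

lemma abs_integral_vHartree_le (μ : Measure Space) [IsFiniteMeasure μ] {f : Space → ℝ}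
    (hf : IsL12 f) : |∫ x, vHartree f x ∂μ| ≤ μ.real univ * (potConst * nrm f) := by
  refine abs_integral_le_integral_abs.trans ?_
  have := integral_mono (integrable_vHartree μ hf).abs (integrable_const (potConst * nrm f))
    fun x => abs_vHartree_le_nrm hf x
  simpa using this

/-! ### Electron densities and the potential energy -/

/-- Nonnegative densities in `L¹ ∩ L²`. -/
structure IsDensity (f : Space → ℝ) : Prop where
  meas : Measurable f
  nonneg : ∀ x, 0 ≤ f x
  l12 : IsL12 f

lemma IsDensity.add {f g : Space → ℝ} (hf : IsDensity f) (hg : IsDensity g) :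
    IsDensity fun x => f x + g x :=
  ⟨hf.meas.add hg.meas, fun x => add_nonneg (hf.nonneg x) (hg.nonneg x), hf.l12.add hg.l12⟩

lemma IsDensity.sq_mul {f : Space → ℝ} (hf : IsDensity f) {m : Space → ℝ} (hm : IsBddMeas m) :
    IsDensity fun x => m x ^ 2 * f x := by
  refine ⟨(hm.meas.pow_const 2).mul hf.meas, fun x => mul_nonneg (sq_nonneg _) (hf.nonneg x), ?_⟩
  have := (hf.l12.mul_bdd hm).mul_bdd hm
  simpa only [← mul_assoc, ← sq] using this

lemma IsDensity.const_mul {f : Space → ℝ} (hf : IsDensity f) {c : ℝ} (hc : 0 ≤ c) :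
    IsDensity fun x => c * f x :=
  ⟨hf.meas.const_mul c, fun x => mul_nonneg hc (hf.nonneg x), hf.l12.const_mul c⟩

/-- The quartic bound puts |u|² in L². This is why L¹ ∩ L² is the natural class of densities. -/
lemma isL12_norm_sq {u : L2} (hu : u ∈ H1) : IsL12 fun x => ‖u x‖ ^ 2 :=
  ⟨integrable_norm_sq u, by simpa only [← pow_mul] using integrable_quartic hu⟩

lemma isDensity_norm_sq {u : L2} (hu : u ∈ H1) : IsDensity fun x => ‖u x‖ ^ 2 :=
  ⟨(measurable_L2 u).norm.pow_const 2, fun _ => by positivity, isL12_norm_sq hu⟩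

lemma isDensity_density {n : ℕ} {Φ : Fin n → L2} (hΦ : ∀ k, Φ k ∈ H1) :
    IsDensity (density Φ) where
  meas := (Finset.measurable_sum _ fun k _ => (measurable_L2 (Φ k)).norm.pow_const 2).const_mul 2
  nonneg x := mul_nonneg zero_le_two (Finset.sum_nonneg fun _ _ => by positivity)
  l12 := (IsL12.sum Finset.univ fun k => isL12_norm_sq (hΦ k)).const_mul 2

lemma integral_density {n : ℕ} (Φ : Fin n → L2) : ∫ x, density Φ x = 2 * ∑ k, ‖Φ k‖ ^ 2 := by
  simp only [density, integral_const_mul, norm_sq_eq_integral]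
  rw [integral_finsetSum _ fun k _ => integrable_norm_sq (Φ k)]

lemma nrm1_density {n : ℕ} (Φ : Fin n → L2) : nrm1 (density Φ) = 2 * ∑ k, ‖Φ k‖ ^ 2 := by
  rw [← integral_density, nrm1_of_nonneg fun _ => ?_]
  exact mul_nonneg zero_le_two (Finset.sum_nonneg fun _ _ => by positivity)

lemma nrm2_norm_sq_le {u : L2} (hu : u ∈ H1) :
    nrm2 (fun x => ‖u x‖ ^ 2) ≤ √(gnConst * (‖u‖ * gr u ^ 3)) := by
  apply Real.sqrt_le_sqrt
  simpa only [← pow_mul] using integral_quartic_le hu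

/-- The potential energy of a density: interaction with the nuclei, Hartree energy and
exchange-correlation energy. -/
def potEnergy (e : ℝ → ℝ) (μ : Measure Space) (f : Space → ℝ) : ℝ :=
  -(∫ x, vHartree f x ∂μ) + 1 / 2 * coul f f + ∫ x, e (f x)

lemma potEnergy_congr (e : ℝ → ℝ) (μ : Measure Space) {f g : Space → ℝ} (h : f =ᵐ[volume] g) :
    potEnergy e μ f = potEnergy e μ g := by
  rw [potEnergy, potEnergy, vHartree_congr h, coul_congr h h,
    integral_congr_ae (g := fun x => e (g x)) (h.mono fun x hx => by simp only [hx])]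

/-- The kinetic energy. -/
def kin {n : ℕ} (Φ : Fin n → L2) : ℝ := ∑ k, gradNormSq (Φ k)

lemma kin_nonneg {n : ℕ} (Φ : Fin n → L2) : 0 ≤ kin Φ :=
  Finset.sum_nonneg fun _ _ => gradNormSq_nonneg _

lemma ksEnergy_eq (e : ℝ → ℝ) (μ : Measure Space) [IsFiniteMeasure μ] {n : ℕ} {Φ : Fin n → L2}
    (hΦ : ∀ k, Φ k ∈ H1) : ksEnergy e μ Φ = kin Φ + potEnergy e μ (density Φ) := by
  have h : ∫ x, ∫ y, density Φ x * density Φ y / ‖x - y‖ = coul (density Φ) (density Φ) := by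
    simp only [coul, vHartree, ← integral_const_mul, mul_div_assoc]
  rw [ksEnergy, h, vExt_mul μ (isDensity_density hΦ).l12, potEnergy, kin]
  simp only [← mul_assoc]
  norm_num
  ring

variable {e : ℝ → ℝ}

lemma IsExchangeCorrelation.integrable_comp (he : IsExchangeCorrelation e) {f : Space → ℝ}
    (hf : IsDensity f) : Integrable fun x => e (f x) := by
  obtain ⟨C, hC0, hC⟩ := he.exists_abs_le
  exact ((hf.l12.int.add hf.l12.sq).const_mul C).mono'
    (he.measurable_comp hf.meas hf.nonneg).aestronglyMeasurable
    (Eventually.of_forall fun x => hC _ (hf.nonneg x))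

lemma IsExchangeCorrelation.exists_integral_sub_le (he : IsExchangeCorrelation e) :
    ∃ C, 0 ≤ C ∧ ∀ f g, IsDensity f → IsDensity g →
      |(∫ x, e (f x)) - ∫ x, e (g x)| ≤ C * (1 + nrm f + nrm g) * nrm (fun x => f x - g x) := by
  obtain ⟨C, hC0, hC⟩ := he.exists_abs_sub_le
  refine ⟨C, hC0, fun f g hf hg => ?_⟩
  have hd := hf.l12.sub hg.l12
  have hs := hf.l12.add hg.l12
  have h1 : ∫ x, |f x - g x| = nrm1 (fun x => f x - g x) := rfl
  have h2 := integral_abs_mul_le hs.memLp hd.memLp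
  have hi := integrable_mul_of_sq hs.memLp hd.memLp
  rw [← integral_sub (he.integrable_comp hf) (he.integrable_comp hg)]
  have h3 : ∫ x, |e (f x) - e (g x)| ≤
      ∫ x, (C * |f x - g x| + C * |(f x + g x) * (f x - g x)|) := by
    refine integral_mono ((he.integrable_comp hf).sub (he.integrable_comp hg)).abs
      ((hd.int.abs.const_mul C).add (hi.abs.const_mul C)) fun x => ?_
    refine (hC _ _ (hf.nonneg x) (hg.nonneg x)).trans (le_of_eq ?_)
    simp only [abs_mul, abs_of_nonneg (add_nonneg (hf.nonneg x) (hg.nonneg x))]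
    ring
  rw [integral_add (hd.int.abs.const_mul C) (hi.abs.const_mul C), integral_const_mul,
    integral_const_mul, h1] at h3
  refine abs_integral_le_integral_abs.trans (h3.trans ?_)
  have h4 : nrm2 (fun x => f x + g x) ≤ nrm f + nrm g :=
    (nrm2_add_le hf.l12 hg.l12).trans (add_le_add (nrm2_le_nrm f) (nrm2_le_nrm g))
  have h5 := nrm1_le_nrm fun x => f x - g x
  have h6 := nrm2_le_nrm fun x => f x - g x
  have h7 : nrm2 (fun x => f x + g x) * nrm2 (fun x => f x - g x) ≤
      (nrm f + nrm g) * nrm (fun x => f x - g x) :=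
    mul_le_mul h4 h6 (nrm2_nonneg _) (add_nonneg (nrm_nonneg f) (nrm_nonneg g))
  calc _ ≤ C * nrm (fun x => f x - g x) + C * ((nrm f + nrm g) * nrm (fun x => f x - g x)) := by
        gcongr; exact h2.trans h7
    _ = _ := by ring

/-- Local Lipschitz continuity of the potential energy. -/
lemma exists_potEnergy_sub_le (he : IsExchangeCorrelation e) (M : ℝ) :
    ∃ C, 0 ≤ C ∧ ∀ (μ : Measure Space) [IsFiniteMeasure μ] (f g : Space → ℝ), μ.real univ ≤ M →
      IsDensity f → IsDensity g → nrm f ≤ M → nrm g ≤ M →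
      |potEnergy e μ f - potEnergy e μ g| ≤ C * nrm (fun x => f x - g x) := by
  obtain ⟨C, hC0, hC⟩ := he.exists_integral_sub_le
  have hp := potConst_pos
  refine ⟨|M| * potConst + potConst * (|M| + |M|) + C * (1 + |M| + |M|), by positivity,
    fun μ _ f g hμ hf hg hfM hgM => ?_⟩
  have hM := le_abs_self M
  have hd := nrm_nonneg fun x => f x - g x
  have h1 := hC f g hf hg
  have h2 := abs_coul_sub_le hf.l12 hg.l12
  have h3 := abs_integral_vHartree_le μ (hf.l12.sub hg.l12)
  have h4 : ∫ x, vHartree (fun y => f y - g y) x ∂μ =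
      (∫ x, vHartree f x ∂μ) - ∫ x, vHartree g x ∂μ := by
    rw [← integral_sub (integrable_vHartree μ hf.l12) (integrable_vHartree μ hg.l12)]
    congr 1; ext x; exact vHartree_sub hf.l12 hg.l12 x
  rw [h4] at h3
  have e1 : C * (1 + nrm f + nrm g) * nrm (fun x => f x - g x) ≤
      C * (1 + |M| + |M|) * nrm (fun x => f x - g x) := by
    gcongr <;> linarith
  have e2 : potConst * (nrm f + nrm g) * nrm (fun x => f x - g x) ≤
      potConst * (|M| + |M|) * nrm (fun x => f x - g x) := by
    gcongr <;> linarith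
  have e3 : μ.real univ * (potConst * nrm (fun x => f x - g x)) ≤
      |M| * (potConst * nrm (fun x => f x - g x)) := by
    gcongr; linarith
  have e4 : 0 ≤ potConst * (|M| + |M|) * nrm (fun x => f x - g x) := by positivity
  simp only [potEnergy]
  rw [abs_le] at h1 h2 h3 ⊢
  constructor <;> nlinarith

variable {e : ℝ → ℝ}

/-! ### Estimates for densities -/

lemma nrm2_norm (u : L2) : nrm2 (fun x => ‖u x‖) = ‖u‖ := by
  rw [nrm2, ← norm_sq_eq_integral, Real.sqrt_sq (norm_nonneg u)]

lemma memLp_norm (u : L2) : MemLp (fun x => ‖u x‖) 2 volume := (Lp.memLp u).norm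

lemma nrm1_sq_sub_le (u v : L2) :
    nrm1 (fun x => ‖u x‖ ^ 2 - ‖v x‖ ^ 2) ≤ ‖u - v‖ * (‖u‖ + ‖v‖) := by
  have h1 := integral_abs_mul_le (memLp_norm (u - v)) (memLp_norm u)
  have h2 := integral_abs_mul_le (memLp_norm (u - v)) (memLp_norm v)
  have i1 := (integrable_mul_of_sq (memLp_norm (u - v)) (memLp_norm u)).abs
  have i2 := (integrable_mul_of_sq (memLp_norm (u - v)) (memLp_norm v)).abs
  rw [nrm2_norm, nrm2_norm] at h1 h2
  have h3 : nrm1 (fun x => ‖u x‖ ^ 2 - ‖v x‖ ^ 2) ≤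
      ∫ x, (|‖(u - v) x‖ * ‖u x‖| + |‖(u - v) x‖ * ‖v x‖|) := by
    refine integral_mono_ae ((integrable_norm_sq u).sub (integrable_norm_sq v)).abs (i1.add i2) ?_
    filter_upwards [Lp.coeFn_sub u v] with x hx
    rw [hx, Pi.sub_apply, abs_mul, abs_mul, abs_norm, abs_norm, abs_norm,
      ← mul_add, sq_sub_sq, abs_mul, abs_of_nonneg (by positivity : 0 ≤ ‖u x‖ + ‖v x‖), mul_comm]
    exact mul_le_mul_of_nonneg_right (abs_norm_sub_norm_le _ _) (by positivity)
  rw [integral_add i1 i2] at h3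
  linarith

lemma nrm2_sq_sub_le {u v : L2} (hu : u ∈ H1) (hv : v ∈ H1) :
    nrm2 (fun x => ‖u x‖ ^ 2 - ‖v x‖ ^ 2) ^ 2 ≤ nrm2 (fun x => ‖(u - v) x‖ ^ 2) *
      (2 * nrm2 (fun x => ‖u x‖ ^ 2) + 2 * nrm2 (fun x => ‖v x‖ ^ 2)) := by
  have hs := ((isL12_norm_sq hu).const_mul 2).add ((isL12_norm_sq hv).const_mul 2)
  have h1 := abs_integral_mul_le (isL12_norm_sq (H1_sub hu hv)).memLp hs.memLp
  have i1 := integrable_mul_of_sq (isL12_norm_sq (H1_sub hu hv)).memLp hs.memLp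
  have h2 := nrm2_add_le ((isL12_norm_sq hu).const_mul 2) ((isL12_norm_sq hv).const_mul 2)
  rw [nrm2_const_mul, nrm2_const_mul, abs_of_pos two_pos] at h2
  rw [nrm2_sq]
  refine (integral_mono_ae ((isL12_norm_sq hu).sub (isL12_norm_sq hv)).sq i1 ?_).trans
    ((le_abs_self _).trans (h1.trans (mul_le_mul_of_nonneg_left h2 (nrm2_nonneg _))))
  filter_upwards [Lp.coeFn_sub u v] with x hx
  rw [hx, Pi.sub_apply, sq_sub_sq, mul_pow, mul_comm]
  have h3 := abs_norm_sub_norm_le (u x) (v x)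
  have h4 : (‖u x‖ - ‖v x‖) ^ 2 ≤ ‖u x - v x‖ ^ 2 := sq_le_sq.2 (by rwa [abs_norm])
  have h5 : (‖u x‖ + ‖v x‖) ^ 2 ≤ 2 * ‖u x‖ ^ 2 + 2 * ‖v x‖ ^ 2 := by
    nlinarith [sq_nonneg (‖u x‖ - ‖v x‖)]
  exact mul_le_mul h4 h5 (sq_nonneg _) (sq_nonneg _)

lemma nrm2_norm_sq_le' {u : L2} (hu : u ∈ H1) {δ M : ℝ} (h : ‖u‖ ≤ δ) (h' : gr u ≤ M) :
    nrm2 (fun x => ‖u x‖ ^ 2) ≤ √(gnConst * (δ * M ^ 3)) := by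
  refine (nrm2_norm_sq_le hu).trans (Real.sqrt_le_sqrt ?_)
  have := gnConst_nonneg
  have := gr_nonneg u
  gcongr
  exact (norm_nonneg u).trans h

lemma nrm_norm_sq_le {u : L2} (hu : u ∈ H1) {M : ℝ} (h : ‖u‖ ≤ M) (h' : gr u ≤ M) :
    nrm (fun x => ‖u x‖ ^ 2) ≤ M ^ 2 + √(gnConst * (M * M ^ 3)) := by
  refine add_le_add ?_ (nrm2_norm_sq_le' hu h h')
  rw [nrm1_of_nonneg fun _ => by positivity, ← norm_sq_eq_integral]
  gcongr

/-- Bounded gradients suffice: the Gagliardo-Nirenberg bound for the difference carries a factor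
‖u_j - v‖, which makes the L² part of the density converge as well. -/
lemma tendsto_nrm_sq_sub {u : ℕ → L2} {v : L2} {M : ℝ} (hu : ∀ j, u j ∈ H1) (hv : v ∈ H1)
    (hM : ∀ j, gr (u j) ≤ M) (h : Tendsto u atTop (𝓝 v)) :
    Tendsto (fun j => nrm (fun x => ‖u j x‖ ^ 2 - ‖v x‖ ^ 2)) atTop (𝓝 0) := by
  have h0 : Tendsto (fun j => ‖u j - v‖) atTop (𝓝 0) := by
    simpa using (h.sub_const v).norm
  have hn : Tendsto (fun j => ‖u j‖) atTop (𝓝 ‖v‖) := h.norm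
  have h1 : Tendsto (fun j => nrm1 (fun x => ‖u j x‖ ^ 2 - ‖v x‖ ^ 2)) atTop (𝓝 0) := by
    refine squeeze_zero (fun j => nrm1_nonneg _) (fun j => nrm1_sq_sub_le (u j) v) ?_
    simpa using h0.mul (hn.add_const ‖v‖)
  have h2 : Tendsto (fun j => nrm2 (fun x => ‖u j x‖ ^ 2 - ‖v x‖ ^ 2)) atTop (𝓝 0) := by
    have hb : ∀ j, nrm2 (fun x => ‖u j x‖ ^ 2 - ‖v x‖ ^ 2) ≤
        √(√(gnConst * (‖u j - v‖ * (M + gr v) ^ 3)) *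
        (2 * √(gnConst * (‖u j‖ * M ^ 3)) + 2 * nrm2 (fun x => ‖v x‖ ^ 2))) := by
      intro j
      apply Real.le_sqrt_of_sq_le
      refine (nrm2_sq_sub_le (hu j) hv).trans ?_
      have e1 := nrm2_norm_sq_le' (H1_sub (hu j) hv) le_rfl
        ((gr_sub_le (hu j) hv).trans (add_le_add_left (hM j) (gr v)))
      have e2 := nrm2_norm_sq_le' (hu j) le_rfl (hM j)
      have := nrm2_nonneg fun x => ‖v x‖ ^ 2
      have := nrm2_nonneg fun x => ‖u j x‖ ^ 2
      exact mul_le_mul e1 (by linarith) (by linarith) (Real.sqrt_nonneg _)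
    refine squeeze_zero (fun j => nrm2_nonneg _) hb ?_
    have c1 : Tendsto (fun j => √(gnConst * (‖u j - v‖ * (M + gr v) ^ 3))) atTop (𝓝 0) := by
      simpa using ((h0.mul_const ((M + gr v) ^ 3)).const_mul gnConst).sqrt
    have c2 := (((hn.mul_const (M ^ 3)).const_mul gnConst).sqrt.const_mul 2).add_const
      (2 * nrm2 (fun x => ‖v x‖ ^ 2))
    simpa using (c1.mul c2).sqrt
  simpa [nrm] using h1.add h2

lemma nrm_sum_le {ι : Type*} (s : Finset ι) {F : ι → Space → ℝ} (h : ∀ i, IsL12 (F i)) :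
    nrm (fun x => ∑ i ∈ s, F i x) ≤ ∑ i ∈ s, nrm (F i) := by
  classical
  induction s using Finset.induction_on with
  | empty => simp [nrm, nrm1, nrm2]
  | insert a s ha ih =>
    simp only [Finset.sum_insert ha]
    exact (nrm_add_le (h a) (IsL12.sum s h)).trans (add_le_add_right ih _)

lemma nrm_density_le {n : ℕ} {Φ : Fin n → L2} (hΦ : ∀ k, Φ k ∈ H1) {M : ℝ} (h : ∀ k, ‖Φ k‖ ≤ M)
    (h' : ∀ k, gr (Φ k) ≤ M) :
    nrm (density Φ) ≤ 2 * (n * (M ^ 2 + √(gnConst * (M * M ^ 3)))) := by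
  have h1 : nrm (density Φ) = 2 * nrm (fun x => ∑ k, ‖Φ k x‖ ^ 2) := by
    have := nrm_const_mul 2 (fun x => ∑ k, ‖Φ k x‖ ^ 2)
    rwa [abs_of_pos two_pos] at this
  rw [h1]
  have h2 := nrm_sum_le Finset.univ fun k => isL12_norm_sq (hΦ k)
  have h3 := Finset.sum_le_sum fun k (_ : k ∈ Finset.univ) => nrm_norm_sq_le (hΦ k) (h k) (h' k)
  simp only [Finset.sum_const, Finset.card_univ, Fintype.card_fin, nsmul_eq_mul] at h3
  linarith

lemma tendsto_nrm_density {n : ℕ} {Φ : ℕ → Fin n → L2} {Ψ : Fin n → L2} {M : ℝ}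
    (hΦ : ∀ j k, Φ j k ∈ H1) (hΨ : ∀ k, Ψ k ∈ H1) (hM : ∀ j k, gr (Φ j k) ≤ M)
    (h : ∀ k, Tendsto (fun j => Φ j k) atTop (𝓝 (Ψ k))) :
    Tendsto (fun j => nrm (fun x => density (Φ j) x - density Ψ x)) atTop (𝓝 0) := by
  have hb : ∀ j, nrm (fun x => density (Φ j) x - density Ψ x) ≤
      2 * ∑ k, nrm (fun x => ‖Φ j k x‖ ^ 2 - ‖Ψ k x‖ ^ 2) := by
    intro j
    have h1 : (fun x => density (Φ j) x - density Ψ x) =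
        fun x => 2 * ∑ k, (‖Φ j k x‖ ^ 2 - ‖Ψ k x‖ ^ 2) := by
      ext x; simp only [density, Finset.sum_sub_distrib]; ring
    rw [h1, nrm_const_mul 2 (fun x => ∑ k, (‖Φ j k x‖ ^ 2 - ‖Ψ k x‖ ^ 2)), abs_of_pos two_pos]
    exact mul_le_mul_of_nonneg_left (nrm_sum_le Finset.univ fun k =>
      (isL12_norm_sq (hΦ j k)).sub (isL12_norm_sq (hΨ k))) zero_le_two
  refine squeeze_zero (fun j => nrm_nonneg _) hb ?_
  have := (tendsto_finsetSum Finset.univ fun k _ =>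
    tendsto_nrm_sq_sub (fun j => hΦ j k) (hΨ k) (fun j => hM j k) (h k)).const_mul 2
  simpa using this

lemma density_mulL2 {n : ℕ} (Φ : Fin n → L2) {m : Space → ℝ} (hm : IsBddMeas m) :
    density (fun k => mulL2 m (Φ k)) =ᵐ[volume] fun x => m x ^ 2 * density Φ x := by
  have := ae_all_iff.2 fun k => mulL2_ae hm (Φ k)
  filter_upwards [this] with x hx
  simp only [density, hx, norm_mul, mul_pow, Complex.norm_real, Real.norm_eq_abs, sq_abs,
    ← Finset.mul_sum]
  ring

lemma density_tr {n : ℕ} (Φ : Fin n → L2) (z : Space) :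
    density (fun k => tr z (Φ k)) =ᵐ[volume] fun x => density Φ (x - z) := by
  have := ae_all_iff.2 fun k => tr_ae z (Φ k)
  filter_upwards [this] with x hx
  simp only [density, hx]

lemma kin_tr {n : ℕ} {Φ : Fin n → L2} (hΦ : ∀ k, Φ k ∈ H1) (z : Space) :
    kin (fun k => tr z (Φ k)) = kin Φ := by
  simp only [kin, gradNormSq_tr (hΦ _)]

lemma coul_comp_sub (f g : Space → ℝ) (z : Space) :
    coul (fun x => f (x - z)) (fun x => g (x - z)) = coul f g := by
  simp only [coul, vHartree_comp_sub]
  exact integral_sub_right_eq_self (fun x => f x * vHartree g x) z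

lemma potEnergy_comp_sub (e : ℝ → ℝ) (f : Space → ℝ) (z : Space) :
    potEnergy e 0 (fun x => f (x - z)) = potEnergy e 0 f := by
  simp only [potEnergy, coul_comp_sub, integral_zero_measure]
  rw [integral_sub_right_eq_self (fun x => e (f x)) z]

/-- The nuclear measure 0 describes free electrons, the problem at infinity; without nuclei the
energy is translation invariant. -/
lemma ksEnergy_tr (e : ℝ → ℝ) {n : ℕ} {Φ : Fin n → L2} (hΦ : ∀ k, Φ k ∈ H1) (z : Space) :
    ksEnergy e 0 (fun k => tr z (Φ k)) = ksEnergy e 0 Φ := by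
  rw [ksEnergy_eq e 0 hΦ, ksEnergy_eq e 0 fun k => H1_tr (hΦ k) z, kin_tr hΦ,
    potEnergy_congr e 0 (density_tr Φ z), potEnergy_comp_sub]

/-! ### Coercivity -/

lemma gr_le_sqrt_kin {n : ℕ} (Φ : Fin n → L2) (k : Fin n) : gr (Φ k) ≤ √(kin Φ) :=
  Real.sqrt_le_sqrt (Finset.single_le_sum (f := fun k => gradNormSq (Φ k))
    (fun _ _ => gradNormSq_nonneg _) (Finset.mem_univ k))

/-- Writing the gradient bound as a² makes the square root of the quartic bound a cube and avoids
fractional powers. -/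
lemma nrm2_density_le {n : ℕ} {Φ : Fin n → L2} (hΦ : ∀ k, Φ k ∈ H1) {M a : ℝ} (hM : 0 ≤ M)
    (ha : 0 ≤ a) (h : ∀ k, ‖Φ k‖ ≤ M) (h' : ∀ k, gr (Φ k) ≤ a ^ 2) :
    nrm2 (density Φ) ≤ 2 * n * √(gnConst * M) * a ^ 3 := by
  have key : ∀ s : Finset (Fin n), nrm2 (fun x => ∑ k ∈ s, ‖Φ k x‖ ^ 2) ≤
      ∑ k ∈ s, nrm2 (fun x => ‖Φ k x‖ ^ 2) := by
    classical
    intro s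
    induction s using Finset.induction_on with
    | empty => simp [nrm2]
    | insert b s hb ih =>
      simp only [Finset.sum_insert hb]
      exact (nrm2_add_le (isL12_norm_sq (hΦ b)) (IsL12.sum s fun k => isL12_norm_sq (hΦ k))).trans
        (add_le_add_right ih _)
  have h1 : nrm2 (density Φ) = 2 * nrm2 (fun x => ∑ k, ‖Φ k x‖ ^ 2) := by
    have := nrm2_const_mul 2 (fun x => ∑ k, ‖Φ k x‖ ^ 2)
    rwa [abs_of_pos two_pos] at this
  have h2 : ∀ k, nrm2 (fun x => ‖Φ k x‖ ^ 2) ≤ √(gnConst * M) * a ^ 3 := by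
    intro k
    refine (nrm2_norm_sq_le' (hΦ k) (h k) (h' k)).trans (le_of_eq ?_)
    rw [← mul_assoc, Real.sqrt_mul (mul_nonneg gnConst_nonneg hM),
      show (a ^ 2) ^ 3 = (a ^ 3) ^ 2 by ring, Real.sqrt_sq (by positivity)]
  have h3 := Finset.sum_le_sum fun k (_ : k ∈ Finset.univ) => h2 k
  simp only [Finset.sum_const, Finset.card_univ, Fintype.card_fin, nsmul_eq_mul] at h3
  have := key Finset.univ
  rw [h1]
  linarith

/-- Weighted arithmetic-geometric means with weights 1/3 and 2/3. The parameter is later the inverse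
square root of the kinetic scale, which gives both terms the order of the kinetic energy. -/
lemma rpow_five_thirds_le {r t : ℝ} (hr : 0 ≤ r) (ht : 0 < t) :
    r ^ (5 / 3 : ℝ) ≤ r / t ^ 2 + t * r ^ 2 := by
  have h := Real.geom_mean_le_arith_mean2_weighted (w₁ := 1 / 3) (w₂ := 2 / 3) (p₁ := r / t ^ 2)
    (p₂ := t * r ^ 2) (by norm_num) (by norm_num) (by positivity) (by positivity) (by norm_num)
  have h1 : (r / t ^ 2) ^ (1 / 3 : ℝ) * (t * r ^ 2) ^ (2 / 3 : ℝ) = r ^ (5 / 3 : ℝ) := by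
    rw [Real.div_rpow hr (by positivity), Real.mul_rpow ht.le (by positivity),
      ← Real.rpow_natCast t 2, ← Real.rpow_natCast r 2, ← Real.rpow_mul ht.le,
      ← Real.rpow_mul hr]
    rcases hr.eq_or_lt with rfl | hr'
    · norm_num
    have ht' : t ^ ((2 : ℝ) / 3) ≠ 0 := by positivity
    norm_num
    field_simp
    rw [← Real.rpow_add hr']
    norm_num
  rw [h1] at h
  have : 0 ≤ r / t ^ 2 := by positivity
  have : 0 ≤ t * r ^ 2 := by positivity
  linarith

lemma cube_le (C : ℝ) (hC : 0 ≤ C) {a δ : ℝ} (ha : 0 ≤ a) (hδ : 0 < δ) :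
    C * a ^ 3 ≤ δ * a ^ 4 + C * (C / δ) ^ 3 := by
  rcases le_total a (C / δ) with h | h
  · have : C * a ^ 3 ≤ C * (C / δ) ^ 3 := by gcongr
    have : 0 ≤ δ * a ^ 4 := by positivity
    linarith
  · have h1 : C ≤ δ * a := by rw [div_le_iff₀ hδ] at h; linarith
    have h2 : C * a ^ 3 ≤ δ * a * a ^ 3 := by gcongr
    have : 0 ≤ C * (C / δ) ^ 3 := by positivity
    nlinarith

/-- Energy bounds imply kinetic energy bounds. -/
lemma exists_kin_le (he : IsExchangeCorrelation e) (n : ℕ) (M : ℝ) :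
    ∃ C, ∀ (μ : Measure Space) [IsFiniteMeasure μ] (Φ : Fin n → L2), μ.real univ ≤ M →
      (∀ k, Φ k ∈ H1) → (∀ k, ‖Φ k‖ ≤ M) → ksEnergy e μ Φ ≤ M → kin Φ ≤ C := by
  set N : ℝ := 2 * (n * M ^ 2) with hN
  have hN0 : 0 ≤ N := by positivity
  set B : ℝ := 2 * n * √(gnConst * |M|) with hB
  have hB0 : 0 ≤ B := by positivity
  -- The small coefficient is fixed so that the 5/3-power contributes at most a⁴/4, a quarter of the
  -- kinetic scale.
  obtain ⟨C1, hC1, hxc⟩ := he.abs_le_rpow (δ := 1 / (4 * (N + B ^ 2 + 1))) (by positivity)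
  set P := |M| * potConst with hP
  have hP0 : 0 ≤ P := mul_nonneg (abs_nonneg _) potConst_pos.le
  refine ⟨2 * (M + C1 * N + P * N + P * B * (P * B / (1 / 4)) ^ 3 + 1 / 2),
    fun μ _ Φ hμ hΦ hM hE => ?_⟩
  have hd := isDensity_density hΦ
  have hMa := le_abs_self M
  -- With a⁴ = 1 + kin, the L² norm of the density is of order a³, so the attraction is of order a³
  -- and the critical exchange-correlation term of order a⁴.
  set a : ℝ := √(√(1 + kin Φ)) with ha
  have hk := kin_nonneg Φ
  have ha2 : a ^ 2 = √(1 + kin Φ) := Real.sq_sqrt (Real.sqrt_nonneg _)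
  have ha4 : a ^ 4 = 1 + kin Φ := by
    rw [show a ^ 4 = (a ^ 2) ^ 2 by ring, ha2, Real.sq_sqrt (by linarith)]
  have ha0 : 0 ≤ a := Real.sqrt_nonneg _
  have ha1 : 1 ≤ a ^ 2 := by rw [ha2]; exact Real.one_le_sqrt.2 (by linarith)
  have hnrm2 : nrm2 (density Φ) ≤ B * a ^ 3 :=
    nrm2_density_le hΦ (abs_nonneg M) ha0 (fun k => (hM k).trans hMa) fun k => by
      rw [ha2]; exact (gr_le_sqrt_kin Φ k).trans (Real.sqrt_le_sqrt (by linarith))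
  have hnrm1 : nrm1 (density Φ) ≤ N := by
    rw [nrm1_density, hN]
    have : ∑ k, ‖Φ k‖ ^ 2 ≤ ∑ _k : Fin n, M ^ 2 := by
      gcongr with k
      exact hM k
    simp at this
    linarith
  have hint : ∫ x, density Φ x = nrm1 (density Φ) := (nrm1_of_nonneg hd.nonneg).symm
  have hnuc : ∫ x, vHartree (density Φ) x ∂μ ≤ P * (N + B * a ^ 3) := by
    refine ((le_abs_self _).trans (abs_integral_vHartree_le μ hd.l12)).trans ?_
    have : nrm (density Φ) ≤ N + B * a ^ 3 := add_le_add hnrm1 hnrm2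
    rw [hP, mul_assoc]
    have := potConst_pos
    have h0 := nrm_nonneg (density Φ)
    gcongr
    linarith
  have hcube := cube_le (P * B) (by positivity) ha0 (show (0 : ℝ) < 1 / 4 by norm_num)
  have hcoul := coul_nonneg hd.nonneg hd.nonneg
  have hxc' : -(∫ x, e (density Φ x)) ≤ C1 * N + 1 / 4 * a ^ 4 := by
    -- With t = 1/a², the two terms of `rpow_five_thirds_le` integrate to at most N a⁴ and B² a⁴.
    have ht : 0 < 1 / a ^ 2 := by positivity
    have i2 : Integrable fun x => density Φ x / (1 / a ^ 2) ^ 2 + 1 / a ^ 2 * density Φ x ^ 2 :=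
      (hd.l12.int.div_const _).add (hd.l12.sq.const_mul _)
    have i1 : Integrable fun x => C1 * density Φ x + 1 / (4 * (N + B ^ 2 + 1)) *
        (density Φ x / (1 / a ^ 2) ^ 2 + 1 / a ^ 2 * density Φ x ^ 2) :=
      (hd.l12.int.const_mul _).add (i2.const_mul _)
    have h1 : ∫ x, -e (density Φ x) ≤ ∫ x, (C1 * density Φ x + 1 / (4 * (N + B ^ 2 + 1)) *
        (density Φ x / (1 / a ^ 2) ^ 2 + 1 / a ^ 2 * density Φ x ^ 2)) := by
      refine integral_mono (he.integrable_comp hd).neg i1 fun x => ?_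
      refine (neg_le_abs _).trans ((hxc _ (hd.nonneg x)).trans ?_)
      gcongr
      exact rpow_five_thirds_le (hd.nonneg x) ht
    rw [integral_neg, integral_add (hd.l12.int.const_mul _) (i2.const_mul _), integral_const_mul,
      integral_const_mul, integral_add (hd.l12.int.div_const _) (hd.l12.sq.const_mul _),
      integral_div, integral_const_mul, ← nrm2_sq, hint] at h1
    have h2 : nrm2 (density Φ) ^ 2 ≤ B ^ 2 * a ^ 6 := by
      calc nrm2 (density Φ) ^ 2 ≤ (B * a ^ 3) ^ 2 := by
            have := nrm2_nonneg (density Φ)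
            gcongr
        _ = _ := by ring
    have hane : a ≠ 0 := by rintro h; rw [h] at ha1; norm_num at ha1
    have h3 : nrm1 (density Φ) / (1 / a ^ 2) ^ 2 + 1 / a ^ 2 * nrm2 (density Φ) ^ 2 ≤
        (N + B ^ 2 + 1) * a ^ 4 := by
      have e1 : nrm1 (density Φ) / (1 / a ^ 2) ^ 2 ≤ N * a ^ 4 := by
        rw [one_div, inv_pow, div_inv_eq_mul, ← pow_mul]
        gcongr
      have e2 : 1 / a ^ 2 * nrm2 (density Φ) ^ 2 ≤ B ^ 2 * a ^ 4 := by
        calc 1 / a ^ 2 * nrm2 (density Φ) ^ 2 ≤ 1 / a ^ 2 * (B ^ 2 * a ^ 6) := by gcongr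
          _ = _ := by field_simp
      nlinarith [pow_nonneg ha0 4]
    have h4 : 1 / (4 * (N + B ^ 2 + 1)) * (nrm1 (density Φ) / (1 / a ^ 2) ^ 2 +
        1 / a ^ 2 * nrm2 (density Φ) ^ 2) ≤ 1 / 4 * a ^ 4 := by
      calc _ ≤ 1 / (4 * (N + B ^ 2 + 1)) * ((N + B ^ 2 + 1) * a ^ 4) := by gcongr
        _ = _ := by field_simp
    have h5 : C1 * nrm1 (density Φ) ≤ C1 * N := by gcongr
    linarith
  rw [ksEnergy_eq e μ hΦ, potEnergy] at hE
  rw [ha4] at hcube hxc'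
  nlinarith

/-! ### The localization formula -/

/-- The restriction of `f + f²` to a spherical shell. -/
def shellInt (R : ℝ) (f : Space → ℝ) : ℝ := ∫ x in shell R, (f x + f x ^ 2)

lemma sq_split (g u : ℂ) {c s dc ds : ℝ} (h : c ^ 2 + s ^ 2 = 1) (h' : c * dc + s * ds = 0) :
    ‖(c : ℂ) * g + dc * u‖ ^ 2 + ‖(s : ℂ) * g + ds * u‖ ^ 2 =
      ‖g‖ ^ 2 + (dc ^ 2 + ds ^ 2) * ‖u‖ ^ 2 := by
  simp only [Complex.sq_norm, Complex.normSq_apply, Complex.add_re, Complex.add_im,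
    Complex.mul_re, Complex.mul_im, Complex.ofReal_re, Complex.ofReal_im]
  linear_combination (g.re ^ 2 + g.im ^ 2) * h + 2 * (g.re * u.re + g.im * u.im) * h'

lemma norm_sq_cut_add (R : ℝ) (u : L2) :
    ‖mulL2 (cosCut R) u‖ ^ 2 + ‖mulL2 (sinCut R) u‖ ^ 2 = ‖u‖ ^ 2 := by
  have hc := (isMultiplier_cosCut R).isBddMeas
  have hs := (isMultiplier_sinCut R).isBddMeas
  have key : ∀ {m : Space → ℝ}, IsBddMeas m → Integrable fun x => m x ^ 2 * ‖u x‖ ^ 2 := by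
    intro m hm
    refine (integrable_norm_sq (mulL2 m u)).congr ?_
    filter_upwards [mulL2_ae hm u] with x hx
    rw [hx, norm_mul, mul_pow, Complex.norm_real, Real.norm_eq_abs, sq_abs]
  rw [norm_mulL2_sq hc, norm_mulL2_sq hs, ← integral_add (key hc) (key hs), norm_sq_eq_integral]
  congr 1; ext x
  rw [← add_mul, sq_cosCut_add, one_mul]

/-- The IMS localization formula: the cross terms cancel pointwise, and the remaining squared
gradients of the cutoffs live on the shell and are bounded uniformly in R. -/
lemma exists_gradNormSq_cut : ∃ C : ℝ, 0 ≤ C ∧ ∀ (R : ℝ) (u : L2), u ∈ H1 →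
    gradNormSq (mulL2 (cosCut R) u) + gradNormSq (mulL2 (sinCut R) u) ≤
      gradNormSq u + C * ∫ x in shell R, ‖u x‖ ^ 2 := by
  obtain ⟨C1, hC1, h1⟩ := exists_partialD_radial_bound isProfile_cos
  obtain ⟨C2, hC2, h2⟩ := exists_partialD_radial_bound isProfile_sin
  refine ⟨3 * (C1 ^ 2 + C2 ^ 2), by positivity, fun R u hu => ?_⟩
  have hc := isMultiplier_cosCut R
  have hs := isMultiplier_sinCut R
  have hi : ∀ i, ‖weakPartial i (mulL2 (cosCut R) u)‖ ^ 2 +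
      ‖weakPartial i (mulL2 (sinCut R) u)‖ ^ 2 ≤
      ‖weakPartial i u‖ ^ 2 + (C1 ^ 2 + C2 ^ 2) * ∫ x in shell R, ‖u x‖ ^ 2 := by
    intro i
    have hI : Integrable fun x => (shell R).indicator (fun x => ‖u x‖ ^ 2) x :=
      (integrable_norm_sq u).indicator (measurableSet_shell R)
    rw [weakPartial_mul hu hc, weakPartial_mul hu hs, norm_sq_eq_integral, norm_sq_eq_integral,
      norm_sq_eq_integral (weakPartial i u), ← integral_indicator (measurableSet_shell R),
      ← integral_const_mul, ← integral_add (integrable_norm_sq _) (integrable_norm_sq _),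
      ← integral_add (integrable_norm_sq _) (hI.const_mul _)]
    refine integral_mono_ae ((integrable_norm_sq _).add (integrable_norm_sq _))
      ((integrable_norm_sq _).add (hI.const_mul _)) ?_
    filter_upwards [Lp.coeFn_add (mulL2 (cosCut R) (weakPartial i u))
        (mulL2 (partialD (cosCut R) i) u),
      Lp.coeFn_add (mulL2 (sinCut R) (weakPartial i u)) (mulL2 (partialD (sinCut R) i) u),
      mulL2_ae hc.isBddMeas (weakPartial i u), mulL2_ae hs.isBddMeas (weakPartial i u),
      mulL2_ae (hc.isBddMeas_partialD i) u, mulL2_ae (hs.isBddMeas_partialD i) u]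
      with x a1 a2 a3 a4 a5 a6
    rw [a1, a2, Pi.add_apply, Pi.add_apply, a3, a4, a5, a6,
      sq_split _ _ (sq_cosCut_add R x) (cosCut_mul_partialD R i x)]
    have b1 := h1 R i x
    have b2 := h2 R i x
    by_cases hx : x ∈ shell R
    · simp only [indicator_of_mem hx] at b1 b2 ⊢
      have c1 : partialD (cosCut R) i x ^ 2 ≤ C1 ^ 2 := sq_le_sq' (abs_le.1 b1).1 (abs_le.1 b1).2
      have c2 : partialD (sinCut R) i x ^ 2 ≤ C2 ^ 2 := sq_le_sq' (abs_le.1 b2).1 (abs_le.1 b2).2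
      gcongr
    · simp only [indicator_of_notMem hx] at b1 b2 ⊢
      have c1 : partialD (cosCut R) i x = 0 := abs_eq_zero.1 (le_antisymm b1 (abs_nonneg _))
      have c2 : partialD (sinCut R) i x = 0 := abs_eq_zero.1 (le_antisymm b2 (abs_nonneg _))
      rw [c1, c2]; simp
  have := Finset.sum_le_sum fun i (_ : i ∈ Finset.univ) => hi i
  simp only [Finset.sum_add_distrib, Finset.sum_const, Finset.card_univ, Fintype.card_fin,
    nsmul_eq_mul] at this
  simp only [gradNormSq]
  push_cast at this
  linarith

lemma exists_kin_cut : ∃ C : ℝ, 0 ≤ C ∧ ∀ (n : ℕ) (R : ℝ) (Φ : Fin n → L2), (∀ k, Φ k ∈ H1) →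
    kin (fun k => mulL2 (cosCut R) (Φ k)) + kin (fun k => mulL2 (sinCut R) (Φ k)) ≤
      kin Φ + C * ∫ x in shell R, density Φ x := by
  obtain ⟨C, hC, h⟩ := exists_gradNormSq_cut
  refine ⟨C, hC, fun n R Φ hΦ => ?_⟩
  have h1 := Finset.sum_le_sum fun k (_ : k ∈ Finset.univ) => h R (Φ k) (hΦ k)
  rw [Finset.sum_add_distrib, Finset.sum_add_distrib, ← Finset.mul_sum] at h1
  have h2 : ∫ x in shell R, density Φ x = 2 * ∑ k, ∫ x in shell R, ‖Φ k x‖ ^ 2 := by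
    simp only [density, integral_const_mul]
    rw [integral_finsetSum _ fun k _ => (integrable_norm_sq (Φ k)).integrableOn]
  have h3 : 0 ≤ ∑ k, ∫ x in shell R, ‖Φ k x‖ ^ 2 :=
    Finset.sum_nonneg fun k _ => integral_nonneg fun _ => by positivity
  rw [h2]
  simp only [kin]
  nlinarith

lemma integral_vHartree_add (μ : Measure Space) [IsFiniteMeasure μ] {f g : Space → ℝ}
    (hf : IsL12 f) (hg : IsL12 g) : ∫ x, vHartree (fun y => f y + g y) x ∂μ =
      (∫ x, vHartree f x ∂μ) + ∫ x, vHartree g x ∂μ := by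
  rw [← integral_add (integrable_vHartree μ hf) (integrable_vHartree μ hg)]
  congr 1; ext x; exact vHartree_add hf hg x

/-- The Coulomb interaction of the two parts is nonnegative and is dropped. Exchange-correlation is
exactly additive off the shell, where one cutoff is 1 and the other 0, and on the shell both
localized terms are nonpositive. The attraction lost by the outer part appears on the right. -/
lemma exists_potEnergy_cut (he : IsExchangeCorrelation e) : ∃ C : ℝ, 0 ≤ C ∧
    ∀ (μ : Measure Space) [IsFiniteMeasure μ] (R : ℝ) (f : Space → ℝ), IsDensity f →
    potEnergy e μ (fun x => cosCut R x ^ 2 * f x) + potEnergy e 0 (fun x => sinCut R x ^ 2 * f x) ≤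
      potEnergy e μ f + (∫ x, vHartree (fun x => sinCut R x ^ 2 * f x) x ∂μ) +
        C * shellInt R f := by
  obtain ⟨C, hC0, hC⟩ := he.exists_abs_le
  refine ⟨C, hC0, fun μ _ R f hf => ?_⟩
  have hc := hf.sq_mul (isMultiplier_cosCut R).isBddMeas
  have hs := hf.sq_mul (isMultiplier_sinCut R).isBddMeas
  have hsplit : f = fun x => cosCut R x ^ 2 * f x + sinCut R x ^ 2 * f x := by
    ext x; rw [← add_mul, sq_cosCut_add, one_mul]
  have h1 : ∫ x, vHartree f x ∂μ = (∫ x, vHartree (fun x => cosCut R x ^ 2 * f x) x ∂μ) +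
      ∫ x, vHartree (fun x => sinCut R x ^ 2 * f x) x ∂μ := by
    rw [← integral_vHartree_add μ hc.l12 hs.l12, ← hsplit]
  have h2 := coul_add_self hc.l12 hs.l12
  rw [← hsplit] at h2
  have h3 := coul_nonneg hc.nonneg hs.nonneg
  have hI : Integrable fun x => (shell R).indicator (fun x => f x + f x ^ 2) x :=
    (hf.l12.int.add hf.l12.sq).indicator (measurableSet_shell R)
  have h4 : (∫ x, e (cosCut R x ^ 2 * f x)) + ∫ x, e (sinCut R x ^ 2 * f x) ≤
      (∫ x, e (f x)) + C * shellInt R f := by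
    rw [shellInt, ← integral_indicator (measurableSet_shell R), ← integral_const_mul,
      ← integral_add (he.integrable_comp hc) (he.integrable_comp hs),
      ← integral_add (he.integrable_comp hf) (hI.const_mul C)]
    refine integral_mono ((he.integrable_comp hc).add (he.integrable_comp hs))
      ((he.integrable_comp hf).add (hI.const_mul C)) fun x => ?_
    by_cases hx : x ∈ shell R
    · simp only [indicator_of_mem hx]
      have n1 := he.nonpos (hc.nonneg x)
      have n2 := he.nonpos (hs.nonneg x)
      have n3 := (neg_le_abs _).trans (hC _ (hf.nonneg x))
      linarith
    · simp only [indicator_of_notMem hx, mul_zero, add_zero]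
      have hx' : jb x < R ∨ R + 1 < jb x := by
        by_contra! hcon
        exact hx ⟨by linarith, by linarith⟩
      rcases hx' with h | h
      · rw [cosCut_eq_one h.le, sinCut_eq_zero h.le]; simp [he.zero]
      · rw [cosCut_eq_zero h.le, sinCut_eq_one h.le]; simp [he.zero]
  simp only [potEnergy, integral_zero_measure]
  linarith

/-- The localization formula: cutting into an inner and an outer part. -/
lemma exists_ksEnergy_cut (he : IsExchangeCorrelation e) : ∃ C : ℝ, 0 ≤ C ∧
    ∀ (n : ℕ) (μ : Measure Space) [IsFiniteMeasure μ] (R : ℝ) (Φ : Fin n → L2), (∀ k, Φ k ∈ H1) →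
    ksEnergy e μ (fun k => mulL2 (cosCut R) (Φ k)) + ksEnergy e 0 (fun k => mulL2 (sinCut R) (Φ k))
      ≤ ksEnergy e μ Φ + (∫ x, vHartree (fun x => sinCut R x ^ 2 * density Φ x) x ∂μ) +
        C * shellInt R (density Φ) := by
  obtain ⟨C1, hC1, h1⟩ := exists_kin_cut
  obtain ⟨C2, hC2, h2⟩ := exists_potEnergy_cut he
  refine ⟨C1 + C2, by positivity, fun n μ _ R Φ hΦ => ?_⟩
  have hc := isMultiplier_cosCut R
  have hs := isMultiplier_sinCut R
  have hd := isDensity_density hΦ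
  rw [ksEnergy_eq e μ hΦ, ksEnergy_eq e μ fun k => H1_mul (hΦ k) hc,
    ksEnergy_eq e 0 fun k => H1_mul (hΦ k) hs, potEnergy_congr e μ (density_mulL2 Φ hc.isBddMeas),
    potEnergy_congr e 0 (density_mulL2 Φ hs.isBddMeas)]
  have h3 := h1 n R Φ hΦ
  have h4 := h2 μ R _ hd
  have h5 : ∫ x in shell R, density Φ x ≤ shellInt R (density Φ) :=
    integral_mono hd.l12.int.integrableOn (hd.l12.int.add hd.l12.sq).integrableOn fun x => by
      simp only [le_add_iff_nonneg_right]; positivity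
  nlinarith

/-! ### Far fields -/

lemma vHartree_le_of_far {f : Space → ℝ} (hf : IsL12 f) (h0 : ∀ x, 0 ≤ f x) {x : Space} {d : ℝ}
    (hd : 0 < d) (h : ∀ y, f y ≠ 0 → d ≤ ‖x - y‖) : vHartree f x ≤ nrm1 f / d := by
  rw [nrm1_of_nonneg h0, ← integral_div]
  refine integral_mono (integrable_coulomb hf x) (hf.int.div_const d) fun y => ?_
  by_cases hy : f y = 0
  · simp [hy]
  · exact div_le_div_of_nonneg_left (h0 y) hd (h y hy)

lemma le_vHartree_of_near {f : Space → ℝ} (hf : IsL12 f) (h0 : ∀ x, 0 ≤ f x) {x : Space} {d : ℝ}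
    (h : ∀ y, f y ≠ 0 → 0 < ‖x - y‖ ∧ ‖x - y‖ ≤ d) : nrm1 f / d ≤ vHartree f x := by
  rw [nrm1_of_nonneg h0, ← integral_div]
  refine integral_mono (hf.int.div_const d) (integrable_coulomb hf x) fun y => ?_
  by_cases hy : f y = 0
  · simp [hy]
  · exact div_le_div_of_nonneg_left (h0 y) (h y hy).1 (h y hy).2

/-- The measure `μ` is concentrated on the ball of radius `L`. -/
def InBall (L : ℝ) (μ : Measure Space) : Prop := ∀ᵐ x ∂μ, ‖x‖ ≤ L

lemma integral_vHartree_le_of_far {μ : Measure Space} [IsFiniteMeasure μ] {L : ℝ}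
    (hμ : InBall L μ) {f : Space → ℝ} (hf : IsDensity f) {d : ℝ} (hd : 0 < d)
    (h : ∀ x y, ‖x‖ ≤ L → f y ≠ 0 → d ≤ ‖x - y‖) :
    ∫ x, vHartree f x ∂μ ≤ μ.real univ * (nrm1 f / d) := by
  have := integral_mono_ae (integrable_vHartree μ hf.l12) (integrable_const (nrm1 f / d))
    (hμ.mono fun x hx => vHartree_le_of_far hf.l12 hf.nonneg hd fun y hy => h x y hx hy)
  simpa using this

lemma le_integral_vHartree_of_near {μ : Measure Space} [IsFiniteMeasure μ] {L : ℝ}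
    (hμ : InBall L μ) {f : Space → ℝ} (hf : IsDensity f) {d : ℝ}
    (h : ∀ x y, ‖x‖ ≤ L → f y ≠ 0 → 0 < ‖x - y‖ ∧ ‖x - y‖ ≤ d) :
    μ.real univ * (nrm1 f / d) ≤ ∫ x, vHartree f x ∂μ := by
  have := integral_mono_ae (integrable_const (nrm1 f / d)) (integrable_vHartree μ hf.l12)
    (hμ.mono fun x hx => le_vHartree_of_near hf.l12 hf.nonneg fun y hy => h x y hx hy)
  simpa using this

lemma sinCut_ne_zero {R : ℝ} {x : Space} (h : sinCut R x ≠ 0) : R - 1 < ‖x‖ := by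
  by_contra! hx
  exact h (sinCut_eq_zero (by linarith [jb_le x]))

lemma nrm1_sq_mul_le {f : Space → ℝ} (hf : IsDensity f) {m : Space → ℝ} (hm : IsBddMeas m)
    (h1 : ∀ x, |m x| ≤ 1) : nrm1 (fun x => m x ^ 2 * f x) ≤ nrm1 f := by
  refine nrm1_mono (hf.sq_mul hm).l12 hf.l12 fun x => ?_
  rw [abs_mul, abs_of_nonneg (sq_nonneg (m x)), ← sq_abs]
  exact mul_le_of_le_one_left (abs_nonneg _) (pow_le_one₀ (abs_nonneg _) (h1 x))

lemma integral_vHartree_sinCut_le {μ : Measure Space} [IsFiniteMeasure μ] {L : ℝ}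
    (hμ : InBall L μ) {f : Space → ℝ} (hf : IsDensity f) {R : ℝ} (hR : L + 1 < R) :
    ∫ x, vHartree (fun x => sinCut R x ^ 2 * f x) x ∂μ ≤
      μ.real univ * (nrm1 (fun x => sinCut R x ^ 2 * f x) / (R - 1 - L)) := by
  refine integral_vHartree_le_of_far hμ (hf.sq_mul (isMultiplier_sinCut R).isBddMeas)
    (by linarith) fun x y hx hy => ?_
  have h1 : sinCut R y ≠ 0 := fun h => hy (by simp [h])
  have h2 := sinCut_ne_zero h1
  have h3 := norm_sub_norm_le y x
  rw [norm_sub_rev] at h3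
  linarith

/-! ### Tails and good radii -/

lemma tendsto_tail {G : Space → ℝ} (hG : Integrable G) :
    Tendsto (fun j : ℕ => ∫ x in {x | (j : ℝ) ≤ jb x}, G x) atTop (𝓝 0) := by
  have hm : ∀ j : ℕ, MeasurableSet {x | (j : ℝ) ≤ jb x} := fun j =>
    measurableSet_le measurable_const continuous_jb.measurable
  have := tendsto_setIntegral_of_antitone (μ := volume) (f := G) hm
    (fun i j hij x hx => (Nat.cast_le.2 hij).trans (show (j : ℝ) ≤ jb x from hx)) ⟨0, hG.integrableOn⟩
  have h0 : (⋂ j : ℕ, {x | (j : ℝ) ≤ jb x}) = ∅ := by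
    ext x
    simp only [mem_iInter, mem_ofPred_eq, mem_empty_iff_false, iff_false, not_forall, not_le]
    exact exists_nat_gt (jb x)
  rwa [h0, setIntegral_empty] at this

lemma shellInt_nonneg (R : ℝ) {f : Space → ℝ} (hf : IsDensity f) : 0 ≤ shellInt R f :=
  integral_nonneg fun x => add_nonneg (hf.nonneg x) (sq_nonneg _)

lemma shellInt_le_tail (j : ℕ) {f : Space → ℝ} (hf : IsDensity f) :
    shellInt j f ≤ ∫ x in {x | (j : ℝ) ≤ jb x}, (f x + f x ^ 2) :=
  setIntegral_mono_set (hf.l12.int.add hf.l12.sq).integrableOn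
    (Eventually.of_forall fun x => add_nonneg (hf.nonneg x) (sq_nonneg _))
    (Eventually.of_forall fun x hx => by
      have := hx.1
      change (j : ℝ) ≤ jb x
      linarith)

lemma tendsto_shellInt {f : Space → ℝ} (hf : IsDensity f) :
    Tendsto (fun j : ℕ => shellInt j f) atTop (𝓝 0) :=
  squeeze_zero (fun _ => shellInt_nonneg _ hf) (fun j => shellInt_le_tail j hf)
    (tendsto_tail (hf.l12.int.add hf.l12.sq))

lemma tendsto_nrm1_sinCut {f : Space → ℝ} (hf : IsDensity f) :
    Tendsto (fun j : ℕ => nrm1 (fun x => sinCut j x ^ 2 * f x)) atTop (𝓝 0) := by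
  refine squeeze_zero (fun _ => nrm1_nonneg _) (fun j => ?_) (tendsto_tail hf.l12.int)
  have hd := hf.sq_mul (isMultiplier_sinCut j).isBddMeas
  rw [nrm1_of_nonneg hd.nonneg, ← integral_indicator
    (measurableSet_le measurable_const continuous_jb.measurable)]
  refine integral_mono hd.l12.int (hf.l12.int.indicator
    (measurableSet_le measurable_const continuous_jb.measurable)) fun x => ?_
  by_cases hx : (j : ℝ) ≤ jb x
  · rw [indicator_of_mem (show x ∈ {x | (j : ℝ) ≤ jb x} from hx)]
    refine mul_le_of_le_one_left (hf.nonneg x) ?_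
    rw [← sq_abs]
    exact pow_le_one₀ (abs_nonneg _) (abs_sinCut_le _ _)
  · rw [indicator_of_notMem (show x ∉ {x | (j : ℝ) ≤ jb x} from hx),
      sinCut_eq_zero (not_le.1 hx).le]
    simp

/-- There are arbitrarily large radii for which the shell contributes `o(1/R)`. -/
lemma exists_shellInt_le {f : Space → ℝ} (hf : IsDensity f) {η : ℝ} (hη : 0 < η) (R₀ : ℕ) :
    ∃ R : ℕ, R₀ ≤ R ∧ 0 < R ∧ shellInt R f ≤ η / R := by
  by_contra! hcon
  -- The shells of width one at even radii are disjoint, so the shell integrals are summable. If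
  -- each exceeded η divided by its radius, they would dominate a harmonic series.
  have hdisj : Pairwise (Function.onFun Disjoint fun j : ℕ => shell (2 * j : ℝ)) := by
    intro i j hij
    refine Set.disjoint_left.2 fun x hi hj => ?_
    have h1 := hi.1; have h2 := hi.2; have h3 := hj.1; have h4 := hj.2
    have h5 : (2 * i : ℝ) < 2 * j + 2 := by linarith
    have h6 : (2 * j : ℝ) < 2 * i + 2 := by linarith
    have h7 : i < j + 1 := by
      have : (i : ℝ) < ((j + 1 : ℕ) : ℝ) := by push_cast; linarith
      exact_mod_cast this
    have h8 : j < i + 1 := by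
      have : (j : ℝ) < ((i + 1 : ℕ) : ℝ) := by push_cast; linarith
      exact_mod_cast this
    omega
  have hs := (hasSum_integral_iUnion (fun j : ℕ => measurableSet_shell (2 * j : ℝ)) hdisj
    (hf.l12.int.add hf.l12.sq).integrableOn).summable
  have h2 : Summable fun j : ℕ => η / 2 * (1 / (j : ℝ)) := by
    refine Summable.of_norm_bounded_eventually_nat hs ?_
    filter_upwards [eventually_ge_atTop (R₀ + 1)] with j hj
    have h3 := hcon (2 * j) (by omega) (by omega)
    push_cast at h3
    rw [Real.norm_of_nonneg (by positivity)]
    refine le_trans (le_of_eq ?_) h3.le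
    field_simp
  exact Real.not_summable_one_div_natCast ((summable_mul_left_iff (by positivity)).1 h2)

lemma IsDensity.shellInt_mono {f g : Space → ℝ} (hf : IsDensity f) (hg : IsDensity g)
    (h : ∀ x, f x ≤ g x) (R : ℝ) : shellInt R f ≤ shellInt R g :=
  integral_mono (hf.l12.int.add hf.l12.sq).integrableOn (hg.l12.int.add hg.l12.sq).integrableOn
    fun x => add_le_add (h x) (pow_le_pow_left₀ (hf.nonneg x) (h x) 2)

/-- At suitable large radii `R`, cutting costs at most `η / R`, also for a second density. -/
lemma exists_good_radius (he : IsExchangeCorrelation e) {n : ℕ} {μ : Measure Space}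
    [IsFiniteMeasure μ] {L : ℝ} (hμ : InBall L μ) {A : Fin n → L2} (hA : ∀ k, A k ∈ H1)
    {g : Space → ℝ} (hg : IsDensity g) {η : ℝ} (hη : 0 < η) (R₀ : ℕ) :
    ∃ R : ℕ, R₀ ≤ R ∧ 0 < R ∧
      ksEnergy e μ (fun k => mulL2 (cosCut R) (A k)) + ksEnergy e 0 (fun k => mulL2 (sinCut R) (A k))
        ≤ ksEnergy e μ A + η / R ∧ shellInt R g ≤ η / R := by
  obtain ⟨C, hC0, hC⟩ := exists_ksEnergy_cut he
  have hd := isDensity_density hA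
  set m := μ.real univ with hm
  have hm0 : 0 ≤ m := measureReal_nonneg
  -- Once R - 1 - L ≥ R/2, an outer charge of η / (4(m + 1)) makes the lost attraction at most
  -- η/(2R). The other half of η/R is reserved for the shell term.
  obtain ⟨R₁, hR₁⟩ := eventually_atTop.1 ((tendsto_nrm1_sinCut hd).eventually_le_const
    (show 0 < η / (4 * (m + 1)) by positivity))
  obtain ⟨R₂, hR₂⟩ := exists_nat_ge (2 * (1 + L))
  obtain ⟨R, hR, hRpos, hs⟩ := exists_shellInt_le (hd.add hg)
    (show 0 < min η (η / (2 * (C + 1))) by positivity) (max (max R₀ R₁) (R₂ + 1))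
  have hRp : (0 : ℝ) < R := Nat.cast_pos.2 hRpos
  have hRL : 2 * (1 + L) < R := hR₂.trans_lt (Nat.cast_lt.2 (by omega))
  refine ⟨R, by omega, hRpos, ?_, ?_⟩
  · refine (hC n μ R A hA).trans ?_
    have h1 := integral_vHartree_sinCut_le hμ hd (R := R) (by linarith)
    have h2 := hR₁ R (by omega)
    have h3 : nrm1 (fun x => sinCut R x ^ 2 * density A x) / (R - 1 - L) ≤
        (η / (4 * (m + 1))) / (R / 2) := by
      apply div_le_div₀ (by positivity) h2 (by positivity) (by linarith)
    have h4 : m * (nrm1 (fun x => sinCut R x ^ 2 * density A x) / (R - 1 - L)) ≤ η / 2 / R := by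
      calc _ ≤ (m + 1) * ((η / (4 * (m + 1))) / (R / 2)) := by
            apply mul_le_mul (by linarith) h3 _ (by positivity)
            exact div_nonneg (nrm1_nonneg _) (by linarith)
        _ = η / 2 / R := by field_simp; norm_num
    have h5 : shellInt R (density A) ≤ η / (2 * (C + 1)) / R :=
      (hd.shellInt_mono (hd.add hg) (fun x => by linarith [hg.nonneg x]) R).trans
        (hs.trans (by gcongr; exact min_le_right _ _))
    have h6 : C * shellInt R (density A) ≤ η / 2 / R := by
      calc _ ≤ (C + 1) * (η / (2 * (C + 1)) / R) := by
            apply mul_le_mul (by linarith) h5 (shellInt_nonneg _ hd) (by positivity)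
        _ = η / 2 / R := by field_simp
    have h7 : η / 2 / (R : ℝ) + η / 2 / R = η / R := by ring
    linarith
  · exact (hg.shellInt_mono (hd.add hg) (fun x => by linarith [hd.nonneg x]) R).trans
      (hs.trans (by gcongr; exact min_le_left _ _))

/-! ### Continuity of the energy -/

lemma tendsto_potEnergy (he : IsExchangeCorrelation e) (μ : Measure Space) [IsFiniteMeasure μ]
    {n : ℕ} {Φ : ℕ → Fin n → L2} {Ψ : Fin n → L2} {M : ℝ} (hΦ : ∀ j k, Φ j k ∈ H1)
    (hΨ : ∀ k, Ψ k ∈ H1) (hn : ∀ j k, ‖Φ j k‖ ≤ M) (hM : ∀ j k, gr (Φ j k) ≤ M)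
    (h : ∀ k, Tendsto (fun j => Φ j k) atTop (𝓝 (Ψ k))) :
    Tendsto (fun j => potEnergy e μ (density (Φ j))) atTop (𝓝 (potEnergy e μ (density Ψ))) := by
  set B := 2 * (n * (M ^ 2 + √(gnConst * (M * M ^ 3)))) with hB
  obtain ⟨C, hC0, hC⟩ := exists_potEnergy_sub_le he (max (μ.real univ) (max B (nrm (density Ψ))))
  rw [tendsto_iff_norm_sub_tendsto_zero]
  refine squeeze_zero (fun j => norm_nonneg _) (fun j => hC μ _ _ (le_max_left _ _)
    (isDensity_density (hΦ j)) (isDensity_density hΨ)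
    ((nrm_density_le (hΦ j) (hn j) (hM j)).trans
      (le_max_of_le_right (le_max_left _ _))) (le_max_of_le_right (le_max_right _ _))) ?_
  simpa using (tendsto_nrm_density hΦ hΨ hM h).const_mul C

lemma kin_lsc {n : ℕ} {Φ : ℕ → Fin n → L2} {Ψ : Fin n → L2} {M : ℝ}
    (h : ∀ k, WeakH1 (fun j => Φ j k) (Ψ k) M) {ε : ℝ} (hε : 0 < ε) :
    ∀ᶠ j in atTop, kin Ψ ≤ kin (Φ j) + ε := by
  have h1 : ∀ᶠ j in atTop, ∀ k, gradNormSq (Ψ k) ≤ gradNormSq (Φ j k) + ε / (n + 1) :=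
    eventually_all.2 fun k => (h k).gradNormSq_lsc (by positivity)
  filter_upwards [h1] with j hj
  have h2 := Finset.sum_le_sum fun k (_ : k ∈ Finset.univ) => hj k
  simp only [Finset.sum_add_distrib, Finset.sum_const, Finset.card_univ, Fintype.card_fin,
    nsmul_eq_mul] at h2
  have h3 : n * (ε / (n + 1)) ≤ ε := by
    rw [mul_div_assoc', div_le_iff₀ (by positivity)]; nlinarith
  simp only [kin]; linarith

lemma ksEnergy_lsc (he : IsExchangeCorrelation e) (μ : Measure Space) [IsFiniteMeasure μ]
    {n : ℕ} {Φ : ℕ → Fin n → L2} {Ψ : Fin n → L2} {M : ℝ}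
    (h : ∀ k, WeakH1 (fun j => Φ j k) (Ψ k) M)
    (hs : ∀ k, Tendsto (fun j => Φ j k) atTop (𝓝 (Ψ k))) {ε : ℝ} (hε : 0 < ε) :
    ∀ᶠ j in atTop, ksEnergy e μ Ψ ≤ ksEnergy e μ (Φ j) + ε := by
  have h1 := tendsto_potEnergy he μ (fun j k => (h k).mem j) (fun k => (h k).limit_mem)
    (fun j k => (h k).norm_le j) (fun j k => (h k).gr_le j) hs
  filter_upwards [kin_lsc h (half_pos hε),
    h1.eventually_const_lt (show potEnergy e μ (density Ψ) - ε / 2 < _ by linarith)] with j h2 h3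
  rw [ksEnergy_eq e μ fun k => (h k).limit_mem, ksEnergy_eq e μ fun k => (h k).mem j]
  linarith

lemma H1Tendsto.exists_bound {n : ℕ} {Φ : ℕ → Fin n → L2} {Ψ : Fin n → L2}
    (h : ∀ k, H1Tendsto (fun j => Φ j k) (Ψ k)) :
    ∃ M, ∀ j k, ‖Φ j k‖ ≤ M ∧ KohnSham.gr (Φ j k) ≤ M := by
  have h1 : ∀ k, ∃ M, ∀ j, ‖Φ j k‖ ≤ M ∧ KohnSham.gr (Φ j k) ≤ M := by
    intro k
    obtain ⟨M1, h1⟩ := (h k).1.norm.bddAbove_range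
    obtain ⟨M2, h2⟩ := (h k).gr.bddAbove_range
    exact ⟨max M1 M2, fun j => ⟨(h1 ⟨j, rfl⟩).trans (le_max_left _ _),
      (h2 ⟨j, rfl⟩).trans (le_max_right _ _)⟩⟩
  choose M hM using h1
  have hle : ∀ k, M k ≤ ∑ k, |M k| := fun k => (le_abs_self _).trans
    (Finset.single_le_sum (f := fun k => |M k|) (fun _ _ => abs_nonneg _) (Finset.mem_univ k))
  exact ⟨∑ k, |M k|, fun j k => ⟨(hM k j).1.trans (hle k), (hM k j).2.trans (hle k)⟩⟩

lemma tendsto_ksEnergy (he : IsExchangeCorrelation e) (μ : Measure Space) [IsFiniteMeasure μ]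
    {n : ℕ} {Φ : ℕ → Fin n → L2} {Ψ : Fin n → L2} (hΦ : ∀ j k, Φ j k ∈ H1)
    (hΨ : ∀ k, Ψ k ∈ H1) (h : ∀ k, H1Tendsto (fun j => Φ j k) (Ψ k)) :
    Tendsto (fun j => ksEnergy e μ (Φ j)) atTop (𝓝 (ksEnergy e μ Ψ)) := by
  obtain ⟨M, hM⟩ := H1Tendsto.exists_bound h
  have h1 := tendsto_potEnergy he μ hΦ hΨ (fun j k => (hM j k).1) (fun j k => (hM j k).2)
    fun k => (h k).1
  have h2 : Tendsto (fun j => kin (Φ j)) atTop (𝓝 (kin Ψ)) :=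
    tendsto_finsetSum _ fun k _ => (h k).gradNormSq
  have h3 := h2.add h1
  rw [← ksEnergy_eq e μ hΨ] at h3
  exact h3.congr fun j => (ksEnergy_eq e μ (hΦ j)).symm

/-! ### Linear combinations of orbitals -/

/-- Linear combinations of the orbitals. -/
def comb {n : ℕ} (A : Fin n → L2) (c : Fin n → ℂ) : L2 := ∑ k, c k • A k

/-- The squared Euclidean norm of a coefficient vector. -/
def csq {n : ℕ} (c : Fin n → ℂ) : ℝ := ∑ k, ‖c k‖ ^ 2

lemma csq_nonneg {n : ℕ} (c : Fin n → ℂ) : 0 ≤ csq c := Finset.sum_nonneg fun _ _ => sq_nonneg _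

lemma sum_norm_le {n : ℕ} (c : Fin n → ℂ) : (∑ k, ‖c k‖) ^ 2 ≤ n * csq c := by
  simpa [csq] using sq_sum_le_card_mul_sum_sq (s := Finset.univ) (f := fun k => ‖c k‖)

lemma comb_mulL2 {n : ℕ} {m : Space → ℝ} (hm : IsBddMeas m) (A : Fin n → L2) (c : Fin n → ℂ) :
    comb (fun k => mulL2 m (A k)) c = mulL2 m (comb A c) := by
  simp only [comb, mulL2_sum hm, mulL2_smul hm]

lemma comb_tr {n : ℕ} (z : Space) (A : Fin n → L2) (c : Fin n → ℂ) :
    comb (fun k => tr z (A k)) c = tr z (comb A c) := by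
  simp only [comb, map_sum, map_smul]

lemma norm_comb_le {n : ℕ} {A : Fin n → L2} {M : ℝ} (h : ∀ k, ‖A k‖ ≤ M) (c : Fin n → ℂ) :
    ‖comb A c‖ ≤ M * ∑ k, ‖c k‖ := by
  rw [Finset.mul_sum]
  refine (norm_sum_le _ _).trans (Finset.sum_le_sum fun k _ => ?_)
  rw [norm_smul, mul_comm]
  exact mul_le_mul_of_nonneg_right (h k) (norm_nonneg _)

lemma comb_sub {n : ℕ} (A B : Fin n → L2) (c : Fin n → ℂ) :
    comb (fun k => A k - B k) c = comb A c - comb B c := by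
  simp only [comb, smul_sub, Finset.sum_sub_distrib]

lemma norm_comb_sq_le {n : ℕ} {A B : Fin n → L2} {M δ : ℝ} (hA : ∀ k, ‖A k‖ ≤ M)
    (hB : ∀ k, ‖B k‖ ≤ M) (h : ∀ k, ‖A k - B k‖ ≤ δ) (hδ : 0 ≤ δ) (hM : 0 ≤ M) (c : Fin n → ℂ) :
    ‖comb A c‖ ^ 2 ≤ ‖comb B c‖ ^ 2 + 2 * n * M * δ * csq c := by
  have h1 := norm_comb_le hA c
  have h2 := norm_comb_le hB c
  have h3 := norm_comb_le h c
  rw [comb_sub] at h3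
  have h4 : ‖comb A c‖ - ‖comb B c‖ ≤ δ * ∑ k, ‖c k‖ := (norm_sub_norm_le _ _).trans h3
  have h5 := sum_norm_le c
  have hs : 0 ≤ ∑ k, ‖c k‖ := Finset.sum_nonneg fun _ _ => norm_nonneg _
  have h6 : ‖comb A c‖ ^ 2 - ‖comb B c‖ ^ 2 ≤ (δ * ∑ k, ‖c k‖) * (2 * M * ∑ k, ‖c k‖) := by
    rw [sq_sub_sq, mul_comm]
    apply mul_le_mul h4 (by linarith) (by positivity) (by positivity)
  have h7 : (δ * ∑ k, ‖c k‖) * (2 * M * ∑ k, ‖c k‖) ≤ 2 * M * δ * (n * csq c) := by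
    calc _ = 2 * M * δ * (∑ k, ‖c k‖) ^ 2 := by ring
      _ ≤ _ := by gcongr
  linarith

/-! ### Splitting weakly convergent sequences -/

lemma norm_cosCut_le (R : ℝ) (u : L2) : ‖mulL2 (cosCut R) u‖ ≤ ‖u‖ := by
  simpa using norm_mulL2_le (isMultiplier_cosCut R).isBddMeas (abs_cosCut_le R) u

lemma norm_sinCut_le (R : ℝ) (u : L2) : ‖mulL2 (sinCut R) u‖ ≤ ‖u‖ := by
  simpa using norm_mulL2_le (isMultiplier_sinCut R).isBddMeas (abs_sinCut_le R) u

lemma exists_gr_cut_le (M : ℝ) : ∃ M', M ≤ M' ∧ ∀ R, ∀ u ∈ H1, ‖u‖ ≤ M → gr u ≤ M →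
    gr (mulL2 (cosCut R) u) ≤ M' ∧ gr (mulL2 (sinCut R) u) ≤ M' := by
  obtain ⟨C, hC0, hC⟩ := exists_gradNormSq_cut
  refine ⟨max M (√(M ^ 2 + C * M ^ 2)), le_max_left _ _, fun R u hu h1 h2 => ?_⟩
  have h3 := hC R u hu
  have h4 : ∫ x in shell R, ‖u x‖ ^ 2 ≤ ‖u‖ ^ 2 := by
    rw [norm_sq_eq_integral]
    exact setIntegral_le_integral (integrable_norm_sq u) (Eventually.of_forall fun _ => sq_nonneg _)
  have h5 : ‖u‖ ^ 2 ≤ M ^ 2 := pow_le_pow_left₀ (norm_nonneg _) h1 2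
  have h6 : gradNormSq u ≤ M ^ 2 := by rw [← gr_sq]; exact pow_le_pow_left₀ (gr_nonneg _) h2 2
  have h7 := gradNormSq_nonneg (mulL2 (cosCut R) u)
  have h8 := gradNormSq_nonneg (mulL2 (sinCut R) u)
  have h9 : C * (∫ x in shell R, ‖u x‖ ^ 2) ≤ C * M ^ 2 := by gcongr; linarith
  constructor <;> exact le_max_of_le_right (Real.sqrt_le_sqrt (by linarith))

lemma vanishesOff_cosCut (R : ℝ) : VanishesOff (R + 1) (cosCut R) := fun x hx =>
  cosCut_eq_zero (hx.le.trans (norm_le_jb x))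

lemma WeakH1.cosCut {u : ℕ → L2} {v : L2} {M M' : ℝ} (h : WeakH1 u v M)
    (hM : ∀ R, ∀ u ∈ H1, ‖u‖ ≤ M → KohnSham.gr u ≤ M →
      KohnSham.gr (KohnSham.mulL2 (cosCut R) u) ≤ M' ∧ KohnSham.gr (KohnSham.mulL2 (sinCut R) u) ≤ M')
    (hMM : M ≤ M') (R : ℝ) :
    WeakH1 (fun j => KohnSham.mulL2 (KohnSham.cosCut R) (u j))
      (KohnSham.mulL2 (KohnSham.cosCut R) v) M' where
  mem j := H1_mul (h.mem j) (isMultiplier_cosCut R)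
  norm_le j := (norm_cosCut_le R _).trans ((h.norm_le j).trans hMM)
  gr_le j := (hM R _ (h.mem j) (h.norm_le j) (h.gr_le j)).1
  weak := h.weak.mulL2 (isMultiplier_cosCut R).isBddMeas

lemma IsDensity.integrable_add_sq {f : Space → ℝ} (hf : IsDensity f) :
    Integrable fun x => f x + f x ^ 2 := hf.l12.int.add hf.l12.sq

lemma shellInt_le_of_nrm {f g : Space → ℝ} (hf : IsDensity f) (hg : IsDensity g) (R : ℝ) :
    shellInt R f ≤ shellInt R g + (1 + nrm f + nrm g) * nrm (fun x => f x - g x) := by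
  have hd := hf.l12.sub hg.l12
  have hs := hf.l12.add hg.l12
  have i1 := integrable_mul_of_sq hs.memLp hd.memLp
  have h1 : shellInt R f - shellInt R g ≤
      ∫ x, (|f x - g x| + |(f x + g x) * (f x - g x)|) := by
    rw [shellInt, shellInt, ← integral_sub hf.integrable_add_sq.integrableOn
      hg.integrable_add_sq.integrableOn]
    refine (integral_mono ((hf.integrable_add_sq.sub hg.integrable_add_sq).integrableOn) (hd.int.abs.add i1.abs).integrableOn
      fun x => ?_).trans
      (setIntegral_le_integral (hd.int.abs.add i1.abs) (Eventually.of_forall fun x => ?_))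
    · simp only [Pi.sub_apply, Pi.add_apply]
      have := le_abs_self (f x - g x)
      have := le_abs_self ((f x + g x) * (f x - g x))
      nlinarith
    · simp only [Pi.zero_apply, Pi.add_apply]; positivity
  rw [integral_add hd.int.abs i1.abs] at h1
  have h2 := integral_abs_mul_le hs.memLp hd.memLp
  have h3 : nrm2 (fun x => f x + g x) ≤ nrm f + nrm g :=
    (nrm2_add_le hf.l12 hg.l12).trans (add_le_add (nrm2_le_nrm f) (nrm2_le_nrm g))
  have h4 : nrm2 (fun x => f x + g x) * nrm2 (fun x => f x - g x) ≤
      (nrm f + nrm g) * nrm (fun x => f x - g x) :=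
    mul_le_mul h3 (nrm2_le_nrm _) (nrm2_nonneg _) (add_nonneg (nrm_nonneg f) (nrm_nonneg g))
  have h5 := nrm1_le_nrm fun x => f x - g x
  have h6 : ∫ x, |f x - g x| = nrm1 (fun x => f x - g x) := rfl
  linarith

lemma shellInt_congr {f g : Space → ℝ} (R : ℝ) (h : ∀ᵐ x, x ∈ shell R → f x = g x) :
    shellInt R f = shellInt R g :=
  setIntegral_congr_ae (measurableSet_shell R) (h.mono fun x hx hxR => by rw [hx hxR])

lemma WeakH1.tendsto_cosCut {n : ℕ} {Φ : ℕ → Fin n → L2} {a : Fin n → L2} {M : ℝ}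
    (h : ∀ k, WeakH1 (fun j => Φ j k) (a k) M) (R : ℝ) (k : Fin n) :
    Tendsto (fun j => KohnSham.mulL2 (KohnSham.cosCut R) (Φ j k)) atTop
      (𝓝 (KohnSham.mulL2 (KohnSham.cosCut R) (a k))) :=
  (h k).tendsto_mulL2 (isMultiplier_cosCut R).isBddMeas (vanishesOff_cosCut R)

/-- The cutoff at radius R + 1 equals 1 on the shell at R, so local strong convergence of the cut
orbitals controls the shell integral. -/
lemma eventually_shellInt_le {n : ℕ} {Φ : ℕ → Fin n → L2} {a : Fin n → L2} {M : ℝ}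
    (h : ∀ k, WeakH1 (fun j => Φ j k) (a k) M) (R : ℝ) {ε : ℝ} (hε : 0 < ε) :
    ∀ᶠ j in atTop, shellInt R (density (Φ j)) ≤ shellInt R (density a) + ε := by
  obtain ⟨M', hMM, hM'⟩ := exists_gr_cut_le M
  have hw := fun k => (h k).cosCut hM' hMM (R + 1)
  have hc := (isMultiplier_cosCut (R + 1)).isBddMeas
  have h0 := tendsto_nrm_density (fun j k => (hw k).mem j) (fun k => (hw k).limit_mem)
    (fun j k => (hw k).gr_le j) (WeakH1.tendsto_cosCut h (R + 1))
  have hb := fun j => nrm_density_le (fun k => (hw k).mem j) (fun k => (hw k).norm_le j)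
    (fun k => (hw k).gr_le j)
  set B := 2 * (n * (M' ^ 2 + √(gnConst * (M' * M' ^ 3))))
  set a' : Fin n → L2 := fun k => KohnSham.mulL2 (KohnSham.cosCut (R + 1)) (a k) with ha'
  have h1 : Tendsto (fun j => (1 + B + nrm (density a')) * nrm (fun x =>
      density (fun k => KohnSham.mulL2 (KohnSham.cosCut (R + 1)) (Φ j k)) x - density a' x))
      atTop (𝓝 0) := by simpa using h0.const_mul (1 + B + nrm (density a'))
  have key : ∀ Ψ : Fin n → L2, shellInt R (density Ψ) =
      shellInt R (density fun k => KohnSham.mulL2 (KohnSham.cosCut (R + 1)) (Ψ k)) := by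
    intro Ψ
    refine shellInt_congr R ((density_mulL2 Ψ hc).mono fun x hx hxR => ?_)
    have h2 : jb x ≤ R + 1 := by have := hxR.2; linarith
    rw [hx]
    simp only [cosCut_eq_one h2, one_pow, one_mul]
  filter_upwards [h1.eventually_le_const hε] with j hj
  rw [key (Φ j), key a]
  refine (shellInt_le_of_nrm (isDensity_density fun k => (hw k).mem j)
    (isDensity_density fun k => (hw k).limit_mem) R).trans (add_le_add_right (le_trans ?_ hj) _)
  have := hb j
  have := nrm_nonneg (fun x =>
      density (fun k => KohnSham.mulL2 (KohnSham.cosCut (R + 1)) (Φ j k)) x - density a' x)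
  gcongr

/-- Splitting off the weak limit of a sequence of orbitals. -/
lemma WeakH1.split (he : IsExchangeCorrelation e) {n : ℕ} {μ : Measure Space} [IsFiniteMeasure μ]
    {L : ℝ} (hμ : InBall L μ) {Φ : ℕ → Fin n → L2} {a : Fin n → L2} {M : ℝ}
    (h : ∀ k, WeakH1 (fun j => Φ j k) (a k) M) {ε : ℝ} (hε : 0 < ε) :
    ∃ R₀ : ℕ, ∀ R : ℕ, R₀ ≤ R → ∀ᶠ j in atTop,
      ksEnergy e μ a + ksEnergy e 0 (fun k => KohnSham.mulL2 (sinCut R) (Φ j k)) ≤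
        ksEnergy e μ (Φ j) + ε ∧
      ∀ c, ‖comb a c‖ ^ 2 + ‖comb (fun k => KohnSham.mulL2 (sinCut R) (Φ j k)) c‖ ^ 2 ≤
        ‖comb (Φ j) c‖ ^ 2 + ε * csq c := by
  obtain ⟨C, hC0, hC⟩ := exists_ksEnergy_cut he
  obtain ⟨M', hMM, hM'⟩ := exists_gr_cut_le M
  have ha : ∀ k, a k ∈ H1 := fun k => (h k).limit_mem
  set m := μ.real univ with hm
  have hm0 : 0 ≤ m := measureReal_nonneg
  set N : ℝ := 2 * (n * M ^ 2)
  have hN : ∀ j, nrm1 (density (Φ j)) ≤ N := by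
    intro j
    rw [nrm1_density]
    have : ∑ k, ‖Φ j k‖ ^ 2 ≤ ∑ _k : Fin n, M ^ 2 := by
      gcongr with k
      exact (h k).norm_le j
    simp at this
    linarith
  set M₁ : ℝ := |M| + ∑ k, ‖a k‖ with hM₁
  have hM₁0 : 0 ≤ M₁ := by positivity
  have haM : ∀ k, ‖a k‖ ≤ M₁ := fun k =>
    (Finset.single_le_sum (f := fun k => ‖a k‖) (fun _ _ => norm_nonneg _)
      (Finset.mem_univ k)).trans (le_add_of_nonneg_left (abs_nonneg _))
  -- Makes 2 n M₁ δ ≤ ε, the perturbation allowed by `norm_comb_sq_le` for the Gram form.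
  set δ : ℝ := ε / (2 * n * M₁ + 1) with hδ
  have hδ0 : 0 < δ := by positivity
  have t1 := (tendsto_ksEnergy he μ (fun j k => H1_mul (ha k) (isMultiplier_cosCut (j : ℝ))) ha
    fun k => H1Tendsto_cosCut (ha k)).eventually_const_lt
    (show ksEnergy e μ a - ε / 5 < ksEnergy e μ a by linarith)
  have t2 := (tendsto_shellInt (isDensity_density ha)).eventually_le_const
    (show 0 < ε / (5 * (C + 1)) by positivity)
  have t3 : ∀ᶠ R : ℕ in atTop, L + 1 < R ∧ m * (N / (R - 1 - L)) ≤ ε / 5 := by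
    have : Tendsto (fun R : ℕ => m * (N / ((R : ℝ) - 1 - L))) atTop (𝓝 (m * 0)) :=
      (((tendsto_atTop_add_const_right _ (-1 - L) tendsto_natCast_atTop_atTop).const_div_atTop
        N).congr fun R => by congr 1; ring).const_mul m
    rw [mul_zero] at this
    exact (tendsto_natCast_atTop_atTop.eventually_gt_atTop (L + 1)).and
      (this.eventually_le_const (by positivity))
  have t4 : ∀ᶠ R : ℕ in atTop, ∀ k, ‖KohnSham.mulL2 (KohnSham.cosCut R) (a k) - a k‖ < δ / 2 :=
    eventually_all.2 fun k => by
      have := ((KohnSham.tendsto_cosCut (a k)).sub_const (a k)).norm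
      rw [sub_self, norm_zero] at this
      exact this.eventually_lt_const (by positivity)
  -- The radius depends only on the weak limit and on uniform bounds: beyond it, cutting the limit
  -- changes little, its shell integral is small, and the attraction of the outer parts is small for
  -- all j.
  obtain ⟨R₀, hR₀⟩ := eventually_atTop.1 (t1.and (t2.and (t3.and t4)))
  refine ⟨R₀, fun R hR => ?_⟩
  obtain ⟨r1, r2, ⟨r3, r3'⟩, r4⟩ := hR₀ R hR
  have hw := fun k => (h k).cosCut hM' hMM R
  have hs := WeakH1.tendsto_cosCut h R
  -- At fixed R the inner parts converge strongly in L² to the inner part of the limit, so the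
  -- energy is lower semicontinuous along them and their Gram forms converge.
  have s1 := ksEnergy_lsc he μ hw hs (show 0 < ε / 5 by positivity)
  have s2 := eventually_shellInt_le h R (show 0 < ε / (5 * (C + 1)) by positivity)
  have s3 : ∀ᶠ j in atTop, ∀ k, ‖KohnSham.mulL2 (KohnSham.cosCut R) (Φ j k) -
      KohnSham.mulL2 (KohnSham.cosCut R) (a k)‖ < δ / 2 :=
    eventually_all.2 fun k => by
      have := ((hs k).sub_const (KohnSham.mulL2 (KohnSham.cosCut R) (a k))).norm
      rw [sub_self, norm_zero] at this
      exact this.eventually_lt_const (by positivity)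
  filter_upwards [s1, s2, s3] with j j1 j2 j3
  constructor
  · have g1 := hC n μ R (Φ j) fun k => (h k).mem j
    have hd := isDensity_density fun k => (h k).mem j
    have g2 := integral_vHartree_sinCut_le hμ hd r3
    have g3 : nrm1 (fun x => sinCut R x ^ 2 * density (Φ j) x) ≤ N :=
      (nrm1_sq_mul_le hd (isMultiplier_sinCut R).isBddMeas (abs_sinCut_le R)).trans (hN j)
    have g4 : m * (nrm1 (fun x => sinCut R x ^ 2 * density (Φ j) x) / (R - 1 - L)) ≤ ε / 5 := by
      refine le_trans ?_ r3'
      have : 0 < (R : ℝ) - 1 - L := by linarith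
      gcongr
    have g5 : C * shellInt R (density (Φ j)) ≤ 2 * (ε / 5) := by
      calc _ ≤ (C + 1) * (ε / (5 * (C + 1)) + ε / (5 * (C + 1))) := by
            apply mul_le_mul (by linarith) (by linarith) (shellInt_nonneg _ hd) (by positivity)
        _ = _ := by field_simp; norm_num
    linarith
  · intro c
    have g1 : ‖comb (Φ j) c‖ ^ 2 =
        ‖comb (fun k => KohnSham.mulL2 (KohnSham.cosCut R) (Φ j k)) c‖ ^ 2 +
        ‖comb (fun k => KohnSham.mulL2 (sinCut R) (Φ j k)) c‖ ^ 2 := by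
      rw [comb_mulL2 (isMultiplier_cosCut R).isBddMeas,
        comb_mulL2 (isMultiplier_sinCut R).isBddMeas, norm_sq_cut_add]
    have g2 := norm_comb_sq_le (A := a) (B := fun k => KohnSham.mulL2 (KohnSham.cosCut R) (Φ j k))
      (M := M₁) (δ := δ) haM
      (fun k => (norm_cosCut_le R _).trans (((h k).norm_le j).trans ((le_abs_self M).trans
        (le_add_of_nonneg_right (by positivity)))))
      (fun k => by
        have q1 := (r4 k).le
        have q2 := (j3 k).le
        have q3 := norm_sub_le (KohnSham.mulL2 (KohnSham.cosCut R) (a k) -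
          KohnSham.mulL2 (KohnSham.cosCut R) (Φ j k))
          (KohnSham.mulL2 (KohnSham.cosCut R) (a k) - a k)
        rw [sub_sub_sub_cancel_left] at q3
        rw [norm_sub_rev] at q2
        linarith) hδ0.le hM₁0 c
    have g3 : 2 * n * M₁ * δ ≤ ε := by
      rw [hδ, mul_div_assoc', div_le_iff₀ (by positivity)]
      nlinarith
    have g4 := mul_le_mul_of_nonneg_right g3 (csq_nonneg c)
    linarith

/-! ### Superposition of orbitals with disjoint supports -/

/-- `u ∈ H¹` vanishes outside `S`, together with its weak derivatives. -/
structure SuppIn (S : Set Space) (u : L2) : Prop where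
  mem : u ∈ H1
  off : ∀ᵐ x, x ∉ S → u x = 0
  off_partial : ∀ i, ∀ᵐ x, x ∉ S → weakPartial i u x = 0

namespace SuppIn

variable {S T : Set Space} {u v : L2}

lemma mono (h : SuppIn S u) (hST : S ⊆ T) : SuppIn T u :=
  ⟨h.mem, h.off.mono fun _ hx hxT => hx fun hS => hxT (hST hS),
    fun i => (h.off_partial i).mono fun _ hx hxT => hx fun hS => hxT (hST hS)⟩

lemma zero (S : Set Space) : SuppIn S 0 := by
  have h0 : ∀ᵐ x, (0 : L2) x = 0 := Lp.coeFn_zero ..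
  refine ⟨H1_zero, h0.mono fun x hx _ => hx, fun i => ?_⟩
  rw [weakPartial_zero]
  exact h0.mono fun x hx _ => hx

lemma add (hu : SuppIn S u) (hv : SuppIn S v) : SuppIn S (u + v) := by
  refine ⟨H1_add hu.mem hv.mem, ?_, fun i => ?_⟩
  · filter_upwards [hu.off, hv.off, Lp.coeFn_add u v] with x h1 h2 h3 hx
    rw [h3, Pi.add_apply, h1 hx, h2 hx, add_zero]
  · rw [weakPartial_add i hu.mem hv.mem]
    filter_upwards [hu.off_partial i, hv.off_partial i, Lp.coeFn_add (weakPartial i u)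
      (weakPartial i v)] with x h1 h2 h3 hx
    rw [h3, Pi.add_apply, h1 hx, h2 hx, add_zero]

lemma smul (c : ℂ) (hu : SuppIn S u) : SuppIn S (c • u) := by
  refine ⟨H1_smul c hu.mem, ?_, fun i => ?_⟩
  · filter_upwards [hu.off, Lp.coeFn_smul c u] with x h1 h3 hx
    rw [h3, Pi.smul_apply, h1 hx, smul_zero]
  · rw [weakPartial_smul i c hu.mem]
    filter_upwards [hu.off_partial i, Lp.coeFn_smul c (weakPartial i u)] with x h1 h3 hx
    rw [h3, Pi.smul_apply, h1 hx, smul_zero]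

lemma comb {n : ℕ} {A : Fin n → L2} (h : ∀ k, SuppIn S (A k)) (c : Fin n → ℂ) :
    SuppIn S (comb A c) := by
  classical
  unfold KohnSham.comb
  induction (Finset.univ : Finset (Fin n)) using Finset.induction_on with
  | empty => exact zero S
  | insert a s ha ih => rw [Finset.sum_insert ha]; exact ((h a).smul (c a)).add ih

lemma tr {L : ℝ} (hu : SuppIn (Metric.closedBall 0 L) u) (z : Space) :
    SuppIn (Metric.closedBall z L) (tr z u) := by
  have key : ∀ {w : L2}, (∀ᵐ x, x ∉ Metric.closedBall (0 : Space) L → w x = 0) →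
      ∀ᵐ x, x ∉ Metric.closedBall z L → KohnSham.tr z w x = 0 := by
    intro w hw
    filter_upwards [(measurePreserving_sub z).quasiMeasurePreserving.ae hw, tr_ae z w]
      with x h1 h2 hx
    rw [h2]
    refine h1 fun h => hx ?_
    rw [mem_closedBall_zero_iff] at h
    rwa [Metric.mem_closedBall, dist_eq_norm]
  refine ⟨H1_tr hu.mem z, key hu.off, fun i => ?_⟩
  rw [weakPartial_tr hu.mem]
  exact key (hu.off_partial i)

lemma cosCut (hu : u ∈ H1) (R : ℝ) :
    SuppIn (Metric.closedBall 0 (R + 1)) (mulL2 (cosCut R) u) := by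
  have hc := isMultiplier_cosCut R
  have hout : ∀ x ∉ Metric.closedBall (0 : Space) (R + 1), R + 1 < jb x := fun x hx => by
    rw [mem_closedBall_zero_iff, not_le] at hx
    exact hx.trans_le (norm_le_jb x)
  refine ⟨H1_mul hu hc, ?_, fun i => ?_⟩
  · filter_upwards [mulL2_ae hc.isBddMeas u] with x h1 hx
    rw [h1, cosCut_eq_zero (hout x hx).le]; simp
  · rw [weakPartial_mul hu hc]
    obtain ⟨C, hC0, hC⟩ := exists_partialD_radial_bound isProfile_cos
    filter_upwards [Lp.coeFn_add (mulL2 (KohnSham.cosCut R) (weakPartial i u))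
      (mulL2 (partialD (KohnSham.cosCut R) i) u), mulL2_ae hc.isBddMeas (weakPartial i u),
      mulL2_ae (hc.isBddMeas_partialD i) u] with x h1 h2 h3 hx
    have h4 : x ∉ shell R := fun h => by
      have h5 := h.2
      have h6 := hout x hx
      linarith
    have h5 := hC R i x
    rw [indicator_of_notMem h4] at h5
    have h6 : partialD (KohnSham.cosCut R) i x = 0 := abs_eq_zero.1 (le_antisymm h5 (abs_nonneg _))
    rw [h1, Pi.add_apply, h2, h3, h6, cosCut_eq_zero (hout x hx).le]; simp

end SuppIn

lemma inner_eq_zero_of_disjoint {S T : Set Space} (hST : Disjoint S T) {u v : L2}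
    (hu : ∀ᵐ x, x ∉ S → u x = 0) (hv : ∀ᵐ x, x ∉ T → v x = 0) : inner ℂ u v = 0 := by
  rw [L2.inner_def]
  refine integral_eq_zero_of_ae ?_
  filter_upwards [hu, hv] with x h1 h2
  by_cases hx : x ∈ S
  · simp [h2 (Set.disjoint_left.1 hST hx)]
  · simp [h1 hx]

lemma norm_sq_add_of_disjoint {S T : Set Space} (hST : Disjoint S T) {u v : L2}
    (hu : ∀ᵐ x, x ∉ S → u x = 0) (hv : ∀ᵐ x, x ∉ T → v x = 0) :
    ‖u + v‖ ^ 2 = ‖u‖ ^ 2 + ‖v‖ ^ 2 := by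
  have := norm_add_sq_eq_norm_sq_add_norm_sq_of_inner_eq_zero u v
    (inner_eq_zero_of_disjoint hST hu hv)
  simpa only [← sq] using this

lemma gradNormSq_add_of_disjoint {S T : Set Space} (hST : Disjoint S T) {u v : L2}
    (hu : SuppIn S u) (hv : SuppIn T v) : gradNormSq (u + v) = gradNormSq u + gradNormSq v := by
  simp only [gradNormSq, weakPartial_add _ hu.mem hv.mem,
    norm_sq_add_of_disjoint hST (hu.off_partial _) (hv.off_partial _), Finset.sum_add_distrib]

lemma density_add_of_disjoint {S T : Set Space} (hST : Disjoint S T) {n : ℕ} {A B : Fin n → L2}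
    (hA : ∀ k, SuppIn S (A k)) (hB : ∀ k, SuppIn T (B k)) :
    density (fun k => A k + B k) =ᵐ[volume]
      fun x => S.indicator (density A) x + T.indicator (density B) x := by
  filter_upwards [ae_all_iff.2 fun k => (hA k).off, ae_all_iff.2 fun k => (hB k).off,
    ae_all_iff.2 fun k => Lp.coeFn_add (A k) (B k)] with x h1 h2 h3
  have h4 : density (fun k => A k + B k) x = 2 * ∑ k, ‖A k x + B k x‖ ^ 2 := by
    simp only [density, h3, Pi.add_apply]
  rw [h4]
  by_cases hx : x ∈ S
  · have hT := Set.disjoint_left.1 hST hx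
    simp [density, indicator_of_mem hx, indicator_of_notMem hT, h2 _ hT]
  · by_cases hT : x ∈ T
    · simp [density, indicator_of_notMem hx, indicator_of_mem hT, h1 _ hx]
    · simp [indicator_of_notMem hx, indicator_of_notMem hT, h1 _ hx, h2 _ hT]

lemma density_indicator {S : Set Space} {n : ℕ} {A : Fin n → L2} (hA : ∀ k, SuppIn S (A k)) :
    S.indicator (density A) =ᵐ[volume] density A := by
  filter_upwards [ae_all_iff.2 fun k => (hA k).off] with x h1
  by_cases hx : x ∈ S
  · rw [indicator_of_mem hx]
  · rw [indicator_of_notMem hx]; simp [density, h1 _ hx]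

lemma IsDensity.indicator {f : Space → ℝ} (hf : IsDensity f) {S : Set Space}
    (hS : MeasurableSet S) : IsDensity (S.indicator f) := by
  refine ⟨hf.meas.indicator hS, fun x => indicator_nonneg (fun x _ => hf.nonneg x) x,
    hf.l12.mono (hf.meas.indicator hS).aestronglyMeasurable (Eventually.of_forall fun x => ?_)⟩
  by_cases hx : x ∈ S
  · rw [indicator_of_mem hx]
  · rw [indicator_of_notMem hx, abs_zero]; exact abs_nonneg _

lemma coul_le_of_far {f g : Space → ℝ} (hf : IsDensity f) (hg : IsDensity g) {d : ℝ} (hd : 0 < d)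
    (h : ∀ x y, f x ≠ 0 → g y ≠ 0 → d ≤ ‖x - y‖) : coul f g ≤ nrm1 f * nrm1 g / d := by
  rw [mul_div_assoc, nrm1_of_nonneg hf.nonneg, ← integral_mul_const]
  refine integral_mono (integrable_mul_vHartree hf.l12.int hg.l12) (hf.l12.int.mul_const _)
    fun x => ?_
  by_cases hx : f x = 0
  · simp [hx]
  · exact mul_le_mul_of_nonneg_left (vHartree_le_of_far hg.l12 hg.nonneg hd fun y hy => h x y hx hy)
      (hf.nonneg x)

lemma potEnergy_add_of_disjoint (he : IsExchangeCorrelation e) (μ : Measure Space)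
    [IsFiniteMeasure μ] {f g : Space → ℝ} (hf : IsDensity f) (hg : IsDensity g)
    (h : ∀ x, f x = 0 ∨ g x = 0) : potEnergy e μ (fun x => f x + g x) =
      potEnergy e μ f + potEnergy e 0 g - (∫ x, vHartree g x ∂μ) + coul f g := by
  have h1 : ∫ x, e (f x + g x) = (∫ x, e (f x)) + ∫ x, e (g x) := by
    rw [← integral_add (he.integrable_comp hf) (he.integrable_comp hg)]
    congr 1; ext x
    rcases h x with h | h <;> simp [h, he.zero]
  simp only [potEnergy, integral_zero_measure, h1, integral_vHartree_add μ hf.l12 hg.l12,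
    coul_add_self hf.l12 hg.l12]
  ring

/-- Superposition of compactly supported orbitals with a translate of other ones. -/
lemma superpose (he : IsExchangeCorrelation e) {n : ℕ} {μ : Measure Space} [IsFiniteMeasure μ]
    {L : ℝ} (hμ : InBall L μ) {A B : Fin n → L2} (hA : ∀ k, SuppIn (Metric.closedBall 0 L) (A k))
    (hB : ∀ k, SuppIn (Metric.closedBall 0 L) (B k)) {z : Space} (hz : 2 * L < ‖z‖) :
    (∀ k, SuppIn (Metric.closedBall 0 (‖z‖ + L)) (A k + tr z (B k))) ∧
    (∀ c, ‖comb (fun k => A k + tr z (B k)) c‖ ^ 2 = ‖comb A c‖ ^ 2 + ‖comb B c‖ ^ 2) ∧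
    ksEnergy e μ (fun k => A k + tr z (B k)) ≤ ksEnergy e μ A + ksEnergy e 0 B +
      nrm1 (density A) * nrm1 (density B) / (‖z‖ - 2 * L) -
      μ.real univ * (nrm1 (density B) / (‖z‖ + 2 * L)) := by
  have hBz := fun k => (hB k).tr z
  have hdist : ∀ x ∈ Metric.closedBall (0 : Space) L, ∀ y ∈ Metric.closedBall z L,
      ‖z‖ - 2 * L ≤ ‖x - y‖ ∧ ‖x - y‖ ≤ ‖z‖ + 2 * L := by
    intro x hx y hy
    rw [mem_closedBall_zero_iff] at hx
    rw [Metric.mem_closedBall, dist_eq_norm] at hy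
    have h1 : ‖z‖ ≤ ‖x - y‖ + ‖y - z‖ + ‖x‖ := by
      calc ‖z‖ = ‖x - (x - y) - (y - z)‖ := by congr 1; abel
        _ ≤ ‖x - (x - y)‖ + ‖y - z‖ := norm_sub_le _ _
        _ ≤ ‖x‖ + ‖x - y‖ + ‖y - z‖ := by gcongr; exact norm_sub_le _ _
        _ = _ := by ring
    have h2 : ‖x - y‖ ≤ ‖x‖ + ‖z‖ + ‖y - z‖ := by
      calc ‖x - y‖ = ‖x - z - (y - z)‖ := by congr 1; abel
        _ ≤ ‖x - z‖ + ‖y - z‖ := norm_sub_le _ _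
        _ ≤ _ := by gcongr; exact norm_sub_le _ _
    constructor <;> linarith
  have hdisj : Disjoint (Metric.closedBall (0 : Space) L) (Metric.closedBall z L) := by
    refine Set.disjoint_left.2 fun x hx hx' => ?_
    have := (hdist x hx x hx').1
    rw [sub_self, norm_zero] at this
    linarith
  refine ⟨fun k => ?_, fun c => ?_, ?_⟩
  · refine ((hA k).mono (Metric.closedBall_subset_closedBall ?_)).add ((hBz k).mono ?_)
    · linarith [norm_nonneg z]
    · refine Metric.closedBall_subset_closedBall' ?_
      rw [dist_zero_right]; linarith
  · have h1 : comb (fun k => A k + tr z (B k)) c = comb A c + comb (fun k => tr z (B k)) c := by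
      simp only [comb, smul_add, Finset.sum_add_distrib]
    rw [h1, norm_sq_add_of_disjoint hdisj (SuppIn.comb hA c).off (SuppIn.comb hBz c).off, comb_tr,
      LinearIsometry.norm_map]
  -- The orbitals vanish off the balls only almost everywhere; indicators give exact supports, so
  -- that the distance estimates hold at every point.
  · set f := (Metric.closedBall (0 : Space) L).indicator (density A) with hf
    set g := (Metric.closedBall z L).indicator (density fun k => tr z (B k)) with hg
    have hdf : IsDensity f :=
      (isDensity_density fun k => (hA k).mem).indicator measurableSet_closedBall
    have hdg : IsDensity g :=
      (isDensity_density fun k => (hBz k).mem).indicator measurableSet_closedBall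
    have hfs : ∀ x, f x ≠ 0 → x ∈ Metric.closedBall (0 : Space) L := fun x hx => by
      by_contra h; exact hx (indicator_of_notMem h _)
    have hgs : ∀ x, g x ≠ 0 → x ∈ Metric.closedBall z L := fun x hx => by
      by_contra h; exact hx (indicator_of_notMem h _)
    have hfA : f =ᵐ[volume] density A := density_indicator hA
    have hgB : g =ᵐ[volume] density fun k => tr z (B k) := density_indicator hBz
    have h1 : kin (fun k => A k + tr z (B k)) = kin A + kin B := by
      simp only [kin, ← Finset.sum_add_distrib]
      refine Finset.sum_congr rfl fun k _ => ?_
      rw [gradNormSq_add_of_disjoint hdisj (hA k) (hBz k), gradNormSq_tr (hB k).mem]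
    have h2 : potEnergy e μ (density fun k => A k + tr z (B k)) = _ :=
      (potEnergy_congr e μ (density_add_of_disjoint hdisj hA hBz)).trans
        (potEnergy_add_of_disjoint he μ hdf hdg fun x => by
          by_contra! hcon
          exact Set.disjoint_left.1 hdisj (hfs x hcon.1) (hgs x hcon.2))
    have h3 : nrm1 f = nrm1 (density A) := nrm1_congr hfA
    have h4 : nrm1 g = nrm1 (density B) := by
      rw [nrm1_congr hgB, nrm1_density, nrm1_density]
      simp only [LinearIsometry.norm_map]
    have h5 := coul_le_of_far hdf hdg (sub_pos.2 hz) fun x y hx hy =>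
      (hdist x (hfs x hx) y (hgs y hy)).1
    have h6 := le_integral_vHartree_of_near hμ hdg (d := ‖z‖ + 2 * L) fun x y hx hy => by
      have := hdist x (mem_closedBall_zero_iff.2 hx) y (hgs y hy)
      exact ⟨by linarith, this.2⟩
    have h7 : potEnergy e 0 g = potEnergy e 0 (density B) := by
      rw [potEnergy_congr e 0 (hgB.trans (density_tr B z)), potEnergy_comp_sub]
    rw [ksEnergy_eq e μ fun k => H1_add (hA k).mem (hBz k).mem, ksEnergy_eq e μ fun k => (hA k).mem,
      ksEnergy_eq e 0 fun k => (hB k).mem, h1, h2, h7, potEnergy_congr e μ hfA, ← h3, ← h4]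
    linarith

/-- Orbitals with bounded support. -/
def CompSupp {n : ℕ} (A : Fin n → L2) : Prop :=
  ∃ L : ℝ, ∀ k, SuppIn (Metric.closedBall 0 L) (A k)

lemma CompSupp.mem {n : ℕ} {A : Fin n → L2} (hA : CompSupp A) (k : Fin n) : A k ∈ H1 :=
  (hA.choose_spec k).mem

lemma exists_norm_eq_space {t : ℝ} (ht : 0 ≤ t) : ∃ z : Space, ‖z‖ = t :=
  ⟨EuclideanSpace.single 0 t, by simp [abs_of_nonneg ht]⟩

lemma InBall.mono {L L' : ℝ} {μ : Measure Space} (h : InBall L μ) (hL : L ≤ L') : InBall L' μ :=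
  Filter.Eventually.mono h fun _ hx => hx.trans hL

/-- The free configuration is translated until its repulsion with the first one falls below ε; the
attraction by the nuclei only helps and is dropped. -/
lemma CompSupp.exists_far (he : IsExchangeCorrelation e) {n : ℕ} {μ : Measure Space}
    [IsFiniteMeasure μ] {L : ℝ} (hμ : InBall L μ) {A B : Fin n → L2} (hA : CompSupp A)
    (hB : CompSupp B) {ε : ℝ} (hε : 0 < ε) : ∃ C : Fin n → L2, CompSupp C ∧
      (∀ c, ‖comb C c‖ ^ 2 = ‖comb A c‖ ^ 2 + ‖comb B c‖ ^ 2) ∧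
      ksEnergy e μ C ≤ ksEnergy e μ A + ksEnergy e 0 B + ε := by
  obtain ⟨L₁, h1⟩ := hA
  obtain ⟨L₂, h2⟩ := hB
  set ℓ := max (max L 0) (max L₁ L₂) with hℓ
  have hℓ0 : 0 ≤ ℓ := le_max_of_le_left (le_max_right _ _)
  set P := nrm1 (density A) * nrm1 (density B) with hP
  have hP0 : 0 ≤ P := mul_nonneg (nrm1_nonneg _) (nrm1_nonneg _)
  -- At this distance the gap between the supports is at least (P + 1)/ε, and the repulsion at most
  -- P divided by it.
  obtain ⟨z, hz⟩ := exists_norm_eq_space (show 0 ≤ 2 * ℓ + (P + 1) / ε by positivity)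
  have hpos : 0 < (P + 1) / ε := by positivity
  obtain ⟨s1, s2, s3⟩ := superpose he (hμ.mono (le_max_of_le_left (le_max_left _ _)))
    (fun k => (h1 k).mono (Metric.closedBall_subset_closedBall
      (le_max_of_le_right (le_max_left _ _) : L₁ ≤ ℓ)))
    (fun k => (h2 k).mono (Metric.closedBall_subset_closedBall
      (le_max_of_le_right (le_max_right _ _) : L₂ ≤ ℓ))) (z := z) (by linarith)
  refine ⟨_, ⟨_, s1⟩, s2, s3.trans ?_⟩
  have h3 : P / (‖z‖ - 2 * ℓ) ≤ ε := by
    rw [hz, add_sub_cancel_left, div_le_iff₀ hpos]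
    field_simp
    linarith
  have h4 : 0 ≤ μ.real univ * (nrm1 (density B) / (‖z‖ + 2 * ℓ)) :=
    mul_nonneg measureReal_nonneg (div_nonneg (nrm1_nonneg _) (by positivity))
  linarith

lemma exists_compSupp_approx (he : IsExchangeCorrelation e) {n : ℕ} (μ : Measure Space)
    [IsFiniteMeasure μ] {A : Fin n → L2} (hA : ∀ k, A k ∈ H1) {ε : ℝ} (hε : 0 < ε) :
    ∃ C : Fin n → L2, CompSupp C ∧ (∀ c, ‖comb C c‖ ^ 2 ≤ ‖comb A c‖ ^ 2) ∧
      ksEnergy e μ C ≤ ksEnergy e μ A + ε := by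
  have h := tendsto_ksEnergy he μ (fun j k => H1_mul (hA k) (isMultiplier_cosCut (j : ℝ))) hA
    fun k => H1Tendsto_cosCut (hA k)
  obtain ⟨j, hj⟩ := (h.eventually_lt_const
    (show ksEnergy e μ A < ksEnergy e μ A + ε by linarith)).exists
  refine ⟨_, ⟨j + 1, fun k => SuppIn.cosCut (hA k) j⟩, fun c => ?_, hj.le⟩
  rw [comb_mulL2 (isMultiplier_cosCut _).isBddMeas]
  exact pow_le_pow_left₀ (norm_nonneg _) (norm_cosCut_le _ _) 2

/-- Cutting to bounded support can only lose mass, hence an inequality between the Gram forms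
instead of the equality for compactly supported orbitals. -/
lemma exists_far (he : IsExchangeCorrelation e) {n : ℕ} {μ : Measure Space}
    [IsFiniteMeasure μ] {L : ℝ} (hμ : InBall L μ) {A B : Fin n → L2} (hA : ∀ k, A k ∈ H1)
    (hB : ∀ k, B k ∈ H1) {ε : ℝ} (hε : 0 < ε) : ∃ C : Fin n → L2, (∀ k, C k ∈ H1) ∧
      (∀ c, ‖comb C c‖ ^ 2 ≤ ‖comb A c‖ ^ 2 + ‖comb B c‖ ^ 2) ∧
      ksEnergy e μ C ≤ ksEnergy e μ A + ksEnergy e 0 B + ε := by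
  obtain ⟨A', a1, a2, a3⟩ := exists_compSupp_approx he μ hA (show 0 < ε / 3 by positivity)
  obtain ⟨B', b1, b2, b3⟩ := exists_compSupp_approx he 0 hB (show 0 < ε / 3 by positivity)
  obtain ⟨C, c1, c2, c3⟩ := a1.exists_far he hμ b1 (show 0 < ε / 3 by positivity)
  refine ⟨C, c1.mem, fun c => ?_, by linarith⟩
  rw [c2]; exact add_le_add (a2 c) (b2 c)

/-- The attraction of the nuclei beats the repulsion of the electrons. -/
lemma exists_gain (he : IsExchangeCorrelation e) {n : ℕ} {Z : ℝ} (hZ : 2 * (n : ℝ) < Z) :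
    ∃ κ : ℝ, 0 < κ ∧ ∀ (μ : Measure Space) [IsFiniteMeasure μ] (ℓ : ℝ), 0 < ℓ → μ.real univ = Z →
      InBall ℓ μ → ∀ A B : Fin n → L2, (∀ k, SuppIn (Metric.closedBall 0 ℓ) (A k)) →
      (∀ k, SuppIn (Metric.closedBall 0 ℓ) (B k)) → nrm1 (density A) ≤ 2 * n →
      ∃ W : Fin n → L2, (∀ k, W k ∈ H1) ∧
        (∀ c, ‖comb W c‖ ^ 2 = ‖comb A c‖ ^ 2 + ‖comb B c‖ ^ 2) ∧
        ksEnergy e μ W ≤ ksEnergy e μ A + ksEnergy e 0 B - κ * nrm1 (density B) / ℓ := by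
  have hZ' : 0 < Z - 2 * n := sub_pos.2 hZ
  -- The free part is placed at distance Kℓ. Its points are within (K + 2)ℓ of the nuclei and at
  -- least (K - 2)ℓ from the other electrons. The gain is positive iff K (Z - 2n) > 2 (Z + 2n), and
  -- the summand 1 makes this strict.
  set K : ℝ := 2 * (Z + 2 * n) / (Z - 2 * n) + 1 with hK
  have hn : (0 : ℝ) ≤ n := Nat.cast_nonneg n
  have hK3 : 3 ≤ K := by
    have : 2 ≤ 2 * (Z + 2 * n) / (Z - 2 * n) := by rw [le_div_iff₀ hZ']; linarith
    linarith
  have hK1 : (K - 1) * (Z - 2 * n) = 2 * (Z + 2 * n) := by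
    rw [hK, add_sub_cancel_right, div_mul_cancel₀ _ hZ'.ne']
  refine ⟨Z / (K + 2) - 2 * n / (K - 2), ?_, ?_⟩
  · rw [sub_pos, div_lt_div_iff₀ (by linarith) (by linarith)]
    nlinarith
  · intro μ _ ℓ hℓ hμZ hμ A B hA hB hm
    obtain ⟨z, hz⟩ := exists_norm_eq_space (show 0 ≤ K * ℓ by positivity)
    obtain ⟨s1, s2, s3⟩ := superpose he hμ hA hB (z := z) (by rw [hz]; nlinarith)
    refine ⟨_, fun k => (s1 k).mem, s2, s3.trans ?_⟩
    have hb := nrm1_nonneg (density B)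
    have h1 : nrm1 (density A) * nrm1 (density B) / (‖z‖ - 2 * ℓ) ≤
        2 * n / (K - 2) * nrm1 (density B) / ℓ := by
      calc _ ≤ 2 * n * nrm1 (density B) / (‖z‖ - 2 * ℓ) := by
            have : 0 < ‖z‖ - 2 * ℓ := by rw [hz]; nlinarith
            gcongr
        _ = _ := by
            rw [hz, ← sub_mul]
            have : K - 2 ≠ 0 := by linarith
            field_simp
    have h2 : μ.real univ * (nrm1 (density B) / (‖z‖ + 2 * ℓ)) =
        Z / (K + 2) * nrm1 (density B) / ℓ := by
      rw [hz, hμZ, ← add_mul]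
      have : K + 2 ≠ 0 := by linarith
      field_simp
    rw [h2]
    have h3 : (Z / (K + 2) - 2 * n / (K - 2)) * nrm1 (density B) / ℓ =
      Z / (K + 2) * nrm1 (density B) / ℓ - 2 * n / (K - 2) * nrm1 (density B) / ℓ := by ring
    linarith

/-! ### Spread-out bumps -/

/-- A smooth bump function at the origin. -/
def bump : ContDiffBump (0 : Space) := ⟨1 / 2, 1, by norm_num, by norm_num⟩

/-- The bump spread out to the length scale `σ`. -/
def spreadFun (σ : ℝ) (x : Space) : ℂ := (bump (σ⁻¹ • x) : ℂ)

lemma spreadFun_contDiff (σ : ℝ) : ContDiff ℝ ∞ (spreadFun σ) :=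
  Complex.ofRealCLM.contDiff.comp (bump.contDiff.comp (contDiff_const_smul σ⁻¹))

lemma spreadFun_eq_zero {σ : ℝ} (hσ : 0 < σ) {x : Space} (hx : σ ≤ ‖x‖) : spreadFun σ x = 0 := by
  have : bump (σ⁻¹ • x) = 0 := by
    apply bump.zero_of_le_dist
    rw [dist_zero_right, norm_smul, Real.norm_of_nonneg (inv_nonneg.2 hσ.le)]
    change (1 : ℝ) ≤ _
    rw [inv_mul_eq_div, le_div_iff₀ hσ]; linarith
  rw [spreadFun, this, Complex.ofReal_zero]

lemma spreadFun_hasCompactSupport {σ : ℝ} (hσ : 0 < σ) : HasCompactSupport (spreadFun σ) :=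
  HasCompactSupport.intro (isCompact_closedBall 0 σ) fun x hx =>
    spreadFun_eq_zero hσ (by rw [mem_closedBall_zero_iff, not_le] at hx; exact hx.le)

/-- The spread-out bump in `L²`. -/
def spread {σ : ℝ} (hσ : 0 < σ) : L2 :=
  ofSchwartz ((spreadFun_hasCompactSupport hσ).toSchwartzMap (spreadFun_contDiff σ))

lemma norm_ofSchwartz_sq (ψ : 𝓢(Space, ℂ)) : ‖ofSchwartz ψ‖ ^ 2 = ∫ x, ‖ψ x‖ ^ 2 := by
  rw [norm_sq_eq_integral]
  exact integral_congr_ae ((ofSchwartz_ae ψ).mono fun x hx => by simp only [hx])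

lemma spreadFun_scale (σ : ℝ) (x : Space) : spreadFun σ x = spreadFun 1 (σ⁻¹ • x) := by
  simp [spreadFun]

lemma integral_scale {σ : ℝ} (hσ : 0 < σ) (f : Space → ℝ) :
    ∫ x, f (σ⁻¹ • x) = σ ^ 3 * ∫ x, f x := by
  rw [Measure.integral_comp_inv_smul_of_nonneg _ _ hσ.le, smul_eq_mul]
  simp

lemma norm_spread_sq {σ : ℝ} (hσ : 0 < σ) : ‖spread hσ‖ ^ 2 = σ ^ 3 * ‖spread one_pos‖ ^ 2 := by
  rw [spread, spread, norm_ofSchwartz_sq, norm_ofSchwartz_sq, ← integral_scale hσ]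
  simp only [HasCompactSupport.toSchwartzMap_toFun, ← spreadFun_scale]

lemma gradNormSq_spread {σ : ℝ} (hσ : 0 < σ) :
    gradNormSq (spread hσ) = σ * gradNormSq (spread one_pos) := by
  simp only [gradNormSq, Finset.mul_sum]
  refine Finset.sum_congr rfl fun i _ => ?_
  rw [spread, spread, weakPartial_ofSchwartz, weakPartial_ofSchwartz, norm_ofSchwartz_sq,
    norm_ofSchwartz_sq]
  have h : ∀ x, ‖fderiv ℝ (spreadFun σ) x (basisVec i)‖ ^ 2 =
      (σ⁻¹) ^ 2 * ‖fderiv ℝ (spreadFun 1) (σ⁻¹ • x) (basisVec i)‖ ^ 2 := by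
    intro x
    have h1 : spreadFun σ = fun x => spreadFun 1 (σ⁻¹ • x) := funext (spreadFun_scale σ)
    rw [h1, fderiv_comp_smul, smul_apply, norm_smul, mul_pow, Real.norm_eq_abs,
      sq_abs]
  simp only [SchwartzMap.lineDerivOp_apply_eq_fderiv]
  change ∫ x, ‖fderiv ℝ (spreadFun σ) x (basisVec i)‖ ^ 2 =
    σ * ∫ x, ‖fderiv ℝ (spreadFun 1) x (basisVec i)‖ ^ 2
  simp only [h, integral_const_mul]
  rw [integral_scale hσ fun x => ‖fderiv ℝ (spreadFun 1) x (basisVec i)‖ ^ 2]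
  field_simp

lemma spread_ne_zero : spread one_pos ≠ 0 := by
  intro h
  have h1 : ⇑((spreadFun_hasCompactSupport one_pos).toSchwartzMap (spreadFun_contDiff 1)) =ᵐ[volume]
      fun _ => (0 : ℂ) := by
    have h2 : spread one_pos =ᵐ[volume] (0 : Space → ℂ) := by rw [h]; exact Lp.coeFn_zero ..
    exact (ofSchwartz_ae _).symm.trans h2
  have h3 := Continuous.ae_eq_iff_eq (volume : Measure Space)
    (spreadFun_contDiff 1).continuous continuous_const |>.1 h1
  have h4 := congrFun h3 0
  have h5 : bump (0 : Space) = 1 :=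
    bump.one_of_mem_closedBall (Metric.mem_closedBall_self bump.rIn_pos.le)
  simp [spreadFun, h5] at h4

lemma suppIn_spread {σ : ℝ} (hσ : 0 < σ) : SuppIn (Metric.closedBall 0 σ) (spread hσ) := by
  have hout : ∀ x ∉ Metric.closedBall (0 : Space) σ, σ < ‖x‖ := fun x hx => by
    rwa [mem_closedBall_zero_iff, not_le] at hx
  refine ⟨H1_ofSchwartz _, ?_, fun i => ?_⟩
  · filter_upwards [ofSchwartz_ae ((spreadFun_hasCompactSupport hσ).toSchwartzMap
      (spreadFun_contDiff σ))] with x h1 hx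
    rw [spread, h1]
    exact spreadFun_eq_zero hσ (hout x hx).le
  · rw [spread, weakPartial_ofSchwartz]
    filter_upwards [ofSchwartz_ae (∂_{basisVec i}
      ((spreadFun_hasCompactSupport hσ).toSchwartzMap (spreadFun_contDiff σ)))] with x h1 hx
    rw [h1, SchwartzMap.lineDerivOp_apply_eq_fderiv]
    have h2 : spreadFun σ =ᶠ[𝓝 x] fun _ => 0 := by
      filter_upwards [(isOpen_lt continuous_const continuous_norm).mem_nhds (hout x hx)] with y hy
      exact spreadFun_eq_zero hσ (le_of_lt hy)
    have h3 : fderiv ℝ (spreadFun σ) x = 0 := by rw [h2.fderiv_eq]; simp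
    change fderiv ℝ (spreadFun σ) x (basisVec i) = 0
    rw [h3]; rfl

/-- Splitting the kernel at the length scale σ of the function balances the two terms: both are of
order 1/σ. -/
lemma vHartree_norm_sq_le {χ : L2} (hχ : χ ∈ H1) (h1 : ‖χ‖ = 1) {G σ : ℝ} (hσ : 0 < σ)
    (hG : 0 ≤ G) (hg : gr χ ≤ G / σ) (x : Space) :
    vHartree (fun x => ‖χ x‖ ^ 2) x ≤ (1 + coulConst * √(gnConst * G ^ 3)) / σ := by
  have hc := coulConst_nonneg
  have hgn := gnConst_nonneg
  have h2 := (le_abs_self _).trans (abs_vHartree_le (isL12_norm_sq hχ) hσ x)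
  have h3 : nrm1 (fun x => ‖χ x‖ ^ 2) = 1 := by
    rw [nrm1_of_nonneg fun x => sq_nonneg _, ← norm_sq_eq_integral, h1, one_pow]
  have h4 : nrm2 (fun x => ‖χ x‖ ^ 2) ≤ √(gnConst * (G / σ) ^ 3) := by
    refine (nrm2_norm_sq_le hχ).trans (Real.sqrt_le_sqrt ?_)
    rw [h1, one_mul]
    have := gr_nonneg χ
    gcongr
  have h5 : √σ * √(gnConst * (G / σ) ^ 3) = √(gnConst * G ^ 3) / σ := by
    rw [← Real.sqrt_mul hσ.le]
    have : σ * (gnConst * (G / σ) ^ 3) = gnConst * G ^ 3 / σ ^ 2 := by field_simp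
    rw [this, Real.sqrt_div (by positivity), Real.sqrt_sq hσ.le]
  rw [h3, mul_one] at h2
  calc _ ≤ _ := h2
    _ ≤ 1 / σ + coulConst * √σ * √(gnConst * (G / σ) ^ 3) := by gcongr
    _ = _ := by rw [mul_assoc, h5]; ring

/-- Normalized bumps with kinetic energy of order `σ⁻²` and Coulomb potential of order `σ⁻¹`. -/
lemma exists_lump : ∃ K : ℝ, 0 < K ∧ ∀ σ : ℝ, 0 < σ → ∃ f : L2,
    SuppIn (Metric.closedBall 0 σ) f ∧ ‖f‖ = 1 ∧ gradNormSq f ≤ K / σ ^ 2 ∧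
    ∀ x, vHartree (fun x => ‖f x‖ ^ 2) x ≤ K / σ := by
  set s := spread one_pos
  have hs : 0 < ‖s‖ := norm_pos_iff.2 spread_ne_zero
  set G := gradNormSq s / ‖s‖ ^ 2 with hG
  have hG0 : 0 ≤ G := div_nonneg (gradNormSq_nonneg _) (by positivity)
  have hc := coulConst_nonneg
  have hgn := gnConst_nonneg
  refine ⟨G + 1 + coulConst * √(gnConst * √G ^ 3), by positivity, fun σ hσ => ?_⟩
  have hne : 0 < ‖spread hσ‖ := by
    have h1 := norm_spread_sq hσ
    have h2 : 0 < ‖spread hσ‖ ^ 2 := by rw [h1]; positivity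
    exact norm_pos_iff.2 fun h => by rw [h] at h2; simp at h2
  set f : L2 := ((‖spread hσ‖⁻¹ : ℝ) : ℂ) • spread hσ with hf
  have hfS := (suppIn_spread hσ).smul ((‖spread hσ‖⁻¹ : ℝ) : ℂ)
  have hnc : ‖((‖spread hσ‖⁻¹ : ℝ) : ℂ)‖ = ‖spread hσ‖⁻¹ := by
    rw [Complex.norm_real, Real.norm_of_nonneg (inv_nonneg.2 hne.le)]
  have hn : ‖f‖ = 1 := by rw [hf, norm_smul, hnc, inv_mul_cancel₀ hne.ne']
  have hgrad : gradNormSq f = G / σ ^ 2 := by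
    have e1 : ‖spread hσ‖ ^ 2 = σ ^ 3 * ‖s‖ ^ 2 := norm_spread_sq hσ
    have e2 : gradNormSq (spread hσ) = σ * gradNormSq s := gradNormSq_spread hσ
    rw [hf, gradNormSq_smul _ (suppIn_spread hσ).mem, hnc, inv_pow, e1, e2, hG]
    field_simp
  refine ⟨f, hfS, hn, ?_, fun x => ?_⟩
  · rw [hgrad]
    gcongr
    have : 0 ≤ coulConst * √(gnConst * √G ^ 3) := by positivity
    linarith
  · have hgr : gr f = √G / σ := by rw [gr, hgrad, Real.sqrt_div hG0, Real.sqrt_sq hσ.le]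
    refine (vHartree_norm_sq_le hfS.mem hn hσ (Real.sqrt_nonneg _) hgr.le x).trans ?_
    gcongr
    linarith

/-! ### Rank-one orbitals -/

/-- The orbitals `(w₁ f, …, wₙ f)`. -/
def rankOne {n : ℕ} (w : Fin n → ℂ) (f : L2) : Fin n → L2 := fun k => w k • f

lemma norm_comb_rankOne_sq {n : ℕ} (w : Fin n → ℂ) {f : L2} (hf : ‖f‖ = 1) (c : Fin n → ℂ) :
    ‖comb (rankOne w f) c‖ ^ 2 = ‖∑ k, c k * w k‖ ^ 2 := by
  simp only [comb, rankOne, smul_smul, ← Finset.sum_smul, norm_smul, hf, mul_one]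

lemma density_rankOne {n : ℕ} (w : Fin n → ℂ) (f : L2) :
    density (rankOne w f) =ᵐ[volume] fun x => 2 * csq w * ‖f x‖ ^ 2 := by
  filter_upwards [ae_all_iff.2 fun k => Lp.coeFn_smul (w k) f] with x hx
  simp only [density, rankOne, hx, Pi.smul_apply, norm_smul, mul_pow, ← Finset.sum_mul, csq]
  ring

lemma nrm1_rankOne {n : ℕ} (w : Fin n → ℂ) {f : L2} (hf : ‖f‖ = 1) :
    nrm1 (density (rankOne w f)) = 2 * csq w := by
  rw [nrm1_density]
  simp [rankOne, norm_smul, hf, csq]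

lemma ksEnergy_rankOne_le (he : IsExchangeCorrelation e) {n : ℕ} (w : Fin n → ℂ) {f : L2}
    (hfm : f ∈ H1) (hf : ‖f‖ = 1) {K σ : ℝ} (h1 : gradNormSq f ≤ K / σ ^ 2)
    (h2 : ∀ x, vHartree (fun x => ‖f x‖ ^ 2) x ≤ K / σ) :
    ksEnergy e 0 (rankOne w f) ≤ csq w * (K / σ ^ 2) + 2 * csq w ^ 2 * (K / σ) := by
  have hc := csq_nonneg w
  have hd : IsDensity fun x => 2 * csq w * ‖f x‖ ^ 2 :=
    (isDensity_norm_sq hfm).const_mul (by positivity)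
  rw [ksEnergy_eq e 0 (Φ := rankOne w f) fun k => H1_smul _ hfm, potEnergy_congr e 0 (density_rankOne w f), potEnergy]
  have h3 : kin (rankOne w f) ≤ csq w * (K / σ ^ 2) := by
    simp only [kin, rankOne, gradNormSq_smul _ hfm, ← Finset.sum_mul]
    exact mul_le_mul_of_nonneg_left h1 hc
  have h4 : ∫ x, e (2 * csq w * ‖f x‖ ^ 2) ≤ 0 :=
    integral_nonpos fun x => he.nonpos (hd.nonneg x)
  have h5 : coul (fun x => 2 * csq w * ‖f x‖ ^ 2) (fun x => 2 * csq w * ‖f x‖ ^ 2) ≤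
      4 * csq w ^ 2 * (K / σ) := by
    have h6 : ∀ x, vHartree (fun x => 2 * csq w * ‖f x‖ ^ 2) x ≤ 2 * csq w * (K / σ) := fun x => by
      rw [vHartree_const_mul]
      exact mul_le_mul_of_nonneg_left (h2 x) (by positivity)
    calc _ ≤ ∫ x, 2 * csq w * ‖f x‖ ^ 2 * (2 * csq w * (K / σ)) :=
          integral_mono (integrable_mul_vHartree hd.l12.int hd.l12) (hd.l12.int.mul_const _)
            fun x => mul_le_mul_of_nonneg_left (h6 x) (hd.nonneg x)
      _ = _ := by
          rw [integral_mul_const, integral_const_mul, ← norm_sq_eq_integral, hf]; ring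
  simp only [integral_zero_measure]
  linarith

/-! ### Completing orbitals to orthonormal ones -/

lemma norm_comb_sq_eq {n : ℕ} (A : Fin n → L2) (c : Fin n → ℂ) :
    ((‖comb A c‖ ^ 2 : ℝ) : ℂ) = ∑ i, ∑ j, conj (c i) * c j * inner ℂ (A i) (A j) := by
  have h := inner_self_eq_norm_sq_to_K (𝕜 := ℂ) (comb A c)
  rw [Complex.ofReal_pow]
  refine h.symm.trans ?_
  rw [comb, sum_inner]
  refine Finset.sum_congr rfl fun i _ => ?_
  rw [inner_sum]
  refine Finset.sum_congr rfl fun j _ => ?_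
  rw [inner_smul_left, inner_smul_right]; ring

open scoped MatrixOrder ComplexOrder in
/-- The defect of the Gram matrix is a sum of rank-one forms. -/
lemma exists_defect {n : ℕ} {A : Fin n → L2} (hA : ∀ c, ‖comb A c‖ ^ 2 ≤ csq c) :
    ∃ w : Fin n → Fin n → ℂ, ∀ c, csq c = ‖comb A c‖ ^ 2 + ∑ l, ‖∑ k, c k * w l k‖ ^ 2 := by
  set G : Matrix (Fin n) (Fin n) ℂ := Matrix.of fun i j => inner ℂ (A i) (A j) with hG
  have hform : ∀ c, star c ⬝ᵥ ((1 - G).mulVec c) = ((csq c - ‖comb A c‖ ^ 2 : ℝ) : ℂ) := by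
    intro c
    rw [Matrix.sub_mulVec, Matrix.one_mulVec, dotProduct_sub, Complex.ofReal_sub,
      norm_comb_sq_eq]
    congr 1
    · simp only [dotProduct, Pi.star_apply, csq, Complex.ofReal_sum]
      refine Finset.sum_congr rfl fun k _ => ?_
      rw [Complex.star_def, Complex.conj_mul']; push_cast; rfl
    · simp only [dotProduct, Matrix.mulVec, Finset.mul_sum, hG, Matrix.of_apply, Pi.star_apply]
      refine Finset.sum_congr rfl fun i _ => Finset.sum_congr rfl fun j _ => ?_
      rw [Complex.star_def]; ring
  have hherm : (1 - G).IsHermitian := by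
    refine Matrix.isHermitian_one.sub (Matrix.IsHermitian.ext fun i j => ?_)
    simp only [hG, Matrix.of_apply, Complex.star_def]
    exact inner_conj_symm _ _
  have hpsd : (1 - G).PosSemidef := by
    refine Matrix.posSemidef_iff_dotProduct_mulVec.2 ⟨hherm, fun c => ?_⟩
    rw [hform]
    exact_mod_cast sub_nonneg.2 (hA c)
  -- Factoring 1 - G = B*B expresses the defect as |Bc|², and each row of B is one rank-one form.
  obtain ⟨B, hB⟩ := CStarAlgebra.nonneg_iff_eq_star_mul_self.1 hpsd.nonneg
  refine ⟨fun l k => B l k, fun c => ?_⟩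
  have h1 := hform c
  rw [hB, Matrix.star_eq_conjTranspose, ← Matrix.mulVec_mulVec, Matrix.dotProduct_mulVec,
    ← Matrix.star_mulVec] at h1
  have h2 : star (B.mulVec c) ⬝ᵥ B.mulVec c = ((∑ l, ‖∑ k, c k * B l k‖ ^ 2 : ℝ) : ℂ) := by
    simp only [dotProduct, Pi.star_apply, Complex.ofReal_sum]
    refine Finset.sum_congr rfl fun l _ => ?_
    rw [Complex.star_def, Complex.conj_mul', Matrix.mulVec, dotProduct]
    simp only [mul_comm (B l _)]
    push_cast; rfl
  rw [h2] at h1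
  have h3 : ∑ l, ‖∑ k, c k * B l k‖ ^ 2 = csq c - ‖comb A c‖ ^ 2 := by exact_mod_cast h1
  linarith

lemma comb_single {n : ℕ} (A : Fin n → L2) (i : Fin n) : comb A (Pi.single i 1) = A i := by
  classical
  simp only [comb]
  rw [Finset.sum_eq_single i]
  · simp
  · intro j _ hj; simp [hj]
  · simp

/-- The condition says that c ↦ `comb A c` is an isometry of Euclidean space, and isometries map the
standard basis to an orthonormal system. -/
lemma orthonormal_of_comb {n : ℕ} {A : Fin n → L2} (h : ∀ c, ‖comb A c‖ ^ 2 = csq c) :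
    Orthonormal ℂ A := by
  let T : EuclideanSpace ℂ (Fin n) →ₗ[ℂ] L2 :=
    { toFun := fun c => comb A c
      map_add' := fun c d => by simp [comb, add_smul, Finset.sum_add_distrib]
      map_smul' := fun r c => by simp [comb, smul_smul, Finset.smul_sum] }
  have hT : ∀ c, ‖T c‖ = ‖c‖ := by
    intro c
    have h1 : ‖T c‖ ^ 2 = ‖c‖ ^ 2 := by
      rw [EuclideanSpace.norm_sq_eq]; exact h c
    exact (pow_left_inj₀ (norm_nonneg _) (norm_nonneg _) two_ne_zero).1 h1
  have h2 := (EuclideanSpace.basisFun (Fin n) ℂ).orthonormal.comp_linearIsometry ⟨T, hT⟩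
  convert h2 using 1
  ext1 i
  simp only [Function.comp_apply, EuclideanSpace.basisFun_apply]
  exact (comb_single A i).symm

/-! ### Relaxation of the orthonormality constraint -/

/-- Spreading to scale σ makes the kinetic energy O(σ⁻²) and the Coulomb energy O(σ⁻¹), while the
exchange-correlation energy is nonpositive. -/
lemma exists_cheap_rankOne (he : IsExchangeCorrelation e) {n : ℕ} (w : Fin n → ℂ) {δ : ℝ}
    (hδ : 0 < δ) : ∃ f : L2, CompSupp (rankOne w f) ∧ ‖f‖ = 1 ∧ ksEnergy e 0 (rankOne w f) ≤ δ := by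
  obtain ⟨K, hK, h⟩ := exists_lump
  set X := (csq w + 2 * csq w ^ 2) * K with hX
  have hc := csq_nonneg w
  have hX0 : 0 ≤ X := by positivity
  set σ := 1 + X / δ with hσ
  have h1 : 1 ≤ σ := le_add_of_nonneg_right (by positivity)
  have hσ0 : 0 < σ := by linarith
  obtain ⟨f, f1, f2, f3, f4⟩ := h σ hσ0
  refine ⟨f, ⟨σ, fun k => f1.smul (w k)⟩, f2, ?_⟩
  refine (ksEnergy_rankOne_le he w f1.mem f2 f3 f4).trans ?_
  have h2 : K / σ ^ 2 ≤ K / σ := by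
    gcongr
    nlinarith
  have h3 : csq w * (K / σ ^ 2) + 2 * csq w ^ 2 * (K / σ) ≤ X / σ := by
    calc _ ≤ csq w * (K / σ) + 2 * csq w ^ 2 * (K / σ) := by gcongr
      _ = _ := by rw [hX]; ring
  refine h3.trans ?_
  rw [div_le_iff₀ hσ0, hσ, mul_add, mul_div_cancel₀ _ hδ.ne']
  linarith

/-- `I` bounds the energy of all orthonormal orbitals from below. -/
def IsLowerBound (e : ℝ → ℝ) (μ : Measure Space) (n : ℕ) (I : ℝ) : Prop :=
  ∀ Φ ∈ ksAdmissible n, I ≤ ksEnergy e μ Φ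

/-- Relaxation does not lower the infimum: the rank-one pieces of the Gram defect are filled in one
at a time by cheap lumps placed far away, until the orbitals are orthonormal. The total cost is
arbitrarily small. -/
lemma IsLowerBound.le_of_relaxed (he : IsExchangeCorrelation e) {n : ℕ} {μ : Measure Space}
    [IsFiniteMeasure μ] {L I : ℝ} (hμ : InBall L μ) (hI : IsLowerBound e μ n I) {A : Fin n → L2}
    (hA : ∀ k, A k ∈ H1) (hQ : ∀ c, ‖comb A c‖ ^ 2 ≤ csq c) : I ≤ ksEnergy e μ A := by
  refine le_of_forall_pos_le_add fun ε hε => ?_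
  obtain ⟨A', a1, a2, a3⟩ := exists_compSupp_approx he μ hA (half_pos hε)
  obtain ⟨w, hw⟩ := exists_defect fun c => (a2 c).trans (hQ c)
  set δ := ε / (2 * (n + 1)) with hδ
  have hδ0 : 0 < δ := by positivity
  have key : ∀ s : Finset (Fin n), ∃ C : Fin n → L2, CompSupp C ∧
      (∀ c, ‖comb C c‖ ^ 2 = ‖comb A' c‖ ^ 2 + ∑ l ∈ s, ‖∑ k, c k * w l k‖ ^ 2) ∧
      ksEnergy e μ C ≤ ksEnergy e μ A' + s.card * δ := by
    classical
    intro s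
    induction s using Finset.induction_on with
    | empty => exact ⟨A', a1, by simp, by simp⟩
    | insert a s ha ih =>
      obtain ⟨C, c1, c2, c3⟩ := ih
      obtain ⟨f, f1, f2, f3⟩ := exists_cheap_rankOne he (w a) (half_pos hδ0)
      obtain ⟨D, d1, d2, d3⟩ := c1.exists_far he hμ f1 (half_pos hδ0)
      refine ⟨D, d1, fun c => ?_, ?_⟩
      · rw [d2, c2, norm_comb_rankOne_sq _ f2, Finset.sum_insert ha]; ring
      · rw [Finset.card_insert_of_notMem ha]; push_cast; linarith
  obtain ⟨C, c1, c2, c3⟩ := key Finset.univ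
  have h1 := hI C ⟨c1.mem, orthonormal_of_comb fun c => (c2 c).trans (hw c).symm⟩
  have h2 : n * δ ≤ ε / 2 := by
    rw [hδ, mul_div_assoc', div_le_iff₀ (by positivity)]
    nlinarith
  simp only [Finset.card_univ, Fintype.card_fin] at c3
  linarith

lemma csq_single {n : ℕ} (k : Fin n) : csq (Pi.single k 1 : Fin n → ℂ) = 1 := by
  classical
  rw [csq, Finset.sum_eq_single k]
  · simp
  · intro j _ hj; simp [hj]
  · simp

lemma norm_sq_le_of_comb {n : ℕ} {A : Fin n → L2} {b : ℝ} (h : ∀ c, ‖comb A c‖ ^ 2 ≤ b * csq c)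
    (k : Fin n) : ‖A k‖ ^ 2 ≤ b := by
  have := h (Pi.single k 1)
  rwa [comb_single, csq_single, mul_one] at this

lemma density_smul {n : ℕ} (s : ℝ) (A : Fin n → L2) :
    density (fun k => (s : ℂ) • A k) =ᵐ[volume] fun x => s ^ 2 * density A x := by
  filter_upwards [ae_all_iff.2 fun k => Lp.coeFn_smul (s : ℂ) (A k)] with x hx
  simp only [density, hx, Pi.smul_apply, norm_smul, mul_pow, ← Finset.mul_sum, Complex.norm_real,
    Real.norm_eq_abs, sq_abs]
  ring

/-- Scaling by (1 + ε)^(-1/2) restores the relaxed constraint. The kinetic energy does not increase,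
and the potential energy changes by O(ε) by its local Lipschitz bound. -/
lemma exists_le_of_almost_relaxed (he : IsExchangeCorrelation e) (n : ℕ) (M : ℝ) :
    ∃ C, 0 ≤ C ∧ ∀ (μ : Measure Space) [IsFiniteMeasure μ] (L I : ℝ), μ.real univ ≤ M →
      InBall L μ → IsLowerBound e μ n I → ∀ ε, 0 ≤ ε → ε ≤ 1 → ∀ A : Fin n → L2,
      (∀ k, A k ∈ H1) → (∀ c, ‖comb A c‖ ^ 2 ≤ (1 + ε) * csq c) → ksEnergy e μ A ≤ M →
      I ≤ ksEnergy e μ A + C * ε := by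
  set M₁ := max M 2 with hM₁
  obtain ⟨C₁, hC₁⟩ := exists_kin_le he n M₁
  set M₂ := max 2 √C₁ with hM₂
  set B := 2 * (n * (M₂ ^ 2 + √(gnConst * (M₂ * M₂ ^ 3)))) with hB
  have hB0 : 0 ≤ B := by positivity
  obtain ⟨C, hC0, hC⟩ := exists_potEnergy_sub_le he (max M B)
  refine ⟨C * B, by positivity, fun μ _ L I hm hμ hI ε hε0 hε1 A hA hQ hE => ?_⟩
  have hA2 : ∀ k, ‖A k‖ ≤ 2 := fun k => by
    have h1 := norm_sq_le_of_comb hQ k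
    nlinarith [norm_nonneg (A k)]
  have hkin : kin A ≤ C₁ := hC₁ μ A (hm.trans (le_max_left _ _)) hA
    (fun k => (hA2 k).trans (le_max_right _ _)) (hE.trans (le_max_left _ _))
  have hgr : ∀ k, gr (A k) ≤ M₂ := fun k =>
    (gr_le_sqrt_kin A k).trans ((Real.sqrt_le_sqrt hkin).trans (le_max_right _ _))
  have hnrm : nrm (density A) ≤ B := nrm_density_le hA (fun k => (hA2 k).trans (le_max_left _ _)) hgr
  set s := √(1 / (1 + ε)) with hs
  have hs2 : s ^ 2 = 1 / (1 + ε) := Real.sq_sqrt (by positivity)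
  have hs1 : s ^ 2 ≤ 1 := by rw [hs2, div_le_one (by positivity)]; linarith
  have hs3 : 1 - s ^ 2 ≤ ε := by
    rw [hs2, sub_le_iff_le_add, ← sub_le_iff_le_add', le_div_iff₀ (by positivity)]
    nlinarith
  have hA' : ∀ k, (s : ℂ) • A k ∈ H1 := fun k => H1_smul _ (hA k)
  have h1 : I ≤ ksEnergy e μ fun k => (s : ℂ) • A k := by
    refine hI.le_of_relaxed he hμ hA' fun c => ?_
    have h2 : comb (fun k => (s : ℂ) • A k) c = (s : ℂ) • comb A c := by
      simp only [comb, Finset.smul_sum, smul_comm (s : ℂ)]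
    rw [h2, norm_smul, mul_pow, Complex.norm_real, Real.norm_eq_abs, sq_abs, hs2]
    have h3 := hQ c
    rw [one_div, inv_mul_le_iff₀ (by positivity)]
    exact h3
  have hd := isDensity_density hA
  have hds := hd.const_mul (sq_nonneg s)
  rw [ksEnergy_eq e μ hA', potEnergy_congr e μ (density_smul s A)] at h1
  rw [ksEnergy_eq e μ hA]
  have hnn := nrm_nonneg (density A)
  have h2 := hC μ _ _ (hm.trans (le_max_left _ _)) hds hd
    (by
      rw [nrm_const_mul, abs_of_nonneg (sq_nonneg s)]
      exact (mul_le_of_le_one_left hnn hs1).trans (hnrm.trans (le_max_right _ _)))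
    (hnrm.trans (le_max_right _ _))
  have h3 : (fun x => s ^ 2 * density A x - density A x) = fun x => (s ^ 2 - 1) * density A x := by
    ext x; ring
  rw [h3, nrm_const_mul, abs_sub_comm (s ^ 2) 1, abs_of_nonneg (sub_nonneg.2 hs1)] at h2
  have h4 : C * ((1 - s ^ 2) * nrm (density A)) ≤ C * (ε * B) := by gcongr
  have h5 : kin (fun k => (s : ℂ) • A k) ≤ kin A := by
    simp only [kin, gradNormSq_smul _ (hA _), ← Finset.mul_sum, Complex.norm_real,
      Real.norm_eq_abs, sq_abs]
    exact mul_le_of_le_one_left (kin_nonneg A) hs1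
  have h6 := (abs_le.1 h2).2
  linarith

lemma nrm1_density_le_of_comb {n : ℕ} {A : Fin n → L2} (hQ : ∀ c, ‖comb A c‖ ^ 2 ≤ csq c) :
    nrm1 (density A) ≤ 2 * n := by
  rw [nrm1_density]
  have h1 : ∑ k, ‖A k‖ ^ 2 ≤ ∑ _k : Fin n, (1 : ℝ) :=
    Finset.sum_le_sum fun k _ => norm_sq_le_of_comb (b := 1) (by simpa using hQ) k
  simp at h1
  linarith

lemma comb_cut_le {n : ℕ} (A : Fin n → L2) (R : ℝ) (c : Fin n → ℂ) :
    ‖comb (fun k => mulL2 (cosCut R) (A k)) c‖ ^ 2 +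
      ‖comb (fun k => mulL2 (sinCut R) (A k)) c‖ ^ 2 = ‖comb A c‖ ^ 2 := by
  rw [comb_mulL2 (isMultiplier_cosCut R).isBddMeas, comb_mulL2 (isMultiplier_sinCut R).isBddMeas,
    norm_sq_cut_add]

/-- Orbitals which are not orthonormal do not attain the minimal energy: the missing charge is
bound by the nuclei. -/
lemma IsLowerBound.lt_of_relaxed (he : IsExchangeCorrelation e) {n : ℕ} {Z : ℝ}
    (hZ : 2 * (n : ℝ) < Z) {μ : Measure Space} [IsFiniteMeasure μ] {L I : ℝ} (hμ : InBall L μ)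
    (hμZ : μ.real univ = Z) (hI : IsLowerBound e μ n I) {A : Fin n → L2} (hA : ∀ k, A k ∈ H1)
    (hQ : ∀ c, ‖comb A c‖ ^ 2 ≤ csq c) {c₀ : Fin n → ℂ} (hc₀ : ‖comb A c₀‖ ^ 2 ≠ csq c₀) :
    I < ksEnergy e μ A := by
  obtain ⟨w, hw⟩ := exists_defect hQ
  obtain ⟨l, hl⟩ : ∃ l, csq (w l) ≠ 0 := by
    by_contra! hcon
    refine hc₀ ?_
    rw [hw c₀]
    have : ∀ l k, w l k = 0 := fun l k => by
      have h1 := (Finset.sum_eq_zero_iff_of_nonneg fun k _ => sq_nonneg ‖w l k‖).1 (hcon l) k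
        (Finset.mem_univ k)
      simpa using h1
    simp [this]
  obtain ⟨κ, hκ, hgain⟩ := exists_gain he hZ
  obtain ⟨K, hK, hlump⟩ := exists_lump
  set s := csq (w l) with hs
  have hs0 : 0 < s := lt_of_le_of_ne (csq_nonneg _) (Ne.symm hl)
  -- Only a fraction t² of the missing mass is added: the self-repulsion is quadratic in the added
  -- mass and the gain linear, so for small t the repulsion takes at most a quarter of κ t² s / R.
  set t := √(min 1 (κ / (8 * K * s))) with ht
  have ht2 : t ^ 2 = min 1 (κ / (8 * K * s)) := Real.sq_sqrt (by positivity)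
  have ht0 : 0 < t ^ 2 := by rw [ht2]; positivity
  have ht1 : t ^ 2 ≤ 1 := by rw [ht2]; exact min_le_left _ _
  have ht3 : 2 * (t ^ 2 * s) * K ≤ κ / 4 := by
    have : t ^ 2 ≤ κ / (8 * K * s) := by rw [ht2]; exact min_le_right _ _
    rw [le_div_iff₀ (by positivity)] at this
    linarith
  set v : Fin n → ℂ := fun k => (t : ℂ) * w l k with hv
  have hvs : csq v = t ^ 2 * s := by
    simp only [csq, hv, norm_mul, mul_pow, Complex.norm_real, Real.norm_eq_abs, sq_abs,
      ← Finset.mul_sum, hs]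
  obtain ⟨R₁, hR₁⟩ := exists_nat_ge (max (L) (4 * K / κ))
  have hη : 0 < κ * (t ^ 2 * s) / 8 := by positivity
  -- One radius R is both the place where A is cut and the length scale of the lump. Cutting costs
  -- an eighth of κ t² s / R; the lump's own energy costs at most half of it.
  obtain ⟨R, hR, hR0, hgood, -⟩ := exists_good_radius he hμ hA (g := fun _ => 0)
    ⟨measurable_const, fun _ => le_rfl, ⟨by simp, by simp⟩⟩ hη R₁
  have hRp : (0 : ℝ) < R := Nat.cast_pos.2 hR0
  have hR1 : (1 : ℝ) ≤ R := by exact_mod_cast hR0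
  have hRR : (R₁ : ℝ) ≤ R := Nat.cast_le.2 hR
  obtain ⟨f, f1, f2, f3, f4⟩ := hlump R hRp
  have hL : L ≤ R := (le_max_left _ _).trans (hR₁.trans hRR)
  have hKR : K / R ≤ κ / 4 := by
    have : 4 * K / κ ≤ R := (le_max_right _ _).trans (hR₁.trans hRR)
    rw [div_le_iff₀ hκ] at this
    rw [div_le_iff₀ hRp]; linarith
  have hE0 : ksEnergy e 0 (rankOne v f) ≤ κ / 2 * (t ^ 2 * s) / R := by
    refine (ksEnergy_rankOne_le he v f1.mem f2 f3 f4).trans ?_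
    rw [hvs]
    have e1 : t ^ 2 * s * (K / (R : ℝ) ^ 2) ≤ t ^ 2 * s * (κ / 4 / R) := by
      rw [sq (R : ℝ), ← div_div]
      gcongr
    have e2 : 2 * (t ^ 2 * s) ^ 2 * (K / R) ≤ κ / 4 * (t ^ 2 * s) / R := by
      calc _ = 2 * (t ^ 2 * s) * K * (t ^ 2 * s) / R := by ring
        _ ≤ _ := by gcongr
    have e3 : t ^ 2 * s * (κ / 4 / R) + κ / 4 * (t ^ 2 * s) / R = κ / 2 * (t ^ 2 * s) / R := by ring
    linarith
  have hcutQ : ∀ c, ‖comb (fun k => mulL2 (cosCut R) (A k)) c‖ ^ 2 ≤ csq c := fun c => by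
    have := comb_cut_le A R c
    have := hQ c
    nlinarith [sq_nonneg ‖comb (fun k => mulL2 (sinCut R) (A k)) c‖]
  obtain ⟨W, W1, W2, W3⟩ := hgain μ (R + 1) (by positivity) hμZ (hμ.mono (by linarith))
    (fun k => mulL2 (cosCut R) (A k)) (rankOne v f) (fun k => SuppIn.cosCut (hA k) R)
    (fun k => (f1.smul (v k)).mono (Metric.closedBall_subset_closedBall (by linarith)))
    (nrm1_density_le_of_comb hcutQ)
  have hgain2 : κ * (t ^ 2 * s) / R ≤ κ * nrm1 (density (rankOne v f)) / (R + 1) := by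
    rw [nrm1_rankOne v f2, hvs, div_le_div_iff₀ hRp (by positivity)]
    have : 0 < κ * (t ^ 2 * s) := by positivity
    nlinarith
  -- The outer part of A is put back far away, which restores its share of the Gram form; another
  -- eighth of the gain pays for this.
  obtain ⟨D, D1, D2, D3⟩ := exists_far he hμ W1
    (fun k => H1_mul (hA k) (isMultiplier_sinCut R)) (ε := κ * (t ^ 2 * s) / 8 / R)
    (by positivity)
  have hDQ : ∀ c, ‖comb D c‖ ^ 2 ≤ csq c := by
    intro c
    have e1 := D2 c
    rw [W2, norm_comb_rankOne_sq v f2] at e1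
    have e2 := comb_cut_le A R c
    have e3 : ‖∑ k, c k * v k‖ ^ 2 = t ^ 2 * ‖∑ k, c k * w l k‖ ^ 2 := by
      have : ∑ k, c k * v k = (t : ℂ) * ∑ k, c k * w l k := by
        rw [Finset.mul_sum]; refine Finset.sum_congr rfl fun k _ => ?_; simp only [hv]; ring
      rw [this, norm_mul, mul_pow, Complex.norm_real, Real.norm_eq_abs, sq_abs]
    have e4 : ‖∑ k, c k * w l k‖ ^ 2 ≤ ∑ l, ‖∑ k, c k * w l k‖ ^ 2 :=
      Finset.single_le_sum (f := fun l => ‖∑ k, c k * w l k‖ ^ 2) (fun _ _ => sq_nonneg _)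
        (Finset.mem_univ l)
    have e5 := hw c
    have e6 : t ^ 2 * ‖∑ k, c k * w l k‖ ^ 2 ≤ ‖∑ k, c k * w l k‖ ^ 2 :=
      mul_le_of_le_one_left (sq_nonneg _) ht1
    linarith
  have h1 := hI.le_of_relaxed he hμ D1 hDQ
  have h2 : 0 < κ * (t ^ 2 * s) / R := by positivity
  have h3 : κ * (t ^ 2 * s) / 8 / (R : ℝ) = (κ * (t ^ 2 * s) / R) / 8 := by ring
  have h4 : κ / 2 * (t ^ 2 * s) / (R : ℝ) = (κ * (t ^ 2 * s) / R) / 2 := by ring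
  rw [h3] at hgood D3
  rw [h4] at hE0
  linarith

/-- Binding of free electrons by the nuclei strictly lowers the energy. -/
lemma exists_binding (he : IsExchangeCorrelation e) {n : ℕ} {Z : ℝ}
    (hZ : 2 * (n : ℝ) < Z) {μ : Measure Space} [IsFiniteMeasure μ] {L : ℝ} (hμ : InBall L μ)
    (hμZ : μ.real univ = Z) {A B : Fin n → L2} (hA : ∀ k, A k ∈ H1) (hB : ∀ k, B k ∈ H1)
    (hQ : ∀ c, ‖comb A c‖ ^ 2 ≤ csq c) (hB0 : 0 < nrm1 (density B)) :
    ∃ C : Fin n → L2, (∀ k, C k ∈ H1) ∧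
      (∀ c, ‖comb C c‖ ^ 2 ≤ ‖comb A c‖ ^ 2 + ‖comb B c‖ ^ 2) ∧
      ksEnergy e μ C < ksEnergy e μ A + ksEnergy e 0 B := by
  obtain ⟨κ, hκ, hgain⟩ := exists_gain he hZ
  obtain ⟨C₀, hC₀, hcut⟩ := exists_ksEnergy_cut he
  set b := nrm1 (density B) with hb
  have hdB := isDensity_density hB
  obtain ⟨R₁, hR₁⟩ := eventually_atTop.1
    ((tendsto_nrm1_sinCut hdB).eventually_le_const (half_pos hB0))
  obtain ⟨R₂, hR₂⟩ := exists_nat_ge L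
  set g := κ * b / 4 with hg
  have hg0 : 0 < g := by positivity
  -- Both clusters are cut at one radius. The gain is at least g/R, and the four losses, two from
  -- cutting and two from putting the outer parts far away, take at most g/(8R) each.
  obtain ⟨R, hR, hR0, hgood, hshell⟩ := exists_good_radius he hμ hA hdB
    (η := g / (8 * (C₀ + 1))) (by positivity) (max R₁ R₂)
  have hRp : (0 : ℝ) < R := Nat.cast_pos.2 hR0
  have hR1 : (1 : ℝ) ≤ R := by exact_mod_cast hR0
  have hL : L ≤ R := hR₂.trans (Nat.cast_le.2 (by omega))
  have hcutQ : ∀ c, ‖comb (fun k => mulL2 (cosCut R) (A k)) c‖ ^ 2 ≤ csq c := fun c => by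
    have := comb_cut_le A R c
    have := hQ c
    nlinarith [sq_nonneg ‖comb (fun k => mulL2 (sinCut R) (A k)) c‖]
  obtain ⟨W, W1, W2, W3⟩ := hgain μ (R + 1) (by positivity) hμZ (hμ.mono (by linarith))
    (fun k => mulL2 (cosCut R) (A k)) (fun k => mulL2 (cosCut R) (B k))
    (fun k => SuppIn.cosCut (hA k) R) (fun k => SuppIn.cosCut (hB k) R)
    (nrm1_density_le_of_comb hcutQ)
  have hmass : b / 2 ≤ nrm1 (density fun k => mulL2 (cosCut R) (B k)) := by
    have e1 := hR₁ R (by omega)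
    have hs := (isMultiplier_sinCut (R : ℝ)).isBddMeas
    rw [← nrm1_congr (density_mulL2 B hs), nrm1_density] at e1
    rw [nrm1_density]
    have e2 : b = 2 * ∑ k, ‖B k‖ ^ 2 := nrm1_density B
    have e3 : ∑ k, ‖B k‖ ^ 2 = ∑ k, ‖mulL2 (cosCut R) (B k)‖ ^ 2 +
        ∑ k, ‖mulL2 (sinCut R) (B k)‖ ^ 2 := by
      rw [← Finset.sum_add_distrib]
      exact Finset.sum_congr rfl fun k _ => (norm_sq_cut_add R (B k)).symm
    linarith
  have hgain2 : g / R ≤ κ * nrm1 (density fun k => mulL2 (cosCut R) (B k)) / (R + 1) := by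
    rw [hg, div_le_div_iff₀ hRp (by positivity)]
    have : κ * (b / 2) ≤ κ * nrm1 (density fun k => mulL2 (cosCut R) (B k)) := by gcongr
    have h0 : 0 < κ * b := by positivity
    nlinarith
  have hBcut := hcut n 0 R B hB
  rw [integral_zero_measure, add_zero] at hBcut
  have hη1 : g / (8 * (C₀ + 1)) / R ≤ g / R / 8 := by
    rw [div_right_comm, ← div_div]
    exact div_le_self (by positivity) (by linarith)
  have hη2 : C₀ * shellInt R (density B) ≤ g / R / 8 := by
    calc _ ≤ (C₀ + 1) * (g / (8 * (C₀ + 1)) / R) := by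
          apply mul_le_mul (by linarith) hshell (shellInt_nonneg _ hdB) (by positivity)
      _ = _ := by field_simp
  have hgR : 0 < g / R := by positivity
  obtain ⟨D, D1, D2, D3⟩ := exists_far he hμ W1
    (fun k => H1_mul (hA k) (isMultiplier_sinCut R)) (ε := g / R / 8) (by positivity)
  obtain ⟨E, E1, E2, E3⟩ := exists_far he hμ D1
    (fun k => H1_mul (hB k) (isMultiplier_sinCut R)) (ε := g / R / 8) (by positivity)
  refine ⟨E, E1, fun c => ?_, by linarith⟩
  have e1 := E2 c
  have e2 := D2 c
  rw [W2] at e2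
  have e3 := comb_cut_le A R c
  have e4 := comb_cut_le B R c
  linarith

/-! ### Vanishing sequences -/

/-- Near zero e is o(r), and at infinity the coefficient of the 5/3-power is arbitrarily small, so
an intermediate power with a large constant covers the rest. For r = |u|² that power is |u|³, the
integral controlled by vanishing. -/
lemma IsExchangeCorrelation.abs_le_three_halves (he : IsExchangeCorrelation e) {δ : ℝ}
    (hδ : 0 < δ) : ∃ C, 0 ≤ C ∧ ∀ r, 0 ≤ r → |e r| ≤ δ * (r + r ^ 2) + C * (r * √r) := by
  obtain ⟨C₁, hC₁, h1⟩ := he.abs_le_small hδ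
  obtain ⟨C₂, hC₂, h2⟩ := he.abs_le_rpow hδ
  refine ⟨C₁ + C₂, by positivity, fun r hr => ?_⟩
  have hsq := Real.sq_sqrt hr
  have hs := Real.sqrt_nonneg r
  have hp : 0 ≤ r * √r := by positivity
  have p1 : 0 ≤ C₁ * (r * √r) := by positivity
  have p2 : 0 ≤ C₂ * (r * √r) := by positivity
  have p3 : 0 ≤ δ * r ^ 2 := by positivity
  rcases le_total r 1 with h | h
  · have h3 : r ≤ √r := Real.le_sqrt_of_sq_le (by nlinarith)
    have h4 : C₁ * r ^ 2 ≤ C₁ * (r * √r) := by rw [sq]; gcongr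
    have := h1 r hr
    linarith
  · have h3 : 1 ≤ √r := Real.one_le_sqrt.2 h
    have h4 : C₂ * r ≤ C₂ * (r * √r) := by
      gcongr
      exact le_mul_of_one_le_right hr h3
    have h5 := rpow_five_thirds_le hr one_pos
    have h6 : δ * r ^ (5 / 3 : ℝ) ≤ δ * (r + r ^ 2) := by
      gcongr; simpa using h5
    have := h2 r hr
    linarith

lemma memLp_sub_ballAverage {u : L2} (hu : u ∈ H1) {ε : ℝ} (hε : 0 < ε) :
    MemLp (fun x => ‖u x - ballAverage ε u x‖) 2 volume ∧
      nrm2 (fun x => ‖u x - ballAverage ε u x‖) ≤ 3 * ε * gr u := by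
  have h := lintegral_sub_ballAverage_le hu hε
  have hm : Measurable fun x => ‖u x - ballAverage ε u x‖ :=
    ((measurable_L2 u).sub (measurable_ballAverage ε u).measurable).norm
  have hg : 0 ≤ 3 * ε * gr u := by have := gr_nonneg u; positivity
  have h1 : ∫⁻ x, ENNReal.ofReal (‖u x - ballAverage ε u x‖ ^ 2) ≤
      ENNReal.ofReal ((3 * ε * gr u) ^ 2) := by
    rw [ENNReal.ofReal_pow hg]
    refine le_trans (le_of_eq (lintegral_congr fun x => ?_)) h
    rw [ENNReal.ofReal_pow (norm_nonneg _), ofReal_norm]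
  have hint : Integrable fun x => ‖u x - ballAverage ε u x‖ ^ 2 := by
    refine ⟨(hm.pow_const 2).aestronglyMeasurable, ?_⟩
    rw [hasFiniteIntegral_iff_ofReal (Eventually.of_forall fun _ => sq_nonneg _)]
    exact h1.trans_lt ENNReal.ofReal_lt_top
  refine ⟨(memLp_two_iff_integrable_sq hm.aestronglyMeasurable).2 hint, ?_⟩
  refine Real.sqrt_le_iff.2 ⟨hg, ?_⟩
  rw [← ENNReal.ofReal_le_ofReal_iff (sq_nonneg _),
    ofReal_integral_eq_lintegral_ofReal hint (Eventually.of_forall fun _ => sq_nonneg _)]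
  exact h1

lemma integrable_cubic {u : L2} (hu : u ∈ H1) : Integrable fun x => ‖u x‖ ^ 3 := by
  refine ((integrable_norm_sq u).add (integrable_quartic hu)).mono'
    ((measurable_L2 u).norm.pow_const 3).aestronglyMeasurable (Eventually.of_forall fun x => ?_)
  rw [Real.norm_of_nonneg (by positivity), Pi.add_apply]
  nlinarith [sq_nonneg (‖u x‖ - 1), sq_nonneg ‖u x‖, sq_nonneg (‖u x‖ ^ 2 - ‖u x‖)]

/-- One factor of |u|³ is replaced by its ball average, at most η far out, plus the averaging error,
which is O(ε) in L² and is paired with |u|² in L². -/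
lemma setIntegral_cubic_le {u : L2} (hu : u ∈ H1) {M ε η R : ℝ} (hε : 0 < ε) (hη : 0 ≤ η)
    (hn : ‖u‖ ≤ M) (hg : gr u ≤ M) (h : ∀ x, R ≤ ‖x‖ → ‖ballAverage ε u x‖ ≤ η) :
    ∫ x in {x | R ≤ ‖x‖}, ‖u x‖ ^ 3 ≤ η * M ^ 2 + √(gnConst * (M * M ^ 3)) * (3 * ε * M) := by
  obtain ⟨h1, h2⟩ := memLp_sub_ballAverage hu hε
  have hF : MeasurableSet {x : Space | R ≤ ‖x‖} := measurableSet_le measurable_const measurable_norm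
  have i1 := integrable_mul_of_sq (isL12_norm_sq hu).memLp h1
  have i2 : Integrable fun x => η * ‖u x‖ ^ 2 + ‖u x‖ ^ 2 * ‖u x - ballAverage ε u x‖ :=
    ((integrable_norm_sq u).const_mul η).add i1
  have h3 : ∫ x in {x | R ≤ ‖x‖}, ‖u x‖ ^ 3 ≤
      ∫ x, (η * ‖u x‖ ^ 2 + ‖u x‖ ^ 2 * ‖u x - ballAverage ε u x‖) := by
    refine (setIntegral_mono_on (integrable_cubic hu).integrableOn i2.integrableOn hF
      fun x hx => ?_).trans (setIntegral_le_integral i2 (Eventually.of_forall fun x => ?_))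
    · have h4 : ‖u x‖ ≤ ‖ballAverage ε u x‖ + ‖u x - ballAverage ε u x‖ := norm_le_insert' _ _
      have h5 := h x hx
      calc ‖u x‖ ^ 3 = ‖u x‖ ^ 2 * ‖u x‖ := by ring
        _ ≤ ‖u x‖ ^ 2 * (η + ‖u x - ballAverage ε u x‖) := by gcongr; linarith
        _ = _ := by ring
    · simp only [Pi.zero_apply]; positivity
  rw [integral_add ((integrable_norm_sq u).const_mul η) i1, integral_const_mul,
    ← norm_sq_eq_integral] at h3
  have h4 := (le_abs_self _).trans (abs_integral_mul_le (isL12_norm_sq hu).memLp h1)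
  have h5 := nrm2_norm_sq_le' hu hn hg
  have h6 : nrm2 (fun x => ‖u x‖ ^ 2) * nrm2 (fun x => ‖u x - ballAverage ε u x‖) ≤
      √(gnConst * (M * M ^ 3)) * (3 * ε * M) :=
    mul_le_mul h5 (h2.trans (by gcongr)) (nrm2_nonneg _) (Real.sqrt_nonneg _)
  have h7 : η * ‖u‖ ^ 2 ≤ η * M ^ 2 := by gcongr
  linarith

/-- A sequence vanishes at infinity if its averages over balls are eventually small far out. -/
def Vanishing (u : ℕ → L2) : Prop :=
  ∀ ε > 0, ∀ η > 0, ∃ R : ℝ, ∀ᶠ j in atTop, ∀ x, R ≤ ‖x‖ → ‖ballAverage ε (u j) x‖ ≤ η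

lemma Vanishing.setIntegral_cubic_le {u : ℕ → L2} (h : Vanishing u) {M : ℝ}
    (hu : ∀ j, u j ∈ H1) (hn : ∀ j, ‖u j‖ ≤ M) (hg : ∀ j, gr (u j) ≤ M) {δ : ℝ} (hδ : 0 < δ) :
    ∃ R : ℝ, ∀ᶠ j in atTop, ∫ x in {x | R ≤ ‖x‖}, ‖u j x‖ ^ 3 ≤ δ := by
  have hM : 0 ≤ M := (norm_nonneg _).trans (hn 0)
  set B := √(gnConst * (M * M ^ 3))
  have hB : 0 ≤ B := Real.sqrt_nonneg _
  obtain ⟨R, hR⟩ := h (δ / (2 * (3 * (B * M) + 1))) (by positivity)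
    (δ / (2 * (M ^ 2 + 1))) (by positivity)
  refine ⟨R, hR.mono fun j hj => ?_⟩
  refine (KohnSham.setIntegral_cubic_le (hu j) (by positivity) (by positivity) (hn j) (hg j)
    hj).trans ?_
  have h1 : δ / (2 * (M ^ 2 + 1)) * M ^ 2 ≤ δ / 2 := by
    rw [div_mul_eq_mul_div, div_le_div_iff₀ (by positivity) (by positivity)]
    nlinarith
  have h2 : B * (3 * (δ / (2 * (3 * (B * M) + 1))) * M) ≤ δ / 2 := by
    have : B * (3 * (δ / (2 * (3 * (B * M) + 1))) * M) =
        δ * (3 * (B * M)) / (2 * (3 * (B * M) + 1)) := by ring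
    rw [this, div_le_div_iff₀ (by positivity) (by positivity)]
    nlinarith
  linarith

/-- The density is at most 2n times the largest |Φ_k|², and -e is increasing. This reduces the
exchange-correlation energy to single orbitals. -/
lemma density_le_sup {n : ℕ} (Φ : Fin n → L2) (x : Space) (he : IsExchangeCorrelation e) :
    -e (density Φ x) ≤ ∑ k, -e (2 * n * ‖Φ k x‖ ^ 2) := by
  have hnn : ∀ k, 0 ≤ -e (2 * n * ‖Φ k x‖ ^ 2) := fun k => neg_nonneg.2 (he.nonpos (by positivity))
  rcases (Finset.univ : Finset (Fin n)).eq_empty_or_nonempty with h0 | h0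
  · simp [density, h0, he.zero]
  obtain ⟨k, -, hk⟩ := Finset.exists_max_image Finset.univ (fun k => ‖Φ k x‖ ^ 2) h0
  have h1 : density Φ x ≤ 2 * n * ‖Φ k x‖ ^ 2 := by
    have := Finset.sum_le_card_nsmul Finset.univ (fun k => ‖Φ k x‖ ^ 2) _ fun i hi => hk i hi
    simp only [Finset.card_univ, Fintype.card_fin, nsmul_eq_mul] at this
    simp only [density]
    linarith
  have h2 := he.antitoneOn (mem_Ici.2 (mul_nonneg zero_le_two
    (Finset.sum_nonneg fun k _ => sq_nonneg _)) : density Φ x ∈ Ici 0)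
    (mem_Ici.2 (by positivity)) h1
  exact (neg_le_neg h2).trans (Finset.single_le_sum
    (f := fun k => -e (2 * n * ‖Φ k x‖ ^ 2)) (fun k _ => hnn k) (Finset.mem_univ k))

/-- The exchange-correlation energy of the outer part of a vanishing sequence tends to zero. -/
lemma Vanishing.le_ksEnergy (he : IsExchangeCorrelation e) {n : ℕ} {Φ : ℕ → Fin n → L2} {M : ℝ}
    (hΦ : ∀ j k, Φ j k ∈ H1) (hn : ∀ j k, ‖Φ j k‖ ≤ M) (hg : ∀ j k, gr (Φ j k) ≤ M)
    (h : ∀ k, Vanishing fun j => Φ j k) {ε : ℝ} (hε : 0 < ε) :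
    ∃ R₀ : ℕ, ∀ R : ℕ, R₀ ≤ R → ∀ᶠ j in atTop,
      -ε ≤ ksEnergy e 0 (fun k => mulL2 (sinCut R) (Φ j k)) := by
  set N : ℝ := 2 * n with hN
  have hN0 : 0 ≤ N := by positivity
  set Q : ℝ := gnConst * (|M| * |M| ^ 3) with hQ
  have hQ0 : 0 ≤ Q := mul_nonneg gnConst_nonneg (by positivity)
  -- Bounds the integral of f + f² for f = N |Φ_k|². Summed over the orbitals, δX and the cubic term
  -- contribute ε/2 each.
  set X : ℝ := N * M ^ 2 + N ^ 2 * Q with hX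
  have hX0 : 0 ≤ X := by positivity
  set δ : ℝ := ε / (2 * (n * X + 1)) with hδ
  have hδ0 : 0 < δ := by positivity
  obtain ⟨C, hC0, hC⟩ := he.abs_le_three_halves hδ0
  set Y : ℝ := C * (N * √N) with hY
  have hY0 : 0 ≤ Y := by positivity
  choose R hR using fun k => (h k).setIntegral_cubic_le (fun j => hΦ j k) (fun j => hn j k)
    (fun j => hg j k) (show 0 < ε / (2 * (n * Y + 1)) by positivity)
  obtain ⟨R₀, hR₀⟩ := exists_nat_ge (1 + ∑ k, |R k|)
  refine ⟨R₀, fun r hr => ?_⟩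
  have hrR : ∀ k, R k ≤ (r : ℝ) - 1 := fun k => by
    have h1 : R k ≤ ∑ k, |R k| := (le_abs_self _).trans
      (Finset.single_le_sum (f := fun k => |R k|) (fun _ _ => abs_nonneg _) (Finset.mem_univ k))
    have h2 : (R₀ : ℝ) ≤ r := Nat.cast_le.2 hr
    linarith
  filter_upwards [eventually_all.2 hR] with j hj
  have hs := isMultiplier_sinCut (r : ℝ)
  have hd := isDensity_density (hΦ j)
  have hds := hd.sq_mul hs.isBddMeas
  set F : Set Space := {x | (r : ℝ) - 1 ≤ ‖x‖} with hF
  have hFm : MeasurableSet F := measurableSet_le measurable_const measurable_norm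
  have hdk : ∀ k, IsDensity fun x => N * ‖Φ j k x‖ ^ 2 := fun k =>
    (isDensity_norm_sq (hΦ j k)).const_mul hN0
  have hpt : ∀ x, -e (sinCut r x ^ 2 * density (Φ j) x) ≤
      F.indicator (fun x => ∑ k, -e (N * ‖Φ j k x‖ ^ 2)) x := by
    intro x
    by_cases hx : x ∈ F
    · rw [indicator_of_mem hx]
      refine le_trans (neg_le_neg ?_) (density_le_sup (Φ j) x he)
      refine he.antitoneOn (hds.nonneg x) (hd.nonneg x) (mul_le_of_le_one_left (hd.nonneg x) ?_)
      rw [← sq_abs]; exact pow_le_one₀ (abs_nonneg _) (abs_sinCut_le _ _)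
    · rw [indicator_of_notMem hx]
      have : sinCut r x = 0 := by
        by_contra h0
        exact hx (le_of_lt (sinCut_ne_zero h0))
      rw [this]; simp [he.zero]
  have hI : Integrable fun x => ∑ k, -e (N * ‖Φ j k x‖ ^ 2) :=
    integrable_finsetSum _ fun k _ => (he.integrable_comp (hdk k)).neg
  have h1 : -(∫ x, e (sinCut r x ^ 2 * density (Φ j) x)) ≤
      ∑ k, ∫ x in F, -e (N * ‖Φ j k x‖ ^ 2) := by
    have hneg : ∀ k, Integrable fun x => -e (N * ‖Φ j k x‖ ^ 2) := fun k =>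
      (he.integrable_comp (hdk k)).neg
    rw [← integral_neg, ← integral_finsetSum _ fun k _ => (hneg k).integrableOn,
      ← integral_indicator hFm]
    exact integral_mono (he.integrable_comp hds).neg (hI.indicator hFm) hpt
  have h2 : ∀ k, ∫ x in F, -e (N * ‖Φ j k x‖ ^ 2) ≤ δ * X + Y * (ε / (2 * (n * Y + 1))) := by
    intro k
    have i1 : Integrable fun x => N * ‖Φ j k x‖ ^ 2 + N ^ 2 * ‖Φ j k x‖ ^ 4 :=
      ((integrable_norm_sq _).const_mul _).add ((integrable_quartic (hΦ j k)).const_mul _)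
    have i2 := integrable_cubic (hΦ j k)
    have e1 : ∫ x in F, -e (N * ‖Φ j k x‖ ^ 2) ≤
        ∫ x in F, (δ * (N * ‖Φ j k x‖ ^ 2 + N ^ 2 * ‖Φ j k x‖ ^ 4) + Y * ‖Φ j k x‖ ^ 3) := by
      refine setIntegral_mono (he.integrable_comp (hdk k)).neg.integrableOn
        ((i1.const_mul δ).add (i2.const_mul Y)).integrableOn fun x => ?_
      refine (neg_le_abs _).trans ((hC _ ((hdk k).nonneg x)).trans (le_of_eq ?_))
      rw [Real.sqrt_mul hN0, Real.sqrt_sq (norm_nonneg _), hY]; ring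
    rw [integral_add (i1.const_mul δ).integrableOn (i2.const_mul Y).integrableOn,
      integral_const_mul, integral_const_mul] at e1
    have e2 : ∫ x in F, (N * ‖Φ j k x‖ ^ 2 + N ^ 2 * ‖Φ j k x‖ ^ 4) ≤ X := by
      refine (setIntegral_le_integral i1 (Eventually.of_forall fun x => by
        simp only [Pi.zero_apply]; positivity)).trans ?_
      rw [integral_add ((integrable_norm_sq _).const_mul _)
        ((integrable_quartic (hΦ j k)).const_mul _), integral_const_mul, integral_const_mul,
        ← norm_sq_eq_integral, hX]
      have q1 : ‖Φ j k‖ ^ 2 ≤ M ^ 2 := pow_le_pow_left₀ (norm_nonneg _) (hn j k) 2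
      have q2 : ∫ x, ‖Φ j k x‖ ^ 4 ≤ Q := by
        refine (integral_quartic_le (hΦ j k)).trans ?_
        have := gr_nonneg (Φ j k)
        have := gnConst_nonneg
        rw [hQ]
        gcongr
        · exact (hn j k).trans (le_abs_self _)
        · exact (hg j k).trans (le_abs_self _)
      gcongr
    have e3 : ∫ x in F, ‖Φ j k x‖ ^ 3 ≤ ε / (2 * (n * Y + 1)) :=
      (setIntegral_mono_set i2.integrableOn (Eventually.of_forall fun x => by
        simp only [Pi.zero_apply]; positivity)
        (Eventually.of_forall fun x hx => (hrR k).trans hx)).trans (hj k)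
    have e4 : δ * (∫ x in F, (N * ‖Φ j k x‖ ^ 2 + N ^ 2 * ‖Φ j k x‖ ^ 4)) ≤ δ * X := by gcongr
    have e5 : Y * (∫ x in F, ‖Φ j k x‖ ^ 3) ≤ Y * (ε / (2 * (n * Y + 1))) := by gcongr
    linarith
  have h3 := h1.trans (Finset.sum_le_sum fun k _ => h2 k)
  simp only [Finset.sum_const, Finset.card_univ, Fintype.card_fin, nsmul_eq_mul] at h3
  have h4 : (n : ℝ) * (δ * X + Y * (ε / (2 * (n * Y + 1)))) ≤ ε := by
    have q1 : n * (δ * X) ≤ ε / 2 := by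
      have : n * (δ * X) = ε * (n * X) / (2 * (n * X + 1)) := by rw [hδ]; ring
      rw [this, div_le_div_iff₀ (by positivity) (by positivity)]
      nlinarith
    have q2 : n * (Y * (ε / (2 * (n * Y + 1)))) ≤ ε / 2 := by
      have : n * (Y * (ε / (2 * (n * Y + 1)))) = ε * (n * Y) / (2 * (n * Y + 1)) := by ring
      rw [this, div_le_div_iff₀ (by positivity) (by positivity)]
      nlinarith
    linarith
  rw [ksEnergy_eq e 0 fun k => H1_mul (hΦ j k) hs,
    potEnergy_congr e 0 (density_mulL2 (Φ j) hs.isBddMeas), potEnergy, integral_zero_measure]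
  have h5 := kin_nonneg fun k => mulL2 (sinCut r) (Φ j k)
  have h6 := coul_nonneg hds.nonneg hds.nonneg
  linarith

/-! ### Translated sequences -/

lemma ballAverage_tr (ε : ℝ) (z : Space) (u : L2) (x : Space) :
    ballAverage ε (tr z u) x = ballAverage ε u (x - z) := by
  rw [ballAverage, ballAverage]
  refine setAverage_congr_fun measurableSet_ball ?_
  have h := (Measure.measurePreserving_sub_left volume x).quasiMeasurePreserving.ae (tr_ae z u)
  filter_upwards [h] with y hy _
  rw [hy]; congr 1; abel

/-- A sequence that does not vanish has a nonzero weak limit along translates. -/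
lemma exists_translate_of_not_vanishing {n : ℕ} {Φ : ℕ → Fin n → L2} {M : ℝ}
    (hΦ : ∀ j k, Φ j k ∈ H1) (hn : ∀ j k, ‖Φ j k‖ ≤ M) (hg : ∀ j k, gr (Φ j k) ≤ M)
    {k₀ : Fin n} (h : ¬ Vanishing fun j => Φ j k₀) :
    ∃ (ns : ℕ → ℕ) (z : ℕ → Space) (b : Fin n → L2), StrictMono ns ∧
      Tendsto (fun m => ‖z m‖) atTop atTop ∧ b k₀ ≠ 0 ∧
      ∀ k, WeakH1 (fun m => tr (-z m) (Φ (ns m) k)) (b k) M := by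
  simp only [Vanishing, not_forall, not_exists] at h
  obtain ⟨ε, hε, η, hη, h⟩ := h
  have hfreq : ∀ m : ℕ, ∃ᶠ j in atTop, ∃ x : Space, (m : ℝ) ≤ ‖x‖ ∧
      η < ‖ballAverage ε (Φ j k₀) x‖ := by
    intro m
    have := h m
    rw [not_eventually] at this
    refine this.mono fun j hj => ?_
    push Not at hj
    exact hj
  obtain ⟨ns, hns, hx⟩ := extraction_forall_of_frequently hfreq
  choose z hz1 hz2 using hx
  obtain ⟨b, ms, hms, hb⟩ := exists_weakH1_subseq_pi
    (u := fun k m => tr (-z m) (Φ (ns m) k)) (M := M) (fun k m => H1_tr (hΦ _ k) _)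
    (fun k m => by rw [LinearIsometry.norm_map]; exact hn _ k)
    (fun k m => by rw [gr_tr (hΦ _ k)]; exact hg _ k)
  refine ⟨ns ∘ ms, z ∘ ms, b, hns.comp hms, ?_, ?_, hb⟩
  · exact tendsto_atTop_mono (fun m => hz1 (ms m))
      (tendsto_natCast_atTop_atTop.comp hms.tendsto_atTop)
  · intro h0
    -- The averages around the moving centres stay above η and become averages at the origin after
    -- translation. Being weakly continuous, they would tend to 0 if the limit were zero.
    have h1 := (hb k₀).weak
    rw [h0] at h1
    have h2 := (h1.ballAverage (ε := ε) 0).norm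
    rw [norm_zero] at h2
    obtain ⟨m, hm⟩ := (h2.eventually_lt_const hη).exists
    rw [ballAverage_tr, zero_sub, neg_neg] at hm
    exact lt_asymm hm (hz2 (ms m))

lemma mulL2_tr {m : Space → ℝ} (hm : IsBddMeas m) (z : Space) (u : L2) :
    mulL2 m (tr z u) = tr z (mulL2 (fun x => m (x + z)) u) := by
  have hm' : IsBddMeas fun x => m (x + z) :=
    ⟨hm.meas.comp (measurable_id.add_const z), hm.bdd.imp fun C hC x => hC _⟩
  apply Lp.ext
  filter_upwards [mulL2_ae hm (tr z u), tr_ae z u, tr_ae z (mulL2 (fun x => m (x + z)) u),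
    (measurePreserving_sub z).quasiMeasurePreserving.ae (mulL2_ae hm' u)] with x h1 h2 h3 h4
  rw [h1, h2, h3, h4, sub_add_cancel]

/-- Cutting out a fixed ball does not affect the weak limits along translates to infinity. -/
lemma WeakTendsto.tr_sinCut {u : ℕ → L2} {b : L2} {M : ℝ} (hu : ∀ j, ‖u j‖ ≤ M) {z : ℕ → Space}
    (hz : Tendsto (fun j => ‖z j‖) atTop atTop) (h : WeakTendsto (fun j => KohnSham.tr (-z j) (u j)) b)
    (R : ℝ) : WeakTendsto (fun j => KohnSham.tr (-z j) (KohnSham.mulL2 (sinCut R) (u j))) b := by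
  have hs := (isMultiplier_sinCut R).isBddMeas
  set m : Space → ℝ := fun x => sinCut R x - 1 with hm
  have hmb : IsBddMeas m := ⟨hs.meas.sub_const 1, 2, fun x => by
    have := abs_sub (sinCut R x) 1
    have := abs_sinCut_le R x
    rw [abs_one] at *; linarith⟩
  -- The removed part lives in a fixed ball. In the moving frame that ball escapes to infinity, so
  -- its multiplier tends to zero strongly on every test function.
  have hm0 : WeakTendsto (fun j => KohnSham.tr (-z j) (KohnSham.mulL2 m (u j))) 0 := by
    intro w
    rw [inner_zero_right]
    have h1 : ∀ j, inner ℂ w (KohnSham.tr (-z j) (KohnSham.mulL2 m (u j))) =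
        inner ℂ (KohnSham.tr (z j) (KohnSham.mulL2 (fun x => m (x + z j)) w)) (u j) := by
      intro j
      rw [inner_tr, neg_neg, inner_mulL2 hmb, mulL2_tr hmb]
    have h2 : Tendsto (fun j => KohnSham.mulL2 (fun x => m (x + z j)) w) atTop (𝓝 0) := by
      have hmz : ∀ j, IsBddMeas fun x => m (x + z j) := fun j =>
        ⟨hmb.meas.comp (measurable_id.add_const _), hmb.bdd.imp fun C hC x => hC _⟩
      refine tendsto_mulL2_zero (C := 2) (m := fun j x => m (x + z j)) hmz (fun j x => ?_)
        (fun x => ?_) w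
      · have := abs_sub (sinCut R (x + z j)) 1
        have := abs_sinCut_le R (x + z j)
        rw [abs_one] at *
        change |sinCut R (x + z j) - 1| ≤ 2
        linarith
      · refine tendsto_const_nhds.congr' ?_
        filter_upwards [hz.eventually_ge_atTop (R + 1 + ‖x‖)] with j hj
        have h3 : ‖z j‖ ≤ ‖x + z j‖ + ‖x‖ := by
          have := norm_sub_le (x + z j) x
          rwa [add_sub_cancel_left] at this
        change 0 = sinCut R (x + z j) - 1
        rw [sinCut_eq_one (by linarith [norm_le_jb (x + z j)]), sub_self]
    rw [tendsto_zero_iff_norm_tendsto_zero]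
    refine squeeze_zero (fun j => norm_nonneg _) (fun j => ?_)
      (by simpa using h2.norm.mul_const M)
    rw [h1]
    refine (norm_inner_le_norm _ _).trans ?_
    rw [LinearIsometry.norm_map]
    exact mul_le_mul_of_nonneg_left (hu j) (norm_nonneg _)
  have h3 := h.add hm0
  rw [add_zero] at h3
  convert h3 using 2 with j
  rw [← map_add, mulL2_one_sub hs]
  congr 1; abel

/-! ### Compactness of minimizing sequences -/

lemma norm_comb_sq_of_orthonormal {n : ℕ} {A : Fin n → L2} (h : Orthonormal ℂ A)
    (c : Fin n → ℂ) : ‖comb A c‖ ^ 2 = csq c := by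
  classical
  have h1 := norm_comb_sq_eq A c
  rw [orthonormal_iff_ite] at h
  simp only [h, mul_ite, mul_one, mul_zero, Finset.sum_ite_eq, Finset.mem_univ, if_true,
    Complex.conj_mul'] at h1
  rw [csq]
  exact_mod_cast h1

lemma inBall_zero (L : ℝ) : InBall L (0 : Measure Space) := by
  simp [InBall]

/-- Minimizing sequences do not lose mass. -/
lemma IsLowerBound.norm_comb_sq_eq (he : IsExchangeCorrelation e) {n : ℕ} {Z : ℝ}
    (hZ : 2 * (n : ℝ) < Z) {μ : Measure Space} [IsFiniteMeasure μ] {L I : ℝ} (hμ : InBall L μ)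
    (hμZ : μ.real univ = Z) (hI : IsLowerBound e μ n I) {Φ : ℕ → Fin n → L2} {a : Fin n → L2}
    {M : ℝ} (h : ∀ k, WeakH1 (fun j => Φ j k) (a k) M)
    (hQ : ∀ j c, ‖comb (Φ j) c‖ ^ 2 = csq c)
    (hE : Tendsto (fun j => ksEnergy e μ (Φ j)) atTop (𝓝 I)) (c : Fin n → ℂ) :
    ‖comb a c‖ ^ 2 = csq c := by
  have hQa : ∀ c, ‖comb a c‖ ^ 2 ≤ csq c := by
    intro c
    refine le_of_forall_pos_le_add fun ε hε => ?_
    have hc := csq_nonneg c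
    obtain ⟨R₀, hR⟩ := WeakH1.split he hμ h (show 0 < ε / (csq c + 1) by positivity)
    obtain ⟨j, -, hj⟩ := (hR R₀ le_rfl).exists
    have h1 := hj c
    rw [hQ] at h1
    have h2 : ε / (csq c + 1) * csq c ≤ ε := by
      rw [div_mul_eq_mul_div, div_le_iff₀ (by positivity)]; nlinarith
    nlinarith [sq_nonneg ‖comb (fun k => KohnSham.mulL2 (sinCut R₀) (Φ j k)) c‖]
  by_contra hne
  -- A weak limit with a Gram defect lies strictly above the infimum, so the escaping part would
  -- have to carry negative energy.
  have hlt := hI.lt_of_relaxed he hZ hμ hμZ (fun k => (h k).limit_mem) hQa hne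
  have hΦ : ∀ j k, Φ j k ∈ H1 := fun j k => (h k).mem j
  have hn : ∀ j k, ‖Φ j k‖ ≤ M := fun j k => (h k).norm_le j
  have hg : ∀ j k, gr (Φ j k) ≤ M := fun j k => (h k).gr_le j
  by_cases hv : ∀ k, Vanishing fun j => Φ j k
  -- Vanishing case: splitting, the lower bound -ε for the outer part and the minimizing property
  -- each lose ε, so the energy of the limit would be below I + 3ε, less than I + 4ε.
  · set ε := (ksEnergy e μ a - I) / 4 with hε
    have hε0 : 0 < ε := by rw [hε]; linarith
    obtain ⟨R₀, hR₀⟩ := WeakH1.split he hμ h hε0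
    obtain ⟨R₁, hR₁⟩ := Vanishing.le_ksEnergy he hΦ hn hg hv hε0
    obtain ⟨j, ⟨j1, -⟩, j2, j3⟩ := ((hR₀ _ (le_max_left R₀ R₁)).and
      ((hR₁ _ (le_max_right R₀ R₁)).and
        (hE.eventually_lt_const (show I < I + ε by linarith)))).exists
    linarith
  -- Otherwise a nonzero cluster b survives along translates. It is bound to the limit a with strict
  -- gain γ, and the remainder is put back far away.
  · push Not at hv
    obtain ⟨k₀, hk₀⟩ := hv
    obtain ⟨ns, z, b, hns, hz, hb0, hb⟩ := exists_translate_of_not_vanishing hΦ hn hg hk₀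
    have hbpos : 0 < nrm1 (density b) := by
      rw [nrm1_density]
      have : ‖b k₀‖ ^ 2 ≤ ∑ k, ‖b k‖ ^ 2 :=
        Finset.single_le_sum (f := fun k => ‖b k‖ ^ 2) (fun _ _ => sq_nonneg _) (Finset.mem_univ _)
      have := norm_pos_iff.2 hb0
      have : 0 < ‖b k₀‖ ^ 2 := by positivity
      linarith
    obtain ⟨C, hC, hCQ, hCE⟩ := exists_binding he hZ hμ hμZ (fun k => (h k).limit_mem)
      (fun k => (hb k).limit_mem) hQa hbpos
    set γ := ksEnergy e μ a + ksEnergy e 0 b - ksEnergy e μ C with hγ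
    have hγ0 : 0 < γ := by rw [hγ]; linarith
    obtain ⟨M', hMM', hM'⟩ := exists_gr_cut_le M
    obtain ⟨K, hK0, hK⟩ := exists_le_of_almost_relaxed he n (max Z (I + 2))
    -- Four errors ε in the energy and the cost 2Kε of repairing a Gram form of size 1 + 2ε must
    -- stay below γ; the choice keeps them below γ/2.
    set ε := min (1 / 2) (γ / (2 * (4 + 2 * K))) with hε
    have hε0 : 0 < ε := lt_min (by norm_num) (by positivity)
    have hε1 : ε ≤ 1 / 2 := min_le_left _ _
    have hε2 : ε * (4 + 2 * K) ≤ γ / 2 := by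
      have := mul_le_mul_of_nonneg_right (min_le_right (1 / 2) (γ / (2 * (4 + 2 * K))))
        (show 0 ≤ 4 + 2 * K by positivity)
      refine this.trans (le_of_eq ?_)
      field_simp
    obtain ⟨R, hR⟩ := WeakH1.split he hμ (fun k => (h k).comp hns.tendsto_atTop) hε0
    have hs := isMultiplier_sinCut (R : ℝ)
    have hsH : ∀ m k, mulL2 (sinCut R) (Φ (ns m) k) ∈ H1 := fun m k => H1_mul (hΦ _ k) hs
    have hψ : ∀ k, WeakH1 (fun m => tr (-z m) (mulL2 (sinCut R) (Φ (ns m) k))) (b k) M' := fun k =>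
      { mem := fun m => H1_tr (hsH m k) _
        norm_le := fun m => by
          rw [LinearIsometry.norm_map]
          exact (norm_sinCut_le _ _).trans ((hn _ k).trans hMM')
        gr_le := fun m => by
          rw [gr_tr (hsH m k)]
          exact (hM' _ _ (hΦ _ k) (hn _ k) (hg _ k)).2
        weak := WeakTendsto.tr_sinCut (fun m => hn (ns m) k) hz (hb k).weak R }
    obtain ⟨R', hR'⟩ := WeakH1.split he (inBall_zero 0) hψ hε0
    obtain ⟨m, ⟨m1, m2⟩, ⟨m3, m4⟩, m5⟩ := ((hR R le_rfl).and ((hR' R' le_rfl).and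
      ((hE.comp hns.tendsto_atTop).eventually_lt_const (show I < I + ε by linarith)))).exists
    rw [ksEnergy_tr e (hsH m)] at m3
    simp only [comb_tr, LinearIsometry.norm_map, Function.comp_apply] at m4 m5
    -- D recombines the bound pair a, b with what remains outside both. Its energy is at most I + 4ε
    -- - γ, too low for an almost admissible competitor.
    obtain ⟨D, hD, hDQ, hDE⟩ := exists_far he hμ hC
      (fun k => H1_mul ((hψ k).mem m) (isMultiplier_sinCut (R' : ℝ))) hε0
    have hDI : ksEnergy e μ D ≤ I + 4 * ε - γ := by linarith
    have hDQ' : ∀ c, ‖comb D c‖ ^ 2 ≤ (1 + 2 * ε) * csq c := by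
      intro c
      have q1 := hDQ c
      have q2 := hCQ c
      have q3 := m4 c
      have q4 := m2 c
      rw [hQ] at q4
      linarith
    have := hK μ L I (hμZ.le.trans (le_max_left _ _)) hμ hI (2 * ε) (by linarith) (by linarith) D
      hD hDQ' ((show ksEnergy e μ D ≤ I + 2 by linarith).trans (le_max_right _ _))
    nlinarith

/-- Minimizing sequences are relatively compact in `H¹`. -/
theorem IsLowerBound.exists_H1Tendsto (he : IsExchangeCorrelation e) {n : ℕ} {Z : ℝ}
    (hZ : 2 * (n : ℝ) < Z) {μ : Measure Space} [IsFiniteMeasure μ] {L I : ℝ} (hμ : InBall L μ)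
    (hμZ : μ.real univ = Z) (hI : IsLowerBound e μ n I) {Φ : ℕ → Fin n → L2}
    (hΦ : ∀ j, Φ j ∈ ksAdmissible n)
    (hE : Tendsto (fun j => ksEnergy e μ (Φ j)) atTop (𝓝 I)) :
    ∃ (a : Fin n → L2) (ns : ℕ → ℕ), StrictMono ns ∧ a ∈ ksAdmissible n ∧ ksEnergy e μ a = I ∧
      ∀ k, H1Tendsto (fun j => Φ (ns j) k) (a k) := by
  obtain ⟨B, hB⟩ := hE.bddAbove_range
  have hB' : ∀ j, ksEnergy e μ (Φ j) ≤ B := fun j => hB ⟨j, rfl⟩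
  have hH : ∀ j k, Φ j k ∈ H1 := fun j => (hΦ j).1
  have h1 : ∀ j k, ‖Φ j k‖ = 1 := fun j => (hΦ j).2.1
  set M₀ := max Z (max 1 B)
  obtain ⟨K, hK⟩ := exists_kin_le he n M₀
  have hkin : ∀ j, kin (Φ j) ≤ K := fun j => hK μ (Φ j) (hμZ.le.trans (le_max_left _ _)) (hH j)
    (fun k => (h1 j k).le.trans ((le_max_left _ _).trans (le_max_right _ _)))
    ((hB' j).trans ((le_max_right _ _).trans (le_max_right _ _)))
  have hgr : ∀ j k, gr (Φ j k) ≤ max 1 √K := fun j k =>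
    (gr_le_sqrt_kin (Φ j) k).trans ((Real.sqrt_le_sqrt (hkin j)).trans (le_max_right _ _))
  have hnm : ∀ j k, ‖Φ j k‖ ≤ max 1 √K := fun j k => (h1 j k).le.trans (le_max_left _ _)
  obtain ⟨a, ns, hns, ha⟩ := exists_weakH1_subseq_pi (u := fun k j => Φ j k) (M := max 1 √K)
    (fun k j => hH j k) (fun k j => hnm j k) (fun k j => hgr j k)
  have hEs : Tendsto (fun j => ksEnergy e μ (Φ (ns j))) atTop (𝓝 I) := hE.comp hns.tendsto_atTop
  have hQ := hI.norm_comb_sq_eq he hZ hμ hμZ ha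
    (fun j => norm_comb_sq_of_orthonormal (hΦ (ns j)).2) hEs
  have haH : ∀ k, a k ∈ H1 := fun k => (ha k).limit_mem
  have hao : Orthonormal ℂ a := orthonormal_of_comb hQ
  have hs : ∀ k, Tendsto (fun j => Φ (ns j) k) atTop (𝓝 (a k)) := fun k => by
    refine (ha k).weak.tendsto_of_norm ?_
    simp only [h1, hao.1 k]
    exact tendsto_const_nhds
  have hpot := tendsto_potEnergy he μ (fun j k => (ha k).mem j) haH (fun j k => (ha k).norm_le j)
    (fun j k => (ha k).gr_le j) hs
  have hadm : a ∈ ksAdmissible n := ⟨haH, hao⟩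
  have hEa : ksEnergy e μ a = I := by
    refine le_antisymm (le_of_forall_pos_le_add fun ε hε => ?_) (hI a hadm)
    refine ge_of_tendsto (hEs.add_const ε) ?_
    exact ksEnergy_lsc he μ ha hs hε
  -- Total and potential energies converge, hence so does the kinetic energy. This is the norm
  -- convergence that upgrades the weak convergence of the gradients.
  have hkt : Tendsto (fun j => kin (Φ (ns j))) atTop (𝓝 (kin a)) := by
    have h2 := hEs.sub hpot
    rw [← hEa, ksEnergy_eq e μ haH, add_sub_cancel_right] at h2
    refine h2.congr fun j => ?_
    rw [ksEnergy_eq e μ (hH _), add_sub_cancel_right]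
  refine ⟨a, ns, hns, hadm, hEa, fun k => ⟨hs k, fun i => ?_⟩⟩
  have h3 : ∀ k i, Tendsto (fun j => (inner ℂ (weakPartial i (a k))
      (weakPartial i (Φ (ns j) k))).re) atTop (𝓝 (‖weakPartial i (a k)‖ ^ 2)) := fun k i =>
    ((ha k).weakPartial i).re_inner_self
  have h4 : Tendsto (fun j => ∑ k, ∑ i, ‖weakPartial i (Φ (ns j) k) - weakPartial i (a k)‖ ^ 2)
      atTop (𝓝 0) := by
    have h5 := (hkt.sub ((tendsto_finsetSum Finset.univ fun k _ =>
      tendsto_finsetSum Finset.univ fun i _ => h3 k i).const_mul 2)).add_const (kin a)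
    have h6 : kin a - 2 * ∑ k, ∑ i, ‖weakPartial i (a k)‖ ^ 2 + kin a = 0 := by
      simp only [kin, gradNormSq]; ring
    rw [h6] at h5
    refine h5.congr fun j => ?_
    simp only [kin, gradNormSq, Finset.mul_sum, ← Finset.sum_sub_distrib, ← Finset.sum_add_distrib]
    refine Finset.sum_congr rfl fun k _ => Finset.sum_congr rfl fun i _ => ?_
    rw [norm_sub_sq (𝕜 := ℂ), inner_re_symm]
    simp
  have h7 : Tendsto (fun j => ‖weakPartial i (Φ (ns j) k) - weakPartial i (a k)‖ ^ 2)
      atTop (𝓝 0) := by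
    refine squeeze_zero (fun _ => sq_nonneg _) (fun j => ?_) h4
    exact (Finset.single_le_sum (f := fun i => ‖weakPartial i (Φ (ns j) k) - weakPartial i (a k)‖ ^ 2)
      (fun _ _ => sq_nonneg _) (Finset.mem_univ i)).trans
      (Finset.single_le_sum (f := fun k => ∑ i, ‖weakPartial i (Φ (ns j) k) - weakPartial i (a k)‖ ^ 2)
      (fun _ _ => Finset.sum_nonneg fun _ _ => sq_nonneg _) (Finset.mem_univ k))
  rw [tendsto_iff_norm_sub_tendsto_zero]
  simpa [Real.sqrt_sq (norm_nonneg _)] using h7.sqrt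

/-! ### The mean-field potential -/

/-- The electronic part `v_H + v_xc(ρ)` of the mean-field potential. -/
def scf (e : ℝ → ℝ) (ρ : Space → ℝ) (x : Space) : ℝ := vHartree ρ x + vXC e (ρ x)

/-- The potential part of the excitation energy of a density `f`. -/
def excPot (e : ℝ → ℝ) (μ : Measure Space) (ρ f : Space → ℝ) : ℝ :=
  -(∫ x, vHartree f x ∂μ) + ∫ x, scf e ρ x * f x

lemma measurable_scf (he : IsExchangeCorrelation e) {ρ : Space → ℝ} (hρ : IsDensity ρ) :
    Measurable (scf e ρ) :=
  (continuous_vHartree hρ.l12).measurable.add (he.measurable_vXC_comp hρ.meas hρ.nonneg)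

lemma exists_abs_scf_le (he : IsExchangeCorrelation e) : ∃ C, 0 ≤ C ∧ ∀ ρ : Space → ℝ,
    IsDensity ρ → ∀ x, |scf e ρ x| ≤ potConst * nrm ρ + 1 + C * ρ x := by
  obtain ⟨C, hC0, hC⟩ := he.abs_vXC_le_small one_pos
  refine ⟨C, hC0, fun ρ hρ x => ?_⟩
  have h1 := abs_vHartree_le_nrm hρ.l12 x
  have h2 := hC (ρ x) (hρ.nonneg x)
  have h3 := abs_add_le (vHartree ρ x) (vXC e (ρ x))
  rw [scf]
  linarith

lemma abs_integral_le_of_abs_le {w ρ f : Space → ℝ} {A C : ℝ}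
    (hρ : IsL12 ρ) (hf : IsL12 f) (hC : 0 ≤ C)
    (h : ∀ x, |w x * f x| ≤ A * |f x| + C * |ρ x * f x|) :
    |∫ x, w x * f x| ≤ A * nrm1 f + C * (nrm2 ρ * nrm2 f) := by
  have i1 := hf.int.abs.const_mul A
  have i2 := (integrable_mul_of_sq hρ.memLp hf.memLp).abs.const_mul C
  refine (abs_integral_le_integral_abs).trans ?_
  calc ∫ x, |w x * f x| ≤ ∫ x, (A * |f x| + C * |ρ x * f x|) :=
        integral_mono_of_nonneg (Eventually.of_forall fun _ => abs_nonneg _) (i1.add i2)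
          (Eventually.of_forall h)
    _ = A * nrm1 f + C * ∫ x, |ρ x * f x| := by
        rw [integral_add i1 i2, integral_const_mul, integral_const_mul, nrm1]
    _ ≤ _ := by
        gcongr
        exact integral_abs_mul_le hρ.memLp hf.memLp

lemma integrable_scf_mul (he : IsExchangeCorrelation e) {ρ f : Space → ℝ} (hρ : IsDensity ρ)
    (hf : IsL12 f) : Integrable fun x => scf e ρ x * f x := by
  obtain ⟨C, hC0, hC⟩ := exists_abs_scf_le he
  refine ((hf.int.abs.const_mul (potConst * nrm ρ + 1)).add
    ((integrable_mul_of_sq hρ.l12.memLp hf.memLp).abs.const_mul C)).mono'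
    ((measurable_scf he hρ).aestronglyMeasurable.mul hf.int.1) (Eventually.of_forall fun x => ?_)
  rw [Real.norm_eq_abs, abs_mul, Pi.add_apply, abs_mul, abs_of_nonneg (hρ.nonneg x)]
  have := mul_le_mul_of_nonneg_right (hC ρ hρ x) (abs_nonneg (f x))
  linarith

lemma exists_abs_integral_scf_le (he : IsExchangeCorrelation e) (B : ℝ) : ∃ K, 0 ≤ K ∧
    ∀ ρ f : Space → ℝ, IsDensity ρ → nrm ρ ≤ B → IsL12 f →
      |∫ x, scf e ρ x * f x| ≤ K * nrm f := by
  obtain ⟨C, hC0, hC⟩ := exists_abs_scf_le he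
  have hp := potConst_pos
  refine ⟨potConst * |B| + 1 + C * |B|, by positivity, fun ρ f hρ hB hf => ?_⟩
  have hB' : nrm ρ ≤ |B| := hB.trans (le_abs_self B)
  refine (abs_integral_le_of_abs_le (A := potConst * |B| + 1) (C := C) hρ.l12 hf hC0
    fun x => ?_).trans ?_
  · rw [abs_mul, abs_mul, abs_of_nonneg (hρ.nonneg x)]
    have h1 : |scf e ρ x| ≤ potConst * |B| + 1 + C * ρ x := by
      have := mul_le_mul_of_nonneg_left hB' hp.le
      linarith [hC ρ hρ x]
    have := mul_le_mul_of_nonneg_right h1 (abs_nonneg (f x))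
    linarith
  · have h1 := nrm1_le_nrm f
    have h2 : nrm2 ρ * nrm2 f ≤ |B| * nrm f :=
      mul_le_mul ((nrm2_le_nrm ρ).trans hB') (nrm2_le_nrm f) (nrm2_nonneg _) (abs_nonneg _)
    have h3 := mul_le_mul_of_nonneg_left h2 hC0
    have h4 := mul_le_mul_of_nonneg_left h1 (show 0 ≤ potConst * |B| + 1 by positivity)
    linarith

lemma exists_abs_excPot_le (he : IsExchangeCorrelation e) (B : ℝ) : ∃ K, 0 ≤ K ∧
    ∀ (μ : Measure Space) [IsFiniteMeasure μ] (ρ f : Space → ℝ), μ.real univ ≤ B →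
      IsDensity ρ → nrm ρ ≤ B → IsL12 f → |excPot e μ ρ f| ≤ K * nrm f := by
  obtain ⟨K, hK0, hK⟩ := exists_abs_integral_scf_le he B
  have hp := potConst_pos
  refine ⟨|B| * potConst + K, by positivity, fun μ _ ρ f hμ hρ hB hf => ?_⟩
  have h1 := abs_integral_vHartree_le μ hf
  have h2 := hK ρ f hρ hB hf
  have h3 : μ.real univ * (potConst * nrm f) ≤ |B| * (potConst * nrm f) :=
    mul_le_mul_of_nonneg_right (hμ.trans (le_abs_self B)) (mul_nonneg hp.le (nrm_nonneg f))
  rw [excPot]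
  refine (abs_add_le _ _).trans ?_
  rw [abs_neg]
  linarith

lemma excitationEnergy_eq (he : IsExchangeCorrelation e) (μ : Measure Space) [IsFiniteMeasure μ]
    {ρ : Space → ℝ} (hρ : IsDensity ρ) {χ : L2} (hχ : χ ∈ H1) :
    excitationEnergy e μ ρ χ = 1 / 2 * gradNormSq χ + excPot e μ ρ fun x => ‖χ x‖ ^ 2 := by
  have hl := isL12_norm_sq hχ
  rw [excitationEnergy, excPot, ← vExt_mul μ hl,
    ← integral_add (integrable_vExt_mul μ hl) (integrable_scf_mul he hρ hl)]
  congr 2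
  ext x
  rw [scf]; ring

lemma excPot_congr (e : ℝ → ℝ) (μ : Measure Space) (ρ : Space → ℝ) {f g : Space → ℝ}
    (h : f =ᵐ[volume] g) : excPot e μ ρ f = excPot e μ ρ g := by
  rw [excPot, excPot, vHartree_congr h]
  congr 1
  exact integral_congr_ae (h.mono fun x hx => by simp only [hx])

/-! ### Decay of the mean-field potential -/

/-- The inner part of the density is far from x and contributes its mass over the distance. For the
outer part the kernel is split at t²: the singular piece is O(t), and the mass of the tail is made
small against t². -/
lemma exists_vHartree_le_far {f : Space → ℝ} (hf : IsDensity f) {δ : ℝ} (hδ : 0 < δ) :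
    ∃ R : ℝ, ∀ x, R ≤ ‖x‖ → vHartree f x ≤ δ := by
  have hc := coulConst_nonneg
  have hn2 := nrm2_nonneg f
  have hn1 := nrm1_nonneg f
  set t := δ / (4 * (coulConst * nrm2 f + 1)) with ht
  have ht0 : 0 < t := by positivity
  have htle : coulConst * t * nrm2 f ≤ δ / 4 := by
    have : coulConst * t * nrm2 f = δ * (coulConst * nrm2 f) / (4 * (coulConst * nrm2 f + 1)) := by
      rw [ht]; ring
    rw [this, div_le_div_iff₀ (by positivity) (by positivity)]
    nlinarith [mul_nonneg hc hn2]
  obtain ⟨S, hS⟩ := ((tendsto_nrm1_sinCut hf).eventually_le_const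
    (show 0 < t ^ 2 * (δ / 4) by positivity)).exists
  have hs := (isMultiplier_sinCut (S : ℝ)).isBddMeas
  have hk := (isMultiplier_cosCut (S : ℝ)).isBddMeas
  refine ⟨S + 1 + (2 * nrm1 f / δ + 1), fun x hx => ?_⟩
  have hd0 : 0 < 2 * nrm1 f / δ + 1 := by positivity
  have h1 : vHartree (fun x => cosCut S x ^ 2 * f x) x ≤ nrm1 f / (2 * nrm1 f / δ + 1) := by
    refine (vHartree_le_of_far (hf.sq_mul hk).l12 (hf.sq_mul hk).nonneg hd0 fun y hy => ?_).trans
      (div_le_div_of_nonneg_right (nrm1_sq_mul_le hf hk (abs_cosCut_le _)) hd0.le)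
    have h2 : ‖y‖ ≤ S + 1 := by
      by_contra! h3
      exact hy (by rw [vanishesOff_cosCut S y h3]; ring)
    have h3 := norm_sub_norm_le x y
    linarith
  have h2 : nrm1 f / (2 * nrm1 f / δ + 1) ≤ δ / 2 := by
    rw [div_le_iff₀ hd0]
    have : δ / 2 * (2 * nrm1 f / δ + 1) = nrm1 f + δ / 2 := by field_simp
    linarith
  have h3 := (le_abs_self _).trans (abs_vHartree_le (hf.sq_mul hs).l12 (r := t ^ 2)
    (by positivity) x)
  have h4 : nrm2 (fun x => sinCut S x ^ 2 * f x) ≤ nrm2 f := by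
    refine nrm2_mono (hf.sq_mul hs).l12 hf.l12 fun x => ?_
    rw [abs_mul, abs_of_nonneg (sq_nonneg (sinCut S x)), ← sq_abs]
    exact mul_le_of_le_one_left (abs_nonneg _) (pow_le_one₀ (abs_nonneg _) (abs_sinCut_le _ x))
  rw [Real.sqrt_sq ht0.le] at h3
  have h5 : 1 / t ^ 2 * nrm1 (fun x => sinCut S x ^ 2 * f x) ≤ δ / 4 := by
    rw [one_div, inv_mul_le_iff₀ (by positivity)]
    exact hS
  have h6 : coulConst * t * nrm2 (fun x => sinCut S x ^ 2 * f x) ≤ coulConst * t * nrm2 f := by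
    gcongr
  have h7 : vHartree f x = vHartree (fun x => cosCut S x ^ 2 * f x) x +
      vHartree (fun x => sinCut S x ^ 2 * f x) x := by
    rw [← vHartree_add (hf.sq_mul hk).l12 (hf.sq_mul hs).l12]
    congr 1
    ext y
    rw [← add_mul, sq_cosCut_add, one_mul]
  linarith

lemma tendsto_nrm2_tail {f : Space → ℝ} (hf : IsDensity f) :
    Tendsto (fun j : ℕ => nrm2 ({x | (j : ℝ) ≤ jb x}.indicator f)) atTop (𝓝 0) := by
  have h := (tendsto_tail hf.l12.sq).sqrt
  rw [Real.sqrt_zero] at h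
  refine h.congr fun j => ?_
  rw [nrm2, ← integral_indicator (measurableSet_le measurable_const continuous_jb.measurable)]
  congr 2
  ext x
  by_cases hx : (j : ℝ) ≤ jb x <;> simp [indicator, hx]

/-- The outer part of a density contributes little to the mean-field energy. -/
lemma exists_scf_tail_le (he : IsExchangeCorrelation e) {ρ : Space → ℝ} (hρ : IsDensity ρ) (M : ℝ)
    {ε : ℝ} (hε : 0 < ε) : ∃ R₀ : ℕ, ∀ R : ℕ, R₀ ≤ R → ∀ u ∈ H1, ‖u‖ ≤ M → gr u ≤ M →
      |∫ x, scf e ρ x * (sinCut R x ^ 2 * ‖u x‖ ^ 2)| ≤ ε := by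
  set B := M ^ 2 + √(gnConst * (M * M ^ 3)) with hB
  have hB0 : 0 ≤ B := by positivity
  set δ := ε / (2 * (2 * B + 1)) with hδ
  have hδ0 : 0 < δ := by positivity
  obtain ⟨C, hC0, hC⟩ := he.abs_vXC_le_small hδ0
  obtain ⟨S, hS⟩ := exists_vHartree_le_far hρ hδ0
  -- Far out, the Hartree potential is below δ and the exchange-correlation potential below δ + Cρ.
  -- The latter is paired with the L² tail of ρ, made small here.
  obtain ⟨R₀, hR₀⟩ := eventually_atTop.1 (((tendsto_nrm2_tail hρ).eventually_le_const
    (show 0 < ε / (2 * (C * B + 1)) by positivity)).and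
    (tendsto_natCast_atTop_atTop.eventually_ge_atTop (S + 1)))
  refine ⟨R₀, fun R hR u hu hn hg => ?_⟩
  obtain ⟨r1, r2⟩ := hR₀ R hR
  have hs := (isMultiplier_sinCut (R : ℝ)).isBddMeas
  have hu2 := isDensity_norm_sq hu
  have hf := hu2.sq_mul hs
  have hT : MeasurableSet {x : Space | (R : ℝ) ≤ jb x} :=
    measurableSet_le measurable_const continuous_jb.measurable
  have hρT : IsL12 ({x | (R : ℝ) ≤ jb x}.indicator ρ) :=
    hρ.l12.mono (hρ.meas.indicator hT).aestronglyMeasurable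
      (Eventually.of_forall fun x => by
        simpa only [Real.norm_eq_abs] using norm_indicator_le_norm_self ρ x)
  have hfn : nrm (fun x => sinCut R x ^ 2 * ‖u x‖ ^ 2) ≤ B := by
    refine (nrm_mono hf.l12 hu2.l12 fun x => ?_).trans (nrm_norm_sq_le hu hn hg)
    rw [abs_mul, abs_of_nonneg (sq_nonneg (sinCut R x)), ← sq_abs]
    exact mul_le_of_le_one_left (abs_nonneg _) (pow_le_one₀ (abs_nonneg _) (abs_sinCut_le _ x))
  refine (abs_integral_le_of_abs_le (A := 2 * δ) (C := C) hρT hf.l12 hC0 fun x => ?_).trans ?_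
  · by_cases h0 : sinCut R x = 0
    · rw [h0]; simp
    have h1 := sinCut_ne_zero h0
    have h2 : (R : ℝ) ≤ jb x := by
      by_contra! h3
      exact h0 (sinCut_eq_zero h3.le)
    rw [indicator_of_mem (show x ∈ {x | (R : ℝ) ≤ jb x} from h2), abs_mul (scf e ρ x),
      abs_mul (ρ x), abs_of_nonneg (hρ.nonneg x)]
    have h3 : |scf e ρ x| ≤ 2 * δ + C * ρ x := by
      have h4 := hS x (by linarith)
      have h5 := hC (ρ x) (hρ.nonneg x)
      have h6 := abs_add_le (vHartree ρ x) (vXC e (ρ x))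
      rw [abs_of_nonneg (vHartree_nonneg hρ.nonneg x)] at h6
      rw [scf]
      linarith
    have := mul_le_mul_of_nonneg_right h3 (abs_nonneg (sinCut R x ^ 2 * ‖u x‖ ^ 2))
    linarith
  · have q1 : nrm1 (fun x => sinCut R x ^ 2 * ‖u x‖ ^ 2) ≤ B := (nrm1_le_nrm _).trans hfn
    have q2 : nrm2 (fun x => sinCut R x ^ 2 * ‖u x‖ ^ 2) ≤ B := (nrm2_le_nrm _).trans hfn
    have q3 : 2 * δ * nrm1 (fun x => sinCut R x ^ 2 * ‖u x‖ ^ 2) ≤ ε / 2 := by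
      refine (mul_le_mul_of_nonneg_left q1 (by positivity)).trans ?_
      have : 2 * δ * B = ε * (2 * B) / (2 * (2 * B + 1)) := by rw [hδ]; ring
      rw [this, div_le_div_iff₀ (by positivity) (by positivity)]
      nlinarith
    have q4 : C * (nrm2 ({x | (R : ℝ) ≤ jb x}.indicator ρ) *
        nrm2 (fun x => sinCut R x ^ 2 * ‖u x‖ ^ 2)) ≤ ε / 2 := by
      refine (mul_le_mul_of_nonneg_left (mul_le_mul r1 q2 (nrm2_nonneg _) (by positivity))
        hC0).trans ?_
      have : C * (ε / (2 * (C * B + 1)) * B) = ε * (C * B) / (2 * (C * B + 1)) := by ring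
      rw [this, div_le_div_iff₀ (by positivity) (by positivity)]
      nlinarith
    linarith

/-! ### Convergence of the potential part of the excitation energy -/

/-- Tight sequences of functionals pass to the limit along weakly convergent sequences. -/
lemma tendsto_of_tight {T : ℕ → (Space → ℝ) → ℝ} {t : ℝ} {K : ℝ}
    (hadd : ∀ j f g, IsL12 f → IsL12 g → T j (fun x => f x + g x) = T j f + T j g)
    (hlip : ∀ j f g, IsL12 f → IsL12 g → |T j f - T j g| ≤ K * nrm fun x => f x - g x)
    (htight : ∀ M ε, 0 < ε → ∃ R : ℕ, ∀ j, ∀ u ∈ H1, ‖u‖ ≤ M → gr u ≤ M →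
      |T j fun x => sinCut R x ^ 2 * ‖u x‖ ^ 2| ≤ ε)
    {χ : ℕ → L2} {χ₀ : L2} {M : ℝ} (h : WeakH1 χ χ₀ M)
    (hconv : Tendsto (fun j => T j fun x => ‖χ₀ x‖ ^ 2) atTop (𝓝 t)) :
    Tendsto (fun j => T j fun x => ‖χ j x‖ ^ 2) atTop (𝓝 t) := by
  suffices hs : Tendsto (fun j => (T j fun x => ‖χ j x‖ ^ 2) - T j fun x => ‖χ₀ x‖ ^ 2) atTop
      (𝓝 0) by
    simpa using hs.add hconv
  rw [Metric.tendsto_atTop']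
  intro ε hε
  set M₁ := max M (max ‖χ₀‖ (gr χ₀)) with hM₁
  -- Tightness removes the outer parts of both the sequence and its weak limit. The inner parts
  -- converge strongly and are compared by the Lipschitz bound.
  obtain ⟨R, hR⟩ := htight M₁ (ε / 4) (by positivity)
  obtain ⟨M', hMM, hM'⟩ := exists_gr_cut_le M
  have hs := (isMultiplier_sinCut (R : ℝ)).isBddMeas
  have hk := (isMultiplier_cosCut (R : ℝ)).isBddMeas
  have hlim := tendsto_nrm_sq_sub
    (fun j => H1_mul (h.mem j) (isMultiplier_cosCut (R : ℝ)))
    (H1_mul h.limit_mem (isMultiplier_cosCut (R : ℝ)))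
    (fun j => (hM' R _ (h.mem j) (h.norm_le j) (h.gr_le j)).1)
    (h.tendsto_mulL2 hk (vanishesOff_cosCut R))
  have hlim' := hlim.const_mul K
  rw [mul_zero] at hlim'
  obtain ⟨N, hN⟩ := eventually_atTop.1 (hlim'.eventually_lt_const (show 0 < ε / 4 by positivity))
  refine ⟨N, fun j hj => ?_⟩
  have hNj := hN j hj.le
  have hsplit : ∀ u ∈ H1, (T j fun x => ‖u x‖ ^ 2) =
      (T j fun x => ‖mulL2 (cosCut R) u x‖ ^ 2) + T j fun x => sinCut R x ^ 2 * ‖u x‖ ^ 2 := by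
    intro u hu
    have hc := isL12_norm_sq (H1_mul hu (isMultiplier_cosCut (R : ℝ)))
    have hsu := ((isDensity_norm_sq hu).sq_mul hs).l12
    rw [← hadd j _ _ hc hsu]
    -- The Lipschitz bound makes the functional blind to null sets, so the almost everywhere
    -- splitting of |u|² may be inserted.
    have h1 := hlip j _ _ (isL12_norm_sq hu) (hc.add hsu)
    have h2 : nrm (fun x => ‖u x‖ ^ 2 -
        (‖mulL2 (cosCut R) u x‖ ^ 2 + sinCut R x ^ 2 * ‖u x‖ ^ 2)) = 0 := by
      have h3 : (fun x => ‖u x‖ ^ 2 -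
          (‖mulL2 (cosCut R) u x‖ ^ 2 + sinCut R x ^ 2 * ‖u x‖ ^ 2)) =ᵐ[volume] fun _ => 0 := by
        filter_upwards [mulL2_ae hk u] with x hx
        rw [hx, norm_mul, Complex.norm_real, Real.norm_eq_abs, mul_pow, sq_abs, ← add_mul,
          sq_cosCut_add, one_mul, sub_self]
      rw [nrm, nrm1_congr h3, nrm2_congr h3]
      simp [nrm1, nrm2]
    rw [h2, mul_zero] at h1
    exact sub_eq_zero.1 (abs_nonpos_iff.1 h1)
  rw [Real.dist_eq, sub_zero, hsplit _ (h.mem j), hsplit _ h.limit_mem]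
  have h1 := (hlip j _ _ (isL12_norm_sq (H1_mul (h.mem j) (isMultiplier_cosCut (R : ℝ))))
    (isL12_norm_sq (H1_mul h.limit_mem (isMultiplier_cosCut (R : ℝ))))).trans hNj.le
  have h2 := hR j (χ j) (h.mem j) ((h.norm_le j).trans (le_max_left _ _))
    ((h.gr_le j).trans (le_max_left _ _))
  have h3 := hR j χ₀ h.limit_mem ((le_max_left _ _).trans (le_max_right _ _))
    ((le_max_right _ _).trans (le_max_right _ _))
  rw [abs_le] at h1 h2 h3
  rw [abs_lt]
  constructor <;> linarith

/-- Convergence of nuclear charge distributions, tested against Coulomb potentials. -/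
def NucTendsto (μs : ℕ → Measure Space) (μ : Measure Space) : Prop :=
  ∀ f : Space → ℝ, IsL12 f →
    Tendsto (fun j => ∫ x, vHartree f x ∂μs j) atTop (𝓝 (∫ x, vHartree f x ∂μ))

lemma integral_vHartree_sub (μ : Measure Space) [IsFiniteMeasure μ] {f g : Space → ℝ}
    (hf : IsL12 f) (hg : IsL12 g) : (∫ x, vHartree f x ∂μ) - ∫ x, vHartree g x ∂μ =
      ∫ x, vHartree (fun y => f y - g y) x ∂μ := by
  rw [← integral_sub (integrable_vHartree μ hf) (integrable_vHartree μ hg)]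
  exact integral_congr_ae (Eventually.of_forall fun x => (vHartree_sub hf hg x).symm)

/-- Tightness comes from the decay of the Coulomb kernel away from the common ball carrying the
nuclei. Charges and wave functions may vary simultaneously. -/
lemma NucTendsto.tendsto_integral {μs : ℕ → Measure Space} [∀ j, IsFiniteMeasure (μs j)]
    {μ : Measure Space} {Z L : ℝ} (hm : ∀ j, (μs j).real univ ≤ Z) (hL : ∀ j, InBall L (μs j))
    (h : NucTendsto μs μ) {χ : ℕ → L2} {χ₀ : L2} {M : ℝ} (hχ : WeakH1 χ χ₀ M) :
    Tendsto (fun j => ∫ x, vHartree (fun y => ‖χ j y‖ ^ 2) x ∂μs j) atTop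
      (𝓝 (∫ x, vHartree (fun y => ‖χ₀ y‖ ^ 2) x ∂μ)) := by
  have hZ : 0 ≤ Z := measureReal_nonneg.trans (hm 0)
  have hp := potConst_pos
  refine tendsto_of_tight (T := fun j f => ∫ x, vHartree f x ∂μs j) (K := Z * potConst)
    (fun j f g hf hg => integral_vHartree_add (μs j) hf hg) (fun j f g hf hg => ?_)
    (fun M ε hε => ?_) hχ (h _ (isL12_norm_sq hχ.limit_mem))
  · rw [integral_vHartree_sub _ hf hg]
    refine (abs_integral_vHartree_le _ (hf.sub hg)).trans ?_
    rw [mul_assoc]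
    exact mul_le_mul_of_nonneg_right (hm j) (mul_nonneg hp.le (nrm_nonneg _))
  · have ht : Tendsto (fun R : ℕ => Z * (M ^ 2 / ((R : ℝ) - 1 - L))) atTop (𝓝 (Z * 0)) :=
      (((tendsto_atTop_add_const_right _ (-1 - L) tendsto_natCast_atTop_atTop).const_div_atTop
        (M ^ 2)).congr fun R => by congr 1; ring).const_mul Z
    rw [mul_zero] at ht
    obtain ⟨R, hR1, hR2⟩ := ((ht.eventually_le_const hε).and
      (tendsto_natCast_atTop_atTop.eventually_gt_atTop (L + 1))).exists
    refine ⟨R, fun j u hu hn hg => ?_⟩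
    have hs := (isMultiplier_sinCut (R : ℝ)).isBddMeas
    have hd := isDensity_norm_sq hu
    rw [abs_of_nonneg (integral_nonneg fun x => vHartree_nonneg (hd.sq_mul hs).nonneg x)]
    have hR0 : 0 < (R : ℝ) - 1 - L := by linarith
    refine (integral_vHartree_sinCut_le (hL j) hd hR2).trans (le_trans ?_ hR1)
    have h1 : nrm1 (fun x => sinCut R x ^ 2 * ‖u x‖ ^ 2) ≤ M ^ 2 := by
      refine (nrm1_sq_mul_le hd hs (abs_sinCut_le _)).trans ?_
      rw [nrm1_of_nonneg hd.nonneg, ← norm_sq_eq_integral]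
      exact pow_le_pow_left₀ (norm_nonneg _) hn 2
    have h2 := nrm1_nonneg (fun x => sinCut R x ^ 2 * ‖u x‖ ^ 2)
    exact mul_le_mul (hm j) (div_le_div_of_nonneg_right h1 hR0.le) (by positivity) hZ

/-- The electronic potential is small far out in the sense of `exists_scf_tail_le`, which makes its
quadratic form weakly continuous. -/
lemma tendsto_integral_scf (he : IsExchangeCorrelation e) {ρ : Space → ℝ} (hρ : IsDensity ρ)
    {χ : ℕ → L2} {χ₀ : L2} {M : ℝ} (hχ : WeakH1 χ χ₀ M) :
    Tendsto (fun j => ∫ x, scf e ρ x * ‖χ j x‖ ^ 2) atTop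
      (𝓝 (∫ x, scf e ρ x * ‖χ₀ x‖ ^ 2)) := by
  obtain ⟨K, hK0, hK⟩ := exists_abs_integral_scf_le he (nrm ρ)
  refine tendsto_of_tight (T := fun _ f => ∫ x, scf e ρ x * f x) (K := K)
    (fun j f g hf hg => ?_) (fun j f g hf hg => ?_) (fun M ε hε => ?_) hχ tendsto_const_nhds
  · rw [← integral_add (integrable_scf_mul he hρ hf) (integrable_scf_mul he hρ hg)]
    simp only [mul_add]
  · rw [← integral_sub (integrable_scf_mul he hρ hf) (integrable_scf_mul he hρ hg)]
    simp only [← mul_sub]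
    exact hK ρ _ hρ le_rfl (hf.sub hg)
  · obtain ⟨R, hR⟩ := exists_scf_tail_le he hρ M hε
    exact ⟨R, fun _ => hR R le_rfl⟩

/-- The Hartree part is Lipschitz in the density. For the merely continuous exchange-correlation
potential, `exists_vXC_sub_le` leaves a uniformly small error plus a multiple of the density
difference. -/
lemma tendsto_integral_scf_sub (he : IsExchangeCorrelation e) {ρs : ℕ → Space → ℝ}
    {ρ : Space → ℝ} (hρs : ∀ j, IsDensity (ρs j)) (hρ : IsDensity ρ)
    (h : Tendsto (fun j => nrm fun x => ρs j x - ρ x) atTop (𝓝 0)) {f : ℕ → Space → ℝ} {B : ℝ}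
    (hf : ∀ j, IsDensity (f j)) (hB : ∀ j, nrm (f j) ≤ B) :
    Tendsto (fun j => (∫ x, scf e (ρs j) x * f j x) - ∫ x, scf e ρ x * f j x) atTop (𝓝 0) := by
  have hB0 : 0 ≤ B := (nrm_nonneg _).trans (hB 0)
  have hp := potConst_pos
  rw [Metric.tendsto_atTop']
  intro ε hε
  set X := B + (2 * nrm ρ + 1) * B with hX
  have hn := nrm_nonneg ρ
  have hX0 : 0 ≤ X := by positivity
  set δ := ε / (2 * (X + 1)) with hδ
  have hδ0 : 0 < δ := by positivity
  obtain ⟨C, hC0, hC⟩ := he.exists_vXC_sub_le hδ0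
  have h1 := h.mul_const ((potConst + C) * B)
  rw [zero_mul] at h1
  obtain ⟨N, hN⟩ := eventually_atTop.1 ((h1.eventually_lt_const (show 0 < ε / 2 by positivity)).and
    (h.eventually_lt_const one_pos))
  refine ⟨N, fun j hj => ?_⟩
  obtain ⟨n1, n2⟩ := hN j hj.le
  set D := nrm fun x => ρs j x - ρ x with hD
  have hD0 : 0 ≤ D := nrm_nonneg _
  have hd := (hρs j).l12.sub hρ.l12
  have hsum : IsL12 fun x => δ * (ρs j x + ρ x) + C * |ρs j x - ρ x| :=
    (((hρs j).l12.add hρ.l12).const_mul δ).add (hd.abs.const_mul C)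
  have hρsn : nrm (ρs j) ≤ nrm ρ + 1 := by
    have := nrm_add_le hd hρ.l12
    simp only [sub_add_cancel] at this
    linarith
  have hsn : nrm2 (fun x => δ * (ρs j x + ρ x) + C * |ρs j x - ρ x|) ≤
      δ * (2 * nrm ρ + 1) + C * D := by
    refine (nrm2_le_nrm _).trans ((nrm_add_le (((hρs j).l12.add hρ.l12).const_mul δ)
      (hd.abs.const_mul C)).trans ?_)
    rw [nrm_const_mul, nrm_const_mul, abs_of_pos hδ0, abs_of_nonneg hC0]
    have q1 := nrm_add_le (hρs j).l12 hρ.l12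
    have q2 : nrm (fun x => |ρs j x - ρ x|) ≤ D := nrm_mono hd.abs hd fun x => by rw [abs_abs]
    gcongr
    linarith
  rw [Real.dist_eq, sub_zero, ← integral_sub (integrable_scf_mul he (hρs j) (hf j).l12)
    (integrable_scf_mul he hρ (hf j).l12)]
  simp only [← sub_mul]
  refine (abs_integral_le_of_abs_le (A := potConst * D + δ) (C := 1) hsum (hf j).l12 zero_le_one
    fun x => ?_).trans_lt ?_
  · rw [abs_mul, abs_mul, abs_of_nonneg ((hf j).nonneg x)]
    have h2 := hC _ _ ((hρs j).nonneg x) (hρ.nonneg x)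
    have h3 := abs_vHartree_le_nrm hd x
    rw [vHartree_sub (hρs j).l12 hρ.l12] at h3
    have h4 : |scf e (ρs j) x - scf e ρ x| ≤ |vHartree (ρs j) x - vHartree ρ x| +
        |vXC e (ρs j x) - vXC e (ρ x)| := by
      rw [scf, scf, add_sub_add_comm]
      exact abs_add_le _ _
    have h5 := le_abs_self (δ * (ρs j x + ρ x) + C * |ρs j x - ρ x|)
    have h6 : |scf e (ρs j) x - scf e ρ x| ≤ potConst * D + δ +
        abs (δ * (ρs j x + ρ x) + C * |ρs j x - ρ x|) := by
      linarith
    have := mul_le_mul_of_nonneg_right h6 ((hf j).nonneg x)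
    linarith
  · have q1 : nrm1 (f j) ≤ B := (nrm1_le_nrm _).trans (hB j)
    have q2 : nrm2 (f j) ≤ B := (nrm2_le_nrm _).trans (hB j)
    have q3 : (potConst * D + δ) * nrm1 (f j) ≤ (potConst * D + δ) * B := by gcongr
    have q4 := mul_le_mul hsn q2 (nrm2_nonneg _) (by positivity)
    have q5 : δ * X ≤ ε / 2 := by
      have : δ * X = ε * X / (2 * (X + 1)) := by rw [hδ]; ring
      rw [this, div_le_div_iff₀ (by positivity) (by positivity)]
      nlinarith
    have q6 : (potConst * D + δ) * B + (δ * (2 * nrm ρ + 1) + C * D) * B =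
        D * ((potConst + C) * B) + δ * X := by rw [hX]; ring
    linarith

/-- Convergence of the potential part of the excitation energy. -/
lemma NucTendsto.tendsto_excPot (he : IsExchangeCorrelation e) {μs : ℕ → Measure Space}
    [∀ j, IsFiniteMeasure (μs j)] {μ : Measure Space} {Z L : ℝ}
    (hm : ∀ j, (μs j).real univ ≤ Z) (hL : ∀ j, InBall L (μs j)) (h : NucTendsto μs μ)
    {ρs : ℕ → Space → ℝ} {ρ : Space → ℝ} (hρs : ∀ j, IsDensity (ρs j)) (hρ : IsDensity ρ)
    (hρt : Tendsto (fun j => nrm fun x => ρs j x - ρ x) atTop (𝓝 0))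
    {χ : ℕ → L2} {χ₀ : L2} {M : ℝ} (hχ : WeakH1 χ χ₀ M) :
    Tendsto (fun j => excPot e (μs j) (ρs j) fun x => ‖χ j x‖ ^ 2) atTop
      (𝓝 (excPot e μ ρ fun x => ‖χ₀ x‖ ^ 2)) := by
  have h1 := h.tendsto_integral hm hL hχ
  have h2 := tendsto_integral_scf he hρ hχ
  have h3 := tendsto_integral_scf_sub he hρs hρ hρt (fun j => isDensity_norm_sq (hχ.mem j))
    fun j => nrm_norm_sq_le (hχ.mem j) (hχ.norm_le j) (hχ.gr_le j)
  have h4 := h1.neg.add (h3.add h2)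
  simpa only [excPot, sub_add_cancel, zero_add] using h4

/-! ### States of negative excitation energy -/

/-- Nuclei are at distance at most L + b and attract. Electrons within S + 1 are at distance at
least a - (S + 1), and those outside are few and feel at most B. The exchange-correlation potential
is nonpositive and is dropped. -/
lemma excitationEnergy_le_of_annulus (he : IsExchangeCorrelation e) {μ : Measure Space}
    [IsFiniteMeasure μ] {L : ℝ} (hμ : InBall L μ) {ρ : Space → ℝ} (hρ : IsDensity ρ) {χ : L2}
    (hχ : χ ∈ H1) (h1 : ‖χ‖ = 1) {a b B : ℝ} {S : ℕ}
    (hab : ∀ᵐ y, χ y ≠ 0 → a ≤ ‖y‖ ∧ ‖y‖ ≤ b) (hL : L < a) (hS : S + 1 < a)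
    (hB : ∀ x, vHartree (fun x => ‖χ x‖ ^ 2) x ≤ B) :
    excitationEnergy e μ ρ χ ≤ 1 / 2 * gradNormSq χ - μ.real univ * (1 / (L + b)) +
      nrm1 ρ / (a - (S + 1)) + B * nrm1 (fun x => sinCut S x ^ 2 * ρ x) := by
  have hA : MeasurableSet {y : Space | a ≤ ‖y‖ ∧ ‖y‖ ≤ b} :=
    (measurableSet_le measurable_const measurable_norm).inter
      (measurableSet_le measurable_norm measurable_const)
  set g := {y : Space | a ≤ ‖y‖ ∧ ‖y‖ ≤ b}.indicator fun x => ‖χ x‖ ^ 2 with hg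
  have hgd : IsDensity g := (isDensity_norm_sq hχ).indicator hA
  have hgχ : (fun x => ‖χ x‖ ^ 2) =ᵐ[volume] g := by
    filter_upwards [hab] with y hy
    by_cases h : y ∈ {y : Space | a ≤ ‖y‖ ∧ ‖y‖ ≤ b}
    · rw [hg, indicator_of_mem h]
    · rw [hg, indicator_of_notMem h]
      have : χ y = 0 := by
        by_contra h0
        exact h (hy h0)
      rw [this]; simp
  have hg0 : ∀ y, g y ≠ 0 → a ≤ ‖y‖ ∧ ‖y‖ ≤ b := fun y hy => by
    have : y ∈ {y : Space | a ≤ ‖y‖ ∧ ‖y‖ ≤ b} := mem_of_indicator_ne_zero hy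
    exact this
  have hg1 : nrm1 g = 1 := by
    rw [← nrm1_congr hgχ, nrm1_of_nonneg fun x => sq_nonneg _, ← norm_sq_eq_integral, h1, one_pow]
  have hs := (isMultiplier_sinCut (S : ℝ)).isBddMeas
  have hk := (isMultiplier_cosCut (S : ℝ)).isBddMeas
  rw [excitationEnergy_eq he μ hρ hχ, excPot_congr e μ ρ hgχ, excPot]
  have q1 := le_integral_vHartree_of_near hμ hgd (d := L + b) fun x y hx hy => by
    obtain ⟨y1, y2⟩ := hg0 y hy
    have h2 := norm_sub_norm_le y x
    have h3 := norm_sub_le x y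
    rw [norm_sub_rev] at h2
    constructor <;> linarith
  rw [hg1] at q1
  have q2 : ∫ x, scf e ρ x * g x ≤ coul g ρ := by
    refine integral_mono (integrable_scf_mul he hρ hgd.l12)
      (integrable_mul_vHartree hgd.l12.int hρ.l12) fun x => ?_
    have := mul_nonpos_of_nonneg_of_nonpos (hgd.nonneg x) (he.deriv_nonpos _ (hρ.nonneg x))
    simp only [scf]
    linarith
  have q3 : coul g ρ = coul (fun x => cosCut S x ^ 2 * ρ x) g +
      coul (fun x => sinCut S x ^ 2 * ρ x) g := by
    rw [← coul_add_left (hρ.sq_mul hk).l12 (hρ.sq_mul hs).l12 hgd.l12, coul_comm hgd.l12 hρ.l12]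
    simp only [← add_mul, sq_cosCut_add, one_mul]
  have q4 : coul (fun x => cosCut S x ^ 2 * ρ x) g ≤ nrm1 ρ / (a - (S + 1)) := by
    have hd : 0 < a - (S + 1) := by linarith
    refine (coul_le_of_far (hρ.sq_mul hk) hgd hd fun x y hx hy => ?_).trans ?_
    · have h2 : ‖x‖ ≤ S + 1 := by
        by_contra! h3
        exact hx (by rw [vanishesOff_cosCut S x h3]; ring)
      have h3 := norm_sub_norm_le y x
      rw [norm_sub_rev] at h3
      linarith [(hg0 y hy).1]
    · rw [hg1, mul_one]
      exact div_le_div_of_nonneg_right (nrm1_sq_mul_le hρ hk (abs_cosCut_le _)) hd.le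
  have q5 : coul (fun x => sinCut S x ^ 2 * ρ x) g ≤
      B * nrm1 (fun x => sinCut S x ^ 2 * ρ x) := by
    rw [nrm1_of_nonneg (hρ.sq_mul hs).nonneg, mul_comm, ← integral_mul_const]
    refine integral_mono (integrable_mul_vHartree (hρ.sq_mul hs).l12.int hgd.l12)
      ((hρ.sq_mul hs).l12.int.mul_const B) fun x => ?_
    have := hB x
    rw [vHartree_congr hgχ] at this
    exact mul_le_mul_of_nonneg_left this ((hρ.sq_mul hs).nonneg x)
  linarith

lemma gr_comb_le {n : ℕ} {A : Fin n → L2} (hA : ∀ k, A k ∈ H1) {g : ℝ} (hg : ∀ k, gr (A k) ≤ g)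
    (c : Fin n → ℂ) : gr (comb A c) ≤ g * ∑ k, ‖c k‖ := by
  classical
  unfold comb
  rw [Finset.mul_sum]
  induction (Finset.univ : Finset (Fin n)) using Finset.induction_on with
  | empty => simp [gr, gradNormSq_zero]
  | insert a s ha ih =>
    rw [Finset.sum_insert ha, Finset.sum_insert ha]
    refine (gr_add_le (H1_smul _ (hA a)) (H1_sum s fun k => H1_smul _ (hA k))).trans
      (add_le_add ?_ ih)
    rw [gr_smul _ (hA a), mul_comm]
    exact mul_le_mul_of_nonneg_right (hg a) (norm_nonneg _)

lemma comb_add {n : ℕ} (A : Fin n → L2) (c d : Fin n → ℂ) :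
    comb A (c + d) = comb A c + comb A d := by
  simp [comb, add_smul, Finset.sum_add_distrib]

lemma comb_smul {n : ℕ} (A : Fin n → L2) (r : ℂ) (c : Fin n → ℂ) :
    comb A (r • c) = r • comb A c := by
  simp [comb, smul_smul, Finset.smul_sum]

/-- Among normalized combinations of `n + 1` orthonormal functions there is one which is orthogonal
to `n` given functions. -/
lemma exists_comb_orthogonal {n : ℕ} (Φ : Fin n → L2) {u : Fin (n + 1) → L2}
    (hu : Orthonormal ℂ u) : ∃ c, csq c = 1 ∧ ‖comb u c‖ = 1 ∧ ∀ k, inner ℂ (Φ k) (comb u c) = 0 := by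
  let T : (Fin (n + 1) → ℂ) →ₗ[ℂ] (Fin n → ℂ) :=
    { toFun := fun c k => inner ℂ (Φ k) (comb u c)
      map_add' := fun c d => by
        ext k; rw [comb_add, inner_add_right]; rfl
      map_smul' := fun r c => by
        ext k; rw [comb_smul, inner_smul_right]; rfl }
  obtain ⟨c, hc, hc0⟩ := Submodule.exists_mem_ne_zero_of_ne_bot
    (LinearMap.ker_ne_bot_of_finrank_lt (f := T) (by simp))
  have hpos : 0 < csq c := by
    obtain ⟨k, hk⟩ := Function.ne_iff.1 hc0
    have h1 : ‖c k‖ ^ 2 ≤ csq c := Finset.single_le_sum (f := fun k => ‖c k‖ ^ 2)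
      (fun _ _ => sq_nonneg _) (Finset.mem_univ k)
    have h2 := norm_pos_iff.2 hk
    have : 0 < ‖c k‖ ^ 2 := by positivity
    linarith
  have hnorm : csq (((√(csq c))⁻¹ : ℂ) • c) = 1 := by
    have h1 : csq (((√(csq c))⁻¹ : ℂ) • c) = ‖((√(csq c))⁻¹ : ℂ)‖ ^ 2 * csq c := by
      simp only [csq, Pi.smul_apply, smul_eq_mul, norm_mul, mul_pow, ← Finset.mul_sum]
    rw [h1, norm_inv, Complex.norm_real, Real.norm_eq_abs, inv_pow, sq_abs, Real.sq_sqrt hpos.le]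
    exact inv_mul_cancel₀ hpos.ne'
  refine ⟨_, hnorm, ?_, fun k => ?_⟩
  · have := norm_comb_sq_of_orthonormal hu (((√(csq c))⁻¹ : ℂ) • c)
    rw [hnorm] at this
    exact (pow_eq_one_iff_of_nonneg (norm_nonneg _) two_ne_zero).1 this
  · have : T (((√(csq c))⁻¹ : ℂ) • c) = 0 := by rw [map_smul, LinearMap.mem_ker.1 hc, smul_zero]
    exact congrFun this k

/-- Spread-out orthonormal functions supported in an annulus. -/
lemma exists_spread_orthonormal (n : ℕ) : ∃ G, 0 ≤ G ∧ ∀ κ σ : ℝ, 1 ≤ κ → 0 < σ →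
    ∃ u : Fin n → L2, Orthonormal ℂ u ∧ (∀ k, gr (u k) ≤ G / σ) ∧
      ∀ k, SuppIn {y | (κ - 1) * σ ≤ ‖y‖ ∧ ‖y‖ ≤ (κ + 3 * n) * σ} (u k) := by
  obtain ⟨K, hK0, hK⟩ := exists_lump
  refine ⟨√K, Real.sqrt_nonneg _, fun κ σ hκ hσ => ?_⟩
  obtain ⟨f, hf, hf1, hfg, -⟩ := hK σ hσ
  -- The centres lie on a ray with spacing 3σ, so balls of radius σ around them are disjoint.
  set z : Fin n → Space := fun k => EuclideanSpace.single 0 ((κ + 3 * (k : ℝ)) * σ) with hz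
  have hzn : ∀ k, ‖z k‖ = (κ + 3 * (k : ℝ)) * σ := fun k => by
    have : 0 ≤ (κ + 3 * (k : ℝ)) * σ := by positivity
    rw [hz, PiLp.norm_single, Real.norm_eq_abs, abs_of_nonneg this]
  have hsupp : ∀ k, SuppIn (Metric.closedBall (z k) σ) (tr (z k) f) := fun k => hf.tr _
  refine ⟨fun k => tr (z k) f, ⟨fun k => ?_, fun k l hkl => ?_⟩, fun k => ?_, fun k => ?_⟩
  · rw [LinearIsometry.norm_map, hf1]
  · refine inner_eq_zero_of_disjoint (Metric.closedBall_disjoint_closedBall ?_)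
      (hsupp k).off (hsupp l).off
    have h1 : dist (z k) (z l) = |(κ + 3 * (k : ℝ)) * σ - (κ + 3 * (l : ℝ)) * σ| := by
      simp [hz, Real.dist_eq]
    have h2 : (κ + 3 * (k : ℝ)) * σ - (κ + 3 * (l : ℝ)) * σ = 3 * σ * ((k : ℝ) - l) := by ring
    have h3 : (1 : ℝ) ≤ |(k : ℝ) - l| := by
      have h4 : ((k : ℕ) : ℤ) - (l : ℕ) ≠ 0 := by
        rw [sub_ne_zero]
        exact_mod_cast Fin.val_ne_of_ne hkl
      exact_mod_cast Int.one_le_abs h4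
    rw [h1, h2, abs_mul, abs_of_pos (by positivity)]
    nlinarith
  · rw [gr_tr hf.mem, gr, ← Real.sqrt_sq hσ.le, ← Real.sqrt_div hK0.le]
    exact Real.sqrt_le_sqrt hfg
  · refine (hsupp k).mono fun y hy => ?_
    rw [Metric.mem_closedBall, dist_eq_norm] at hy
    have h1 := norm_sub_norm_le (z k) y
    rw [norm_sub_rev] at h1
    have h2 := norm_sub_norm_le y (z k)
    rw [hzn] at h1 h2
    have h3 : ((k : ℕ) : ℝ) + 1 ≤ n := by exact_mod_cast k.2
    have h4 : 0 ≤ ((k : ℕ) : ℝ) := Nat.cast_nonneg _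
    constructor <;> nlinarith

/-- If the nuclear charge exceeds the number of electrons, there are states of negative excitation
energy orthogonal to the occupied orbitals. -/
lemma exists_lumoAdmissible_neg (he : IsExchangeCorrelation e) {n : ℕ} {Z : ℝ}
    (hZ : 2 * (n : ℝ) < Z) {μ : Measure Space} [IsFiniteMeasure μ] {L : ℝ} (hμ : InBall L μ)
    (hμZ : μ.real univ = Z) {Φ : Fin n → L2} (hΦ : Φ ∈ ksAdmissible n) :
    ∃ χ ∈ lumoAdmissible Φ, excitationEnergy e μ (density Φ) χ < 0 := by
  have hZ' : 0 < Z - 2 * n := sub_pos.2 hZ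
  have hn : (0 : ℝ) ≤ n := Nat.cast_nonneg n
  have hZ0 : 0 < Z := by linarith
  obtain ⟨G₀, hG₀, hG⟩ := exists_spread_orthonormal (n + 1)
  set G := G₀ * (n + 1) with hGdef
  have hG0 : 0 ≤ G := by positivity
  -- In units of σ, the nuclei are at distance at most t = κ + 3n + 4 and the inner electrons at
  -- least κ - 2. Attraction wins iff κ (Z - 2n) > 2Z + 2n (3n + 4), and the added 1 makes this
  -- strict.
  set κ : ℝ := (2 * Z + 2 * n * (3 * n + 4) + 1) / (Z - 2 * n) with hκ
  have hκ' : κ * (Z - 2 * n) = 2 * Z + 2 * n * (3 * n + 4) + 1 := div_mul_cancel₀ _ hZ'.ne'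
  have hκ2 : 2 < κ := by
    rw [hκ, lt_div_iff₀ hZ']; nlinarith [mul_nonneg hn hn]
  set t : ℝ := κ + 3 * n + 4 with ht
  have ht0 : 0 < t := by positivity
  set γ : ℝ := Z / t - 2 * n / (κ - 2) with hγ
  have hγ0 : 0 < γ := by
    rw [hγ, sub_pos, div_lt_div_iff₀ (by linarith) ht0, ht]
    nlinarith
  set B := 1 + coulConst * √(gnConst * G ^ 3) with hB
  have hB0 : 0 < B := by have := coulConst_nonneg; positivity
  have hρ := isDensity_density hΦ.1
  obtain ⟨S, hS⟩ := ((tendsto_nrm1_sinCut hρ).eventually_le_const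
    (show 0 < γ / (4 * B) by positivity)).exists
  -- The net attraction is γ/σ. This scale keeps the kinetic energy O(σ⁻²) below a quarter of it;
  -- the choice of S does the same for the outer electrons.
  set σ : ℝ := max 1 (max L (max (S + 1) (4 * G ^ 2 / γ))) with hσ
  have hσ1 : 1 ≤ σ := le_max_left _ _
  have hσL : L ≤ σ := (le_max_left _ _).trans (le_max_right _ _)
  have hσS : S + 1 ≤ σ :=
    (le_max_left _ _).trans ((le_max_right _ _).trans (le_max_right _ _))
  have hσG : 4 * G ^ 2 / γ ≤ σ :=
    (le_max_right _ _).trans ((le_max_right _ _).trans (le_max_right _ _))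
  have hσ0 : 0 < σ := by linarith
  obtain ⟨u, hu1, hu2, hu3⟩ := hG κ σ (by linarith) hσ0
  obtain ⟨c, hc, hc1, hcΦ⟩ := exists_comb_orthogonal Φ hu1
  have hsupp := SuppIn.comb hu3 c
  have hχ := hsupp.mem
  set χ := comb u c with hχdef
  have hck : ∑ k, ‖c k‖ ≤ n + 1 := by
    calc ∑ k, ‖c k‖ ≤ ∑ _k : Fin (n + 1), (1 : ℝ) := Finset.sum_le_sum fun k _ => by
          have h1 : ‖c k‖ ^ 2 ≤ 1 := hc ▸ Finset.single_le_sum (f := fun k => ‖c k‖ ^ 2)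
            (fun _ _ => sq_nonneg _) (Finset.mem_univ k)
          exact (sq_le_one_iff₀ (norm_nonneg _)).1 h1
      _ = n + 1 := by simp
  have hgχ : gr χ ≤ G / σ := by
    refine (gr_comb_le (fun k => (hu3 k).mem) hu2 c).trans ?_
    rw [hGdef, mul_div_right_comm]
    gcongr
  refine ⟨χ, ⟨hχ, hcΦ, hc1⟩, ?_⟩
  have key := excitationEnergy_le_of_annulus he (hμ.mono hσL) hρ hχ hc1
    (a := (κ - 1) * σ) (b := (κ + 3 * ((n + 1 : ℕ) : ℝ)) * σ) (S := S) (B := B / σ)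
    (hsupp.off.mono fun y hy h0 => by
      by_contra h
      exact h0 (hy h)) (by nlinarith) (by nlinarith)
    (vHartree_norm_sq_le hχ hc1 hσ0 hG0 hgχ)
  refine key.trans_lt ?_
  have k1 : 1 / 2 * gradNormSq χ ≤ γ / 4 / σ := by
    rw [← gr_sq]
    have h1 : gr χ ^ 2 ≤ (G / σ) ^ 2 := pow_le_pow_left₀ (gr_nonneg _) hgχ 2
    have h2 : (G / σ) ^ 2 ≤ γ / 4 / σ := by
      rw [div_pow, div_le_div_iff₀ (by positivity) hσ0]
      rw [div_le_iff₀ hγ0] at hσG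
      nlinarith
    have : 0 ≤ gr χ ^ 2 := sq_nonneg _
    linarith
  have k2 : μ.real univ * (1 / (σ + (κ + 3 * ((n + 1 : ℕ) : ℝ)) * σ)) = Z / t / σ := by
    rw [hμZ, ht]; push_cast; field_simp; ring
  have k3 : nrm1 (density Φ) / ((κ - 1) * σ - (S + 1)) ≤ 2 * n / (κ - 2) / σ := by
    have h1 : nrm1 (density Φ) ≤ 2 * n := by
      rw [nrm1_density]; simp [hΦ.2.1]
    rw [div_div]
    have h2 : 0 < (κ - 2) * σ := mul_pos (by linarith) hσ0
    exact div_le_div₀ (by positivity) h1 h2 (by linarith)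
  have k4 : B / σ * nrm1 (fun x => sinCut S x ^ 2 * density Φ x) ≤ γ / 4 / σ := by
    have := mul_le_mul_of_nonneg_left hS (show 0 ≤ B / σ by positivity)
    refine this.trans (le_of_eq ?_)
    field_simp
  rw [k2]
  have k5 : γ / 4 / σ - Z / t / σ + 2 * n / (κ - 2) / σ + γ / 4 / σ = -(γ / 2) / σ := by
    rw [hγ]; ring
  have k6 : -(γ / 2) / σ < 0 := div_neg_of_neg_of_pos (by linarith) hσ0
  linarith

/-! ### Algebra of `H¹` convergence -/

lemma weakPartial_comb {n : ℕ} {A : Fin n → L2} (hA : ∀ k, A k ∈ H1) (c : Fin n → ℂ) (i : Fin 3) :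
    weakPartial i (comb A c) = ∑ k, c k • weakPartial i (A k) := by
  rw [comb, weakPartial_sum i _ fun k => H1_smul _ (hA k)]
  exact Finset.sum_congr rfl fun k _ => weakPartial_smul i _ (hA k)

lemma H1_comb {n : ℕ} {A : Fin n → L2} (hA : ∀ k, A k ∈ H1) (c : Fin n → ℂ) : comb A c ∈ H1 :=
  H1_sum _ fun k => H1_smul _ (hA k)

lemma H1Tendsto.comb {n : ℕ} {A : ℕ → Fin n → L2} {a : Fin n → L2} (hA : ∀ j k, A j k ∈ H1)
    (ha : ∀ k, a k ∈ H1) (h : ∀ k, H1Tendsto (fun j => A j k) (a k)) {c : ℕ → Fin n → ℂ}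
    {c₀ : Fin n → ℂ} (hc : Tendsto c atTop (𝓝 c₀)) :
    H1Tendsto (fun j => KohnSham.comb (A j) (c j)) (KohnSham.comb a c₀) := by
  have hc' := tendsto_pi_nhds.1 hc
  refine ⟨tendsto_finsetSum _ fun k _ => (hc' k).smul (h k).1, fun i => ?_⟩
  simp only [weakPartial_comb ha, fun j => weakPartial_comb (hA j)]
  exact tendsto_finsetSum _ fun k _ => (hc' k).smul ((h k).2 i)

lemma H1Tendsto.const_sub {u : ℕ → L2} {v w : L2} (hu : ∀ j, u j ∈ H1) (hv : v ∈ H1) (hw : w ∈ H1)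
    (h : H1Tendsto u v) : H1Tendsto (fun j => w - u j) (w - v) := by
  refine ⟨tendsto_const_nhds.sub h.1, fun i => ?_⟩
  simp only [weakPartial_sub i hw hv, fun j => weakPartial_sub i hw (hu j)]
  exact tendsto_const_nhds.sub (h.2 i)

lemma H1Tendsto.smul {u : ℕ → L2} {v : L2} (hu : ∀ j, u j ∈ H1) (hv : v ∈ H1)
    (h : H1Tendsto u v) {c : ℕ → ℂ} {c₀ : ℂ} (hc : Tendsto c atTop (𝓝 c₀)) :
    H1Tendsto (fun j => c j • u j) (c₀ • v) := by
  refine ⟨hc.smul h.1, fun i => ?_⟩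
  simp only [weakPartial_smul i _ hv, fun j => weakPartial_smul i (c j) (hu j)]
  exact hc.smul (h.2 i)

lemma H1Tendsto.comp {u : ℕ → L2} {v : L2} (h : H1Tendsto u v) {ns : ℕ → ℕ}
    (hns : Tendsto ns atTop atTop) : H1Tendsto (fun j => u (ns j)) v :=
  ⟨h.1.comp hns, fun i => (h.2 i).comp hns⟩

/-! ### Coercivity and homogeneity of the excitation energy -/

lemma excitationEnergy_smul (he : IsExchangeCorrelation e) (μ : Measure Space) [IsFiniteMeasure μ]
    {ρ : Space → ℝ} (hρ : IsDensity ρ) {χ : L2} (hχ : χ ∈ H1) (c : ℂ) :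
    excitationEnergy e μ ρ (c • χ) = ‖c‖ ^ 2 * excitationEnergy e μ ρ χ := by
  have h : (fun x => ‖(c • χ : L2) x‖ ^ 2) =ᵐ[volume] fun x => ‖c‖ ^ 2 * ‖χ x‖ ^ 2 := by
    filter_upwards [Lp.coeFn_smul c χ] with x hx
    rw [hx, Pi.smul_apply, norm_smul, mul_pow]
  rw [excitationEnergy_eq he μ hρ hχ, excitationEnergy_eq he μ hρ (H1_smul c hχ),
    excPot_congr e μ ρ h, gradNormSq_smul c hχ, excPot, excPot]
  simp only [vHartree_const_mul, integral_const_mul, mul_left_comm (scf e ρ _)]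
  ring

/-- Uniform coercivity of the excitation energy. -/
lemma exists_gradNormSq_le (he : IsExchangeCorrelation e) (B : ℝ) : ∃ C, 0 ≤ C ∧
    ∀ (μ : Measure Space) [IsFiniteMeasure μ] (ρ : Space → ℝ) (χ : L2), μ.real univ ≤ B →
      IsDensity ρ → nrm ρ ≤ B → χ ∈ H1 → ‖χ‖ = 1 →
        gradNormSq χ ≤ 4 * excitationEnergy e μ ρ χ + C := by
  obtain ⟨K, hK0, hK⟩ := exists_abs_excPot_le he B
  set k := K * √gnConst with hk
  have hk0 : 0 ≤ k := by positivity
  refine ⟨4 * K + 256 * k ^ 4, by positivity, fun μ _ ρ χ hμ hρ hB hχ h1 => ?_⟩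
  have h2 := (abs_le.1 (hK μ ρ _ hμ hρ hB (isL12_norm_sq hχ))).1
  have h3 : nrm1 (fun x => ‖χ x‖ ^ 2) = 1 := by
    rw [nrm1_of_nonneg fun x => sq_nonneg _, ← norm_sq_eq_integral, h1, one_pow]
  have h4 := nrm2_norm_sq_le hχ
  -- In this variable the L² norm of the density is O(t³) and the kinetic energy of order t⁴; the
  -- two cases below compare t with 4k.
  set t := √(gr χ) with ht
  have ht0 : 0 ≤ t := Real.sqrt_nonneg _
  have htg : gr χ = t ^ 2 := (Real.sq_sqrt (gr_nonneg χ)).symm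
  rw [h1, one_mul, htg, Real.sqrt_mul gnConst_nonneg, ← pow_mul, mul_comm 2 3, pow_mul,
    Real.sqrt_sq (by positivity)] at h4
  have h5 : K * nrm2 (fun x => ‖χ x‖ ^ 2) ≤ k * t ^ 3 := by
    have := mul_le_mul_of_nonneg_left h4 hK0
    rw [hk]; linarith
  have h6 : k * t ^ 3 ≤ t ^ 4 / 4 + 64 * k ^ 4 := by
    rcases le_total t (4 * k) with h | h
    · have : k * t ^ 3 ≤ k * (4 * k) ^ 3 := by gcongr
      nlinarith [pow_nonneg ht0 4]
    · have : k * t ^ 3 ≤ t / 4 * t ^ 3 := by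
        gcongr
        linarith
      nlinarith [pow_nonneg hk0 4]
  have h7 : gradNormSq χ = t ^ 4 := by rw [← gr_sq, htg]; ring
  have h8 : K * nrm (fun x => ‖χ x‖ ^ 2) = K + K * nrm2 (fun x => ‖χ x‖ ^ 2) := by
    rw [nrm, h3]; ring
  rw [excitationEnergy_eq he μ hρ hχ, h7]
  linarith

/-! ### Limits of Kohn-Sham systems -/

/-- A convergent sequence of nuclear charge distributions and admissible orbitals. -/
structure KSLimit {n : ℕ} (Z L : ℝ) (μs : ℕ → Measure Space) (μ : Measure Space)
    (Φs : ℕ → Fin n → L2) (Φ : Fin n → L2) : Prop where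
  mass : ∀ j, (μs j).real univ = Z
  ball : ∀ j, InBall L (μs j)
  nuc : NucTendsto μs μ
  mem : ∀ j, Φs j ∈ ksAdmissible n
  mem_lim : Φ ∈ ksAdmissible n
  orb : ∀ k, H1Tendsto (fun j => Φs j k) (Φ k)

namespace KSLimit

variable {n : ℕ} {Z L : ℝ} {μs : ℕ → Measure Space} {μ : Measure Space} {Φs : ℕ → Fin n → L2}
  {Φ : Fin n → L2}

lemma comp (h : KSLimit Z L μs μ Φs Φ) {ns : ℕ → ℕ} (hns : Tendsto ns atTop atTop) :
    KSLimit Z L (fun j => μs (ns j)) μ (fun j => Φs (ns j)) Φ where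
  mass _ := h.mass _
  ball _ := h.ball _
  nuc f hf := (h.nuc f hf).comp hns
  mem _ := h.mem _
  mem_lim := h.mem_lim
  orb k := (h.orb k).comp hns

lemma isDensity (h : KSLimit Z L μs μ Φs Φ) (j : ℕ) : IsDensity (density (Φs j)) :=
  isDensity_density (h.mem j).1

lemma isDensity_lim (h : KSLimit Z L μs μ Φs Φ) : IsDensity (density Φ) :=
  isDensity_density h.mem_lim.1

lemma tendsto_density (h : KSLimit Z L μs μ Φs Φ) :
    Tendsto (fun j => nrm fun x => density (Φs j) x - density Φ x) atTop (𝓝 0) := by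
  obtain ⟨M, hM⟩ := H1Tendsto.exists_bound h.orb
  exact tendsto_nrm_density (fun j => (h.mem j).1) h.mem_lim.1 (fun j k => (hM j k).2)
    fun k => (h.orb k).1

lemma exists_nrm_density_le (h : KSLimit Z L μs μ Φs Φ) : ∃ B, ∀ j, nrm (density (Φs j)) ≤ B := by
  obtain ⟨M, hM⟩ := H1Tendsto.exists_bound h.orb
  exact ⟨_, fun j => nrm_density_le (h.mem j).1 (fun k => (hM j k).1) fun k => (hM j k).2⟩

variable [∀ j, IsFiniteMeasure (μs j)]

lemma tendsto_excPot (he : IsExchangeCorrelation e) (h : KSLimit Z L μs μ Φs Φ) {χ : ℕ → L2}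
    {χ₀ : L2} {M : ℝ} (hχ : WeakH1 χ χ₀ M) :
    Tendsto (fun j => excPot e (μs j) (density (Φs j)) fun x => ‖χ j x‖ ^ 2) atTop
      (𝓝 (excPot e μ (density Φ) fun x => ‖χ₀ x‖ ^ 2)) :=
  h.nuc.tendsto_excPot he (fun j => (h.mass j).le) h.ball h.isDensity h.isDensity_lim
    h.tendsto_density hχ

lemma exists_gradNormSq_le (he : IsExchangeCorrelation e) (h : KSLimit Z L μs μ Φs Φ) :
    ∃ C, ∀ j, ∀ χ ∈ lumoAdmissible (Φs j),
      gradNormSq χ ≤ 4 * excitationEnergy e (μs j) (density (Φs j)) χ + C := by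
  obtain ⟨B, hB⟩ := h.exists_nrm_density_le
  obtain ⟨C, -, hC⟩ := KohnSham.exists_gradNormSq_le he (max Z B)
  exact ⟨C, fun j χ hχ => hC _ _ χ ((h.mass j).le.trans (le_max_left _ _)) (h.isDensity j)
    ((hB j).trans (le_max_right _ _)) hχ.1 hχ.2.2⟩

variable [IsFiniteMeasure μ]

lemma tendsto_excitationEnergy (he : IsExchangeCorrelation e) (h : KSLimit Z L μs μ Φs Φ)
    {χ : ℕ → L2} {χ₀ : L2} (hχ : ∀ j, χ j ∈ H1) (hχ₀ : χ₀ ∈ H1) (ht : H1Tendsto χ χ₀) :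
    Tendsto (fun j => excitationEnergy e (μs j) (density (Φs j)) (χ j)) atTop
      (𝓝 (excitationEnergy e μ (density Φ) χ₀)) := by
  obtain ⟨M, hM⟩ := H1Tendsto.exists_bound (n := 1) (Φ := fun j _ => χ j) (Ψ := fun _ => χ₀)
    fun _ => ht
  rw [excitationEnergy_eq he μ h.isDensity_lim hχ₀]
  refine ((ht.gradNormSq.const_mul (1 / 2)).add (h.tendsto_excPot he (M := M)
    ⟨hχ, fun j => (hM j 0).1, fun j => (hM j 0).2, WeakTendsto.of_tendsto ht.1⟩)).congr fun j => ?_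
  rw [excitationEnergy_eq he _ (h.isDensity j) (hχ j)]

/-- Recovery sequences for competitors of the lowest unoccupied orbital. -/
lemma exists_recovery (he : IsExchangeCorrelation e) (h : KSLimit Z L μs μ Φs Φ) {ψ : L2}
    (hψ : ψ ∈ lumoAdmissible Φ) : ∃ ψs : ℕ → L2, (∀ᶠ j in atTop, ψs j ∈ lumoAdmissible (Φs j)) ∧
      Tendsto (fun j => excitationEnergy e (μs j) (density (Φs j)) (ψs j)) atTop
        (𝓝 (excitationEnergy e μ (density Φ) ψ)) := by
  obtain ⟨hψH, hψo, hψ1⟩ := hψ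
  have hm := fun j => (h.mem j).1
  -- The competitor is made orthogonal to the approximating orbitals by subtracting its projection
  -- and normalizing. The coefficients tend to zero, so the correction disappears in H¹.
  set c : ℕ → Fin n → ℂ := fun j k => inner ℂ (Φs j k) ψ with hc
  have hc0 : Tendsto c atTop (𝓝 0) := tendsto_pi_nhds.2 fun k => by
    have := (h.orb k).1.inner (𝕜 := ℂ) (tendsto_const_nhds (x := ψ))
    rwa [hψo k] at this
  have hcH : ∀ j, comb (Φs j) (c j) ∈ H1 := fun j => H1_comb (hm j) _
  have hcomb := H1Tendsto.comb hm h.mem_lim.1 h.orb hc0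
  have hcz : comb Φ 0 = 0 := by simp [comb]
  rw [hcz] at hcomb
  have hw := hcomb.const_sub hcH H1_zero hψH
  rw [sub_zero] at hw
  set w : ℕ → L2 := fun j => ψ - comb (Φs j) (c j) with hwdef
  have hwH : ∀ j, w j ∈ H1 := fun j => H1_sub hψH (hcH j)
  have hwn : Tendsto (fun j => ‖w j‖) atTop (𝓝 1) := hψ1 ▸ hw.1.norm
  have hr : Tendsto (fun j => ((‖w j‖⁻¹ : ℝ) : ℂ)) atTop (𝓝 1) := by
    have := (Complex.continuous_ofReal.tendsto _).comp (hwn.inv₀ one_ne_zero)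
    rw [inv_one, Complex.ofReal_one] at this
    exact this
  have hs := hw.smul hwH hψH hr
  rw [one_smul] at hs
  refine ⟨fun j => ((‖w j‖⁻¹ : ℝ) : ℂ) • w j, ?_,
    h.tendsto_excitationEnergy he (fun j => H1_smul _ (hwH j)) hψH hs⟩
  filter_upwards [hwn.eventually_const_lt one_half_lt_one] with j hj
  refine ⟨H1_smul _ (hwH j), fun k => ?_, ?_⟩
  · rw [inner_smul_right, hwdef, inner_sub_right, comb, (h.mem j).2.inner_right_fintype, sub_self,
      mul_zero]
  · have : 0 < ‖w j‖ := by linarith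
    rw [norm_smul, Complex.norm_real, Real.norm_eq_abs, abs_of_pos (inv_pos.2 this),
      inv_mul_cancel₀ this.ne']

/-- Lower semicontinuity for the lowest unoccupied orbital: negative energies are attained. -/
lemma exists_lumoAdmissible_le (he : IsExchangeCorrelation e) (h : KSLimit Z L μs μ Φs Φ)
    {χ : ℕ → L2} (hχ : ∀ j, χ j ∈ lumoAdmissible (Φs j)) {E : ℝ} (hE : E < 0)
    (hχE : Tendsto (fun j => excitationEnergy e (μs j) (density (Φs j)) (χ j)) atTop (𝓝 E)) :
    ∃ ψ ∈ lumoAdmissible Φ, excitationEnergy e μ (density Φ) ψ ≤ E := by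
  obtain ⟨C, hC⟩ := h.exists_gradNormSq_le he
  obtain ⟨B, hB⟩ := hχE.bddAbove_range
  have hg : ∀ j, gr (χ j) ≤ max 1 √(4 * B + C) := fun j => by
    refine (Real.sqrt_le_sqrt ?_).trans (le_max_right _ _)
    have h1 : excitationEnergy e (μs j) (density (Φs j)) (χ j) ≤ B := hB ⟨j, rfl⟩
    linarith [hC j _ (hχ j)]
  obtain ⟨χ₀, ns, hns, hw⟩ := exists_weakH1_subseq (fun j => (hχ j).1)
    (fun j => (hχ j).2.2.le.trans (le_max_left 1 √(4 * B + C))) hg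
  have hχ₀ := hw.limit_mem
  have hlim := h.comp hns.tendsto_atTop
  have hEs : Tendsto (fun j => excitationEnergy e (μs (ns j)) (density (Φs (ns j))) (χ (ns j)))
      atTop (𝓝 E) := hχE.comp hns.tendsto_atTop
  have horth : ∀ k, inner ℂ (Φ k) χ₀ = 0 := fun k => by
    have h1 : Tendsto (fun j => (inner ℂ (Φ k - Φs (ns j) k) (χ (ns j)) : ℂ)) atTop (𝓝 0) := by
      have h2 := ((hlim.orb k).1.const_sub (Φ k)).norm
      rw [sub_self, norm_zero] at h2
      refine squeeze_zero_norm (fun j => (norm_inner_le_norm _ _).trans ?_) h2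
      rw [(hχ (ns j)).2.2, mul_one]
    refine tendsto_nhds_unique (hw.weak (Φ k)) (h1.congr fun j => ?_)
    rw [inner_sub_left, (hχ (ns j)).2.1 k, sub_zero]
  have hn1 : ‖χ₀‖ ^ 2 ≤ 1 := le_of_forall_pos_le_add fun ε hε => by
    obtain ⟨j, hj⟩ := (hw.weak.norm_sq_lsc hε).exists
    rwa [(hχ (ns j)).2.2, one_pow] at hj
  have hle : excitationEnergy e μ (density Φ) χ₀ ≤ E := le_of_forall_pos_le_add fun ε hε => by
    have h1 := hlim.tendsto_excPot he hw
    have h2 := h1.eventually_const_lt (show excPot e μ (density Φ) (fun x => ‖χ₀ x‖ ^ 2) - ε / 3 <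
      excPot e μ (density Φ) fun x => ‖χ₀ x‖ ^ 2 by linarith)
    have h3 := hEs.eventually_lt_const (show E < E + ε / 3 by linarith)
    obtain ⟨j, j1, j2, j3⟩ := ((hw.gradNormSq_lsc (show 0 < ε / 3 by positivity)).and
      (h2.and h3)).exists
    rw [excitationEnergy_eq he _ (h.isDensity _) (hχ (ns j)).1] at j3
    rw [excitationEnergy_eq he μ h.isDensity_lim hχ₀]
    linarith
  -- The zero function has energy 0, while the energy of the weak limit is at most E < 0.
  have hne : χ₀ ≠ 0 := by
    rintro rfl
    have := excitationEnergy_smul he μ h.isDensity_lim H1_zero 0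
    rw [smul_zero, norm_zero] at this
    linarith
  have hpos : 0 < ‖χ₀‖ := norm_pos_iff.2 hne
  refine ⟨((‖χ₀‖⁻¹ : ℝ) : ℂ) • χ₀, ⟨H1_smul _ hχ₀, fun k => ?_, ?_⟩, ?_⟩
  · rw [inner_smul_right, horth, mul_zero]
  · rw [norm_smul, Complex.norm_real, Real.norm_eq_abs, abs_of_pos (inv_pos.2 hpos),
      inv_mul_cancel₀ hpos.ne']
  -- The factor ‖χ₀‖⁻² is at least 1 and multiplies a negative number, so normalizing a limit that
  -- lost mass only lowers the energy.
  · rw [excitationEnergy_smul he μ h.isDensity_lim hχ₀, Complex.norm_real, Real.norm_eq_abs, sq_abs,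
      inv_pow]
    have h1 : 1 ≤ (‖χ₀‖ ^ 2)⁻¹ := (one_le_inv₀ (by positivity)).2 hn1
    nlinarith

/-- Approximate lowest unoccupied orbitals yield a lowest unoccupied orbital in the limit. -/
lemma exists_isLUMO (he : IsExchangeCorrelation e) (h : KSLimit Z L μs μ Φs Φ)
    (hneg : ∃ ψ ∈ lumoAdmissible Φ, excitationEnergy e μ (density Φ) ψ < 0)
    {χ : ℕ → L2} (hχ : ∀ j, χ j ∈ lumoAdmissible (Φs j)) {δ : ℕ → ℝ} (hδ : Tendsto δ atTop (𝓝 0))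
    (hmin : ∀ j, ∀ ψ ∈ lumoAdmissible (Φs j), excitationEnergy e (μs j) (density (Φs j)) (χ j) ≤
      excitationEnergy e (μs j) (density (Φs j)) ψ + δ j) :
    ∃ ns : ℕ → ℕ, StrictMono ns ∧ ∃ φ, IsLUMO e μ Φ φ ∧
      Tendsto (fun j => excitationEnergy e (μs (ns j)) (density (Φs (ns j))) (χ (ns j))) atTop
        (𝓝 (excitationEnergy e μ (density Φ) φ)) := by
  obtain ⟨C, hC⟩ := h.exists_gradNormSq_le he
  obtain ⟨ψ₀, hψ₀, hψ₀neg⟩ := hneg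
  set t : ℕ → ℝ := fun j => excitationEnergy e (μs j) (density (Φs j)) (χ j) with ht
  have hlow : ∀ j, -C / 4 ≤ t j := fun j => by
    have h1 := hC j _ (hχ j)
    have h2 := gradNormSq_nonneg (χ j)
    change -C / 4 ≤ excitationEnergy e (μs j) (density (Φs j)) (χ j)
    linarith
  -- Recovery sequences transfer the almost minimality of χ_j to every competitor of the limit
  -- problem.
  have hup : ∀ ψ ∈ lumoAdmissible Φ, ∀ ε > 0, ∀ᶠ j in atTop,
      t j < excitationEnergy e μ (density Φ) ψ + ε := by
    intro ψ hψ ε hε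
    obtain ⟨ψs, h1, h2⟩ := h.exists_recovery he hψ
    have h3 := h2.add hδ
    rw [add_zero] at h3
    filter_upwards [h1, h3.eventually_lt_const (lt_add_of_pos_right _ hε)] with j j1 j2
    exact (hmin j _ j1).trans_lt j2
  -- The energies are bounded below by coercivity, and eventually above by 0 because of the negative
  -- state ψ₀.
  obtain ⟨E, -, ns, hns, hE⟩ := tendsto_subseq_of_frequently_bounded
    (Metric.isBounded_Icc (-C / 4) 0) (x := t) ((hup ψ₀ hψ₀
      (-excitationEnergy e μ (density Φ) ψ₀) (by linarith)).mono fun j hj =>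
        ⟨hlow j, by linarith⟩).frequently
  have hEle : ∀ ψ ∈ lumoAdmissible Φ, E ≤ excitationEnergy e μ (density Φ) ψ := fun ψ hψ =>
    le_of_forall_pos_le_add fun ε hε =>
      le_of_tendsto hE ((hns.tendsto_atTop.eventually (hup ψ hψ ε hε)).mono fun _ hj => hj.le)
  obtain ⟨φ, hφ, hφE⟩ := (h.comp hns.tendsto_atTop).exists_lumoAdmissible_le he
    (fun j => hχ (ns j)) ((hEle ψ₀ hψ₀).trans_lt hψ₀neg) hE
  refine ⟨ns, hns, φ, ⟨hφ, fun ψ hψ => hφE.trans (hEle ψ hψ)⟩, ?_⟩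
  rw [le_antisymm hφE (hEle φ hφ)]
  exact hE

/-- Approximate highest occupied orbitals yield a highest occupied orbital in the limit. -/
lemma exists_isHOMO (he : IsExchangeCorrelation e) (h : KSLimit Z L μs μ Φs Φ)
    {χ : ℕ → L2} (hχ : ∀ j, χ j ∈ homoAdmissible (Φs j)) {δ : ℕ → ℝ} (hδ : Tendsto δ atTop (𝓝 0))
    (hmax : ∀ j, ∀ ψ ∈ homoAdmissible (Φs j), excitationEnergy e (μs j) (density (Φs j)) ψ ≤
      excitationEnergy e (μs j) (density (Φs j)) (χ j) + δ j) :
    ∃ ns : ℕ → ℕ, StrictMono ns ∧ ∃ φ, IsHOMO e μ Φ φ ∧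
      Tendsto (fun j => excitationEnergy e (μs (ns j)) (density (Φs (ns j))) (χ (ns j))) atTop
        (𝓝 (excitationEnergy e μ (density Φ) φ)) := by
  have hc : ∀ j, ∃ c, comb (Φs j) c = χ j := fun j =>
    (Submodule.mem_span_range_iff_exists_fun ℂ).1 (hχ j).1
  choose c hc using hc
  have hn : ∀ j, csq (c j) = 1 := fun j => by
    rw [← norm_comb_sq_of_orthonormal (h.mem j).2, hc, (hχ j).2, one_pow]
  have hcb : ∀ j, c j ∈ Metric.closedBall (0 : Fin n → ℂ) 1 := fun j => by
    rw [mem_closedBall_zero_iff, pi_norm_le_iff_of_nonneg zero_le_one]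
    intro k
    have h1 : ‖c j k‖ ^ 2 ≤ 1 := hn j ▸ Finset.single_le_sum (f := fun k => ‖c j k‖ ^ 2)
      (fun _ _ => sq_nonneg _) (Finset.mem_univ k)
    exact (sq_le_one_iff₀ (norm_nonneg _)).1 h1
  -- The unit sphere of coefficients is compact, and the orbitals converge in H¹, so the HOMO
  -- candidates converge strongly.
  obtain ⟨c₀, -, ns, hns, hlim⟩ := tendsto_subseq_of_bounded Metric.isBounded_closedBall hcb
  have hk := h.comp hns.tendsto_atTop
  have hconv := H1Tendsto.comb (fun j => (hk.mem j).1) hk.mem_lim.1 hk.orb hlim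
  have hφH : comb Φ c₀ ∈ H1 := H1_comb h.mem_lim.1 c₀
  have hE := hk.tendsto_excitationEnergy he (fun j => H1_comb (hk.mem j).1 _) hφH hconv
  simp only [Function.comp_apply, hc] at hE hconv
  have hφ1 : ‖comb Φ c₀‖ = 1 := by
    refine tendsto_nhds_unique hconv.1.norm ?_
    simp only [(hχ _).2]
    exact tendsto_const_nhds
  refine ⟨ns, hns, comb Φ c₀, ⟨⟨(Submodule.mem_span_range_iff_exists_fun ℂ).2 ⟨c₀, rfl⟩, hφ1⟩,
    fun ψ hψ => ?_⟩, hE⟩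
  obtain ⟨d, rfl⟩ := (Submodule.mem_span_range_iff_exists_fun ℂ).1 hψ.1
  have hd : csq d = 1 := by
    rw [← norm_comb_sq_of_orthonormal h.mem_lim.2]
    change ‖∑ k, d k • Φ k‖ ^ 2 = 1
    rw [hψ.2, one_pow]
  -- A competitor with coefficients d is approximated by the combinations of the approximating
  -- orbitals with the same coefficients, which are again normalized.
  have hconv' := H1Tendsto.comb (fun j => (hk.mem j).1) hk.mem_lim.1 hk.orb
    (tendsto_const_nhds (x := d))
  have hE' := hk.tendsto_excitationEnergy he (fun j => H1_comb (hk.mem j).1 d)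
    (H1_comb h.mem_lim.1 d) hconv'
  have h1 := hE.add (hδ.comp hns.tendsto_atTop)
  rw [add_zero] at h1
  refine le_of_tendsto_of_tendsto' hE' h1 fun j => hmax (ns j) _
    ⟨(Submodule.mem_span_range_iff_exists_fun ℂ).2 ⟨d, rfl⟩, ?_⟩
  have := norm_comb_sq_of_orthonormal (h.mem (ns j)).2 d
  rw [hd] at this
  exact (pow_eq_one_iff_of_nonneg (norm_nonneg _) two_ne_zero).1 this

end KSLimit

/-! ### Ground states -/

/-- Orbitals of low energy have bounded kinetic energy, hence densities bounded in L¹ ∩ L².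
Comparison with the zero density bounds the potential energy below, and the kinetic energy is
nonnegative. -/
lemma exists_isLowerBound (he : IsExchangeCorrelation e) (μ : Measure Space) [IsFiniteMeasure μ]
    (n : ℕ) : ∃ I, IsLowerBound e μ n I := by
  set M := max (μ.real univ) 1
  obtain ⟨K, hK⟩ := exists_kin_le he n M
  set M' := max 1 √K
  set B := 2 * (n * (M' ^ 2 + √(gnConst * (M' * M' ^ 3))))
  obtain ⟨C, hC0, hC⟩ := exists_potEnergy_sub_le he (max M B)
  have h0 : IsDensity fun _ : Space => (0 : ℝ) := ⟨measurable_const, fun _ => le_rfl,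
    ⟨integrable_zero _ _ _, by simp⟩⟩
  have hp0 : potEnergy e μ (fun _ => 0) = 0 := by
    simp [potEnergy, coul, vHartree, he.zero]
  have hn0 : nrm (fun _ : Space => (0 : ℝ)) = 0 := by simp [nrm, nrm1, nrm2]
  have hB0 : 0 ≤ B := by positivity
  refine ⟨-(C * B), fun Φ hΦ => ?_⟩
  by_contra! hlt
  have hneg : ksEnergy e μ Φ ≤ M := by
    have : 0 ≤ C * B := by positivity
    have : (1 : ℝ) ≤ M := le_max_right _ _
    linarith
  have hk := hK μ Φ (le_max_left _ _) hΦ.1 (fun k => (hΦ.2.1 k).le.trans (le_max_right _ _)) hneg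
  have hB : nrm (density Φ) ≤ B := nrm_density_le hΦ.1
    (fun k => (hΦ.2.1 k).le.trans (le_max_left _ _))
    fun k => (gr_le_sqrt_kin Φ k).trans ((Real.sqrt_le_sqrt hk).trans (le_max_right _ _))
  have h1 := hC μ (density Φ) _ ((le_max_left _ _).trans (le_max_left _ _))
    (isDensity_density hΦ.1) h0 (hB.trans (le_max_right _ _))
    (hn0.le.trans (hB0.trans (le_max_right _ _)))
  simp only [hp0, sub_zero] at h1
  have h2 : C * nrm (density Φ) ≤ C * B := by gcongr
  have h3 := (abs_le.1 (h1.trans h2)).1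
  rw [ksEnergy_eq e μ hΦ.1] at hlt
  linarith [kin_nonneg Φ]

lemma integral_vHartree_density (μ : Measure Space) [IsFiniteMeasure μ] {n : ℕ} {Φ : Fin n → L2}
    (hΦ : ∀ k, Φ k ∈ H1) : ∫ x, vHartree (density Φ) x ∂μ =
      2 * ∑ k, ∫ x, vHartree (fun y => ‖Φ k y‖ ^ 2) x ∂μ := by
  rw [← integral_finsetSum _ fun k _ => integrable_vHartree μ (isL12_norm_sq (hΦ k)),
    ← integral_const_mul]
  refine integral_congr_ae (Eventually.of_forall fun x => ?_)
  simp only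
  rw [show density Φ = fun y => 2 * ∑ k, ‖Φ k y‖ ^ 2 from rfl, vHartree_const_mul]
  simp only [vHartree, Finset.sum_div]
  rw [integral_finsetSum _ fun k _ => integrable_coulomb (isL12_norm_sq (hΦ k)) x]

lemma ksEnergy_sub (e : ℝ → ℝ) (μ ν : Measure Space) [IsFiniteMeasure μ] [IsFiniteMeasure ν] {n : ℕ}
    {Φ : Fin n → L2} (hΦ : ∀ k, Φ k ∈ H1) : ksEnergy e μ Φ - ksEnergy e ν Φ =
      (∫ x, vHartree (density Φ) x ∂ν) - ∫ x, vHartree (density Φ) x ∂μ := by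
  rw [ksEnergy_eq e μ hΦ, ksEnergy_eq e ν hΦ, potEnergy, potEnergy]
  ring

/-- Approximate ground states yield a ground state in the limit. -/
theorem exists_isGroundState (he : IsExchangeCorrelation e) {n : ℕ} {Z L : ℝ}
    (hZ : 2 * (n : ℝ) < Z) {μs : ℕ → Measure Space} [∀ j, IsFiniteMeasure (μs j)] {μ : Measure Space}
    [IsFiniteMeasure μ] (hm : ∀ j, (μs j).real univ = Z) (hL : ∀ j, InBall L (μs j))
    (hμZ : μ.real univ = Z) (hμL : InBall L μ) (hnuc : NucTendsto μs μ) {Φs : ℕ → Fin n → L2}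
    (hΦ : ∀ j, Φs j ∈ ksAdmissible n) {δ : ℕ → ℝ} (hδ : Tendsto δ atTop (𝓝 0))
    (hmin : ∀ j, ∀ Ψ ∈ ksAdmissible n, ksEnergy e (μs j) (Φs j) ≤ ksEnergy e (μs j) Ψ + δ j) :
    ∃ ns : ℕ → ℕ, StrictMono ns ∧ ∃ Φ, IsGroundState e μ Φ ∧
      KSLimit Z L (fun j => μs (ns j)) μ (fun j => Φs (ns j)) Φ := by
  have hconv : ∀ Ψ ∈ ksAdmissible n,
      Tendsto (fun j => ksEnergy e (μs j) Ψ) atTop (𝓝 (ksEnergy e μ Ψ)) := by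
    intro Ψ hΨ
    have h1 := ((hnuc _ (isDensity_density hΨ.1).l12).const_sub
      (∫ x, vHartree (density Ψ) x ∂μ)).add_const (ksEnergy e μ Ψ)
    rw [sub_self, zero_add] at h1
    refine h1.congr fun j => ?_
    rw [← ksEnergy_sub e (μs j) μ hΨ.1, sub_add_cancel]
  -- The first term of the sequence serves as a fixed competitor and bounds all the energies from
  -- above.
  obtain ⟨E₀, hE₀⟩ := ((hconv _ (hΦ 0)).add hδ).bddAbove_range
  have hE : ∀ j, ksEnergy e (μs j) (Φs j) ≤ E₀ := fun j => (hmin j _ (hΦ 0)).trans (hE₀ ⟨j, rfl⟩)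
  have h1 : ∀ j k, ‖Φs j k‖ = 1 := fun j => (hΦ j).2.1
  set M₀ := max Z (max 1 E₀)
  obtain ⟨K, hK⟩ := exists_kin_le he n M₀
  have hkin : ∀ j, kin (Φs j) ≤ K := fun j => hK (μs j) (Φs j) ((hm j).le.trans (le_max_left _ _))
    (hΦ j).1 (fun k => (h1 j k).le.trans ((le_max_left _ _).trans (le_max_right _ _)))
    ((hE j).trans ((le_max_right _ _).trans (le_max_right _ _)))
  obtain ⟨a, ns, hns, ha⟩ := exists_weakH1_subseq_pi (u := fun k j => Φs j k) (M := max 1 √K)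
    (fun k j => (hΦ j).1 k) (fun k j => (h1 j k).le.trans (le_max_left _ _))
    (fun k j => (gr_le_sqrt_kin (Φs j) k).trans
      ((Real.sqrt_le_sqrt (hkin j)).trans (le_max_right _ _)))
  have hsub : NucTendsto (fun j => μs (ns j)) μ := fun f hf => (hnuc f hf).comp hns.tendsto_atTop
  -- The two energies differ only in the nuclear attraction, which converges even along weakly
  -- convergent orbitals. The charge can thus be frozen at its limit before strong convergence is
  -- known.
  have hdiff : Tendsto (fun j => ksEnergy e μ (Φs (ns j)) - ksEnergy e (μs (ns j)) (Φs (ns j)))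
      atTop (𝓝 0) := by
    have hc : NucTendsto (fun _ => μ) μ := fun f _ => tendsto_const_nhds
    have h2 := (tendsto_finsetSum Finset.univ fun k _ => hsub.tendsto_integral
      (fun j => (hm (ns j)).le) (fun j => hL (ns j)) (ha k)).const_mul 2
    have h3 := (tendsto_finsetSum Finset.univ fun k _ => hc.tendsto_integral
      (fun _ => hμZ.le) (fun _ => hμL) (ha k)).const_mul 2
    have h4 := h2.sub h3
    rw [sub_self] at h4
    refine h4.congr fun j => ?_
    rw [ksEnergy_sub e μ (μs (ns j)) (hΦ _).1, integral_vHartree_density _ (hΦ _).1,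
      integral_vHartree_density _ (hΦ _).1]
  obtain ⟨I₀, hI₀⟩ := exists_isLowerBound he μ n
  set I := sInf (ksEnergy e μ '' ksAdmissible n) with hI
  have hbdd : BddBelow (ksEnergy e μ '' (ksAdmissible n : Set (Fin n → L2))) :=
    ⟨I₀, by rintro _ ⟨Ψ, hΨ, rfl⟩; exact hI₀ Ψ hΨ⟩
  have hIl : IsLowerBound e μ n I := fun Ψ hΨ => csInf_le hbdd ⟨Ψ, hΨ, rfl⟩
  -- With the charge frozen, the approximate ground states form a minimizing sequence for the limit
  -- charge, to which the compactness theorem applies.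
  have hEI : Tendsto (fun j => ksEnergy e μ (Φs (ns j))) atTop (𝓝 I) := by
    refine tendsto_order.2 ⟨fun b hb => Eventually.of_forall fun j => hb.trans_le (hIl _ (hΦ _)),
      fun b hb => ?_⟩
    obtain ⟨_, ⟨Ψ, hΨ, rfl⟩, hΨb⟩ := exists_lt_of_csInf_lt
      (show (ksEnergy e μ '' ksAdmissible n).Nonempty from ⟨_, Φs 0, hΦ 0, rfl⟩) hb
    have h2 := (((hconv Ψ hΨ).comp hns.tendsto_atTop).add (hδ.comp hns.tendsto_atTop)).add hdiff
    rw [add_zero, add_zero] at h2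
    filter_upwards [h2.eventually_lt_const hΨb] with j hj
    have h3 := hmin (ns j) Ψ hΨ
    simp only [Function.comp_apply] at hj
    linarith
  obtain ⟨Φ, ms, hms, hΦa, hΦI, hΦt⟩ := hIl.exists_H1Tendsto he hZ hμL hμZ (fun j => hΦ (ns j)) hEI
  refine ⟨ns ∘ ms, hns.comp hms, Φ, ⟨hΦa, fun Ψ hΨ => hΦI.le.trans (hIl Ψ hΨ)⟩,
    fun j => hm _, fun j => hL _, fun f hf => (hsub f hf).comp hms.tendsto_atTop, fun j => hΦ _,
    hΦa, hΦt⟩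

/-! ### Compactness of the nuclear charge distributions -/

section Nuclear

variable {Ω : Set Space} {Z : ℝ} {μ : Measure Space}

lemma isFiniteMeasure_of_mem (h : μ ∈ nuclearCharges Ω Z) : IsFiniteMeasure μ :=
  ⟨by rw [h.2]; exact ENNReal.ofReal_lt_top⟩

lemma measureReal_univ_of_mem (hZ : 0 ≤ Z) (h : μ ∈ nuclearCharges Ω Z) : μ.real univ = Z := by
  rw [measureReal_def, h.2, ENNReal.toReal_ofReal hZ]

lemma inBall_of_mem {L : ℝ} (hL : ∀ x ∈ Ω, ‖x‖ ≤ L) (h : μ ∈ nuclearCharges Ω Z) : InBall L μ :=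
  measure_mono_null (fun x hx hxΩ => hx (hL x hxΩ)) h.1

lemma nuclearCharges_nonempty (hΩ : IsClosed Ω) (hne : Ω.Nonempty) :
    (nuclearCharges Ω Z).Nonempty := by
  obtain ⟨x, hx⟩ := hne
  refine ⟨ENNReal.ofReal Z • Measure.dirac x, ?_, by simp⟩
  rw [Measure.smul_apply, Measure.dirac_apply' _ hΩ.isOpen_compl.measurableSet]
  simp [hx]

/-- Nuclear charge distributions on a compact set are sequentially compact. -/
lemma exists_nucTendsto_subseq (hZ : 0 < Z) (hΩ : IsCompact Ω) {μs : ℕ → Measure Space}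
    (hμ : ∀ j, μs j ∈ nuclearCharges Ω Z) :
    ∃ μ ∈ nuclearCharges Ω Z, ∃ ns : ℕ → ℕ, StrictMono ns ∧ NucTendsto (fun j => μs (ns j)) μ := by
  set z := ENNReal.ofReal Z with hz
  have hz0 : z ≠ 0 := (ENNReal.ofReal_pos.2 hZ).ne'
  have hzt : z ≠ ⊤ := ENNReal.ofReal_ne_top
  -- The charges are normalized to probability measures; with no mass outside the compact set Ω,
  -- Prokhorov's theorem applies with tolerance zero.
  set P : ℕ → ProbabilityMeasure Space := fun j => ⟨z⁻¹ • μs j, ⟨by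
    rw [Measure.smul_apply, (hμ j).2, smul_eq_mul, ENNReal.inv_mul_cancel hz0 hzt]⟩⟩ with hP
  have hcomp : IsCompact {Q : ProbabilityMeasure Space | ∀ _ : ℕ, Q Ωᶜ ≤ 0} :=
    isCompact_setOfPred_probabilityMeasure_mass_eq_compl_isCompact_le
      (u := fun _ => 0) tendsto_const_nhds (fun _ => hΩ) (Or.inl inferInstance)
  have hPm : ∀ j, P j ∈ {Q : ProbabilityMeasure Space | ∀ _ : ℕ, Q Ωᶜ ≤ 0} := fun j _ => by
    refine le_of_eq ?_
    rw [ProbabilityMeasure.null_iff_toMeasure_null]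
    change (z⁻¹ • μs j) Ωᶜ = 0
    rw [Measure.smul_apply, (hμ j).1, smul_zero]
  obtain ⟨Q, hQ, ns, hns, hlim⟩ := hcomp.isSeqCompact hPm
  have hQ0 : (Q : Measure Space) Ωᶜ = 0 :=
    (ProbabilityMeasure.null_iff_toMeasure_null _ _).1 (le_antisymm (hQ 0) zero_le)
  refine ⟨z • (Q : Measure Space), ⟨?_, ?_⟩, ns, hns, fun f hf => ?_⟩
  · rw [Measure.smul_apply, hQ0, smul_zero]
  · rw [Measure.smul_apply, measure_univ, smul_eq_mul, mul_one]
  -- Coulomb potentials of L¹ ∩ L² functions are bounded and continuous, hence legitimate test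
  -- functions for weak convergence of measures.
  · have h1 := ProbabilityMeasure.tendsto_iff_forall_integral_tendsto.1 hlim
      (BoundedContinuousFunction.ofNormedAddCommGroup (vHartree f) (continuous_vHartree hf)
        (potConst * nrm f) fun x => abs_vHartree_le_nrm hf x)
    have h2 := h1.const_mul Z
    have hzr : z.toReal = Z := ENNReal.toReal_ofReal hZ.le
    rw [integral_smul_measure, hzr, smul_eq_mul]
    refine h2.congr fun j => ?_
    change Z * ∫ x, vHartree f x ∂(z⁻¹ • μs (ns j)) = _
    rw [integral_smul_measure, ENNReal.toReal_inv, hzr, smul_eq_mul, mul_inv_cancel_left₀ hZ.ne']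

end Nuclear

/-! ### Existence and compactness of Kohn-Sham solutions -/

/-- Constant sequences turn the stability results into existence results for a fixed charge, applied
to sequences of near-minimizers. -/
lemma KSLimit.const {n : ℕ} {Z L : ℝ} {μ : Measure Space} {Φ : Fin n → L2} (hm : μ.real univ = Z)
    (hL : InBall L μ) (hΦ : Φ ∈ ksAdmissible n) : KSLimit Z L (fun _ => μ) μ (fun _ => Φ) Φ :=
  ⟨fun _ => hm, fun _ => hL, fun _ _ => tendsto_const_nhds, fun _ => hΦ, hΦ,
    fun _ => ⟨tendsto_const_nhds, fun _ => tendsto_const_nhds⟩⟩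

lemma tendsto_inv_natCast_add_one : Tendsto (fun j : ℕ => ((j : ℝ) + 1)⁻¹) atTop (𝓝 0) := by
  simpa only [one_div] using tendsto_one_div_add_atTop_nhds_zero_nat (𝕜 := ℝ)

lemma ksAdmissible_nonempty (n : ℕ) : (ksAdmissible n).Nonempty := by
  obtain ⟨G, -, hG⟩ := exists_spread_orthonormal n
  obtain ⟨u, h1, -, h3⟩ := hG 1 1 le_rfl one_pos
  exact ⟨u, fun k => (h3 k).mem, h1⟩

/-- A function bounded below on a nonempty set has near-minimizers. -/
lemma exists_near_min {α : Type*} {S : Set α} (hS : S.Nonempty) {F : α → ℝ} {b : ℝ}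
    (hb : ∀ x ∈ S, b ≤ F x) {δ : ℝ} (hδ : 0 < δ) : ∃ x ∈ S, ∀ y ∈ S, F x ≤ F y + δ := by
  have hbdd : BddBelow (F '' S) := ⟨b, by rintro _ ⟨x, hx, rfl⟩; exact hb x hx⟩
  obtain ⟨_, ⟨x, hx, rfl⟩, hlt⟩ := exists_lt_of_csInf_lt (hS.image F)
    (lt_add_of_pos_right (sInf (F '' S)) hδ)
  exact ⟨x, hx, fun y hy => hlt.le.trans (by gcongr; exact csInf_le hbdd ⟨y, hy, rfl⟩)⟩

lemma exists_isHOMO (he : IsExchangeCorrelation e) {n : ℕ} (hn : 0 < n) {μ : Measure Space}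
    [IsFiniteMeasure μ] {L : ℝ} (hL : InBall L μ) {Φ : Fin n → L2} (hΦ : Φ ∈ ksAdmissible n) :
    ∃ φ, IsHOMO e μ Φ φ := by
  have h := KSLimit.const rfl hL hΦ
  set F : (Fin n → ℂ) → ℝ := fun c => excitationEnergy e μ (density Φ) (comb Φ c) with hF
  have hFc : Continuous F := SeqContinuous.continuous fun c c₀ hc =>
    h.tendsto_excitationEnergy he (fun j => H1_comb hΦ.1 (c j)) (H1_comb hΦ.1 c₀)
      (H1Tendsto.comb (fun _ => hΦ.1) hΦ.1 h.orb hc)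
  have hcont : Continuous (csq : (Fin n → ℂ) → ℝ) := by unfold csq; fun_prop
  have hK : IsCompact {c : Fin n → ℂ | csq c = 1} := by
    refine Metric.isCompact_of_isClosed_isBounded (isClosed_eq hcont continuous_const)
      (Metric.isBounded_closedBall.subset (t := Metric.closedBall 0 1) fun c hc => ?_)
    rw [mem_closedBall_zero_iff, pi_norm_le_iff_of_nonneg zero_le_one]
    intro k
    have h1 : ‖c k‖ ^ 2 ≤ 1 := (show csq c = 1 from hc) ▸
      Finset.single_le_sum (f := fun k => ‖c k‖ ^ 2) (fun _ _ => sq_nonneg _) (Finset.mem_univ k)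
    exact (sq_le_one_iff₀ (norm_nonneg _)).1 h1
  obtain ⟨c, hc, hmax⟩ := hK.exists_isMaxOn ⟨_, csq_single ⟨0, hn⟩⟩ hFc.continuousOn
  refine ⟨comb Φ c, ⟨(Submodule.mem_span_range_iff_exists_fun ℂ).2 ⟨c, rfl⟩, ?_⟩, fun ψ hψ => ?_⟩
  · have := norm_comb_sq_of_orthonormal hΦ.2 c
    rw [show csq c = 1 from hc] at this
    exact (pow_eq_one_iff_of_nonneg (norm_nonneg _) two_ne_zero).1 this
  · obtain ⟨d, rfl⟩ := (Submodule.mem_span_range_iff_exists_fun ℂ).1 hψ.1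
    refine hmax (show csq d = 1 from ?_)
    rw [← norm_comb_sq_of_orthonormal hΦ.2]
    change ‖∑ k, d k • Φ k‖ ^ 2 = 1
    rw [hψ.2, one_pow]

lemma exists_isLUMO (he : IsExchangeCorrelation e) {n : ℕ} {Z : ℝ} (hZ : 2 * (n : ℝ) < Z)
    {μ : Measure Space} [IsFiniteMeasure μ] {L : ℝ} (hm : μ.real univ = Z) (hL : InBall L μ)
    {Φ : Fin n → L2} (hΦ : Φ ∈ ksAdmissible n) : ∃ φ, IsLUMO e μ Φ φ := by
  have h := KSLimit.const hm hL hΦ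
  have hneg := exists_lumoAdmissible_neg he hZ hL hm hΦ
  obtain ⟨C, hC⟩ := h.exists_gradNormSq_le he
  have hlow : ∀ χ ∈ lumoAdmissible Φ, -C / 4 ≤ excitationEnergy e μ (density Φ) χ := fun χ hχ => by
    have := hC 0 χ hχ
    have := gradNormSq_nonneg χ
    linarith
  choose χ hχ hmin using fun j : ℕ => exists_near_min (hneg.imp fun _ h => h.1) hlow
    (show 0 < ((j : ℝ) + 1)⁻¹ by positivity)
  obtain ⟨-, -, φ, hφ, -⟩ := h.exists_isLUMO he hneg hχ tendsto_inv_natCast_add_one hmin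
  exact ⟨φ, hφ⟩

/-- Existence of a ground state, a HOMO and a LUMO. -/
theorem exists_solvesKS (he : IsExchangeCorrelation e) {n : ℕ} (hn : 0 < n) {Z : ℝ}
    (hZ : 2 * (n : ℝ) < Z) {μ : Measure Space} [IsFiniteMeasure μ] {L : ℝ} (hm : μ.real univ = Z)
    (hL : InBall L μ) : ∃ (Φ : Fin n → L2) (φH φL : L2), SolvesKS e μ Φ φH φL := by
  obtain ⟨I, hI⟩ := exists_isLowerBound he μ n
  choose Φs hΦs hmin using fun j : ℕ => exists_near_min (ksAdmissible_nonempty n) hI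
    (show 0 < ((j : ℝ) + 1)⁻¹ by positivity)
  obtain ⟨-, -, Φ, hΦ, -⟩ := exists_isGroundState he hZ (fun _ => hm) (fun _ => hL) hm hL
    (fun _ _ => tendsto_const_nhds) hΦs tendsto_inv_natCast_add_one hmin
  obtain ⟨φH, hH⟩ := exists_isHOMO he hn hL hΦ.1
  obtain ⟨φL, hφL⟩ := exists_isLUMO he hZ hm hL hΦ.1
  exact ⟨Φ, φH, φL, hΦ, hH, hφL⟩

/-- Solutions of the Kohn-Sham system are sequentially compact with respect to the nuclear charge
distribution, and the bandgap passes to the limit. -/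
theorem exists_solvesKS_limit (he : IsExchangeCorrelation e) {n : ℕ} {Z L : ℝ}
    (hZ : 2 * (n : ℝ) < Z) {μs : ℕ → Measure Space} [∀ j, IsFiniteMeasure (μs j)] {μ : Measure Space}
    [IsFiniteMeasure μ] (hm : ∀ j, (μs j).real univ = Z) (hL : ∀ j, InBall L (μs j))
    (hμZ : μ.real univ = Z) (hμL : InBall L μ) (hnuc : NucTendsto μs μ) {Φs : ℕ → Fin n → L2}
    {φHs φLs : ℕ → L2} (h : ∀ j, SolvesKS e (μs j) (Φs j) (φHs j) (φLs j)) (εstar : ℝ) :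
    ∃ ns : ℕ → ℕ, StrictMono ns ∧ ∃ (Φ : Fin n → L2) (φH φL : L2), SolvesKS e μ Φ φH φL ∧
      Tendsto (fun j => bandgapFunctional e εstar (Φs (ns j)) (φHs (ns j)) (φLs (ns j)) (μs (ns j)))
        atTop (𝓝 (bandgapFunctional e εstar Φ φH φL μ)) := by
  -- Exact solutions enter the stability theorems as approximate ones with error zero. Subsequences
  -- are extracted successively for the ground state, the HOMO and the LUMO.
  have h0 : Tendsto (fun _ : ℕ => (0 : ℝ)) atTop (𝓝 0) := tendsto_const_nhds
  obtain ⟨n₁, hn₁, Φ, hΦ, k₁⟩ := exists_isGroundState he hZ hm hL hμZ hμL hnuc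
    (fun j => (h j).groundState.1) h0 fun j Ψ hΨ => by
      rw [add_zero]; exact (h j).groundState.2 hΨ
  obtain ⟨n₂, hn₂, φH, hH, tH⟩ := k₁.exists_isHOMO he (fun j => (h (n₁ j)).homo.1) h0
    fun j ψ hψ => by rw [add_zero]; exact (h (n₁ j)).homo.2 hψ
  have k₂ := k₁.comp hn₂.tendsto_atTop
  obtain ⟨n₃, hn₃, φL, hφL, tL⟩ := k₂.exists_isLUMO he
    (exists_lumoAdmissible_neg he hZ hμL hμZ hΦ.1) (fun j => (h (n₁ (n₂ j))).lumo.1) h0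
    fun j ψ hψ => by rw [add_zero]; exact (h (n₁ (n₂ j))).lumo.2 hψ
  refine ⟨n₁ ∘ n₂ ∘ n₃, hn₁.comp (hn₂.comp hn₃), Φ, φH, φL, ⟨hΦ, hH, hφL⟩, ?_⟩
  exact (((tL.sub (tH.comp hn₃.tendsto_atTop)).sub_const εstar).abs).pow 2

end

end KohnSham

/-! ### The minimization of the bandgap functional. -/

theorem theorem4p2 (n : ℕ) (hn : 0 < n) (Z : ℝ) (hZ : 2 * (n : ℝ) < Z)
    (Ω : Set KohnSham.Space) (hΩ : IsCompact Ω) (hΩne : Ω.Nonempty)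
    (e : ℝ → ℝ) (he : KohnSham.IsExchangeCorrelation e)
    (εstar : ℝ) (hε : 0 < εstar) :
    ∃ μ ∈ KohnSham.nuclearCharges Ω Z, ∃ (Φ : Fin n → KohnSham.L2) (φH φL : KohnSham.L2),
      KohnSham.SolvesKS e μ Φ φH φL ∧
      ∀ μ' ∈ KohnSham.nuclearCharges Ω Z, ∀ (Φ' : Fin n → KohnSham.L2) (φH' φL' : KohnSham.L2),
        KohnSham.SolvesKS e μ' Φ' φH' φL' →
        KohnSham.bandgapFunctional e εstar Φ φH φL μ ≤
          KohnSham.bandgapFunctional e εstar Φ' φH' φL' μ' := by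
  open KohnSham MeasureTheory Set Filter Topology in
  have hZ0 : 0 < Z := lt_of_le_of_lt (by positivity) hZ
  obtain ⟨L, hL⟩ := hΩ.isBounded.exists_norm_le
  have hfin : ∀ μ ∈ nuclearCharges Ω Z, IsFiniteMeasure μ := fun μ h => isFiniteMeasure_of_mem h
  -- Solutions need not be unique for a given charge, so the infimum is taken over all values
  -- attained by solutions of the system.
  set S : Set ℝ := {t | ∃ μ ∈ nuclearCharges Ω Z, ∃ (Φ : Fin n → L2) (φH φL : L2),
    SolvesKS e μ Φ φH φL ∧ bandgapFunctional e εstar Φ φH φL μ = t} with hS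
  have hne : S.Nonempty := by
    obtain ⟨μ, hμ⟩ := nuclearCharges_nonempty (Z := Z) hΩ.isClosed hΩne
    have := hfin μ hμ
    obtain ⟨Φ, φH, φL, h⟩ := exists_solvesKS he hn hZ (measureReal_univ_of_mem hZ0.le hμ)
      (inBall_of_mem hL hμ)
    exact ⟨_, μ, hμ, Φ, φH, φL, h, rfl⟩
  have hbdd : BddBelow S := ⟨0, by
    rintro _ ⟨μ, -, Φ, φH, φL, -, rfl⟩
    exact sq_nonneg _⟩
  -- Along a minimizing sequence, first the charges converge weakly and then the solutions converge.
  -- The value at the limit is the infimum because the bandgap itself converges.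
  obtain ⟨t, -, ht, htS⟩ := exists_seq_tendsto_sInf hne hbdd
  choose μs hμs Φs φHs φLs hsol heq using htS
  obtain ⟨μ, hμ, ns, hns, hnuc⟩ := exists_nucTendsto_subseq hZ0 hΩ hμs
  have := fun j => hfin (μs j) (hμs j)
  have := hfin μ hμ
  obtain ⟨ms, hms, Φ, φH, φL, hΦ, hlim⟩ := exists_solvesKS_limit he hZ
    (fun j => measureReal_univ_of_mem hZ0.le (hμs (ns j))) (fun j => inBall_of_mem hL (hμs (ns j)))
    (measureReal_univ_of_mem hZ0.le hμ) (inBall_of_mem hL hμ) hnuc (fun j => hsol (ns j)) εstar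
  refine ⟨μ, hμ, Φ, φH, φL, hΦ, fun μ' hμ' Φ' φH' φL' h' => ?_⟩
  have hJ : bandgapFunctional e εstar Φ φH φL μ = sInf S := by
    refine tendsto_nhds_unique hlim ?_
    simp only [heq]
    exact ht.comp (hns.comp hms).tendsto_atTop
  rw [hJ]
  exact csInf_le hbdd ⟨μ', hμ', Φ', φH', φL', h', rfl⟩
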